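/- Let $F$ be a non-archimedean local field of odd residue characteristic, $O=F[[t]]$, $K=F((t))$, and let $\tilde\psi$ be a complex additive character of $F$ that is trivial on the maximal ideal of $O_F$ and non-trivial on $O_F$. Put $O_n^*=(O/t^{n+1}O)^*$, $O^*(1)=1+tO$, $B=K/O$, $B_n=t^{-n}O/O$ and $H_\infty=O^*\ltimes B=\bigcup_n (O^*\ltimes B_n)$. A pro-vector space is a formal countable inverse limit $\varprojlim_i V_i$ of complex vector spaces of at most countable dimension, with $\mathrm{Hom}(V,W)=\varprojlim_j\varinjlim_i\mathrm{Hom}(V_i,W_j)$. A smooth representation of $H_\infty$ on a pro-vector space $V$ is a representation of the group object $\varinjlim_n\varprojlim_m (O_m^*\times B_n)$, that is, a compatible, unital and multiplicative system of elements $$\rho_n\in \varprojlim_j\varinjlim_{i,m}\mathrm{Hom}\bigl(V_i,\,C^\infty(O_m^*\times B_n,V_j)\bigr)\qquad(n\ge 0),$$ where $C^\infty$ denotes locally constant functions; morphisms, invariance and coinvariants are understood in the sense of the group object. For a subgroup $T$ of $O^*\ltimes B_n$ and a character $\kappa$ of $T$, the coinvariants $V_{T,\kappa}$ represent the functor sending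 a pro-vector space $W$ to the set of morphisms $\beta:V\to W$ with $\beta\circ\rho(h)=\kappa(h)\beta$ on $T$. The representation $V$ is cuspidal if $V_{B_1}=0$. Let $M_n$ be the space of locally constant compactly supported measures on $O_n^*$ and let $\mathbb M=\varprojlim_n M_n$ be the formal limit along push-forward of measures. It is a smooth representation of $H_\infty$: $O^*$ acts by shifts and $b\in B$ acts by multiplication by $\phi_b(x)=\tilde\psi(\mathrm{Res}_{t=0}(bx\,dt))$. Then: (1) For every smooth cuspidal representation $\mathbb V$ of $H_\infty$ the pro-vector space $\mathbb L(\mathbb V)=\mathrm{Hom}_{H_\infty}(\mathbb M,\mathbb V)$ exists, i.e. the functor $T\mapsto \mathrm{Hom}_{H_\infty}(T\otimes\mathbb M,\mathbb V)$ on pro-vector spaces is represented by a pro-vector space $\mathbb L(\mathbb V)$, and the canonical morphism $\mathbb L(\mathbb V)\otimes\mathbb M\to\mathbb V$ is an isomorphism of representations. (2) The functor $\overline{\mathcal W}$ of coinvariants $\mathbb V\mapsto \mathbb V_{B_1\times O^*(1),\hat\psi}$ exists on the category of smooth representations of $H_\infty$, where $\hat\psi(b,a)=\tilde\psi(\mathrm{Res}_{t=0}(b\,dt))$,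 and its restriction to the full subcategory of cuspidal representations is an equivalence onto the category of pro-vector spaces. (3) The representation $\mathbb M$ is irreducible: it is non-zero and every subobject of it in the category of smooth representations of $H_\infty$ is zero or all of $\mathbb M$. -/

import Mathlib

open CategoryTheory
universe u v w

/-- A pro-vector space: a countable inverse system of complex vector spaces of at most countable
dimension, thought of as its formal limit.  Morphisms are `lim_j colim_i Hom(V_i, W_j)`, see the
category instance below. -/
structure ProVect : Type (u + 1) where
  obj : ℕ → Type u
  [addCommGroup : ∀ n, AddCommGroup (obj n)]
  [module : ∀ n, Module ℂ (obj n)]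
  rank_le : ∀ n, Module.rank ℂ (obj n) ≤ Cardinal.aleph0
  map : ∀ {i j : ℕ}, i ≤ j → (obj j →ₗ[ℂ] obj i)
  map_self : ∀ (i : ℕ) (x : obj i), map (le_refl i) x = x
  map_map : ∀ {i j k : ℕ} (hij : i ≤ j) (hjk : j ≤ k) (x : obj k),
    map hij (map hjk x) = map (hij.trans hjk) x

attribute [instance] ProVect.addCommGroup ProVect.module

namespace ProVect

/-- Representatives of elements of `lim_j colim_i Maps(S, Hom(V_i, W_j))`: for each `j` an index
`i = idx j` and a family, indexed by `S`, of linear maps `V_i → W_j`; the members for different `j`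
are compatible after passing to some later index `k`, uniformly in `S`. -/
structure PreFam (S : Type v) (V W : ProVect.{u}) : Type (max u v) where
  idx : ℕ → ℕ
  app : ∀ j : ℕ, S → (V.obj (idx j) →ₗ[ℂ] W.obj j)
  compat : ∀ {i j : ℕ} (h : i ≤ j), ∃ (k : ℕ) (hi : idx i ≤ k) (hj : idx j ≤ k),
    ∀ (s : S) (x : V.obj k), W.map h (app j s (V.map hj x)) = app i s (V.map hi x)

namespace PreFam

variable {S : Type v} {S' : Type w} {U V W : ProVect.{u}}

/-- Equality in `lim_j colim_i Maps(S, Hom(V_i, W_j))`. -/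
def Rel (f g : PreFam S V W) : Prop :=
  ∀ j : ℕ, ∃ (k : ℕ) (hf : f.idx j ≤ k) (hg : g.idx j ≤ k),
    ∀ (s : S) (x : V.obj k), f.app j s (V.map hf x) = g.app j s (V.map hg x)

instance setoid (S : Type v) (V W : ProVect.{u}) : Setoid (PreFam S V W) where
  r := Rel
  iseqv :=
    { refl := fun f j => ⟨f.idx j, le_rfl, le_rfl, fun _ _ => rfl⟩
      symm := fun h j => by
        obtain ⟨k, hf, hg, e⟩ := h j
        exact ⟨k, hg, hf, fun s x => (e s x).symm⟩
      trans := fun {f g h} h₁ h₂ j => by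
        obtain ⟨k, hf, hg, e⟩ := h₁ j
        obtain ⟨l, hg', hh, e'⟩ := h₂ j
        refine ⟨max k l, hf.trans (le_max_left _ _), hh.trans (le_max_right _ _), fun s x => ?_⟩
        have a := e s (V.map (le_max_left k l) x)
        have b := e' s (V.map (le_max_right k l) x)
        rw [V.map_map, V.map_map] at a b
        exact a.trans b }

def id (S : Type v) (V : ProVect.{u}) : PreFam S V V where
  idx := fun j => j
  app := fun _ _ => LinearMap.id
  compat := fun {i j} h => ⟨j, h, le_rfl, fun s x => by simp [V.map_map]⟩

def comp (g : PreFam S V W) (f : PreFam S U V) : PreFam S U W where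
  idx := fun j => f.idx (g.idx j)
  app := fun j s => (g.app j s).comp (f.app (g.idx j) s)
  compat := fun {i j} h => by
    obtain ⟨k, hi, hj, e⟩ := g.compat h
    obtain ⟨l, hl, hl', e'⟩ := f.compat hi
    obtain ⟨m, hm, hm', e''⟩ := f.compat hj
    refine ⟨max l m, hl.trans (le_max_left _ _), hm.trans (le_max_right _ _), fun s x => ?_⟩
    have a := e' s (U.map (le_max_left l m) x)
    have b := e'' s (U.map (le_max_right l m) x)
    rw [U.map_map, U.map_map] at a b
    have hk : U.map (hl'.trans (le_max_left l m)) x = U.map (hm'.trans (le_max_right l m)) x := rfl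
    have c := e s (f.app k s (U.map (hl'.trans (le_max_left l m)) x))
    rw [a, hk, b] at c
    exact c

def restrict (p : S' → S) (f : PreFam S V W) : PreFam S' V W where
  idx := f.idx
  app := fun j s => f.app j (p s)
  compat := fun h => by
    obtain ⟨k, hi, hj, e⟩ := f.compat h
    exact ⟨k, hi, hj, fun s x => e (p s) x⟩

def twist (κ : S → ℂ) (f : PreFam S V W) : PreFam S V W where
  idx := f.idx
  app := fun j s => κ s • f.app j s
  compat := fun h => by
    obtain ⟨k, hi, hj, e⟩ := f.compat h
    exact ⟨k, hi, hj, fun s x => by simp [e s x]⟩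

theorem comp_rel {g g' : PreFam S V W} {f f' : PreFam S U V} (hg : g ≈ g') (hf : f ≈ f') :
    g.comp f ≈ g'.comp f' := by
  intro j
  obtain ⟨k, h₁, h₂, e⟩ := hg j
  obtain ⟨l, l₁, l₁', e₁⟩ := f.compat h₁
  obtain ⟨m, m₁, m₁', e₂⟩ := f'.compat h₂
  obtain ⟨n, n₁, n₁', e₃⟩ := hf k
  refine ⟨max l (max m n), l₁.trans (le_max_left _ _),
    m₁.trans ((le_max_left m n).trans (le_max_right _ _)), fun s x => ?_⟩
  have hl := le_max_left l (max m n)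
  have hm := (le_max_left m n).trans (le_max_right l (max m n))
  have hn := (le_max_right m n).trans (le_max_right l (max m n))
  have a := e₁ s (U.map hl x)
  have b := e₂ s (U.map hm x)
  have c := e₃ s (U.map hn x)
  rw [U.map_map, U.map_map] at a b c
  have d := e s (f.app k s (U.map (l₁'.trans hl) x))
  rw [a] at d
  have d' : V.map h₂ (f.app k s (U.map (l₁'.trans hl) x))
      = f'.app (g'.idx j) s (U.map (m₁.trans hm) x) := by
    rw [← b]
    exact congrArg _ c
  rw [d'] at d
  exact d

end PreFam

/-- Families of morphisms of pro-vector spaces `V → W` indexed by the set `S`: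
`lim_j colim_i Maps(S, Hom(V_i, W_j))`. -/
def Fam (S : Type v) (V W : ProVect.{u}) : Type (max u v) :=
  Quotient (PreFam.setoid S V W)

namespace Fam

variable {S : Type v} {S' : Type w} {U V W : ProVect.{u}}

def id (S : Type v) (V : ProVect.{u}) : Fam S V V := Quotient.mk _ (PreFam.id S V)

/-- Pointwise composition of families. -/
def comp (g : Fam S V W) (f : Fam S U V) : Fam S U W :=
  Quotient.map₂ PreFam.comp (fun _ _ hg _ _ hf => PreFam.comp_rel hg hf) g f

/-- Pull-back of a family along a map of index sets. -/
def restrict (p : S' → S) (f : Fam S V W) : Fam S' V W :=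
  Quotient.map (PreFam.restrict p) (fun f g h j => by
    obtain ⟨k, hf, hg, e⟩ := h j
    exact ⟨k, hf, hg, fun s x => e (p s) x⟩) f

/-- The family `s ↦ κ(s) f(s)`. -/
def twist (κ : S → ℂ) (f : Fam S V W) : Fam S V W :=
  Quotient.map (PreFam.twist κ) (fun f g h j => by
    obtain ⟨k, hf, hg, e⟩ := h j
    exact ⟨k, hf, hg, fun s x => by
      exact congrArg (κ s • ·) (e s x)⟩) f

theorem id_comp (f : Fam S V W) : (Fam.id S W).comp f = f := by
  induction f using Quotient.inductionOn with
  | h f => exact Quotient.sound fun j => ⟨f.idx j, le_rfl, le_rfl, fun _ _ => rfl⟩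

theorem comp_id (f : Fam S V W) : f.comp (Fam.id S V) = f := by
  induction f using Quotient.inductionOn with
  | h f => exact Quotient.sound fun j => ⟨f.idx j, le_rfl, le_rfl, fun _ _ => rfl⟩

theorem comp_assoc {T : ProVect.{u}} (h : Fam S W T) (g : Fam S V W) (f : Fam S U V) :
    (h.comp g).comp f = h.comp (g.comp f) := by
  induction f using Quotient.inductionOn with
  | h f =>
  induction g using Quotient.inductionOn with
  | h g =>
  induction h using Quotient.inductionOn with
  | h h => rfl

theorem restrict_comp (p : S' → S) (g : Fam S V W) (f : Fam S U V) :
    (g.comp f).restrict p = (g.restrict p).comp (f.restrict p) := by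
  induction f using Quotient.inductionOn with
  | h f =>
  induction g using Quotient.inductionOn with
  | h g => rfl

theorem restrict_id (p : S' → S) : (Fam.id S V).restrict p = Fam.id S' V := rfl

end Fam

/-- The category of pro-vector spaces, with `Hom(V, W) = lim_j colim_i Hom(V_i, W_j)`: a morphism
is a family indexed by a point. -/
instance : Category.{u} ProVect.{u} where
  Hom V W := Fam Unit V W
  id V := Fam.id Unit V
  comp f g := Fam.comp g f
  id_comp f := Fam.comp_id f
  comp_id f := Fam.id_comp f
  assoc f g h := (Fam.comp_assoc h g f).symm

/-- The constant family. -/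
def const (S : Type v) {V W : ProVect.{u}} (f : V ⟶ W) : Fam S V W :=
  Fam.restrict (fun _ => ()) f

end ProVect

namespace ProVect
open scoped TensorProduct

variable {S : Type v} {S' : Type w}

theorem const_comp (S : Type v) {U V W : ProVect.{u}} (f : U ⟶ V) (g : V ⟶ W) :
    const S (f ≫ g) = (const S g).comp (const S f) :=
  Fam.restrict_comp _ _ _

theorem const_id (S : Type v) (V : ProVect.{u}) : const S (𝟙 V) = Fam.id S V := rfl

theorem restrict_const (p : S' → S) {V W : ProVect.{u}} (f : V ⟶ W) :
    (const S f).restrict p = const S' f := by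
  induction f using Quotient.inductionOn with
  | h f => rfl

/-- The tensor product of pro-vector spaces, the formal limit of `V_j ⊗ W_j` (the diagonal is cofinal in the
system of all `V_i ⊗ W_j`). -/
def tensor (V W : ProVect.{u}) : ProVect.{u} where
  obj j := V.obj j ⊗[ℂ] W.obj j
  rank_le j := by
    rw [rank_tensorProduct']
    exact (mul_le_mul' (V.rank_le j) (W.rank_le j)).trans Cardinal.aleph0_mul_aleph0.le
  map h := TensorProduct.map (V.map h) (W.map h)
  map_self i x := by
    have h1 : V.map (le_refl i) = LinearMap.id := LinearMap.ext (V.map_self i)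
    have h2 : W.map (le_refl i) = LinearMap.id := LinearMap.ext (W.map_self i)
    rw [h1, h2, TensorProduct.map_id, LinearMap.id_apply]
  map_map {i j k} hij hjk x := by
    rw [← LinearMap.comp_apply, ← TensorProduct.map_comp]
    have h1 : (V.map hij).comp (V.map hjk) = V.map (hij.trans hjk) :=
      LinearMap.ext (V.map_map hij hjk)
    have h2 : (W.map hij).comp (W.map hjk) = W.map (hij.trans hjk) :=
      LinearMap.ext (W.map_map hij hjk)
    rw [h1, h2]

variable {V V' V'' W W' W'' : ProVect.{u}}

section TensorLemmas

variable {A B C A₁ B₁ C₁ : Type u}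
  [AddCommGroup A] [Module ℂ A] [AddCommGroup B] [Module ℂ B] [AddCommGroup C] [Module ℂ C]
  [AddCommGroup A₁] [Module ℂ A₁] [AddCommGroup B₁] [Module ℂ B₁] [AddCommGroup C₁] [Module ℂ C₁]


theorem tensor_map_map {f : B →ₗ[ℂ] C} {a : A →ₗ[ℂ] B} {h : A →ₗ[ℂ] C}
    {g : B₁ →ₗ[ℂ] C₁} {b : A₁ →ₗ[ℂ] B₁} {k : A₁ →ₗ[ℂ] C₁}
    (e : ∀ x, f (a x) = h x) (e' : ∀ x, g (b x) = k x) (x : A ⊗[ℂ] A₁) :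
    TensorProduct.map f g (TensorProduct.map a b x) = TensorProduct.map h k x := by
  rw [← LinearMap.comp_apply, ← TensorProduct.map_comp]
  congr 2
  · exact LinearMap.ext e
  · exact LinearMap.ext e'

end TensorLemmas

def PreFam.tensor (f : PreFam S V V') (g : PreFam S W W') :
    PreFam S (V.tensor W) (V'.tensor W') where
  idx j := max (f.idx j) (g.idx j)
  app j s := TensorProduct.map ((f.app j s).comp (V.map (le_max_left _ _)))
    ((g.app j s).comp (W.map (le_max_right _ _)))
  compat {i j} h := by
    obtain ⟨k, hi, hj, e⟩ := f.compat h
    obtain ⟨l, li, lj, e'⟩ := g.compat h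
    have hk := le_max_left k l
    have hl := le_max_right k l
    refine ⟨max k l, max_le (hi.trans hk) (li.trans hl), max_le (hj.trans hk) (lj.trans hl),
      fun s x => ?_⟩
    have r := tensor_map_map (f := (f.app i s).comp (V.map (le_max_left _ (g.idx i))))
      (g := (g.app i s).comp (W.map (le_max_right (f.idx i) _)))
      (a := V.map (max_le (hi.trans hk) (li.trans hl)))
      (b := W.map (max_le (hi.trans hk) (li.trans hl)))
      (h := (f.app i s).comp (V.map (hi.trans hk)))
      (k := (g.app i s).comp (W.map (li.trans hl)))
      (fun x => congrArg (f.app i s) (V.map_map _ _ x))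
      (fun x => congrArg (g.app i s) (W.map_map _ _ x)) x
    have r' := tensor_map_map (f := (f.app j s).comp (V.map (le_max_left _ (g.idx j))))
      (g := (g.app j s).comp (W.map (le_max_right (f.idx j) _)))
      (a := V.map (max_le (hj.trans hk) (lj.trans hl)))
      (b := W.map (max_le (hj.trans hk) (lj.trans hl)))
      (h := (f.app j s).comp (V.map (hj.trans hk)))
      (k := (g.app j s).comp (W.map (lj.trans hl)))
      (fun x => congrArg (f.app j s) (V.map_map _ _ x))
      (fun x => congrArg (g.app j s) (W.map_map _ _ x)) x
    refine (congrArg ((V'.tensor W').map h) r').trans (Eq.trans ?_ r.symm)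
    refine tensor_map_map (fun y => ?_) (fun y => ?_) x
    · have := e s (V.map hk y)
      rw [V.map_map, V.map_map] at this
      exact this
    · have := e' s (W.map hl y)
      rw [W.map_map, W.map_map] at this
      exact this

theorem PreFam.tensor_app_map (f : PreFam S V V') (g : PreFam S W W') (j : ℕ) (s : S) {k : ℕ}
    (hf : f.idx j ≤ k) (hg : g.idx j ≤ k) (h : max (f.idx j) (g.idx j) ≤ k)
    (x : (V.tensor W).obj k) :
    (f.tensor g).app j s ((V.tensor W).map h x) =
      TensorProduct.map ((f.app j s).comp (V.map hf)) ((g.app j s).comp (W.map hg)) x :=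
  tensor_map_map (f := (f.app j s).comp (V.map (le_max_left _ (g.idx j))))
    (g := (g.app j s).comp (W.map (le_max_right (f.idx j) _)))
    (a := V.map h) (b := W.map h)
    (h := (f.app j s).comp (V.map hf)) (k := (g.app j s).comp (W.map hg))
    (fun x => congrArg (f.app j s) (V.map_map _ _ x))
    (fun x => congrArg (g.app j s) (W.map_map _ _ x)) x

/-- The tensor product `s ↦ f(s) ⊗ g(s)` of two families. -/
def Fam.tensor (f : Fam S V V') (g : Fam S W W') : Fam S (V.tensor W) (V'.tensor W') :=
  Quotient.map₂ PreFam.tensor (fun f f' hf g g' hg j => by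
    obtain ⟨k, h, h', e⟩ := hf j
    obtain ⟨l, m, m', e'⟩ := hg j
    have hk := le_max_left k l
    have hl := le_max_right k l
    refine ⟨max k l, max_le (h.trans hk) (m.trans hl), max_le (h'.trans hk) (m'.trans hl),
      fun s x => ?_⟩
    refine (PreFam.tensor_app_map f g j s (h.trans hk) (m.trans hl) _ x).trans (Eq.trans ?_
      (PreFam.tensor_app_map f' g' j s (h'.trans hk) (m'.trans hl) _ x).symm)
    congr 2
    · ext y
      have := e s (V.map hk y)
      rw [V.map_map, V.map_map] at this
      exact this
    · ext y
      have := e' s (W.map hl y)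
      rw [W.map_map, W.map_map] at this
      exact this) f g

theorem Fam.tensor_restrict (p : S' → S) (f : Fam S V V') (g : Fam S W W') :
    (f.tensor g).restrict p = (f.restrict p).tensor (g.restrict p) := by
  induction f using Quotient.inductionOn with
  | h f =>
  induction g using Quotient.inductionOn with
  | h g => rfl

theorem Fam.tensor_id (S : Type v) (V W : ProVect.{u}) :
    (Fam.id S V).tensor (Fam.id S W) = Fam.id S (V.tensor W) := by
  refine Quotient.sound fun j => ⟨j, (max_self j).le, le_rfl, fun s x => ?_⟩
  exact PreFam.tensor_app_map (PreFam.id S V) (PreFam.id S W) j s le_rfl le_rfl _ x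

theorem Fam.tensor_comp (f' : Fam S V' V'') (f : Fam S V V') (g' : Fam S W' W'')
    (g : Fam S W W') : (f'.comp f).tensor (g'.comp g) = (f'.tensor g').comp (f.tensor g) := by
  induction f using Quotient.inductionOn with
  | h f =>
  induction g using Quotient.inductionOn with
  | h g =>
  induction f' using Quotient.inductionOn with
  | h f' =>
  induction g' using Quotient.inductionOn with
  | h g' =>
  refine Quotient.sound fun j => ?_
  obtain ⟨k, k₁, k₂, e⟩ := f.compat (le_max_left (f'.idx j) (g'.idx j))
  obtain ⟨l, l₁, l₂, e'⟩ := g.compat (le_max_right (f'.idx j) (g'.idx j))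
  have hk := le_max_left k l
  have hl := le_max_right k l
  refine ⟨max k l, max_le (k₁.trans hk) (l₁.trans hl), max_le (k₂.trans hk) (l₂.trans hl),
    fun s x => ?_⟩
  refine (PreFam.tensor_app_map (f'.comp f) (g'.comp g) j s (k₁.trans hk) (l₁.trans hl) _
    x).trans ?_
  refine Eq.trans ?_ (congrArg ((f'.tensor g').app j s)
    (PreFam.tensor_app_map f g (max (f'.idx j) (g'.idx j)) s (k₂.trans hk) (l₂.trans hl) _ x)).symm
  refine (tensor_map_map (fun y => ?_) (fun y => ?_) x).symm
  · have := e s (V.map hk y)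
    rw [V.map_map, V.map_map] at this
    exact congrArg (f'.app j s) this
  · have := e' s (W.map hl y)
    rw [W.map_map, W.map_map] at this
    exact congrArg (g'.app j s) this

end ProVect

open scoped PowerSeries LaurentSeries ValuativeRel

section LoopGroup

variable (F : Type u) [Field F]

/-- `B = K / O`, where `O = F⟦t⟧` and `K = F⸨t⸩`, as an `O`-module. -/
abbrev PolarParts : Type u := F⸨X⸩ ⧸ LinearMap.range (Algebra.linearMap F⟦X⟧ F⸨X⸩)

/-- The residue `f dt ↦ Res_{t = 0} (f dt)`, as a function on `K / O`. -/
noncomputable def PolarParts.residue : PolarParts F →+ F :=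
  QuotientAddGroup.lift (LinearMap.range (Algebra.linearMap F⟦X⟧ F⸨X⸩)).toAddSubgroup
    { toFun := fun f => HahnSeries.coeff f (-1)
      map_zero' := rfl
      map_add' := fun _ _ => rfl }
    (by
      rintro _ ⟨f, rfl⟩
      change HahnSeries.coeff (f : F⸨X⸩) (-1) = 0
      exact HahnSeries.embDomain_of_notMem_range (by rintro ⟨n, hn⟩; simp at hn))

/-- The multiplication action of `O^*` on `K / O`. -/
noncomputable def unitsAction : F⟦X⟧ˣ →* MulAut (Multiplicative (PolarParts F)) where
  toFun a := AddEquiv.toMultiplicative (DistribMulAction.toAddEquiv (PolarParts F) a)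
  map_one' := by
    ext b
    exact congrArg Multiplicative.ofAdd (one_smul F⟦X⟧ˣ (Multiplicative.toAdd b))
  map_mul' a a' := by
    ext b
    exact congrArg Multiplicative.ofAdd (mul_smul a a' (Multiplicative.toAdd b))

/-- The group `H_∞ = O^* ⋉ K / O`. -/
abbrev HInf : Type u := Multiplicative (PolarParts F) ⋊[unitsAction F] F⟦X⟧ˣ

variable {F}

/-- The component of `h` in `K / O`. -/
noncomputable def HInf.polar (h : HInf F) : PolarParts F := Multiplicative.toAdd h.left

/-- The component of `h` in `O^*`. -/
def HInf.unit (h : HInf F) : F⟦X⟧ˣ := h.right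

theorem HInf.polar_mul (h h' : HInf F) :
    (h * h').polar = h.polar + (h.unit : F⟦X⟧) • h'.polar := rfl

theorem HInf.unit_mul (h h' : HInf F) : (h * h').unit = h.unit * h'.unit := rfl

theorem HInf.polar_one : (1 : HInf F).polar = 0 := rfl

theorem HInf.unit_one : (1 : HInf F).unit = 1 := rfl

variable (F)

/-- The subgroup `O^* ⋉ B_n` of `H_∞`, where `B_n = t⁻ⁿ O / O` is the kernel of `tⁿ` on `K / O`. -/
noncomputable def HInf.level (n : ℕ) : Subgroup (HInf F) where
  carrier := {h | (PowerSeries.X ^ n : F⟦X⟧) • h.polar = 0}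
  one_mem' := smul_zero _
  mul_mem' {a b} ha hb := by
    simp only [Set.mem_ofPred_eq] at ha hb ⊢
    rw [HInf.polar_mul, smul_add, ha, smul_comm, hb, smul_zero, zero_add]
  inv_mem' {a} ha := by
    simp only [Set.mem_ofPred_eq] at ha ⊢
    have h1 : (a * a⁻¹).polar = 0 := by rw [mul_inv_cancel]; rfl
    rw [HInf.polar_mul] at h1
    have h2 : (a.unit : F⟦X⟧) • ((PowerSeries.X ^ n : F⟦X⟧) • (a⁻¹).polar) = 0 := by
      have h3 := congrArg (fun b => (PowerSeries.X ^ n : F⟦X⟧) • b) h1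
      simp only [smul_add, ha, zero_add, smul_zero] at h3
      rw [smul_comm, h3]
    exact (smul_eq_zero_iff_eq a.unit).1 h2

variable {F}

theorem HInf.level_mono {m n : ℕ} (h : m ≤ n) : HInf.level F m ≤ HInf.level F n := by
  intro a ha
  change (PowerSeries.X ^ n : F⟦X⟧) • a.polar = 0
  obtain ⟨k, rfl⟩ := Nat.exists_eq_add_of_le h
  have ha' : (PowerSeries.X ^ m : F⟦X⟧) • a.polar = 0 := ha
  rw [pow_add, mul_comm, mul_smul, ha', smul_zero]

/-- The coordinates `(a_0, …, a_m)` of the class of `a` in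
`O_m^* = (O / t^(m+1))^* = {y ∈ F^(m+1) | y_0 ≠ 0}`. -/
noncomputable def jet (m : ℕ) (a : F⟦X⟧ˣ) : Fin (m + 1) → F :=
  fun i => PowerSeries.coeff (i : ℕ) (a : F⟦X⟧)

/-- The coordinates of the image of `h ∈ O^* ⋉ B_n` in `O_m^* × B_n ⊆ F^(m+1) × F^n`: the first
`m + 1` coefficients of the unit and the coefficients of `t⁻¹, …, t⁻ⁿ` of the polar part. -/
noncomputable def HInf.coords (m n : ℕ) (h : HInf.level F n) : (Fin (m + 1) → F) × (Fin n → F) :=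
  (jet m (h : HInf F).unit,
    fun k => PolarParts.residue F ((PowerSeries.X ^ (k : ℕ) : F⟦X⟧) • (h : HInf F).polar))

variable [TopologicalSpace F]

/-- The topology on `O^* ⋉ B_n` pulled back from `O_m^* × B_n`.  A function is locally constant for
it if and only if it factors through a locally constant function on `O_m^* × B_n`. -/
noncomputable abbrev HInf.depthTopology (m n : ℕ) : TopologicalSpace (HInf.level F n) :=
  TopologicalSpace.induced (HInf.coords m n) inferInstance

/-- A family indexed by `O^* ⋉ B_n` is smooth if it lies in
`lim_j colim_(i, m) Hom(V_i, C^∞(O_m^* × B_n, W_j))`, with `C^∞` the locally constant functions;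
i.e. `O^* ⋉ B_n` is regarded as the pro-object `lim_m (O_m^* × B_n)` of the category of locally
profinite spaces. -/
def IsSmoothFam {n : ℕ} {V W : ProVect.{u}} (ρ : ProVect.Fam (HInf.level F n) V W) : Prop :=
  ∃ p : ProVect.PreFam (HInf.level F n) V W, ρ = Quotient.mk _ p ∧
    ∀ j : ℕ, ∃ m : ℕ, ∀ x : V.obj (p.idx j),
      @IsLocallyConstant _ _ (HInf.depthTopology m n) (fun h => p.app j h x)

open ProVect

variable (F)

/-- Smooth representations of `H_∞` on pro-vector spaces, i.e. representations of the group object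
`colim_n lim_m (O_m^* × B_n)`: a compatible system of smooth families `ρ n` over the subgroups
`O^* ⋉ B_n` (which exhaust `H_∞`), unital and multiplicative.  All identities are identities of
families, i.e. they hold at some stage of the pro-system uniformly in the group variables. -/
structure SmoothRep : Type (u + 1) where
  space : ProVect.{u}
  ρ : ∀ n : ℕ, Fam (HInf.level F n) space space
  smooth : ∀ n, IsSmoothFam (ρ n)
  restrict_eq : ∀ {m n : ℕ} (h : m ≤ n),
    (ρ n).restrict (Subgroup.inclusion (HInf.level_mono h)) = ρ m
  one_eq : ∀ n, (ρ n).restrict (fun _ : Unit => 1) = 𝟙 space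
  mul_eq : ∀ n, (ρ n).restrict (fun p : HInf.level F n × HInf.level F n => p.1 * p.2) =
    ((ρ n).restrict Prod.fst).comp ((ρ n).restrict Prod.snd)

namespace SmoothRep

variable {F}

/-- Morphisms of representations of the group object: the families `f ∘ ρ_V` and `ρ_W ∘ f` over
`O^* ⋉ B_n` agree for all `n`. -/
@[ext]
structure Hom (V W : SmoothRep F) : Type u where
  hom : V.space ⟶ W.space
  comm : ∀ n, (const (HInf.level F n) hom).comp (V.ρ n) =
    (W.ρ n).comp (const (HInf.level F n) hom)

instance : Category.{u} (SmoothRep F) where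
  Hom := Hom
  id V := ⟨𝟙 V.space, fun n => by
    rw [const_id, Fam.id_comp, Fam.comp_id]⟩
  comp f g := ⟨f.hom ≫ g.hom, fun n => by
    rw [const_comp, Fam.comp_assoc, f.comm, ← Fam.comp_assoc, g.comm, Fam.comp_assoc]⟩
  id_comp f := Hom.ext (Category.id_comp f.hom)
  comp_id f := Hom.ext (Category.comp_id f.hom)
  assoc f g h := Hom.ext (Category.assoc f.hom g.hom h.hom)

variable (F) in
/-- The underlying pro-vector space. -/
def forget : SmoothRep F ⥤ ProVect.{u} where
  obj V := V.space
  map f := f.hom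

/-- `β ∘ ρ(h) = κ(h) β` for `h ∈ T`, as families indexed by the group `T`. -/
def IsSemiInvariant (V : SmoothRep F) {n : ℕ} (T : Subgroup (HInf.level F n)) (κ : T → ℂ)
    {W : ProVect.{u}} (β : V.space ⟶ W) : Prop :=
  (const T β).comp ((V.ρ n).restrict ((↑) : T → HInf.level F n)) = (const T β).twist κ

/-- `q : V → Q` exhibits `Q` as the coinvariants `V_{T, κ}`: it is the universal morphism from `V`
to a pro-vector space on which `T` acts through `κ`. -/
structure IsCoinvariants (V : SmoothRep F) {n : ℕ} (T : Subgroup (HInf.level F n)) (κ : T → ℂ)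
    {Q : ProVect.{u}} (q : V.space ⟶ Q) : Prop where
  semiInvariant : V.IsSemiInvariant T κ q
  existsUnique_desc : ∀ (W : ProVect.{u}) (β : V.space ⟶ W), V.IsSemiInvariant T κ β →
    ∃! γ : Q ⟶ W, q ≫ γ = β

variable (F) in
/-- The subgroup `B_1 = t⁻¹ O / O` of `O^* ⋉ B_1`. -/
def subgroupB1 : Subgroup (HInf.level F 1) where
  carrier := {h | (h : HInf F).unit = 1}
  one_mem' := rfl
  mul_mem' {a b} ha hb := by
    simp only [Set.mem_ofPred_eq] at ha hb ⊢
    rw [Subgroup.coe_mul, HInf.unit_mul, ha, hb, mul_one]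
  inv_mem' {a} ha := by
    simp only [Set.mem_ofPred_eq] at ha ⊢
    have h1 : ((a * a⁻¹ : HInf.level F 1) : HInf F).unit = 1 := by rw [mul_inv_cancel]; rfl
    rwa [Subgroup.coe_mul, HInf.unit_mul, ha, one_mul] at h1

variable (F) in
/-- The subgroup `O^*(1) × B_1` of `O^* ⋉ B_1`, where `O^*(1) = 1 + t O`. -/
def whittakerSubgroup : Subgroup (HInf.level F 1) where
  carrier := {h | PowerSeries.constantCoeff ((h : HInf F).unit : F⟦X⟧) = 1}
  one_mem' := by
    simp only [Set.mem_ofPred_eq]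
    rw [Subgroup.coe_one, HInf.unit_one, Units.val_one, map_one]
  mul_mem' {a b} ha hb := by
    simp only [Set.mem_ofPred_eq] at ha hb ⊢
    rw [Subgroup.coe_mul, HInf.unit_mul, Units.val_mul, map_mul, ha, hb, mul_one]
  inv_mem' {a} ha := by
    simp only [Set.mem_ofPred_eq] at ha ⊢
    have h1 : PowerSeries.constantCoeff
        (((a * a⁻¹ : HInf.level F 1) : HInf F).unit : F⟦X⟧) = 1 := by
      rw [mul_inv_cancel, Subgroup.coe_one, HInf.unit_one, Units.val_one, map_one]
    rwa [Subgroup.coe_mul, HInf.unit_mul, Units.val_mul, map_mul, ha, one_mul] at h1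

/-- `V` is cuspidal if `V_{B_1} = 0`. -/
def IsCuspidal (V : SmoothRep F) : Prop :=
  ∃ (Q : ProVect.{u}) (q : V.space ⟶ Q),
    V.IsCoinvariants (subgroupB1 F) (fun _ => 1) q ∧ Limits.IsZero Q

/-- The representation `T ⊗ V`, where `H_∞` acts on the second factor. -/
def tensor (T : ProVect.{u}) (V : SmoothRep F) : SmoothRep F where
  space := T.tensor V.space
  ρ n := (Fam.id _ T).tensor (V.ρ n)
  smooth n := by
    obtain ⟨p, hp, hs⟩ := V.smooth n
    refine ⟨(PreFam.id _ T).tensor p, ?_, fun j => ?_⟩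
    · rw [hp]; rfl
    · obtain ⟨m, hm⟩ := hs j
      refine ⟨m, fun x => ?_⟩
      let _ := HInf.depthTopology (F := F) m n
      change IsLocallyConstant (fun h => TensorProduct.map
        (((PreFam.id _ T).app j h).comp (T.map _)) ((p.app j h).comp (V.space.map _)) x)
      induction x using TensorProduct.induction_on with
      | zero =>
        simp only [map_zero]
        exact IsLocallyConstant.const _
      | tmul a b =>
        have := (hm (V.space.map (le_max_right _ _) b)).comp
          (fun z => (T.map (le_max_left j (p.idx j)) a) ⊗ₜ[ℂ] z)
        exact this
      | add a b ha hb =>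
        simp only [map_add]
        exact ha.add hb
  restrict_eq h := by
    rw [Fam.tensor_restrict, V.restrict_eq h, Fam.restrict_id]
  one_eq n := by
    rw [Fam.tensor_restrict, V.one_eq n, Fam.restrict_id]
    exact Fam.tensor_id _ _ _
  mul_eq n := by
    rw [Fam.tensor_restrict, V.mul_eq n, Fam.tensor_restrict, Fam.tensor_restrict,
      ← Fam.tensor_comp, Fam.restrict_id, Fam.restrict_id, Fam.restrict_id, Fam.comp_id]

theorem const_tensor (S : Type v) {T T' : ProVect.{u}} (f : T ⟶ T') (V : ProVect.{u}) :
    const S (Fam.tensor f (Fam.id Unit V) : T.tensor V ⟶ T'.tensor V) =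
      (const S f).tensor (Fam.id S V) :=
  Fam.tensor_restrict _ _ _

/-- The functor `T ↦ T ⊗ V`. -/
def tensorFunctor (V : SmoothRep F) : ProVect.{u} ⥤ SmoothRep F where
  obj T := tensor T V
  map {T T'} f := ⟨Fam.tensor f (Fam.id Unit V.space), fun n => by
    change (const _ _).comp ((Fam.id _ T).tensor (V.ρ n)) =
      ((Fam.id _ T').tensor (V.ρ n)).comp (const _ _)
    rw [const_tensor, ← Fam.tensor_comp, ← Fam.tensor_comp, Fam.id_comp, Fam.id_comp, Fam.comp_id,
      Fam.comp_id]⟩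
  map_id T := Hom.ext (Fam.tensor_id _ _ _)
  map_comp f g := Hom.ext (by
    have h := Fam.tensor_comp g f (Fam.id Unit V.space) (Fam.id Unit V.space)
    rw [Fam.id_comp] at h
    exact h)

end SmoothRep

end LoopGroup

section Schwartz

open Topology

variable {F : Type u} [Field F]

/-- The coefficients `0, …, n` of a power series. -/
noncomputable def pjet (n : ℕ) (p : F⟦X⟧) : Fin (n + 1) → F := fun i => PowerSeries.coeff (i : ℕ) p

/-- The truncated power series with given coefficients. -/
noncomputable def extJet (n : ℕ) (y : Fin (n + 1) → F) : F⟦X⟧ :=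
  PowerSeries.mk fun i => if h : i < n + 1 then y ⟨i, h⟩ else 0

theorem pjet_extJet (n : ℕ) (y : Fin (n + 1) → F) : pjet n (extJet n y) = y := by
  funext i
  have := i.2
  simp only [pjet, extJet, PowerSeries.coeff_mk, this, dif_pos]

/-- Multiplication in `O / t^(n+1)` in coordinates. -/
noncomputable def mulJet (n : ℕ) (w y : Fin (n + 1) → F) : Fin (n + 1) → F :=
  pjet n (extJet n w * extJet n y)

theorem coeff_extJet_pjet {n i : ℕ} (h : i ≤ n) (p : F⟦X⟧) :
    PowerSeries.coeff i (extJet n (pjet n p)) = PowerSeries.coeff i p := by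
  simp only [extJet, pjet, PowerSeries.coeff_mk, Nat.lt_succ_of_le h, dif_pos]

theorem mulJet_pjet (n : ℕ) (p q : F⟦X⟧) : mulJet n (pjet n p) (pjet n q) = pjet n (p * q) := by
  funext i
  simp only [mulJet, pjet]
  rw [PowerSeries.coeff_mul, PowerSeries.coeff_mul]
  refine Finset.sum_congr rfl fun x hx => ?_
  have hx' : x.1 + x.2 = i := by simpa using hx
  have hi := i.2
  rw [coeff_extJet_pjet (by omega), coeff_extJet_pjet (by omega)]

theorem pjet_surj (n : ℕ) (y : Fin (n + 1) → F) : ∃ p, y = pjet n p :=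
  ⟨extJet n y, (pjet_extJet n y).symm⟩

theorem jet_eq_pjet (n : ℕ) (a : F⟦X⟧ˣ) : jet n a = pjet n (a : F⟦X⟧) := rfl

theorem mulJet_jet (n : ℕ) (a b : F⟦X⟧ˣ) : mulJet n (jet n a) (jet n b) = jet n (a * b) := by
  simp [jet_eq_pjet, mulJet_pjet]

theorem mulJet_inv_cancel (n : ℕ) (a : F⟦X⟧ˣ) (y : Fin (n + 1) → F) :
    mulJet n (jet n a⁻¹) (mulJet n (jet n a) y) = y := by
  obtain ⟨p, rfl⟩ := pjet_surj n y
  rw [jet_eq_pjet, jet_eq_pjet, mulJet_pjet, mulJet_pjet, ← mul_assoc, Units.inv_mul, one_mul]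

theorem mulJet_zero (n : ℕ) (w y : Fin (n + 1) → F) : mulJet n w y 0 = w 0 * y 0 := by
  simp [mulJet, pjet, extJet]

theorem jet_zero_ne (n : ℕ) (a : F⟦X⟧ˣ) : jet n a 0 ≠ 0 := by
  have : IsUnit (PowerSeries.constantCoeff (a : F⟦X⟧)) := a.isUnit.map _
  simpa [jet] using this.ne_zero

theorem jet_surj (n : ℕ) {y : Fin (n + 1) → F} (h : y 0 ≠ 0) : ∃ a, jet n a = y := by
  have hu : IsUnit (extJet n y) := by
    rw [PowerSeries.isUnit_iff_constantCoeff]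
    simpa [extJet] using h
  exact ⟨hu.unit, pjet_extJet n y⟩

variable (F) in
theorem PolarParts.residue_C_smul (c : F) (b : PolarParts F) :
    residue F (PowerSeries.C c • b) = c * residue F b := by
  obtain ⟨f, rfl⟩ := Submodule.Quotient.mk_surjective _ b
  rw [← Submodule.Quotient.mk_smul]
  change HahnSeries.coeff (PowerSeries.C c • f) (-1) = c * HahnSeries.coeff f (-1)
  rw [Algebra.smul_def]
  have : algebraMap F⟦X⟧ F⸨X⸩ (PowerSeries.C c) = HahnSeries.C c := by
    simp
  rw [this, HahnSeries.C_mul_eq_smul, HahnSeries.coeff_smul, smul_eq_mul]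

theorem PolarParts.residue_smul {n : ℕ} (p : F⟦X⟧) (b : PolarParts F)
    (hb : (PowerSeries.X ^ n : F⟦X⟧) • b = 0) :
    residue F (p • b) = ∑ i : Fin n, PowerSeries.coeff (i : ℕ) p *
      residue F ((PowerSeries.X ^ (i : ℕ) : F⟦X⟧) • b) := by
  induction n generalizing p b with
  | zero =>
    have : b = 0 := by simpa using hb
    simp [this]
  | succ n ih =>
    rw [Fin.sum_univ_succ]
    conv_lhs => rw [PowerSeries.eq_X_mul_shift_add_const p]
    rw [add_smul, map_add, add_comm, PolarParts.residue_C_smul, mul_comm PowerSeries.X, mul_smul,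
      ih]
    · congr 1
      · simp
      · refine Finset.sum_congr rfl fun i _ => ?_
        rw [smul_smul, ← pow_succ]
        simp
    · rw [smul_smul, ← pow_succ]
      exact hb

section Top

variable [TopologicalSpace F]

variable (F) in
/-- Locally constant compactly supported functions on `O_n^* = {y ∈ F^(n+1) | y_0 ≠ 0}`, extended by
zero to `F^(n+1)`. -/
def schwartzJets (n : ℕ) : Submodule ℂ ((Fin (n + 1) → F) → ℂ) where
  carrier := {g | IsLocallyConstant g ∧ HasCompactSupport g ∧ ∀ y, y 0 = 0 → g y = 0}
  zero_mem' := ⟨IsLocallyConstant.const 0, HasCompactSupport.zero, fun _ _ => rfl⟩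
  add_mem' {f g} hf hg := ⟨hf.1.add hg.1, hf.2.1.add hg.2.1, fun y hy => by
    rw [Pi.add_apply, hf.2.2 y hy, hg.2.2 y hy, add_zero]⟩
  smul_mem' c f hf := ⟨hf.1.comp (fun z : ℂ => c * z),
    hf.2.1.comp_left (g := fun z : ℂ => c * z) (mul_zero c), fun y hy => by
      rw [Pi.smul_apply, hf.2.2 y hy, smul_zero]⟩

variable (F) in
/-- The space `M_n` of locally constant compactly supported measures on `O_n^*`.  Its elements are
written `f(x) dx` with `dx` a Haar measure on the group `O_n^*`, and `f` is regarded as a function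
on `O^*` through the projection `O^* → O_n^*`. -/
noncomputable def schwartzUnits (n : ℕ) : Submodule ℂ (F⟦X⟧ˣ → ℂ) :=
  (schwartzJets F n).map (LinearMap.funLeft ℂ ℂ (jet n))

theorem mem_schwartzUnits {n : ℕ} {f : F⟦X⟧ˣ → ℂ} :
    f ∈ schwartzUnits F n ↔ ∃ g ∈ schwartzJets F n, ∀ x, f x = g (jet n x) := by
  constructor
  · rintro ⟨g, hg, rfl⟩
    exact ⟨g, hg, fun _ => rfl⟩
  · rintro ⟨g, hg, h⟩
    exact ⟨g, hg, funext fun x => (h x).symm⟩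

theorem countable_compactOpen (Y : Type*) [TopologicalSpace Y] [SecondCountableTopology Y] :
    {K : Set Y | IsCompact K ∧ IsOpen K}.Countable := by
  have hB := TopologicalSpace.isBasis_countableBasis Y
  have hc := TopologicalSpace.countable_countableBasis Y
  refine ((Set.countable_ofPred_finite_subset hc).image Set.sUnion).mono ?_
  rintro K ⟨hK, hO⟩
  obtain ⟨S, hS, rfl⟩ := hB.open_eq_sUnion hO
  obtain ⟨t, ht⟩ := hK.elim_finite_subcover (fun s : S => (s : Set Y))
    (fun s => hB.isOpen (hS s.2)) (by rw [Set.sUnion_eq_iUnion])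
  refine ⟨Subtype.val '' (t : Set S), ⟨t.finite_toSet.image _, ?_⟩, ?_⟩
  · rintro _ ⟨s, _, rfl⟩
    exact hS s.2
  · refine Set.Subset.antisymm (Set.sUnion_subset_sUnion ?_) fun y hy => ?_
    · rintro _ ⟨s, _, rfl⟩
      exact s.2
    · obtain ⟨s, hs, hy⟩ := Set.mem_iUnion₂.1 (ht hy)
      exact ⟨s, ⟨s, hs, rfl⟩, hy⟩

theorem rank_schwartz_le {Y : Type u} [TopologicalSpace Y] [SecondCountableTopology Y]
    (S : Submodule ℂ (Y → ℂ)) (hS : ∀ f ∈ S, IsLocallyConstant f ∧ HasCompactSupport f) :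
    Module.rank ℂ S ≤ Cardinal.aleph0 := by
  let I : Set (Y → ℂ) := (fun K : Set Y => K.indicator 1) '' {K | IsCompact K ∧ IsOpen K}
  have hI : I.Countable := (countable_compactOpen Y).image _
  have hle : S ≤ Submodule.span ℂ I := by
    intro f hf
    obtain ⟨hl, hc⟩ := hS f hf
    obtain ⟨t, ht⟩ := hc.elim_finite_subcover (fun c : ℂ => f ⁻¹' {c}) (fun c => hl _)
      (fun y _ => Set.mem_iUnion.2 ⟨f y, rfl⟩)
    have hfs : f = ∑ c ∈ t.erase 0, c • (f ⁻¹' {c}).indicator (1 : Y → ℂ) := by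
      funext y
      rw [Finset.sum_apply]
      by_cases hy : f y = 0
      · rw [hy]
        refine (Finset.sum_eq_zero fun c hc => ?_).symm
        have : c ≠ 0 := Finset.ne_of_mem_erase hc
        simp [Set.indicator, hy, this.symm]
      · have hyt : f y ∈ t := by
          obtain ⟨c, hc, h⟩ := Set.mem_iUnion₂.1 (ht (subset_tsupport f hy))
          have h : f y = c := h
          rwa [h]
        rw [Finset.sum_eq_single (f y)]
        · simp [Set.indicator]
        · intro c _ hc
          simp [Set.indicator, hc.symm]
        · intro h
          exact absurd (Finset.mem_erase.2 ⟨hy, hyt⟩) h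
    rw [hfs]
    refine Submodule.sum_mem _ fun c hc' => Submodule.smul_mem _ _ (Submodule.subset_span ?_)
    refine ⟨_, ⟨?_, hl _⟩, rfl⟩
    refine hc.of_isClosed_subset (hl.isClosed_fiber c) fun y hy => subset_tsupport f ?_
    have hy : f y = c := hy
    rw [Function.mem_support, hy]
    exact Finset.ne_of_mem_erase hc'
  exact (Submodule.rank_mono hle).trans ((rank_span_le I).trans (Cardinal.mk_le_aleph0_iff.2 hI))

theorem eventually_forall_eq {A Z E : Type*} [TopologicalSpace A] [TopologicalSpace Z]
    {Φ : A → Z → E} (a₀ : A) {C : Set Z} (hC : IsCompact C)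
    (h : ∀ z ∈ C, ∀ᶠ p in 𝓝 (a₀, z), Φ p.1 p.2 = Φ a₀ z) :
    ∀ᶠ a in 𝓝 a₀, ∀ z ∈ C, Φ a z = Φ a₀ z := by
  refine hC.eventually_forall_of_forall_eventually (P := fun a z => Φ a z = Φ a₀ z) fun z hz => ?_
  have h₁ := h z hz
  have h₂ : Filter.Tendsto (fun p : A × Z => (a₀, p.2)) (𝓝 (a₀, z)) (𝓝 (a₀, z)) := by
    have : Continuous (fun p : A × Z => (a₀, p.2)) := by fun_prop
    exact this.tendsto (a₀, z)
  filter_upwards [h₁, h₂.eventually h₁] with p e₁ e₂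
  exact e₁.trans e₂.symm

variable [IsTopologicalRing F]

theorem continuous_extJet (n i : ℕ) :
    Continuous fun y : Fin (n + 1) → F => PowerSeries.coeff i (extJet n y) := by
  simp only [extJet, PowerSeries.coeff_mk]
  split_ifs with h
  · exact continuous_apply _
  · exact continuous_const

theorem continuous_mulJet (n : ℕ) :
    Continuous fun p : (Fin (n + 1) → F) × (Fin (n + 1) → F) => mulJet n p.1 p.2 := by
  refine continuous_pi fun i => ?_
  simp only [mulJet, pjet, PowerSeries.coeff_mul]
  refine continuous_finsetSum _ fun x _ => ?_
  exact ((continuous_extJet n _).comp continuous_fst).mul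
    ((continuous_extJet n _).comp continuous_snd)

theorem continuous_mulJet_right (n : ℕ) (w : Fin (n + 1) → F) : Continuous (mulJet n w) := by
  have h : Continuous fun y : Fin (n + 1) → F => (w, y) := Continuous.prodMk_right w
  have h' := Continuous.comp (continuous_mulJet n) h
  exact h'

/-- Multiplication by a unit as a homeomorphism. -/
noncomputable def mulJetHomeo (n : ℕ) (a : F⟦X⟧ˣ) : (Fin (n + 1) → F) ≃ₜ (Fin (n + 1) → F) where
  toFun y := mulJet n (jet n a) y
  invFun y := mulJet n (jet n a⁻¹) y
  left_inv := mulJet_inv_cancel n a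
  right_inv y := by
    have h := mulJet_inv_cancel n a⁻¹ y
    rw [inv_inv] at h
    exact h
  continuous_toFun := continuous_mulJet_right n _
  continuous_invFun := continuous_mulJet_right n _

theorem continuousAt_invJet [ContinuousInv₀ F] (n i : ℕ) {w : Fin (n + 1) → F} (hw : w 0 ≠ 0) :
    ContinuousAt (fun w : Fin (n + 1) → F => PowerSeries.coeff i (extJet n w)⁻¹) w := by
  have h0 : ContinuousAt (fun w : Fin (n + 1) → F =>
      (PowerSeries.constantCoeff (extJet n w))⁻¹) w := by
    simp only [← PowerSeries.coeff_zero_eq_constantCoeff_apply]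
    refine ContinuousAt.inv₀ (continuous_extJet n 0).continuousAt ?_
    simpa [extJet] using hw
  induction i using Nat.strong_induction_on with
  | _ i ih =>
    have hi := fun w : Fin (n + 1) → F => PowerSeries.coeff_inv i (extJet n w)
    rw [funext hi]
    split_ifs with h
    · exact h0
    · refine h0.neg.mul ?_
      refine tendsto_finsetSum _ fun x _ => ?_
      split_ifs with hx
      · exact (continuous_extJet n _).continuousAt.mul (ih _ hx)
      · exact continuousAt_const

theorem jet_inv (n : ℕ) (a : F⟦X⟧ˣ) : jet n a⁻¹ = pjet n (extJet n (jet n a))⁻¹ := by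
  have hc : PowerSeries.constantCoeff (extJet n (jet n a)) ≠ 0 := by
    simpa [extJet] using jet_zero_ne n a
  have h1 : mulJet n (jet n a) (pjet n (extJet n (jet n a))⁻¹) = pjet n 1 := by
    conv_lhs => rw [← pjet_extJet n (jet n a), mulJet_pjet, pjet_extJet]
    rw [PowerSeries.mul_inv_cancel _ hc]
  rw [← mulJet_inv_cancel n a (pjet n (extJet n (jet n a))⁻¹), h1, jet_eq_pjet, mulJet_pjet,
    mul_one]

end Top

end Schwartz

section MeasureRep

open Topology MeasureTheory

variable (F : Type u) [Field F] [ValuativeRel F] [TopologicalSpace F] [IsNonarchimedeanLocalField F]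

theorem secondCountable_localField : SecondCountableTopology F := by
  let _ := IsTopologicalAddGroup.rightUniformSpace F
  have := isUniformAddGroup_of_addCommGroup (G := F)
  let _ : (Valued.v (R := F)).RankOne :=
  { hom' := ValuativeRel.IsRankLeOne.nonempty.some.emb (R := F).comp
      MonoidWithZeroHom.ValueGroup₀.embedding
    strictMono' := ValuativeRel.IsRankLeOne.nonempty.some.strictMono.comp
        MonoidWithZeroHom.ValueGroup₀.embedding_strictMono }
  open scoped Valued in
  have : ProperSpace F := .of_nontriviallyNormedField_of_weaklyLocallyCompactSpace F
  open scoped Valued in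
  exact secondCountable_of_proper

theorem t2Space_localField : T2Space F := by
  let _ := IsTopologicalAddGroup.rightUniformSpace F
  have := isUniformAddGroup_of_addCommGroup (G := F)
  infer_instance

/-- An additive character of `F` that is trivial on the maximal ideal of the ring of integers `O_F`
and non-trivial on `O_F`. -/
structure ResidualChar where
  toAddChar : AddChar F ℂ
  trivial_of_lt_one : ∀ x : F, ValuativeRel.valuation F x < 1 → toAddChar x = 1
  exists_ne_one : ∃ x : F, ValuativeRel.valuation F x ≤ 1 ∧ toAddChar x ≠ 1

variable {F}

theorem ResidualChar.isLocallyConstant (ψ : ResidualChar F) : IsLocallyConstant ψ.toAddChar := by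
  rw [IsLocallyConstant.iff_eventually_eq]
  intro x
  have h0 : {y : F | ValuativeRel.valuation F y < 1} ∈ 𝓝 (0 : F) :=
    (IsValuativeTopology.mem_nhds_zero_iff _).2 ⟨1, by simp⟩
  have h1 : Filter.Tendsto (fun y => y - x) (𝓝 x) (𝓝 (0 : F)) := by
    have : Continuous fun y : F => y - x := by fun_prop
    simpa using this.tendsto x
  filter_upwards [h1 h0] with y hy
  have : ψ.toAddChar (x + (y - x)) = ψ.toAddChar x * ψ.toAddChar (y - x) := AddChar.map_add_eq_mul _ _ _
  rw [ψ.trivial_of_lt_one _ hy, mul_one] at this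
  simpa using this

theorem ne_zero_of_toAddChar (ψ : ResidualChar F) (x : F) : ψ.toAddChar x ≠ 0 := by
  intro h
  have h1 := AddChar.map_add_eq_mul ψ.toAddChar x (-x)
  rw [h, zero_mul, add_neg_cancel, AddChar.map_zero_eq_one] at h1
  exact one_ne_zero h1

namespace MeasureRep

/-- The operator `(h f)(x) = φ_b(x) f(a x)` for `h = b a`, `a ∈ O^*`, `b ∈ K / O`, where
`φ_b(x) = ψ(Res (b x dt))`: shift by `a` followed by multiplication by `φ_b`. -/
noncomputable def act (ψ : ResidualChar F) (h : HInf F) : (F⟦X⟧ˣ → ℂ) →ₗ[ℂ] (F⟦X⟧ˣ → ℂ) where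
  toFun f x := ψ.toAddChar (PolarParts.residue F ((x : F⟦X⟧) • h.polar)) * f (h.unit * x)
  map_add' f g := by
    funext x
    simp [mul_add]
  map_smul' c f := by
    funext x
    simp [mul_left_comm]

theorem act_one (ψ : ResidualChar F) (f : F⟦X⟧ˣ → ℂ) : act ψ 1 f = f := by
  funext x
  change ψ.toAddChar (PolarParts.residue F ((x : F⟦X⟧) • (1 : HInf F).polar)) *
    f ((1 : HInf F).unit * x) = f x
  rw [HInf.polar_one, HInf.unit_one, smul_zero, map_zero, AddChar.map_zero_eq_one, one_mul, one_mul]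

theorem act_mul (ψ : ResidualChar F) (h h' : HInf F) (f : F⟦X⟧ˣ → ℂ) :
    act ψ (h * h') f = act ψ h (act ψ h' f) := by
  funext x
  change ψ.toAddChar (PolarParts.residue F ((x : F⟦X⟧) • (h * h').polar)) *
    f ((h * h').unit * x) =
    ψ.toAddChar (PolarParts.residue F ((x : F⟦X⟧) • h.polar)) *
      (ψ.toAddChar (PolarParts.residue F (((h.unit * x : F⟦X⟧ˣ) : F⟦X⟧) • h'.polar)) *
        f (h'.unit * (h.unit * x)))
  rw [HInf.polar_mul, HInf.unit_mul, smul_add, map_add, AddChar.map_add_eq_mul, mul_assoc,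
    smul_smul, Units.val_mul, mul_comm (x : F⟦X⟧), mul_comm h.unit h'.unit, mul_assoc h'.unit]

/-- The function `φ_b` in coordinates. -/
noncomputable def phase (ψ : ResidualChar F) {k n : ℕ} (hn : n ≤ k + 1) (c : Fin n → F)
    (y : Fin (k + 1) → F) : ℂ :=
  ψ.toAddChar (∑ i : Fin n, y ⟨i, by omega⟩ * c i)

theorem phase_eq (ψ : ResidualChar F) {k n : ℕ} (hn : n ≤ k + 1) (h : HInf.level F n)
    (x : F⟦X⟧ˣ) : ψ.toAddChar (PolarParts.residue F ((x : F⟦X⟧) • (h : HInf F).polar)) =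
      phase ψ hn (HInf.coords 0 n h).2 (jet k x) := by
  rw [PolarParts.residue_smul _ _ h.2]
  rfl

theorem continuous_pairing {k n : ℕ} (hn : n ≤ k + 1) :
    Continuous fun p : (Fin n → F) × (Fin (k + 1) → F) =>
      ∑ i : Fin n, p.2 ⟨i, by omega⟩ * p.1 i := by
  fun_prop

theorem isLocallyConstant_phase (ψ : ResidualChar F) {k n : ℕ} (hn : n ≤ k + 1) :
    IsLocallyConstant fun p : (Fin n → F) × (Fin (k + 1) → F) => phase ψ hn p.1 p.2 :=
  ψ.isLocallyConstant.comp_continuous (continuous_pairing hn)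

theorem act_mem (ψ : ResidualChar F) {k n : ℕ} (hn : n ≤ k + 1) (h : HInf.level F n)
    {f : F⟦X⟧ˣ → ℂ} (hf : f ∈ schwartzUnits F k) : act ψ h f ∈ schwartzUnits F k := by
  obtain ⟨g, ⟨hg, hc, h0⟩, hfg⟩ := mem_schwartzUnits.1 hf
  refine mem_schwartzUnits.2 ⟨fun y => phase ψ hn (HInf.coords 0 n h).2 y *
    g (mulJetHomeo k (h : HInf F).unit y), ⟨?_, ?_, fun y hy => ?_⟩, fun x => ?_⟩
  · have h1 : IsLocallyConstant fun y : Fin (k + 1) → F => phase ψ hn (HInf.coords 0 n h).2 y :=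
      (isLocallyConstant_phase ψ hn).comp_continuous (Continuous.prodMk_right _)
    exact h1.mul (hg.comp_continuous (mulJetHomeo k (h : HInf F).unit).continuous)
  · exact (hc.comp_homeomorph (mulJetHomeo k (h : HInf F).unit)).mul_left
  · have : (mulJetHomeo k (h : HInf F).unit y) 0 = 0 := by
      change mulJet k _ y 0 = 0
      rw [mulJet_zero, hy, mul_zero]
    exact (congrArg _ (h0 _ this)).trans (mul_zero _)
  · change ψ.toAddChar _ * f _ = _
    rw [phase_eq ψ hn, hfg, ← mulJet_jet]
    rfl

theorem isLocallyConstant_act (ψ : ResidualChar F) {k n : ℕ} (hn : n ≤ k + 1)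
    {f : F⟦X⟧ˣ → ℂ} (hf : f ∈ schwartzUnits F k) :
    @IsLocallyConstant _ _ (HInf.depthTopology k n) (fun h : HInf.level F n => act ψ h f) := by
  let _ := HInf.depthTopology (F := F) k n
  rw [IsLocallyConstant.iff_eventually_eq]
  intro h₀
  obtain ⟨g, ⟨hg, hc, h0⟩, hfg⟩ := mem_schwartzUnits.1 hf
  obtain ⟨g₁, ⟨hg₁, hc₁, -⟩, hfg₁⟩ := mem_schwartzUnits.1 (act_mem ψ hn h₀ hf)
  have hcoords : Continuous (HInf.coords (F := F) k n) := continuous_induced_dom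
  set a₀ := (h₀ : HInf F).unit with ha₀
  have hs : ∀ᶠ w in 𝓝 (jet k (1 : F⟦X⟧ˣ)), ∀ z ∈ tsupport g, g (mulJet k w z) =
      g (mulJet k (jet k 1) z) := by
    refine eventually_forall_eq (Φ := fun w z => g (mulJet k w z)) _ hc fun z _ => ?_
    exact (IsLocallyConstant.iff_eventually_eq _).1
      (hg.comp_continuous (continuous_mulJet k)) (jet k 1, z)
  have hone : ∀ z : F⟦X⟧ˣ, mulJet k (jet k 1) (jet k z) = jet k z := fun z => by
    rw [mulJet_jet, one_mul]
  have hs1 : ∀ᶠ h : HInf.level F n in 𝓝 h₀, ∀ z ∈ tsupport g,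
      g (mulJet k (jet k ((h : HInf F).unit * a₀⁻¹)) z) = g (mulJet k (jet k 1) z) := by
    have hcont : Continuous fun h : HInf.level F n => jet k ((h : HInf F).unit * a₀⁻¹) := by
      have : (fun h : HInf.level F n => jet k ((h : HInf F).unit * a₀⁻¹)) = fun h =>
          mulJet k (jet k a₀⁻¹) (HInf.coords k n h).1 := by
        funext h
        change _ = mulJet k (jet k a₀⁻¹) (jet k _)
        rw [mulJet_jet, mul_comm]
      rw [this]
      exact (continuous_mulJet_right k _).comp (continuous_fst.comp hcoords)
    have ht := hcont.tendsto h₀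
    rw [← ha₀, mul_inv_cancel] at ht
    exact ht.eventually hs
  have hs2 : ∀ᶠ h : HInf.level F n in 𝓝 h₀, ∀ z ∈ tsupport g,
      g (mulJet k (jet k (a₀ * (h : HInf F).unit⁻¹)) z) = g (mulJet k (jet k 1) z) := by
    have hcont : ContinuousAt (fun h : HInf.level F n => jet k (a₀ * (h : HInf F).unit⁻¹)) h₀ := by
      have : (fun h : HInf.level F n => jet k (a₀ * (h : HInf F).unit⁻¹)) = fun h =>
          mulJet k (jet k a₀) (pjet k (extJet k (HInf.coords k n h).1)⁻¹) := by
        funext h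
        change _ = mulJet k (jet k a₀) (pjet k (extJet k (jet k _))⁻¹)
        rw [← jet_inv, mulJet_jet]
      rw [this]
      refine (continuous_mulJet_right k _).continuousAt.comp ?_
      have h1 : ContinuousAt (fun w : Fin (k + 1) → F => pjet k (extJet k w)⁻¹)
          (HInf.coords k n h₀).1 :=
        continuousAt_pi.2 fun i => continuousAt_invJet k i (jet_zero_ne k _)
      exact ContinuousAt.comp (f := fun h => (HInf.coords k n h).1) h1
        (continuous_fst.comp hcoords).continuousAt
    have ht := hcont.tendsto
    rw [← ha₀, mul_inv_cancel] at ht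
    exact ht.eventually hs
  have hp : ∀ᶠ h : HInf.level F n in 𝓝 h₀, ∀ z ∈ tsupport g₁,
      phase ψ hn (HInf.coords k n h).2 z = phase ψ hn (HInf.coords k n h₀).2 z := by
    have := eventually_forall_eq (Φ := fun c z => phase ψ hn c z) (HInf.coords k n h₀).2 hc₁
      fun z _ => (IsLocallyConstant.iff_eventually_eq _).1 (isLocallyConstant_phase ψ hn) (_, z)
    exact ((continuous_snd.comp hcoords).tendsto h₀).eventually this
  filter_upwards [hs1, hs2, hp] with h e₁ e₂ e₃
  have hshift : ∀ x, f ((h : HInf F).unit * x) = f (a₀ * x) := by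
    intro x
    rw [hfg, hfg]
    by_cases hz : jet k (a₀ * x) ∈ tsupport g
    · have := e₁ _ hz
      rw [hone, mulJet_jet] at this
      rw [← this]
      congr 2
      rw [mul_assoc, inv_mul_cancel_left]
    · by_cases hz' : jet k ((h : HInf F).unit * x) ∈ tsupport g
      · have := e₂ _ hz'
        rw [hone, mulJet_jet] at this
        rw [← this]
        congr 2
        rw [mul_assoc, inv_mul_cancel_left]
      · rw [image_eq_zero_of_notMem_tsupport hz, image_eq_zero_of_notMem_tsupport hz']
  funext x
  have h1 : act ψ h f x = phase ψ hn (HInf.coords k n h).2 (jet k x) * f (a₀ * x) := by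
    rw [← hshift x]
    change ψ.toAddChar _ * f _ = _
    rw [phase_eq ψ hn]
    rfl
  have h2 : act ψ h₀ f x = phase ψ hn (HInf.coords k n h₀).2 (jet k x) * f (a₀ * x) := by
    change ψ.toAddChar _ * f _ = _
    rw [phase_eq ψ hn]
    rfl
  by_cases hz : jet k x ∈ tsupport g₁
  · rw [h1, h2, e₃ _ hz]
  · have h3 : act ψ h₀ f x = 0 := by
      rw [hfg₁, image_eq_zero_of_notMem_tsupport hz]
    rw [h3, h1]
    rw [h2] at h3
    have hne : phase ψ hn (HInf.coords k n h₀).2 (jet k x) ≠ 0 :=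
      ne_zero_of_toAddChar ψ _
    rw [(mul_eq_zero.1 h3).resolve_left hne, mul_zero]

/-- The unit `1 + y t^(n+1)`. -/
noncomputable def unip (n : ℕ) (y : F) : F⟦X⟧ˣ :=
  (PowerSeries.isUnit_iff_constantCoeff (φ := 1 + PowerSeries.C y * PowerSeries.X ^ (n + 1))).2
    (by simp) |>.unit

theorem unip_val (n : ℕ) (y : F) :
    (unip n y : F⟦X⟧) = 1 + PowerSeries.C y * PowerSeries.X ^ (n + 1) := rfl

/-- Push-forward of measures along the projection `O_(n+1)^* → O_n^*`, in terms of densities with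
respect to Haar measures: integration over the cosets of its kernel `{1 + y t^(n+1) | y ∈ F} ≃ F`. -/
noncomputable def fibreIntegral (n : ℕ) (f : F⟦X⟧ˣ → ℂ) (x : F⟦X⟧ˣ) : ℂ :=
  let _ : MeasurableSpace F := borel F
  have : BorelSpace F := ⟨rfl⟩
  ∫ y : F, f (x * unip n y) ∂(Measure.addHaar : Measure F)

theorem fibreIntegral_act (ψ : ResidualChar F) {k : ℕ} (h : HInf.level F (k + 1))
    (f : F⟦X⟧ˣ → ℂ) : fibreIntegral k (act ψ h f) = act ψ h (fibreIntegral k f) := by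
  funext x
  change (let _ : MeasurableSpace F := borel F
    have : BorelSpace F := ⟨rfl⟩
    ∫ y : F, ψ.toAddChar (PolarParts.residue F (((x * unip k y : F⟦X⟧ˣ) : F⟦X⟧) •
      (h : HInf F).polar)) * f ((h : HInf F).unit * (x * unip k y))
        ∂(Measure.addHaar : Measure F)) =
    ψ.toAddChar (PolarParts.residue F ((x : F⟦X⟧) • (h : HInf F).polar)) *
    (let _ : MeasurableSpace F := borel F
    have : BorelSpace F := ⟨rfl⟩
    ∫ y : F, f ((h : HInf F).unit * x * unip k y) ∂(Measure.addHaar : Measure F))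
  have hb : ∀ y, ((x * unip k y : F⟦X⟧ˣ) : F⟦X⟧) • (h : HInf F).polar =
      (x : F⟦X⟧) • (h : HInf F).polar := fun y => by
    have h0 : (PowerSeries.X ^ (k + 1) : F⟦X⟧) • (h : HInf F).polar = 0 := h.2
    rw [Units.val_mul, mul_smul, unip_val, add_smul, one_smul, mul_smul, h0, smul_zero, add_zero]
  simp only [hb, mul_assoc]
  exact integral_const_mul _ _

theorem jet_unip (n : ℕ) (x : F⟦X⟧ˣ) (y : F) :
    jet (n + 1) (x * unip n y) = Fin.snoc (α := fun _ => F) (jet n x)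
      (PowerSeries.coeff (n + 1) (x : F⟦X⟧) + jet n x 0 * y) := by
  have key : ∀ i : ℕ, PowerSeries.coeff i ((x * unip n y : F⟦X⟧ˣ) : F⟦X⟧) =
      PowerSeries.coeff i (x : F⟦X⟧) +
        y * (if n + 1 ≤ i then PowerSeries.coeff (i - (n + 1)) (x : F⟦X⟧) else 0) := fun i => by
    rw [Units.val_mul, unip_val, mul_add, mul_one, map_add, mul_left_comm, PowerSeries.coeff_C_mul,
      PowerSeries.coeff_mul_X_pow']
  funext i
  refine Fin.lastCases ?_ (fun j => ?_) i
  · rw [Fin.snoc_last]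
    change PowerSeries.coeff (n + 1) _ = _
    rw [key, if_pos le_rfl, Nat.sub_self, mul_comm y]
    rfl
  · rw [Fin.snoc_castSucc]
    change PowerSeries.coeff (j : ℕ) _ = PowerSeries.coeff (j : ℕ) _
    rw [key, if_neg (by omega), mul_zero, add_zero]

section Fibre

variable {n : ℕ} {g : (Fin (n + 1 + 1) → F) → ℂ}

theorem continuous_snoc :
    Continuous fun p : (Fin (n + 1) → F) × F => Fin.snoc (α := fun _ => F) p.1 p.2 :=
  Continuous.finSnoc (A := fun _ => F) continuous_fst continuous_snd

theorem tsupport_ne_zero (hg : g ∈ schwartzJets F (n + 1)) {y : Fin (n + 1 + 1) → F}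
    (hy : y ∈ tsupport g) : y 0 ≠ 0 := by
  intro h
  have hcl : IsClosed (Function.support g) :=
    ⟨by rw [Function.compl_support]; exact hg.1 {0}⟩
  rw [tsupport, hcl.closure_eq] at hy
  exact hy (hg.2.2 y h)

/-- The projection of the support to the first `n + 1` coordinates. -/
def base (g : (Fin (n + 1 + 1) → F) → ℂ) : Set (Fin (n + 1) → F) :=
  (fun y i => y (Fin.castSucc i)) '' tsupport g

/-- The projection of the support to the last coordinate. -/
def top (g : (Fin (n + 1 + 1) → F) → ℂ) : Set F := (fun y => y (Fin.last _)) '' tsupport g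

theorem isCompact_base (hg : g ∈ schwartzJets F (n + 1)) : IsCompact (base g) :=
  IsCompact.image hg.2.1 (by fun_prop)

theorem isCompact_top (hg : g ∈ schwartzJets F (n + 1)) : IsCompact (top g) :=
  IsCompact.image hg.2.1 (by fun_prop)

theorem base_ne_zero (hg : g ∈ schwartzJets F (n + 1)) {z : Fin (n + 1) → F} (hz : z ∈ base g) :
    z 0 ≠ 0 := by
  obtain ⟨y, hy, rfl⟩ := hz
  exact tsupport_ne_zero hg hy

theorem mem_base {z : Fin (n + 1) → F} {w : F}
    (h : g (Fin.snoc (α := fun _ => F) z w) ≠ 0) : z ∈ base g :=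
  ⟨_, subset_tsupport g h, funext fun i => Fin.snoc_castSucc (α := fun _ => F) _ _ i⟩

theorem mem_top {z : Fin (n + 1) → F} {w : F}
    (h : g (Fin.snoc (α := fun _ => F) z w) ≠ 0) : w ∈ top g :=
  ⟨_, subset_tsupport g h, Fin.snoc_last (α := fun _ => F) _ _⟩

theorem integrable_fibre [MeasurableSpace F] [BorelSpace F]
    (hg : g ∈ schwartzJets F (n + 1)) (z : Fin (n + 1) → F) (hz : z 0 ≠ 0) (c : F) :
    Integrable (fun y : F => g (Fin.snoc (α := fun _ => F) z (c + z 0 * y)))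
      (Measure.addHaar : Measure F) := by
  have := t2Space_localField F
  have := secondCountable_localField F
  refine Continuous.integrable_of_hasCompactSupport ?_ ?_
  · have h1 : Continuous fun y : F => Fin.snoc (α := fun _ => F) z (c + z 0 * y) :=
      continuous_snoc.comp (by fun_prop : Continuous fun y : F => (z, c + z 0 * y))
    exact hg.1.continuous.comp h1
  · refine HasCompactSupport.intro (K := (fun w => (w - c) / z 0) '' top g)
      ((isCompact_top hg).image (by fun_prop)) fun y hy => ?_
    by_contra hne
    exact hy ⟨_, mem_top hne, by field_simp; ring⟩

/-- `fibreIntegral` in coordinates. -/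
noncomputable def jetIntegral (g : (Fin (n + 1 + 1) → F) → ℂ) (z : Fin (n + 1) → F) : ℂ :=
  open Classical in
  let _ : MeasurableSpace F := borel F
  have : BorelSpace F := ⟨rfl⟩
  if z 0 = 0 then 0 else
    ∫ y : F, g (Fin.snoc (α := fun _ => F) z (z 0 * y)) ∂(Measure.addHaar : Measure F)

theorem jetIntegral_of_notMem {z : Fin (n + 1) → F} (hz : z ∉ base g) : jetIntegral g z = 0 := by
  have h0 : ∀ w, g (Fin.snoc (α := fun _ => F) z w) = 0 := fun w => by
    by_contra h
    exact hz (mem_base h)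
  simp [jetIntegral, h0]

theorem jetIntegral_mem (hg : g ∈ schwartzJets F (n + 1)) : jetIntegral g ∈ schwartzJets F n := by
  have := t2Space_localField F
  refine ⟨?_, HasCompactSupport.intro (isCompact_base hg) fun z hz => jetIntegral_of_notMem hz,
    fun y hy => by simp [jetIntegral, hy]⟩
  rw [IsLocallyConstant.iff_eventually_eq]
  intro z
  by_cases hz : z ∈ base g
  · have hz0 := base_ne_zero hg hz
    let C : Set F := (fun p : F × (Fin (n + 1) → F) => p.1 / p.2 0) '' (top g ×ˢ base g)
    have hC : IsCompact C := by
      refine ((isCompact_top hg).prod (isCompact_base hg)).image_of_continuousOn ?_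
      refine ContinuousOn.div (by fun_prop) (by fun_prop) ?_
      rintro ⟨w, z'⟩ ⟨_, h⟩
      exact base_ne_zero hg h
    have hcont : Continuous fun p : (Fin (n + 1) → F) × F =>
        Fin.snoc (α := fun _ => F) p.1 (p.1 0 * p.2) :=
      continuous_snoc.comp
        (by fun_prop : Continuous fun p : (Fin (n + 1) → F) × F => (p.1, p.1 0 * p.2))
    have h1 : ∀ᶠ z' in 𝓝 z, ∀ y ∈ C, g (Fin.snoc (α := fun _ => F) z' (z' 0 * y)) =
        g (Fin.snoc (α := fun _ => F) z (z 0 * y)) :=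
      eventually_forall_eq (Φ := fun z' y => g (Fin.snoc (α := fun _ => F) z' (z' 0 * y))) z hC
        fun y _ => (IsLocallyConstant.iff_eventually_eq _).1 (hg.1.comp_continuous hcont) (z, y)
    have h2 : ∀ᶠ z' in 𝓝 z, z' 0 ≠ 0 :=
      (continuous_apply (0 : Fin (n + 1))).continuousAt.eventually_ne hz0
    filter_upwards [h1, h2] with z' e hz'
    have hout : ∀ z' : Fin (n + 1) → F, z' 0 ≠ 0 → ∀ y ∉ C,
        g (Fin.snoc (α := fun _ => F) z' (z' 0 * y)) = 0 := fun z' hz' y hy => by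
      by_contra h
      exact hy ⟨(z' 0 * y, z'), ⟨mem_top h, mem_base h⟩, by field_simp⟩
    have heq : ∀ y, g (Fin.snoc (α := fun _ => F) z' (z' 0 * y)) =
        g (Fin.snoc (α := fun _ => F) z (z 0 * y)) := fun y => by
      by_cases hy : y ∈ C
      · exact e y hy
      · rw [hout z' hz' y hy, hout z hz0 y hy]
    simp [jetIntegral, hz', hz0, heq]
  · filter_upwards [(isCompact_base hg).isClosed.isOpen_compl.mem_nhds hz] with z' hz'
    rw [jetIntegral_of_notMem hz, jetIntegral_of_notMem hz']

theorem fibreIntegral_eq (f : F⟦X⟧ˣ → ℂ) (hf : ∀ x, f x = g (jet (n + 1) x)) (x : F⟦X⟧ˣ) :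
    fibreIntegral n f x = jetIntegral g (jet n x) := by
  have hx := jet_zero_ne n x
  let _ : MeasurableSpace F := borel F
  have : BorelSpace F := ⟨rfl⟩
  have := secondCountable_localField F
  have h1 : jetIntegral g (jet n x) = ∫ y : F, g (Fin.snoc (α := fun _ => F) (jet n x)
      (jet n x 0 * y)) ∂(Measure.addHaar : Measure F) := if_neg hx
  have h2 : fibreIntegral n f x = ∫ y : F, f (x * unip n y) ∂(Measure.addHaar : Measure F) := rfl
  rw [h1, h2]
  refine Eq.trans ?_ (integral_add_right_eq_self
    (fun y : F => g (Fin.snoc (α := fun _ => F) (jet n x) (jet n x 0 * y)))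
    (PowerSeries.coeff (n + 1) (x : F⟦X⟧) / jet n x 0))
  refine congrArg _ (funext fun y => ?_)
  rw [hf, jet_unip]
  congr 2
  field_simp
  ring

theorem fibreIntegral_mem {f : F⟦X⟧ˣ → ℂ} (hf : f ∈ schwartzUnits F (n + 1)) :
    fibreIntegral n f ∈ schwartzUnits F n := by
  obtain ⟨g, hg, hfg⟩ := mem_schwartzUnits.1 hf
  exact mem_schwartzUnits.2 ⟨_, jetIntegral_mem hg, fibreIntegral_eq f hfg⟩

theorem integrable_unip [MeasurableSpace F] [BorelSpace F] {f : F⟦X⟧ˣ → ℂ}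
    (hf : f ∈ schwartzUnits F (n + 1)) (x : F⟦X⟧ˣ) :
    Integrable (fun y : F => f (x * unip n y)) (Measure.addHaar : Measure F) := by
  obtain ⟨g, hg, hfg⟩ := mem_schwartzUnits.1 hf
  have h1 := integrable_fibre hg (jet n x) (jet_zero_ne n x)
    (PowerSeries.coeff (n + 1) (x : F⟦X⟧))
  have h2 : (fun y : F => f (x * unip n y)) = fun y : F => g (Fin.snoc (α := fun _ => F) (jet n x)
      (PowerSeries.coeff (n + 1) (x : F⟦X⟧) + jet n x 0 * y)) := by
    funext y
    rw [hfg, jet_unip]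
  rw [h2]
  exact h1

end Fibre

/-- The push-forward map `M_(n+1) → M_n`. -/
noncomputable def step (n : ℕ) : schwartzUnits F (n + 1) →ₗ[ℂ] schwartzUnits F n where
  toFun f := ⟨fibreIntegral n f, fibreIntegral_mem f.2⟩
  map_add' f g := by
    let _ : MeasurableSpace F := borel F
    have : BorelSpace F := ⟨rfl⟩
    refine Subtype.ext (funext fun x => ?_)
    exact integral_add (integrable_unip f.2 x) (integrable_unip g.2 x)
  map_smul' c f := by
    let _ : MeasurableSpace F := borel F
    have : BorelSpace F := ⟨rfl⟩
    refine Subtype.ext (funext fun x => ?_)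
    exact integral_const_mul _ _

/-- The push-forward map `M_j → M_i`, `i ≤ j`. -/
noncomputable def proj {i j : ℕ} (h : i ≤ j) : schwartzUnits F j →ₗ[ℂ] schwartzUnits F i :=
  Nat.leRecOn (C := fun k => schwartzUnits F k →ₗ[ℂ] schwartzUnits F i) h
    (fun {k} φ => φ.comp (step k)) LinearMap.id

theorem proj_self (i : ℕ) : proj (le_refl i) = (LinearMap.id : schwartzUnits F i →ₗ[ℂ] _) :=
  Nat.leRecOn_self _

theorem proj_succ {i j : ℕ} (h : i ≤ j) :
    proj (h.trans (Nat.le_succ j)) = (proj h).comp (step (F := F) j) :=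
  Nat.leRecOn_succ h _

theorem proj_proj {i j k : ℕ} (hij : i ≤ j) (hjk : j ≤ k) (f : schwartzUnits F k) :
    proj hij (proj hjk f) = proj (hij.trans hjk) f := by
  induction k, hjk using Nat.le_induction with
  | base => rw [proj_self]; rfl
  | succ k hk ih =>
    rw [proj_succ hk, proj_succ (hij.trans hk)]
    exact ih (step k f)

variable (F) in
/-- The pro-vector space `𝕄 = lim M_n`. -/
noncomputable def space : ProVect.{u} where
  obj n := schwartzUnits F n
  rank_le n := by
    have := secondCountable_localField F
    refine (LinearMap.rank_le_of_surjective
      ((LinearMap.funLeft ℂ ℂ (jet n)).submoduleMap (schwartzJets F n))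
      (LinearMap.submoduleMap_surjective _ _)).trans ?_
    exact rank_schwartz_le _ fun f hf => ⟨hf.1, hf.2.1⟩
  map h := proj h
  map_self i x := by rw [proj_self]; rfl
  map_map hij hjk x := proj_proj hij hjk x

/-- The action of `O^* ⋉ B_n` on `M_k` for `n ≤ k + 1`. -/
noncomputable def actOn (ψ : ResidualChar F) {k n : ℕ} (hn : n ≤ k + 1) (h : HInf.level F n) :
    schwartzUnits F k →ₗ[ℂ] schwartzUnits F k :=
  (act ψ h).restrict fun _ hf => act_mem ψ hn h hf

theorem actOn_step (ψ : ResidualChar F) {k n : ℕ} (hn : n ≤ k + 1) (h : HInf.level F n)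
    (f : schwartzUnits F (k + 1)) :
    step k (actOn ψ (hn.trans (Nat.le_succ _)) h f) = actOn ψ hn h (step k f) :=
  Subtype.ext (fibreIntegral_act ψ ⟨h, HInf.level_mono hn h.2⟩ f)

theorem actOn_proj (ψ : ResidualChar F) {i j n : ℕ} (hij : i ≤ j) (hn : n ≤ i + 1)
    (hn' : n ≤ j + 1) (h : HInf.level F n) (f : schwartzUnits F j) :
    proj hij (actOn ψ hn' h f) = actOn ψ hn h (proj hij f) := by
  induction j, hij using Nat.le_induction with
  | base => rw [proj_self]; rfl
  | succ j hj ih =>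
    rw [proj_succ hj, LinearMap.comp_apply, LinearMap.comp_apply,
      actOn_step ψ (hn.trans (Nat.succ_le_succ hj)), ih]

open ProVect

theorem compat_aux (ψ : ResidualChar F) {i j n : ℕ} (hij : i ≤ j) (h : HInf.level F n)
    (f : schwartzUnits F (max j n)) :
    proj hij (proj (le_max_left j n) (actOn ψ ((le_max_right j n).trans (Nat.le_succ _)) h
      (proj (le_refl _) f))) =
    proj (le_max_left i n) (actOn ψ ((le_max_right i n).trans (Nat.le_succ _)) h
      (proj (max_le_max hij (le_refl n)) f)) := by
  rw [← actOn_proj ψ (max_le_max hij (le_refl n)) ((le_max_right i n).trans (Nat.le_succ _))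
    ((le_max_right j n).trans (Nat.le_succ _)), proj_proj, proj_proj, proj_self]
  rfl

/-- The action of `O^* ⋉ B_n` on `𝕄`: on `M_j` one acts through `M_(max j n) → M_j`, since `M_j`
itself carries an action of `O^* ⋉ B_n` only for `n ≤ j + 1`. -/
noncomputable def preFam (ψ : ResidualChar F) (n : ℕ) :
    PreFam (HInf.level F n) (space F) (space F) where
  idx j := max j n
  app j h := (proj (le_max_left j n)).comp
    (actOn ψ ((le_max_right j n).trans (Nat.le_succ _)) h)
  compat {i j} hij :=
    ⟨max j n, max_le_max hij le_rfl, le_rfl, fun h f => compat_aux ψ hij h f⟩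

theorem actOn_inclusion (ψ : ResidualChar F) {k m n : ℕ} (hmn : m ≤ n) (hn : n ≤ k + 1)
    (h : HInf.level F m) :
    actOn ψ hn (Subgroup.inclusion (HInf.level_mono hmn) h) = actOn ψ (hmn.trans hn) h := by
  have e : ((Subgroup.inclusion (HInf.level_mono hmn) h : HInf.level F n) : HInf F) = h :=
    Subgroup.coe_inclusion (HInf.level_mono hmn) h
  ext f x
  change act ψ ((Subgroup.inclusion (HInf.level_mono hmn) h : HInf.level F n) : HInf F) f x =
    act ψ h f x
  rw [e]

theorem restrict_aux (ψ : ResidualChar F) {m n : ℕ} (hmn : m ≤ n) (j : ℕ) (h : HInf.level F m)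
    (f : schwartzUnits F (max j n)) :
    proj (le_max_left j n) (actOn ψ ((le_max_right j n).trans (Nat.le_succ _))
      (Subgroup.inclusion (HInf.level_mono hmn) h) (proj (le_refl _) f)) =
    proj (le_max_left j m) (actOn ψ ((le_max_right j m).trans (Nat.le_succ _)) h
      (proj (max_le_max (le_refl j) hmn) f)) := by
  rw [actOn_inclusion ψ hmn, ← actOn_proj ψ (max_le_max (le_refl j) hmn)
    ((le_max_right j m).trans (Nat.le_succ _))
    ((hmn.trans (le_max_right j n)).trans (Nat.le_succ _)), proj_proj, proj_self,
    LinearMap.id_apply]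

theorem one_aux (ψ : ResidualChar F) (j n : ℕ) (f : schwartzUnits F (max j n)) :
    proj (le_max_left j n) (actOn ψ ((le_max_right j n).trans (Nat.le_succ _))
      (1 : HInf.level F n) (proj (le_refl _) f)) = proj (le_max_left j n) f := by
  rw [proj_self]
  exact congrArg _ (Subtype.ext (act_one ψ f))

theorem mul_aux (ψ : ResidualChar F) (j n : ℕ) (h h' : HInf.level F n)
    (f : schwartzUnits F (max (max j n) n)) :
    proj (le_max_left j n) (actOn ψ ((le_max_right j n).trans (Nat.le_succ _)) (h * h')
      (proj (le_max_left (max j n) n) f)) =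
    proj (le_max_left j n) (actOn ψ ((le_max_right j n).trans (Nat.le_succ _)) h
      (proj (le_max_left (max j n) n)
        (actOn ψ ((le_max_right (max j n) n).trans (Nat.le_succ _)) h'
          (proj (le_refl _) f)))) := by
  rw [actOn_proj ψ (le_max_left (max j n) n) ((le_max_right j n).trans (Nat.le_succ _)),
    proj_proj]
  exact congrArg _ (Subtype.ext (act_mul ψ h h' _))

/-- The representation `𝕄` of `H_∞`. -/
noncomputable def rep (ψ : ResidualChar F) : SmoothRep F where
  space := space F
  ρ n := Quotient.mk _ (preFam ψ n)
  smooth n := by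
    refine ⟨preFam ψ n, rfl, fun j => ⟨max j n, fun f => ?_⟩⟩
    let _ := HInf.depthTopology (F := F) (max j n) n
    have h1 : IsLocallyConstant (fun h : HInf.level F n =>
        actOn ψ ((le_max_right j n).trans (Nat.le_succ _)) h f) := by
      have h2 := isLocallyConstant_act ψ ((le_max_right j n).trans (Nat.le_succ _)) f.2
      rw [IsLocallyConstant.iff_eventually_eq] at h2 ⊢
      intro h₀
      filter_upwards [h2 h₀] with h e
      exact Subtype.ext e
    exact h1.comp (proj (le_max_left j n))
  restrict_eq hmn := Quotient.sound fun j =>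
    ⟨_, le_rfl, max_le_max le_rfl hmn, fun h f => restrict_aux ψ hmn j h f⟩
  one_eq n := Quotient.sound fun j =>
    ⟨_, le_rfl, le_max_left j n, fun _ f => one_aux ψ j n f⟩
  mul_eq n := Quotient.sound fun j =>
    ⟨max (max j n) n, le_max_left (max j n) n, le_rfl, fun h f => mul_aux ψ j n h.1 h.2 f⟩

end MeasureRep

end MeasureRep

section Cuspidal

variable {F : Type u} [Field F] [ValuativeRel F] [TopologicalSpace F] [IsNonarchimedeanLocalField F]

/-- The character `ψ(Res)` of `B_1`, extended trivially to `O^*(1) × B_1`. -/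
noncomputable def whittakerChar (ψ : ResidualChar F) (h : SmoothRep.whittakerSubgroup F) : ℂ :=
  ψ.toAddChar (PolarParts.residue F ((h : HInf.level F 1) : HInf F).polar)

/-- `W`, together with the projections `q_V : V → W(V)`, is the functor of coinvariants
`V ↦ V_{O^*(1) × B_1, ψ}`. -/
def IsWhittakerFunctor (ψ : ResidualChar F) (W : SmoothRep F ⥤ ProVect.{u})
    (q : SmoothRep.forget F ⟶ W) : Prop :=
  ∀ V : SmoothRep F, V.IsCoinvariants (SmoothRep.whittakerSubgroup F) (whittakerChar ψ) (q.app V)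

/-- `L` is the pro-vector space of homomorphisms `Hom_{H_∞}(M, V)` and `β : L ⊗ M → V` is the
canonical morphism: morphisms of representations `T ⊗ M → V` are the same as morphisms `T → L` of
pro-vector spaces. -/
def IsHomSpace (M V : SmoothRep F) {L : ProVect.{u}} (β : M.tensorFunctor.obj L ⟶ V) : Prop :=
  ∀ (T : ProVect.{u}) (f : M.tensorFunctor.obj T ⟶ V),
    ∃! g : T ⟶ L, M.tensorFunctor.map g ≫ β = f

variable (F) in
/-- The full subcategory of smooth cuspidal representations. -/
def cuspidalReps : ObjectProperty (SmoothRep F) := fun V => V.IsCuspidal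

/-- `V` is irreducible: it is non-zero and has no subobjects other than zero and itself. -/
def SmoothRep.IsIrreducible (V : SmoothRep F) : Prop :=
  ¬ Limits.IsZero V ∧ ∀ (U : SmoothRep F) (f : U ⟶ V), Mono f → Limits.IsZero U ∨ IsIso f

end Cuspidal

/-! The theorem is Fourier analysis on `B_(m+1) = t^(-m-1)O/O`. The residue pairing with `O/t^(m+1)O
= F^(m+1)`, followed by `ψ`, turns every point `y` of `F^(m+1)` into a character `χ_y` of `B_(m+1)`.
A smooth representation `E` of `O_m^* ⋉ B_(m+1)` then behaves like the space of compactly supported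
sections of a sheaf on `F^(m+1)` whose fibre at `y` is the space of `χ_y`-coinvariants, and the
group algebra of `B_(m+1)` acts by multiplication by trigonometric polynomials, which cut out
polydiscs inside any compact set (`exists_polarEval_eq_indicator`). The subgroup `B_1` sees only the
coordinate `y_0`. The part of `E` generated by the vectors `b w - w` with `b ∈ B_1` therefore lives
on `y_0 ≠ 0`, that is on `O_m^*`. There the units act simply transitively, so the sheaf is
determined by its fibre `L` at `1`, and this part of `E` is `L ⊗ M_m`
(`IsSmoothStage.exists_equiv`).

The group acts on a pro-vector space only through maps `V_i → V_j`, so the stages of `V` carry no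
representation. They are replaced by spaces `E_k` spanned by translates of orbit functions `g ↦ g w`
with values in a stage of `V`. These are genuine smooth representations of `O_(m k)^* ⋉ B_(m k + 1)`
through which the transition maps of `V` factor (`nonempty_stageTower`). For cuspidal `V` the maps
into `E_k` eventually land in the part `L_k ⊗ M_(m k)`. By Schur's lemma (`exists_eq_map_proj`) the
transitions between these parts are `τ_k ⊗ proj`, so the `L_k` form a pro-vector space `L` and `V ≅
L ⊗ 𝕄` (`IsCuspidal.exists_iso_tensor`).

Schur's lemma rests on uniqueness of the Whittaker functional. A functional on `M_i` invariant under
the units congruent to `1` modulo `t^(k+1)` factors through push-forward to `M_k`, because integrals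
over fibres are finite sums of translates (`eq_zero_of_step_eq_zero`); the character of `B_(k+1)`
then isolates the value at `1`. Thus `L ↦ L ⊗ 𝕄` is an equivalence onto the cuspidal
representations. This gives (1). The Whittaker coinvariants of `L ⊗ 𝕄` are `L`, naturally in `L`,
which gives (2).

For (3), a subobject of `𝕄` is again cuspidal (`isCuspidal_of_mono`), hence of the form `L ⊗ 𝕄`, and
its inclusion comes from a monomorphism from `L` to the unit `ℂ`. Such an `L` is zero or all of `ℂ`.
-/

namespace ProVect
-- Stagewise calculus in the category of pro-vector spaces.
open Filter
open scoped TensorProduct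

variable {S : Type v} {S' : Type w} {U V W : ProVect.{u}}

/-- The transition map `V_i → V_j`, extended by zero to pairs with `i < j`. -/
noncomputable def tr (V : ProVect.{u}) (j i : ℕ) : V.obj i →ₗ[ℂ] V.obj j :=
  if h : j ≤ i then V.map h else 0

theorem tr_eq (V : ProVect.{u}) {j i : ℕ} (h : j ≤ i) : V.tr j i = V.map h := dif_pos h

@[simp] theorem tr_self (V : ProVect.{u}) (i : ℕ) (x : V.obj i) : V.tr i i x = x := by
  rw [tr_eq V le_rfl, V.map_self]

theorem tr_tr (V : ProVect.{u}) {i j k : ℕ} (hij : i ≤ j) (hjk : j ≤ k) (x : V.obj k) :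
    V.tr i j (V.tr j k x) = V.tr i k x := by
  rw [tr_eq V hij, tr_eq V hjk, tr_eq V (hij.trans hjk), V.map_map]

namespace Fam

/-- The class of a representative. -/
def mk (p : PreFam S V W) : Fam S V W := Quotient.mk _ p

/-- A choice of representative of a family. -/
noncomputable def out (f : Fam S V W) : PreFam S V W :=
  Quotient.out (s := PreFam.setoid S V W) f

theorem mk_out (f : Fam S V W) : mk f.out = f := Quotient.out_eq (s := PreFam.setoid S V W) f

/-- A choice of stage on which the `j`-th component of a family is defined. -/
noncomputable abbrev idx (f : Fam S V W) (j : ℕ) : ℕ := f.out.idx j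

/-- The `j`-th component of a family as a family of maps `V_i → W_j`, for `i ≥ f.idx j`. -/
noncomputable def app (f : Fam S V W) (j i : ℕ) (s : S) : V.obj i →ₗ[ℂ] W.obj j :=
  (f.out.app j s).comp (V.tr (f.idx j) i)

theorem app_tr (f : Fam S V W) {j i i' : ℕ} (h : f.idx j ≤ i) (h' : i ≤ i') (s : S)
    (x : V.obj i') : f.app j i s (V.tr i i' x) = f.app j i' s x :=
  congrArg (f.out.app j s) (V.tr_tr h h' x)

/-- Agreement at one stage persists at all later ones. Every identity of families thus becomes an
eventual statement in `i`, uniform in `s` and `x`, and finitely many of them can be combined by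
`filter_upwards`. -/
theorem tr_app (f : Fam S V W) {j j' : ℕ} (h : j ≤ j') :
    ∀ᶠ i in atTop, ∀ s x, W.tr j j' (f.app j' i s x) = f.app j i s x := by
  obtain ⟨k, hi, hj, e⟩ := f.out.compat h
  filter_upwards [eventually_ge_atTop k] with i hk s x
  have := e s (V.tr k i x)
  simp only [← tr_eq, V.tr_tr hi hk, V.tr_tr hj hk] at this
  exact this

theorem mk_eq_mk_iff (p q : PreFam S V W) :
    ((mk p : Fam S V W) = mk q) ↔ ∀ j, ∀ᶠ i in atTop, ∀ s x,
      p.app j s (V.tr (p.idx j) i x) = q.app j s (V.tr (q.idx j) i x) := by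
  refine (Quotient.eq (r := PreFam.setoid S V W)).trans (forall_congr' fun j => ⟨?_, fun h => ?_⟩)
  · rintro ⟨k, hf, hg, e⟩
    filter_upwards [eventually_ge_atTop k] with i hk s x
    have := e s (V.tr k i x)
    rwa [← tr_eq, ← tr_eq, V.tr_tr hf hk, V.tr_tr hg hk] at this
  · obtain ⟨k, e, hk⟩ := (h.and (eventually_ge_atTop (max (p.idx j) (q.idx j)))).exists
    refine ⟨k, (le_max_left _ _).trans hk, (le_max_right _ _).trans hk, fun s x => ?_⟩
    rw [← tr_eq, ← tr_eq]
    exact e s x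

theorem ext_iff (f g : Fam S V W) :
    f = g ↔ ∀ j, ∀ᶠ i in atTop, ∀ s x, f.app j i s x = g.app j i s x := by
  have := mk_eq_mk_iff f.out g.out
  rwa [mk_out, mk_out] at this

theorem mk_app (p : PreFam S V W) (j : ℕ) : ∀ᶠ i in atTop, ∀ s x,
    (mk p : Fam S V W).app j i s x = p.app j s (V.tr (p.idx j) i x) :=
  (mk_eq_mk_iff (mk p : Fam S V W).out p).1 (mk_out _) j

/-- The intermediate stage `i'` may be any index beyond `g.idx j`, although `PreFam.comp` fixes it;
this freedom lets one stage satisfy several requirements at once. -/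
theorem comp_app (g : Fam S V W) (f : Fam S U V) (j : ℕ) {i' : ℕ} (h : g.idx j ≤ i') :
    ∀ᶠ i in atTop, ∀ s x, (g.comp f).app j i s x = g.app j i' s (f.app i' i s x) := by
  have e : g.comp f = mk (g.out.comp f.out) := by
    conv_lhs => rw [← mk_out f, ← mk_out g]
    rfl
  rw [e]
  filter_upwards [mk_app (g.out.comp f.out) j, f.tr_app h] with i e₁ e₂ s x
  rw [e₁, app, LinearMap.comp_apply, e₂]
  rfl

theorem restrict_app (p : S' → S) (f : Fam S V W) (j : ℕ) :
    ∀ᶠ i in atTop, ∀ s x, (f.restrict p).app j i s x = f.app j i (p s) x := by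
  have e : f.restrict p = mk (f.out.restrict p) := by
    conv_lhs => rw [← mk_out f]
    rfl
  rw [e]
  exact mk_app _ j

theorem twist_app (κ : S → ℂ) (f : Fam S V W) (j : ℕ) :
    ∀ᶠ i in atTop, ∀ s x, (f.twist κ).app j i s x = κ s • f.app j i s x := by
  have e : f.twist κ = mk (f.out.twist κ) := by
    conv_lhs => rw [← mk_out f]
    rfl
  rw [e]
  exact mk_app _ j

theorem id_app (S : Type v) (V : ProVect.{u}) (j : ℕ) :
    ∀ᶠ i in atTop, ∀ s x, (Fam.id S V).app j i s x = V.tr j i x :=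
  mk_app _ j

theorem tensor_app {V' W' : ProVect.{u}} (f : Fam S V V') (g : Fam S W W') (j : ℕ) :
    ∀ᶠ i in atTop, ∀ s x, (f.tensor g).app j i s x =
      TensorProduct.map (f.app j i s) (g.app j i s) x := by
  have e : f.tensor g = mk (f.out.tensor g.out) := by
    conv_lhs => rw [← mk_out f, ← mk_out g]
    rfl
  rw [e]
  filter_upwards [mk_app (f.out.tensor g.out) j,
    eventually_ge_atTop (max (f.idx j) (g.idx j))] with i e₁ hi s x
  rw [e₁]
  refine (congrArg _ (congrArg (fun (l : _ →ₗ[ℂ] _) => l x)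
    (tr_eq _ (show max (f.out.idx j) (g.out.idx j) ≤ i from hi)))).trans ?_
  refine (PreFam.tensor_app_map _ _ j s ((le_max_left _ _).trans hi) ((le_max_right _ _).trans hi)
    _ x).trans ?_
  rw [← tr_eq, ← tr_eq]
  rfl

end Fam

theorem tensor_tr (V W : ProVect.{u}) {j i : ℕ} (h : j ≤ i) :
    (V.tensor W).tr j i = TensorProduct.map (V.tr j i) (W.tr j i) := by
  rw [tr_eq _ h, tr_eq _ h, tr_eq _ h]
  rfl

/-- The maps `V_i → W_j` that represent a morphism `V → W`. -/
noncomputable def happ (f : V ⟶ W) (j i : ℕ) : V.obj i →ₗ[ℂ] W.obj j := Fam.app f j i ()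

noncomputable def hidx (f : V ⟶ W) (j : ℕ) : ℕ := Fam.idx f j

theorem happ_tr (f : V ⟶ W) {j i i' : ℕ} (h : hidx f j ≤ i) (h' : i ≤ i')
    (x : V.obj i') : happ f j i (V.tr i i' x) = happ f j i' x :=
  Fam.app_tr f h h' () x

theorem tr_happ (f : V ⟶ W) {j j' : ℕ} (h : j ≤ j') :
    ∀ᶠ i in atTop, ∀ x, W.tr j j' (happ f j' i x) = happ f j i x :=
  (Fam.tr_app f h).mono fun _ e x => e () x

theorem hom_ext_iff (f g : V ⟶ W) :
    f = g ↔ ∀ j, ∀ᶠ i in atTop, ∀ x, happ f j i x = happ g j i x :=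
  (Fam.ext_iff f g).trans (forall_congr' fun _ => eventually_congr (Eventually.of_forall
    fun _ => ⟨fun e x => e () x, fun e _ x => e x⟩))

theorem comp_happ (f : U ⟶ V) (g : V ⟶ W) (j : ℕ) {i' : ℕ} (h : hidx g j ≤ i') :
    ∀ᶠ i in atTop, ∀ x, happ (f ≫ g) j i x = happ g j i' (happ f i' i x) :=
  (Fam.comp_app g f j h).mono fun _ e x => e () x

theorem id_happ (V : ProVect.{u}) (j : ℕ) :
    ∀ᶠ i in atTop, ∀ x, happ (𝟙 V) j i x = V.tr j i x :=
  (Fam.id_app Unit V j).mono fun _ e x => e () x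

theorem const_app (S : Type v) (f : V ⟶ W) (j : ℕ) :
    ∀ᶠ i in atTop, ∀ s x, (const S f).app j i s x = happ f j i x :=
  (Fam.restrict_app _ f j).mono fun _ e s x => e s x

/-- A morphism from its components. -/
noncomputable def homMk (idx : ℕ → ℕ) (a : ∀ j, V.obj (idx j) →ₗ[ℂ] W.obj j)
    (h : ∀ j j', j ≤ j' → ∀ᶠ i in atTop, ∀ x : V.obj i,
      W.tr j j' (a j' (V.tr (idx j') i x)) = a j (V.tr (idx j) i x)) : V ⟶ W :=
  Fam.mk
    { idx := idx
      app := fun j _ => a j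
      compat := fun {i j} hij => by
        obtain ⟨k, e, hk⟩ := ((h i j hij).and (eventually_ge_atTop (max (idx i) (idx j)))).exists
        refine ⟨k, (le_max_left _ _).trans hk, (le_max_right _ _).trans hk, fun s x => ?_⟩
        rw [← tr_eq, ← tr_eq, ← tr_eq]
        exact e x }

theorem homMk_happ (idx : ℕ → ℕ) (a : ∀ j, V.obj (idx j) →ₗ[ℂ] W.obj j) (h) (j : ℕ) :
    ∀ᶠ i in atTop, ∀ x, happ (homMk idx a h) j i x = a j (V.tr (idx j) i x) :=
  (Fam.mk_app _ j).mono fun _ e x => e () x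

/-- The zero morphism. -/
noncomputable def zeroHom (V W : ProVect.{u}) : V ⟶ W :=
  homMk (fun j => j) (fun _ => 0) fun _ _ _ => by simp

theorem zeroHom_happ (V W : ProVect.{u}) (j : ℕ) :
    ∀ᶠ i in atTop, ∀ x, happ (zeroHom V W) j i x = 0 :=
  (homMk_happ _ _ _ j).mono fun _ e x => e x

theorem comp_zeroHom (f : U ⟶ V) : f ≫ zeroHom V W = zeroHom U W := by
  refine (hom_ext_iff _ _).2 fun j => ?_
  obtain ⟨k, e, hk⟩ := ((zeroHom_happ V W j).and
    (eventually_ge_atTop (hidx (zeroHom V W) j))).exists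
  filter_upwards [comp_happ f (zeroHom V W) j hk, zeroHom_happ U W j] with i e₁ e₂ x
  rw [e₁, e, e₂]

theorem zeroHom_comp (f : V ⟶ W) : zeroHom U V ≫ f = zeroHom U W := by
  refine (hom_ext_iff _ _).2 fun j => ?_
  filter_upwards [comp_happ (zeroHom U V) f j le_rfl, zeroHom_happ U W j,
    zeroHom_happ U V (hidx f j)] with i e₁ e₂ e₃ x
  rw [e₁, e₃, e₂, map_zero]

theorem eq_zeroHom_iff (f : V ⟶ W) :
    f = zeroHom V W ↔ ∀ j, ∀ᶠ i in atTop, ∀ x, happ f j i x = 0 := by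
  refine (hom_ext_iff _ _).trans (forall_congr' fun j => ?_)
  refine ⟨fun h => ?_, fun h => ?_⟩
  · filter_upwards [h, zeroHom_happ V W j] with i e₁ e₂ x
    rw [e₁, e₂]
  · filter_upwards [h, zeroHom_happ V W j] with i e₁ e₂ x
    rw [e₁, e₂]

theorem isZero_of_id_eq (h : 𝟙 V = zeroHom V V) : Limits.IsZero V where
  unique_to W := ⟨⟨⟨zeroHom V W⟩, fun f => by
    rw [← Category.id_comp f, h, zeroHom_comp]; rfl⟩⟩
  unique_from W := ⟨⟨⟨zeroHom W V⟩, fun f => by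
    rw [← Category.comp_id f, h, comp_zeroHom]; rfl⟩⟩

theorem isZero_iff : Limits.IsZero V ↔ ∀ j, ∀ᶠ i in atTop, ∀ x, V.tr j i x = 0 := by
  have key : 𝟙 V = zeroHom V V ↔ ∀ j, ∀ᶠ i in atTop, ∀ x, V.tr j i x = 0 := by
    refine (eq_zeroHom_iff _).trans (forall_congr' fun j => ?_)
    refine ⟨fun h => ?_, fun h => ?_⟩
    · filter_upwards [h, id_happ V j] with i e₁ e₂ x
      rw [← e₂, e₁]
    · filter_upwards [h, id_happ V j] with i e₁ e₂ x
      rw [e₂, e₁]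
  exact ⟨fun h => key.1 (h.eq_of_src _ _), fun h => isZero_of_id_eq (key.2 h)⟩

/-- The constant pro-vector space on `A`. -/
def constant (A : Type u) [AddCommGroup A] [Module ℂ A]
    (hA : Module.rank ℂ A ≤ Cardinal.aleph0) : ProVect.{u} where
  obj _ := A
  rank_le _ := hA
  map _ := LinearMap.id
  map_self _ _ := rfl
  map_map _ _ _ := rfl

theorem constant_tr (A : Type u) [AddCommGroup A] [Module ℂ A]
    (hA : Module.rank ℂ A ≤ Cardinal.aleph0) {j i : ℕ} (h : j ≤ i) (x : A) :
    (constant A hA).tr j i x = x := by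
  rw [tr_eq _ h]
  rfl

/-- A morphism to a constant pro-vector space from a map on one stage. -/
noncomputable def toConstant (A : Type u) [AddCommGroup A] [Module ℂ A]
    (hA : Module.rank ℂ A ≤ Cardinal.aleph0) (k : ℕ) (f : V.obj k →ₗ[ℂ] A) :
    V ⟶ constant A hA :=
  homMk (fun _ => k) (fun _ => f) fun j j' h => Eventually.of_forall fun i x =>
    constant_tr A hA h _

theorem toConstant_happ (A : Type u) [AddCommGroup A] [Module ℂ A]
    (hA : Module.rank ℂ A ≤ Cardinal.aleph0) (k : ℕ) (f : V.obj k →ₗ[ℂ] A) (j : ℕ) :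
    ∀ᶠ i in atTop, ∀ x, happ (toConstant A hA k f) j i x = f (V.tr k i x) :=
  homMk_happ _ _ _ j

/-- A pro-vector space from maps between successive stages. -/
def ofSteps (L : ℕ → Type u) [∀ k, AddCommGroup (L k)] [∀ k, Module ℂ (L k)]
    (hL : ∀ k, Module.rank ℂ (L k) ≤ Cardinal.aleph0) (τ : ∀ k, L (k + 1) →ₗ[ℂ] L k) :
    ProVect.{u} where
  obj := L
  rank_le := hL
  map {i _} h := Nat.leRecOn (C := fun k => L k →ₗ[ℂ] L i) h
    (fun {k} φ => φ.comp (τ k)) LinearMap.id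
  map_self i x := by rw [Nat.leRecOn_self]; rfl
  map_map {i j k} hij hjk x := by
    induction k, hjk using Nat.le_induction with
    | base => rw [Nat.leRecOn_self]; rfl
    | succ k hk ih =>
      rw [Nat.leRecOn_succ hk, Nat.leRecOn_succ (hij.trans hk)]
      exact ih (τ k x)

theorem ofSteps_tr_succ (L : ℕ → Type u) [∀ k, AddCommGroup (L k)] [∀ k, Module ℂ (L k)]
    (hL : ∀ k, Module.rank ℂ (L k) ≤ Cardinal.aleph0) (τ : ∀ k, L (k + 1) →ₗ[ℂ] L k)
    {j k : ℕ} (h : j ≤ k) (x : L (k + 1)) :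
    (ofSteps L hL τ).tr j (k + 1) x = (ofSteps L hL τ).tr j k (τ k x) := by
  rw [tr_eq _ h, tr_eq _ (h.trans k.le_succ)]
  exact congrArg (fun l : L (k + 1) →ₗ[ℂ] L j => l x)
    (Nat.leRecOn_succ (C := fun k => L k →ₗ[ℂ] L j) h _)

/-! ### Coequalizers of two families of morphisms. -/

section Coequalizer

variable (f g : Fam S U V)

/-- The relations at stage `n` will be the differences of `f` and `g` taken from stage `c n` of the
source. For the transition maps to carry relations to relations, `c n` has to lie beyond the
compatibility bounds for all `n' ≤ n` simultaneously. -/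
theorem exists_coequalizer_stage : ∃ c : ℕ → ℕ, Monotone c ∧ (∀ n, n ≤ c n) ∧
    ∀ n, f.idx n ≤ c n ∧ g.idx n ≤ c n ∧ ∀ i, c n ≤ i → ∀ n' ≤ n, ∀ s x, V.tr n' n (f.app n i s x) = f.app n' i s x ∧
      V.tr n' n (g.app n i s x) = g.app n' i s x := by
  have h : ∀ n, ∃ b, ∀ i, b ≤ i → n ≤ i ∧ f.idx n ≤ i ∧ g.idx n ≤ i ∧ ∀ n' ≤ n, ∀ s x,
      V.tr n' n (f.app n i s x) = f.app n' i s x ∧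
      V.tr n' n (g.app n i s x) = g.app n' i s x := fun n => by
    rw [← eventually_atTop]
    have h1 : ∀ᶠ i in atTop, ∀ n' ∈ Set.Iic n, ∀ s x, V.tr n' n (f.app n i s x) = f.app n' i s x ∧
        V.tr n' n (g.app n i s x) = g.app n' i s x := by
      rw [eventually_all_finite (Set.finite_Iic n)]
      intro n' hn
      filter_upwards [f.tr_app hn, g.tr_app hn] with i e₁ e₂ s x
      exact ⟨e₁ s x, e₂ s x⟩
    filter_upwards [eventually_ge_atTop n, eventually_ge_atTop (f.idx n),
      eventually_ge_atTop (g.idx n), h1] with i e₀ e₁ e₂ e₃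
    exact ⟨e₀, e₁, e₂, e₃⟩
  choose b hb using h
  have hbn : ∀ n, b n ≤ ∑ l ∈ Finset.range (n + 1), b l := fun n =>
    Finset.single_le_sum (f := b) (fun _ _ => Nat.zero_le _) (by simp)
  -- The partial sums dominate the bounds `b` and are monotone, which `b` itself need not be.
  refine ⟨fun n => ∑ l ∈ Finset.range (n + 1), b l, fun n n' h => ?_, fun n => (hb n _ (hbn n)).1,
    fun n => ⟨(hb n _ (hbn n)).2.1, (hb n _ (hbn n)).2.2.1,
      fun i hi => (hb n i ((hbn n).trans hi)).2.2.2⟩⟩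
  exact Finset.sum_le_sum_of_subset (by simpa using h)

/-- The relations imposed on the `n`-th stage of a coequalizer. -/
def coeqRel (c : ℕ → ℕ) (n : ℕ) : Submodule ℂ (V.obj n) :=
  Submodule.span ℂ {y | ∃ s x, y = f.app n (c n) s x - g.app n (c n) s x}

theorem coeqRel_le {c : ℕ → ℕ} (hc : Monotone c) (h : ∀ n, f.idx n ≤ c n ∧ g.idx n ≤ c n ∧
    ∀ i, c n ≤ i → ∀ n' ≤ n, ∀ s x, V.tr n' n (f.app n i s x) = f.app n' i s x ∧
      V.tr n' n (g.app n i s x) = g.app n' i s x) {i j : ℕ} (hij : i ≤ j) :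
    coeqRel f g c j ≤ (coeqRel f g c i).comap (V.tr i j) := by
  refine Submodule.span_le.2 ?_
  rintro _ ⟨s, x, rfl⟩
  refine Submodule.subset_span ⟨s, U.tr (c i) (c j) x, ?_⟩
  have := (h j).2.2 (c j) le_rfl i hij s x
  rw [map_sub, this.1, this.2, Fam.app_tr f (h i).1 (hc hij), Fam.app_tr g (h i).2.1 (hc hij)]

/-- The coequalizer is formed stage by stage, dividing by `coeqRel`. A morphism `β` that coequalizes
`f` and `g` need not kill the relations at the stage where its `j`-th component is first defined,
but it does at some later stage `k j`, and the descended morphism uses that stage. -/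
theorem exists_coequalizer (f g : Fam S U V) : ∃ (Q : ProVect.{u}) (q : V ⟶ Q),
    (const S q).comp f = (const S q).comp g ∧
    ∀ (W : ProVect.{u}) (β : V ⟶ W), (const S β).comp f = (const S β).comp g →
      ∃! γ : Q ⟶ W, q ≫ γ = β := by
  obtain ⟨c, hc, hcn, h⟩ := exists_coequalizer_stage f g
  let Q : ProVect.{u} :=
    { obj := fun n => V.obj n ⧸ coeqRel f g c n
      rank_le := fun n => (rank_quotient_le _).trans (V.rank_le n)
      map := fun {i j} hij => Submodule.mapQ _ _ (V.tr i j) (coeqRel_le f g hc h hij)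
      map_self := fun i x => by
        obtain ⟨x, rfl⟩ := Submodule.Quotient.mk_surjective _ x
        rw [Submodule.mapQ_apply, tr_self]
      map_map := fun {i j k} hij hjk x => by
        obtain ⟨x, rfl⟩ := Submodule.Quotient.mk_surjective _ x
        rw [Submodule.mapQ_apply, Submodule.mapQ_apply, Submodule.mapQ_apply, tr_tr V hij hjk] }
  have hQ : ∀ {j i : ℕ} (hij : j ≤ i) (x : V.obj i),
      Q.tr j i (Submodule.Quotient.mk x) = Submodule.Quotient.mk (V.tr j i x) := by
    intro j i hij x
    rw [tr_eq _ hij]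
    rfl
  let q : V ⟶ Q := homMk (fun j => j) (fun j => (coeqRel f g c j).mkQ) fun j j' hj => by
    filter_upwards [eventually_ge_atTop j'] with i hi x
    rw [Submodule.mkQ_apply, hQ hj, V.tr_tr hj hi]
    rfl
  have hq : ∀ j, ∀ᶠ i in atTop, ∀ x, happ q j i x = Submodule.Quotient.mk (V.tr j i x) :=
    fun j => homMk_happ _ _ _ j
  refine ⟨Q, q, ?_, fun W β hβ => ?_⟩
  · refine (Fam.ext_iff _ _).2 fun j => ?_
    obtain ⟨k, e, ec, hk, hjk⟩ := ((hq j).and ((const_app S q j).and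
      ((eventually_ge_atTop (Fam.idx (const S q) j)).and (eventually_ge_atTop j)))).exists
    filter_upwards [Fam.comp_app (const S q) f j hk, Fam.comp_app (const S q) g j hk,
      eventually_ge_atTop (c j), f.tr_app hjk, g.tr_app hjk] with i e₁ e₂ hi e₃ e₄ s x
    rw [e₁, e₂, ec, ec, e, e, e₃, e₄, ← Fam.app_tr f (h j).1 hi, ← Fam.app_tr g (h j).2.1 hi]
    exact (Submodule.Quotient.eq _).2 (Submodule.subset_span ⟨s, _, rfl⟩)
  · have hβ' : ∀ j, ∃ k, hidx β j ≤ k ∧ coeqRel f g c k ≤ LinearMap.ker (happ β j k) := by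
      intro j
      rw [Fam.ext_iff] at hβ
      obtain ⟨k, ec, hk, hk'⟩ := ((const_app S β j).and
        ((eventually_ge_atTop (Fam.idx (const S β) j)).and
          (eventually_ge_atTop (hidx β j)))).exists
      obtain ⟨N, hN⟩ := eventually_atTop.1 ((hβ j).and ((Fam.comp_app (const S β) f j hk).and
        (Fam.comp_app (const S β) g j hk)))
      have hkm := le_max_left k N
      refine ⟨max k N, hk'.trans hkm, Submodule.span_le.2 ?_⟩
      rintro _ ⟨s, x, rfl⟩
      rw [SetLike.mem_coe, LinearMap.mem_ker, map_sub, sub_eq_zero,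
        ← happ_tr β hk' hkm, ← happ_tr β hk' hkm]
      have e := (h (max k N)).2.2 (c (max k N)) le_rfl k hkm s x
      -- The relations at stage `max k N` come from stage `c (max k N)` of the source; `n ≤ c n`
      -- puts this beyond `N`, where the identities for `β` hold.
      have e' := hN (c (max k N)) ((le_max_right k N).trans (hcn _))
      rw [e.1, e.2, ← ec, ← ec, ← e'.2.1, ← e'.2.2, e'.1]
    choose k hk hker using hβ'
    let γ : Q ⟶ W := homMk k (fun j => (coeqRel f g c (k j)).liftQ (happ β j (k j)) (hker j))
      fun j j' hj => by
        filter_upwards [tr_happ β hj, eventually_ge_atTop (k j), eventually_ge_atTop (k j')]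
          with i e h₁ h₂ x
        obtain ⟨x, rfl⟩ := Submodule.Quotient.mk_surjective _ x
        rw [hQ h₁, hQ h₂, Submodule.liftQ_apply, Submodule.liftQ_apply, happ_tr β (hk j) h₁,
          happ_tr β (hk j') h₂, e]
    have hγ : q ≫ γ = β := by
      refine (hom_ext_iff _ _).2 fun j => ?_
      obtain ⟨l, e, hl, hl'⟩ := ((homMk_happ k _ _ j : ∀ᶠ i in atTop, ∀ x, happ γ j i x = _).and
        ((eventually_ge_atTop (hidx γ j)).and (eventually_ge_atTop (k j)))).exists
      filter_upwards [comp_happ q γ j hl, hq l, eventually_ge_atTop l] with i e₁ e₂ hi x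
      rw [e₁, e₂, e, hQ hl', Submodule.liftQ_apply, V.tr_tr hl' hi, happ_tr β (hk j) (hl'.trans hi)]
    refine ⟨γ, hγ, fun γ' hγ' => (hom_ext_iff _ _).2 fun j => ?_⟩
    have key : ∀ δ : Q ⟶ W, q ≫ δ = β → ∀ᶠ i in atTop, ∀ x : V.obj i,
        happ δ j i (Submodule.Quotient.mk x) = happ β j i x := by
      rintro δ rfl
      filter_upwards [comp_happ q δ j le_rfl, hq (hidx δ j), eventually_ge_atTop (hidx δ j)]
        with i e₁ e₂ hi x
      rw [e₁, e₂, ← hQ hi, happ_tr δ le_rfl hi]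
    filter_upwards [key γ hγ, key γ' hγ'] with i e₁ e₂ x
    obtain ⟨x, rfl⟩ := Submodule.Quotient.mk_surjective _ x
    rw [e₁, e₂]

end Coequalizer

end ProVect

/-! ### Smooth representations, morphisms and coinvariants in terms of stages. -/

namespace SmoothRep
open Filter ProVect

section
variable {F : Type u} [Field F] [TopologicalSpace F] {U V W : SmoothRep F}

/-- A stage on which the `j`-th component of the action of `O^* ⋉ B_n` is defined. -/
noncomputable def ridx (V : SmoothRep F) (n j : ℕ) : ℕ := (V.ρ n).idx j

open Classical in
/-- The maps `V_i → V_j` by which `h ∈ O^* ⋉ B_n` acts, for `i ≥ V.ridx n j`. -/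
noncomputable def act (V : SmoothRep F) (n j i : ℕ) (h : HInf F) :
    V.space.obj i →ₗ[ℂ] V.space.obj j :=
  if hh : h ∈ HInf.level F n then (V.ρ n).app j i ⟨h, hh⟩ else 0

theorem act_eq (V : SmoothRep F) {n : ℕ} (j i : ℕ) {h : HInf F} (hh : h ∈ HInf.level F n) :
    V.act n j i h = (V.ρ n).app j i ⟨h, hh⟩ := dif_pos hh

theorem act_coe (V : SmoothRep F) {n : ℕ} (j i : ℕ) (h : HInf.level F n) :
    V.act n j i h = (V.ρ n).app j i h := dif_pos h.2

theorem act_tr (V : SmoothRep F) {n j i i' : ℕ} (hi : V.ridx n j ≤ i) (h' : i ≤ i') (h : HInf F)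
    (x : V.space.obj i') : V.act n j i h (V.space.tr i i' x) = V.act n j i' h x := by
  by_cases hh : h ∈ HInf.level F n
  · rw [act_eq V _ _ hh, act_eq V _ _ hh, Fam.app_tr _ hi h']
  · simp [act, hh]

theorem tr_act (V : SmoothRep F) (n : ℕ) {j j' : ℕ} (hj : j ≤ j') : ∀ᶠ i in atTop, ∀ h x,
    V.space.tr j j' (V.act n j' i h x) = V.act n j i h x := by
  filter_upwards [(V.ρ n).tr_app hj] with i e h x
  by_cases hh : h ∈ HInf.level F n
  · rw [act_eq V _ _ hh, act_eq V _ _ hh, e]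
  · simp [act, hh]

theorem act_mono (V : SmoothRep F) {m n : ℕ} (hmn : m ≤ n) (j : ℕ) : ∀ᶠ i in atTop,
    ∀ h ∈ HInf.level F m, ∀ x, V.act n j i h x = V.act m j i h x := by
  filter_upwards [Fam.restrict_app (Subgroup.inclusion (HInf.level_mono hmn)) (V.ρ n) j]
    with i e h hh x
  rw [act_eq V _ _ hh, act_eq V _ _ (HInf.level_mono hmn hh), ← V.restrict_eq hmn, e]
  rfl

theorem act_one (V : SmoothRep F) (n j : ℕ) : ∀ᶠ i in atTop, ∀ x,
    V.act n j i 1 x = V.space.tr j i x := by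
  filter_upwards [Fam.restrict_app (fun _ : Unit => (1 : HInf.level F n)) (V.ρ n) j,
    id_happ V.space j] with i e e' x
  have h1 := e () x
  have h2 := e' x
  rw [V.one_eq n] at h1
  rw [act_eq V _ _ (one_mem _), ← h2]
  exact h1.symm

theorem act_mul (V : SmoothRep F) (n j : ℕ) {i' : ℕ} (hi : V.ridx n j ≤ i') : ∀ᶠ i in atTop,
    ∀ h ∈ HInf.level F n, ∀ h' ∈ HInf.level F n, ∀ x,
      V.act n j i (h * h') x = V.act n j i' h (V.act n i' i h' x) := by
  let p₁ : HInf.level F n × HInf.level F n → HInf.level F n := Prod.fst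
  let p₂ : HInf.level F n × HInf.level F n → HInf.level F n := Prod.snd
  obtain ⟨k, e₁, hk, hk'⟩ := ((Fam.restrict_app p₁ (V.ρ n) j).and
    ((eventually_ge_atTop (((V.ρ n).restrict p₁).idx j)).and (eventually_ge_atTop i'))).exists
  filter_upwards [Fam.comp_app ((V.ρ n).restrict p₁) ((V.ρ n).restrict p₂) j hk,
    Fam.restrict_app (fun p : HInf.level F n × HInf.level F n => p.1 * p.2) (V.ρ n) j,
    Fam.restrict_app p₂ (V.ρ n) k, (V.ρ n).tr_app hk'] with i e₂ e₃ e₄ e₅ h hh h' hh' x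
  have a₂ := e₂ (⟨h, hh⟩, ⟨h', hh'⟩) x
  have a₃ := e₃ (⟨h, hh⟩, ⟨h', hh'⟩) x
  rw [V.mul_eq n] at a₃
  rw [e₁, e₄] at a₂
  rw [act_eq V _ _ (mul_mem hh hh'), act_eq V _ _ hh, act_eq V _ _ hh', ← e₅,
    Fam.app_tr _ hi hk']
  exact a₃.symm.trans a₂

theorem isLocallyConstant_act (V : SmoothRep F) (n j : ℕ) : ∃ m, ∀ᶠ i in atTop, ∀ x,
    @IsLocallyConstant _ _ (HInf.depthTopology m n)
      (fun h : HInf.level F n => V.act n j i h x) := by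
  obtain ⟨p, hp, hs⟩ := V.smooth n
  obtain ⟨m, hm⟩ := hs j
  refine ⟨m, ?_⟩
  filter_upwards [Fam.mk_app p j] with i e x
  have h1 : (fun h : HInf.level F n => V.act n j i h x) = fun h =>
      p.app j h (V.space.tr (p.idx j) i x) := by
    funext h
    rw [act_coe, ← e]
    exact congrArg (fun f => Fam.app f j i h x) hp
  rw [h1]
  exact hm _

theorem comm_happ (f : V ⟶ W) (n j : ℕ) {i' i'' : ℕ} (h' : hidx f.hom j ≤ i')
    (h'' : W.ridx n j ≤ i'') : ∀ᶠ i in atTop, ∀ h ∈ HInf.level F n, ∀ x,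
      happ f.hom j i' (V.act n i' i h x) = W.act n j i'' h (happ f.hom i'' i x) := by
  let c := const (HInf.level F n) f.hom
  have hc : c.comp (V.ρ n) = (W.ρ n).comp c := f.comm n
  obtain ⟨k, e₁, hk, hk'⟩ := ((const_app (HInf.level F n) f.hom j).and
    ((eventually_ge_atTop (c.idx j)).and (eventually_ge_atTop i'))).exists
  filter_upwards [Fam.comp_app c (V.ρ n) j hk, Fam.comp_app (W.ρ n) c j h'',
    const_app (HInf.level F n) f.hom i'', (V.ρ n).tr_app hk'] with i e₂ e₃ e₄ e₅ h hh x
  have a₂ := e₂ ⟨h, hh⟩ x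
  have a₃ := e₃ ⟨h, hh⟩ x
  rw [hc] at a₂
  rw [e₁] at a₂
  rw [e₄] at a₃
  rw [act_eq V _ _ hh, act_eq W _ _ hh, ← e₅, happ_tr _ h' hk', ← a₂, a₃]

/-- A morphism of representations from a morphism of pro-vector spaces that is equivariant on
stages. -/
noncomputable def homOfHapp (f : V.space ⟶ W.space) (hf : ∀ n j, ∃ i' i'', hidx f j ≤ i' ∧
    W.ridx n j ≤ i'' ∧ ∀ᶠ i in atTop, ∀ h ∈ HInf.level F n, ∀ x,
      happ f j i' (V.act n i' i h x) = W.act n j i'' h (happ f i'' i x)) : V ⟶ W where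
  hom := f
  comm n := by
    refine (Fam.ext_iff _ _).2 fun j => ?_
    obtain ⟨i', i'', h', h'', e⟩ := hf n j
    obtain ⟨k, e₁, hk, hk'⟩ := ((const_app (HInf.level F n) f j).and
      ((eventually_ge_atTop ((const (HInf.level F n) f).idx j)).and
        (eventually_ge_atTop i'))).exists
    filter_upwards [e, Fam.comp_app (const _ f) (V.ρ n) j hk,
      Fam.comp_app (W.ρ n) (const _ f) j h'', const_app (HInf.level F n) f i'',
      (V.ρ n).tr_app hk'] with i e e₂ e₃ e₄ e₅ h x
    have a := e h h.2 x
    rw [act_coe, act_coe, ← e₅, happ_tr _ h' hk'] at a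
    rw [e₂, e₁, e₃, e₄, a]

/-- One admissible intermediate stage for each `j` is enough: two candidates are compared at their
maximum, since both `happ` and `act` are compatible with the transition maps. -/
theorem isSemiInvariant_iff {n : ℕ} (T : Subgroup (HInf.level F n)) (κ : T → ℂ) {Q : ProVect.{u}}
    (β : V.space ⟶ Q) : V.IsSemiInvariant T κ β ↔ ∀ j, ∃ i', hidx β j ≤ i' ∧
      ∀ᶠ i in atTop, ∀ (h : T) x, happ β j i' (V.act n i' i (h : HInf.level F n) x) =
        κ h • happ β j i x := by
  have key : V.IsSemiInvariant T κ β ↔ ∀ j, ∀ i', hidx β j ≤ i' → ∀ᶠ i in atTop, ∀ (h : T) x,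
      happ β j i' (V.act n i' i (h : HInf.level F n) x) = κ h • happ β j i x := by
    refine (Fam.ext_iff _ _).trans (forall_congr' fun j => ?_)
    have h0 : ∀ i', hidx β j ≤ i' → ∀ᶠ i in atTop, ∀ (h : T) x,
        ((const T β).comp ((V.ρ n).restrict ((↑) : T → HInf.level F n))).app j i h x =
          happ β j i' (V.act n i' i (h : HInf.level F n) x) := fun i' h' => by
      obtain ⟨k, e₁, hk, hk'⟩ := ((const_app T β j).and
        ((eventually_ge_atTop ((const T β).idx j)).and (eventually_ge_atTop i'))).exists
      filter_upwards [Fam.comp_app (const T β) _ j hk, Fam.restrict_app ((↑) : T → _) (V.ρ n) k,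
        (V.ρ n).tr_app hk'] with i e₂ e₃ e₄ h x
      rw [e₂, e₁, e₃, act_coe, ← e₄, happ_tr _ h' hk']
    have h1 : ∀ᶠ i in atTop, ∀ (h : T) x, ((const T β).twist κ).app j i h x =
        κ h • happ β j i x := by
      filter_upwards [Fam.twist_app κ (const T β) j, const_app T β j] with i e₁ e₂ h x
      rw [e₁, e₂]
    refine ⟨fun e i' h' => ?_, fun e => ?_⟩
    · filter_upwards [e, h0 i' h', h1] with i e₁ e₂ e₃ h x
      rw [← e₂, e₁, e₃]
    · filter_upwards [e _ le_rfl, h0 _ le_rfl, h1] with i e₁ e₂ e₃ h x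
      rw [e₂, e₁, e₃]
  refine key.trans (forall_congr' fun j => ⟨fun h => ⟨_, le_rfl, h _ le_rfl⟩, ?_⟩)
  rintro ⟨k, hk, e⟩ i' h'
  have hm := le_max_left k i'
  have hm' := le_max_right k i'
  filter_upwards [e, V.tr_act n hm, V.tr_act n hm'] with i e₁ e₂ e₃ h x
  rw [← e₁, ← e₃, ← e₂, happ_tr _ h' hm', happ_tr _ hk hm]

theorem IsSemiInvariant.eventually {n : ℕ} {T : Subgroup (HInf.level F n)} {κ : T → ℂ}
    {Q : ProVect.{u}} {β : V.space ⟶ Q} (hβ : V.IsSemiInvariant T κ β) (j : ℕ) :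
    ∃ N, ∀ k, N ≤ k → ∀ᶠ i in atTop, ∀ (h : T) x,
      happ β j k (V.act n k i (h : HInf.level F n) x) = κ h • happ β j i x := by
  obtain ⟨i', h', e⟩ := (isSemiInvariant_iff T κ β).1 hβ j
  refine ⟨i', fun k hk => ?_⟩
  filter_upwards [e, V.tr_act n hk] with i e₁ e₂ h x
  rw [← e₁, ← e₂, happ_tr _ h' hk]

/-- Semi-invariance of `β` says that `β` coequalizes two families of endomorphisms of `V` indexed by
`T`: the restricted action and the scalars `κ`. -/
theorem exists_isCoinvariants (V : SmoothRep F) {n : ℕ} (T : Subgroup (HInf.level F n))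
    (κ : T → ℂ) : ∃ (Q : ProVect.{u}) (q : V.space ⟶ Q), V.IsCoinvariants T κ q := by
  have key : ∀ {W : ProVect.{u}} (β : V.space ⟶ W),
      (const T β).comp ((Fam.id T V.space).twist κ) = (const T β).twist κ := fun {W} β => by
    induction β using Quotient.inductionOn with
    | h b =>
      refine Quotient.sound (s := PreFam.setoid _ _ _) fun j =>
        ⟨b.idx j, le_rfl, le_rfl, fun s x => ?_⟩
      exact map_smul (b.app j ()) (κ s) _
  obtain ⟨Q, q, h, h'⟩ := exists_coequalizer ((V.ρ n).restrict ((↑) : T → HInf.level F n))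
    ((Fam.id T V.space).twist κ)
  refine ⟨Q, q, h.trans (key q), fun W β hβ => h' W β (Eq.trans hβ (key β).symm)⟩

theorem tensor_act (T : ProVect.{u}) (V : SmoothRep F) (n j : ℕ) : ∀ᶠ i in atTop,
    ∀ h ∈ HInf.level F n, ∀ x, (tensor T V).act n j i h x =
      TensorProduct.map (T.tr j i) (V.act n j i h) x := by
  filter_upwards [Fam.tensor_app (Fam.id _ T) (V.ρ n) j, Fam.id_app (HInf.level F n) T j]
    with i e e' h hh x
  have hT : (Fam.id (HInf.level F n) T).app j i ⟨h, hh⟩ = T.tr j i := LinearMap.ext (e' _)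
  rw [act_eq _ _ _ hh, act_eq _ _ _ hh, ← hT]
  exact e _ _

theorem tensorFunctor_map_happ (V : SmoothRep F) {T T' : ProVect.{u}} (f : T ⟶ T') (j : ℕ) :
    ∀ᶠ i in atTop, ∀ x, happ (V.tensorFunctor.map f).hom j i x =
      TensorProduct.map (happ f j i) (V.space.tr j i) x := by
  filter_upwards [Fam.tensor_app f (Fam.id Unit V.space) j, Fam.id_app Unit V.space j]
    with i e e' x
  have hT : (Fam.id Unit V.space).app j i () = V.space.tr j i := LinearMap.ext (e' _)
  rw [← hT]
  exact e _ _

/-- An isomorphism of representations from an equivariant isomorphism of pro-vector spaces. -/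
theorem isIso_of_hom (f : V ⟶ W) [IsIso f.hom] : IsIso f := by
  refine ⟨⟨⟨inv f.hom, fun n => ?_⟩, Hom.ext (IsIso.hom_inv_id f.hom),
    Hom.ext (IsIso.inv_hom_id f.hom)⟩⟩
  have h := f.comm n
  have h1 : (const (HInf.level F n) (inv f.hom)).comp (const _ f.hom) = Fam.id _ _ := by
    rw [← const_comp, IsIso.hom_inv_id]; rfl
  have h2 : (const (HInf.level F n) f.hom).comp (const _ (inv f.hom)) = Fam.id _ _ := by
    rw [← const_comp, IsIso.inv_hom_id]; rfl
  calc (const _ (inv f.hom)).comp (W.ρ n)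
      = (const _ (inv f.hom)).comp (((W.ρ n).comp (const _ f.hom)).comp
          (const _ (inv f.hom))) := by rw [Fam.comp_assoc, h2, Fam.comp_id]
    _ = (V.ρ n).comp (const _ (inv f.hom)) := by
      rw [← h, ← Fam.comp_assoc, ← Fam.comp_assoc, h1, Fam.id_comp]

/-- The zero morphism of representations. -/
noncomputable def zeroHom (V W : SmoothRep F) : V ⟶ W :=
  homOfHapp (ProVect.zeroHom V.space W.space) fun n j => by
    obtain ⟨k, e, hk⟩ := ((zeroHom_happ V.space W.space j).and
      (eventually_ge_atTop (hidx (ProVect.zeroHom V.space W.space) j))).exists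
    refine ⟨k, _, hk, le_rfl, ?_⟩
    filter_upwards [zeroHom_happ V.space W.space (W.ridx n j)] with i e' h hh x
    rw [e, e', map_zero]

theorem isZero_iff : Limits.IsZero V ↔ Limits.IsZero V.space := by
  refine ⟨fun h => isZero_of_id_eq ?_, fun h => ⟨fun W => ⟨⟨⟨zeroHom V W⟩, fun f => ?_⟩⟩,
    fun W => ⟨⟨⟨zeroHom W V⟩, fun f => ?_⟩⟩⟩⟩
  · exact congrArg Hom.hom (h.eq_of_src (𝟙 V) (zeroHom V V))
  · exact Hom.ext (h.eq_of_src _ _)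
  · exact Hom.ext (h.eq_of_tgt _ _)

end

end SmoothRep

/-! ### The groups `B_n` in coordinates. -/

section PolarSubgroup

variable (F : Type u) [Field F]

/-- The subgroup `B_n = t⁻ⁿ O / O` of `O^* ⋉ B_n`. -/
def polarSubgroup (n : ℕ) : Subgroup (HInf.level F n) where
  carrier := {h | (h : HInf F).unit = 1}
  one_mem' := rfl
  mul_mem' {a b} ha hb := by
    simp only [Set.mem_ofPred_eq] at ha hb ⊢
    rw [Subgroup.coe_mul, HInf.unit_mul, ha, hb, mul_one]
  inv_mem' {a} ha := by
    simp only [Set.mem_ofPred_eq] at ha ⊢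
    have h1 : ((a * a⁻¹ : HInf.level F n) : HInf F).unit = 1 := by rw [mul_inv_cancel]; rfl
    rwa [Subgroup.coe_mul, HInf.unit_mul, ha, one_mul] at h1

variable {F} {n : ℕ}

/-- The coefficients of `t⁻¹, …, t⁻ⁿ` of the polar part. -/
noncomputable def polarCoeff (h : HInf.level F n) : Fin n → F :=
  fun k => PolarParts.residue F ((PowerSeries.X ^ (k : ℕ) : F⟦X⟧) • (h : HInf F).polar)

theorem polarCoeff_mul (b b' : polarSubgroup F n) :
    polarCoeff (b * b' : polarSubgroup F n).1 = polarCoeff b.1 + polarCoeff b'.1 := by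
  funext k
  have h : (((b * b' : polarSubgroup F n) : HInf.level F n) : HInf F).polar =
      ((b : HInf.level F n) : HInf F).polar + ((b' : HInf.level F n) : HInf F).polar := by
    rw [Subgroup.coe_mul, Subgroup.coe_mul, HInf.polar_mul,
      show ((b : HInf.level F n) : HInf F).unit = 1 from b.2, Units.val_one, one_smul]
  simp only [polarCoeff, Pi.add_apply, h, smul_add, map_add]

theorem polarCoeff_one : polarCoeff (1 : HInf.level F n) = 0 := by
  funext k
  simp only [polarCoeff, Pi.zero_apply]
  rw [Subgroup.coe_one, HInf.polar_one, smul_zero, map_zero]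

/-- The element `c t^(-i-1)` of `K / O`. -/
noncomputable def polarSingle (i : ℕ) (c : F) : PolarParts F :=
  Submodule.Quotient.mk (HahnSeries.single (-(i : ℤ) - 1) c)

theorem X_pow_smul_single (j i : ℕ) (c : F) :
    (PowerSeries.X ^ j : F⟦X⟧) • (HahnSeries.single (-(i : ℤ) - 1) c : F⸨X⸩) =
      HahnSeries.single ((j : ℤ) - i - 1) c := by
  rw [Algebra.smul_def]
  have : algebraMap F⟦X⟧ F⸨X⸩ (PowerSeries.X ^ j) = HahnSeries.single (j : ℤ) 1 :=
    HahnSeries.ofPowerSeries_X_pow j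
  rw [this, HahnSeries.single_mul_single, one_mul]
  congr 1
  ring

theorem residue_X_pow_polarSingle (j i : ℕ) (c : F) :
    PolarParts.residue F ((PowerSeries.X ^ j : F⟦X⟧) • polarSingle i c) =
      if j = i then c else 0 := by
  rw [polarSingle, ← Submodule.Quotient.mk_smul, X_pow_smul_single]
  change HahnSeries.coeff (HahnSeries.single ((j : ℤ) - i - 1) c) (-1) = _
  rw [HahnSeries.coeff_single]
  congr 1
  simp only [eq_iff_iff]
  omega

theorem X_pow_smul_polarSingle {j i : ℕ} (h : i < j) (c : F) :
    (PowerSeries.X ^ j : F⟦X⟧) • polarSingle i c = 0 := by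
  rw [polarSingle, ← Submodule.Quotient.mk_smul, X_pow_smul_single]
  refine (Submodule.Quotient.mk_eq_zero _).2
    ⟨PowerSeries.C c * PowerSeries.X ^ (j - i - 1), ?_⟩
  change (HahnSeries.ofPowerSeries ℤ F) _ = _
  rw [map_mul, HahnSeries.ofPowerSeries_X_pow, HahnSeries.ofPowerSeries_C]
  rw [HahnSeries.C_mul_eq_smul]
  ext k
  rw [HahnSeries.coeff_smul, HahnSeries.coeff_single, HahnSeries.coeff_single]
  have : ((j - i - 1 : ℕ) : ℤ) = (j : ℤ) - i - 1 := by omega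
  rw [this]
  split_ifs <;> simp

/-- The element `c t^(-i-1)` of `B_n`. -/
noncomputable def polarElem (i : Fin n) (c : F) : polarSubgroup F n :=
  ⟨⟨⟨Multiplicative.ofAdd (polarSingle i c), 1⟩, X_pow_smul_polarSingle i.2 c⟩, rfl⟩

theorem polarCoeff_polarElem (i : Fin n) (c : F) :
    polarCoeff (polarElem i c).1 = Pi.single i c := by
  funext k
  refine (residue_X_pow_polarSingle (k : ℕ) (i : ℕ) c).trans ?_
  rw [Pi.single_apply]
  simp only [Fin.ext_iff]

end PolarSubgroup

/-! ### Polydiscs in `F^n`. -/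

section LocalField

open Topology ValuativeRel

variable {F : Type u} [Field F] [ValuativeRel F] [TopologicalSpace F] [IsNonarchimedeanLocalField F]
  {n : ℕ}

theorem exists_ne_zero_forall_le {ι : Type*} [Finite ι] (y : ι → F) :
    ∃ d : F, d ≠ 0 ∧ valuation F 1 ≤ valuation F d ∧ ∀ i, valuation F (y i) ≤ valuation F d := by
  obtain ⟨M, hM⟩ := (Set.finite_range fun i => valuation F (y i)).bddAbove
  obtain ⟨d, hd⟩ := valuation_surjective (max M 1)
  have h1 : valuation F 1 ≤ valuation F d := by rw [hd, map_one]; exact le_max_right _ _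
  refine ⟨d, ?_, h1, fun i => ?_⟩
  · rintro rfl
    rw [map_zero, map_one] at h1
    exact not_lt_of_ge h1 zero_lt_one
  · rw [hd]
    exact (hM ⟨i, rfl⟩).trans (le_max_left _ _)

theorem valuation_pos {d : F} (hd : d ≠ 0) : 0 < valuation F d :=
  zero_lt_iff.2 ((map_ne_zero _).2 hd)

theorem exists_valuation_lt {d : F} (hd : d ≠ 0) :
    ∃ c : F, c ≠ 0 ∧ valuation F c < valuation F d := by
  obtain ⟨r, hr, hr'⟩ := Valuation.IsNontrivial.exists_lt_one (v := valuation F)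
  refine ⟨r * d, mul_ne_zero (by simpa using hr) hd, ?_⟩
  rw [map_mul]
  exact mul_lt_of_lt_one_left (valuation_pos hd) hr'

theorem nhds_zero_basis_le :
    (𝓝 (0 : F)).HasBasis (fun c : F => c ≠ 0) fun c => {x | valuation F x ≤ valuation F c} := by
  refine (IsValuativeTopology.hasBasis_nhds_zero' F).to_hasBasis (fun γ hγ => ?_) fun c hc => ?_
  · obtain ⟨d, rfl⟩ := valuation_surjective γ
    obtain ⟨c, hc, hcd⟩ := exists_valuation_lt (d := d) (by simpa using hγ)
    exact ⟨c, hc, fun x hx => lt_of_le_of_lt hx hcd⟩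
  · exact ⟨valuation F c, by simpa using hc, fun x hx => (show valuation F x < _ from hx).le⟩

/-- The polydisc of radius `|c|` about `y₀`. -/
def box (c : F) (y₀ : Fin n → F) : Set (Fin n → F) :=
  {y | ∀ i, valuation F (y i - y₀ i) ≤ valuation F c}

theorem mem_box_self (c : F) (y₀ : Fin n → F) : y₀ ∈ box c y₀ := fun i => by simp

theorem box_mono {c d : F} (h : valuation F c ≤ valuation F d) (y₀ : Fin n → F) :
    box c y₀ ⊆ box d y₀ := fun _ hy i => (hy i).trans h

theorem nhds_basis_box (y₀ : Fin n → F) :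
    (𝓝 y₀).HasBasis (fun c : F => c ≠ 0) fun c => box c y₀ := by
  have h0 : ∀ c : F, c ≠ 0 → box c y₀ ∈ 𝓝 y₀ := fun c hc => by
    have h1 : ∀ i, {y : Fin n → F | valuation F (y i - y₀ i) ≤ valuation F c} ∈ 𝓝 y₀ := fun i => by
      have h2 : Filter.Tendsto (fun y : Fin n → F => y i - y₀ i) (𝓝 y₀) (𝓝 0) := by
        have : Continuous fun y : Fin n → F => y i - y₀ i := by fun_prop
        simpa using this.tendsto y₀
      exact h2 (nhds_zero_basis_le.mem_of_mem hc)
    exact (Filter.eventually_all.2 h1 : ∀ᶠ y in 𝓝 y₀, ∀ i, _)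
  refine ⟨fun s => ⟨fun hs => ?_, fun ⟨c, hc, hcs⟩ => Filter.mem_of_superset (h0 c hc) hcs⟩⟩
  have hs' : (fun z : Fin n → F => z + y₀) ⁻¹' s ∈ 𝓝 (0 : Fin n → F) := by
    have : Continuous fun z : Fin n → F => z + y₀ := by fun_prop
    exact this.continuousAt (by simpa using hs)
  rw [nhds_pi, Filter.mem_pi'] at hs'
  obtain ⟨I, t, ht, hts⟩ := hs'
  choose c hc hct using fun i => nhds_zero_basis_le.mem_iff.1 (ht i)
  -- A common lower bound for the radii `c i` is the inverse of a common upper bound for their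
  -- inverses.
  obtain ⟨d, hd, -, hcd⟩ := exists_ne_zero_forall_le fun i => (c i)⁻¹
  refine ⟨d⁻¹, inv_ne_zero hd, fun y hy => ?_⟩
  have : y - y₀ ∈ (fun z : Fin n → F => z + y₀) ⁻¹' s := hts fun i _ => hct i ((hy i).trans (by
      have h1 := hcd i
      rw [map_inv₀] at h1
      rw [map_inv₀]
      exact (inv_le_comm₀ (valuation_pos (hc i)) (valuation_pos hd)).1 h1) :
        valuation F (y i - y₀ i) ≤ valuation F (c i))
  simpa using this

theorem box_mem_nhds {c : F} (hc : c ≠ 0) (y₀ : Fin n → F) : box c y₀ ∈ 𝓝 y₀ :=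
  (nhds_basis_box y₀).mem_of_mem hc

theorem isCompact_box (c : F) (y₀ : Fin n → F) : IsCompact (box c y₀) := by
  have h : IsCompact (Set.pi Set.univ fun _ : Fin n => {x | valuation F x ≤ valuation F c}) :=
    isCompact_univ_pi fun _ => IsNonarchimedeanLocalField.isCompact_closedBall F _
  convert h.image (show Continuous fun z : Fin n → F => z + y₀ by fun_prop) using 1
  ext y
  refine ⟨fun hy => ⟨y - y₀, fun i _ => hy i, by simp⟩, ?_⟩
  rintro ⟨z, hz, rfl⟩ i
  simpa using hz i (Set.mem_univ i)

theorem IsCompact.exists_subset_box {K : Set (Fin n → F)} (hK : IsCompact K) :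
    ∃ d : F, d ≠ 0 ∧ K ⊆ box d 0 := by
  refine hK.induction_on (p := fun K => ∃ d : F, d ≠ 0 ∧ K ⊆ box d 0)
    ⟨1, one_ne_zero, Set.empty_subset _⟩ ?_ ?_ fun y _ => ?_
  · rintro s t hst ⟨d, hd, h⟩
    exact ⟨d, hd, hst.trans h⟩
  · rintro s t ⟨d, hd, h⟩ ⟨d', hd', h'⟩
    rcases le_total (valuation F d) (valuation F d') with hdd | hdd
    · exact ⟨d', hd', Set.union_subset (h.trans (box_mono hdd _)) h'⟩
    · exact ⟨d, hd, Set.union_subset h (h'.trans (box_mono hdd _))⟩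
  · obtain ⟨d, hd, hd1, hy⟩ := exists_ne_zero_forall_le y
    refine ⟨box 1 y, mem_nhdsWithin_of_mem_nhds (box_mem_nhds one_ne_zero y), d, hd,
      fun z hz i => ?_⟩
    have : z i - (0 : Fin n → F) i = (z i - y i) + y i := by simp
    rw [this]
    exact (Valuation.map_add _ _ _).trans (max_le ((hz i).trans hd1) (hy i))

theorem add_mem_box {c : F} {y z y₀ : Fin n → F} (hy : y ∈ box c y₀) (hz : z ∈ box c 0) :
    y + z ∈ box c y₀ := fun i => by
  have : (y + z) i - y₀ i = (y i - y₀ i) + (z i - (0 : Fin n → F) i) := by simp; ring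
  rw [this]
  exact (Valuation.map_add _ _ _).trans (max_le (hy i) (hz i))

/-- By the ultrametric inequality every point of a polydisc is a centre. -/
theorem box_eq_of_mem {c : F} {y y₀ : Fin n → F} (hy : y ∈ box c y₀) : box c y = box c y₀ := by
  have key : ∀ {y y₀ : Fin n → F}, y ∈ box c y₀ → box c y ⊆ box c y₀ := fun {y y₀} hy z hz i => by
    have : z i - y₀ i = (z i - y i) + (y i - y₀ i) := by ring
    rw [this]
    exact (Valuation.map_add _ _ _).trans (max_le (hz i) (hy i))
  refine Set.Subset.antisymm (key hy) (key fun i => ?_)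
  rw [Valuation.map_sub_swap]
  exact hy i

end LocalField

/-! ### Trigonometric polynomials on the space of characters of `B_n`. -/

section Characters

open Topology ValuativeRel

variable {F : Type u} [Field F] [ValuativeRel F] [TopologicalSpace F] [IsNonarchimedeanLocalField F]
  {n : ℕ} (ψ : ResidualChar F)

/-- The character `b ↦ ψ(y · b)` of `B_n`. -/
noncomputable def polarChar (y : Fin n → F) : polarSubgroup F n →* ℂ where
  toFun b := ψ.toAddChar (∑ i, y i * polarCoeff b.1 i)
  map_one' := by
    rw [Subgroup.coe_one, polarCoeff_one]
    simp
  map_mul' b b' := by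
    rw [polarCoeff_mul, ← AddChar.map_add_eq_mul, ← Finset.sum_add_distrib]
    simp only [Pi.add_apply, mul_add]

theorem polarChar_apply (y : Fin n → F) (b : polarSubgroup F n) :
    polarChar ψ y b = ψ.toAddChar (∑ i, y i * polarCoeff b.1 i) := rfl

theorem polarChar_add (y z : Fin n → F) (b : polarSubgroup F n) :
    polarChar ψ (y + z) b = polarChar ψ y b * polarChar ψ z b := by
  rw [polarChar_apply, polarChar_apply, polarChar_apply, ← AddChar.map_add_eq_mul,
    ← Finset.sum_add_distrib]
  simp only [Pi.add_apply, add_mul]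

theorem polarChar_zero (b : polarSubgroup F n) : polarChar ψ 0 b = 1 := by
  simp [polarChar_apply]

theorem polarChar_polarElem (y : Fin n → F) (i : Fin n) (c : F) :
    polarChar ψ y (polarElem i c) = ψ.toAddChar (y i * c) := by
  rw [polarChar_apply, polarCoeff_polarElem, Finset.sum_eq_single i]
  · rw [Pi.single_eq_same]
  · intro j _ hj
    rw [Pi.single_eq_of_ne hj, mul_zero]
  · simp

theorem isLocallyConstant_polarChar (b : polarSubgroup F n) :
    IsLocallyConstant fun y : Fin n → F => polarChar ψ y b :=
  ψ.isLocallyConstant.comp_continuous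
    (by fun_prop : Continuous fun y : Fin n → F => ∑ i, y i * polarCoeff b.1 i)

/-- The value of an element of the group algebra of `B_n` at the character `y`. -/
noncomputable def polarEval (y : Fin n → F) : MonoidAlgebra ℂ (polarSubgroup F n) →ₐ[ℂ] ℂ :=
  MonoidAlgebra.lift ℂ ℂ _ (polarChar ψ y)

theorem polarEval_single (y : Fin n → F) (b : polarSubgroup F n) (c : ℂ) :
    polarEval ψ y (MonoidAlgebra.single b c) = c * polarChar ψ y b := by
  rw [polarEval, MonoidAlgebra.lift_single, smul_eq_mul]

theorem isLocallyConstant_polarEval (t : MonoidAlgebra ℂ (polarSubgroup F n)) :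
    IsLocallyConstant fun y : Fin n → F => polarEval ψ y t := by
  induction t using MonoidAlgebra.induction_on with
  | of b =>
    have h : (fun y : Fin n → F => polarEval ψ y (MonoidAlgebra.of ℂ _ b)) =
        fun y => polarChar ψ y b := by
      funext y
      rw [MonoidAlgebra.of_apply, polarEval_single, one_mul]
    rw [h]
    exact isLocallyConstant_polarChar ψ b
  | add s t hs ht =>
    simp only [map_add]
    exact hs.add ht
  | smul r t ht =>
    simp only [map_smul]
    exact ht.comp (fun z : ℂ => r • z)

/-- Every compact open polydisc is cut out, within a compact set, by a trigonometric polynomial. -/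
theorem exists_polarEval_eq_indicator {K : Set (Fin n → F)} (hK : IsCompact K) {c : F} (hc : c ≠ 0)
    (y₀ : Fin n → F) : ∃ t : MonoidAlgebra ℂ (polarSubgroup F n),
      (∀ y ∈ box c y₀, polarEval ψ y t = 1) ∧ ∀ y ∈ K, y ∉ box c y₀ → polarEval ψ y t = 0 := by
  have hloc : ∀ y ∉ box c y₀, ∃ t : MonoidAlgebra ℂ (polarSubgroup F n),
      (∀ z ∈ box c y₀, polarEval ψ z t = 1) ∧ polarEval ψ y t = 0 := fun y hy => by
    obtain ⟨i, hi⟩ := not_forall.1 hy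
    rw [not_le] at hi
    obtain ⟨x, hx, hx'⟩ := ψ.exists_ne_one
    have hne : y i - y₀ i ≠ 0 := by
      intro h
      rw [h, map_zero] at hi
      exact not_lt_zero hi
    -- The scaling makes `y - y₀` pair with `b` to `x`, where `ψ` is non-trivial. For `z` in the
    -- polydisc, `|z_i - y₀_i| < |y_i - y₀_i|`, so `z - y₀` pairs with `b` into the maximal ideal,
    -- where `ψ` is trivial.
    set b : polarSubgroup F n := polarElem i (x / (y i - y₀ i))
    have hb : polarChar ψ (y - y₀) b = ψ.toAddChar x := by
      rw [polarChar_polarElem, Pi.sub_apply, mul_div_cancel₀ _ hne]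
    have hb' : ∀ z ∈ box c y₀, polarChar ψ (z - y₀) b = 1 := fun z hz => by
      rw [polarChar_polarElem]
      refine ψ.trivial_of_lt_one _ ?_
      rw [Pi.sub_apply, map_mul, map_div₀]
      have h1 := lt_of_le_of_lt (hz i) hi
      have h2 : valuation F (z i - y₀ i) * (valuation F x / valuation F (y i - y₀ i)) ≤
          valuation F (z i - y₀ i) * (1 / valuation F (y i - y₀ i)) := by
        gcongr
        exact zero_le
      refine lt_of_le_of_lt h2 ?_
      rw [mul_one_div]
      exact (div_lt_one₀ (valuation_pos hne)).2 h1
    set ζ := ψ.toAddChar x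
    have hζ : (1 - ζ) ≠ 0 := sub_ne_zero.2 hx'.symm
    have hy0 : polarChar ψ y₀ b ≠ 0 := ne_zero_of_toAddChar ψ _
    have hval : ∀ z, polarChar ψ z b = polarChar ψ (z - y₀) b * polarChar ψ y₀ b := fun z => by
      rw [← polarChar_add, sub_add_cancel]
    -- Its value at `z` is `(χ - ζ) / (1 - ζ)` with `χ = polarChar ψ (z - y₀) b`: the affine
    -- function of `χ` that is `1` at `χ = 1`, hence on the polydisc, and `0` at `χ = ζ`, hence at
    -- `y`.
    refine ⟨MonoidAlgebra.single b ((1 - ζ)⁻¹ * (polarChar ψ y₀ b)⁻¹) -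
      algebraMap ℂ _ ((1 - ζ)⁻¹ * ζ), fun z hz => ?_, ?_⟩
    · rw [map_sub, polarEval_single, AlgHom.commutes, hval z, hb' z hz, Algebra.algebraMap_self,
        RingHom.id_apply]
      field_simp
    · rw [map_sub, polarEval_single, AlgHom.commutes, hval y, hb, Algebra.algebraMap_self,
        RingHom.id_apply]
      field_simp
      ring
  choose! t ht ht' using hloc
  -- Products of such `t` keep the value `1` on the polydisc and collect the zeros, so by
  -- compactness it is enough to treat a neighbourhood of each point.
  refine hK.induction_on (p := fun K => ∃ t : MonoidAlgebra ℂ (polarSubgroup F n),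
      (∀ y ∈ box c y₀, polarEval ψ y t = 1) ∧ ∀ y ∈ K, y ∉ box c y₀ → polarEval ψ y t = 0)
    ⟨1, fun y _ => map_one _, fun y hy => hy.elim⟩ ?_ ?_ fun y _ => ?_
  · rintro s s' hs ⟨t, h, h'⟩
    exact ⟨t, h, fun y hy => h' y (hs hy)⟩
  · rintro s s' ⟨t, h₁, h₂⟩ ⟨t', h₁', h₂'⟩
    refine ⟨t * t', fun y hy => by rw [map_mul, h₁ y hy, h₁' y hy, one_mul], ?_⟩
    rintro y (hy | hy) hy'
    · rw [map_mul, h₂ y hy hy', zero_mul]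
    · rw [map_mul, h₂' y hy hy', mul_zero]
  · by_cases hy : y ∈ box c y₀
    · refine ⟨box c y₀, mem_nhdsWithin_of_mem_nhds ?_, 1, fun y _ => map_one _,
        fun z hz hz' => (hz' hz).elim⟩
      rw [← box_eq_of_mem hy]
      exact box_mem_nhds hc y
    · refine ⟨{z | polarEval ψ z (t y) = 0}, mem_nhdsWithin_of_mem_nhds ?_, t y, ht y hy,
        fun z hz _ => hz⟩
      have := (IsLocallyConstant.iff_eventually_eq _).1 (isLocallyConstant_polarEval ψ (t y)) y
      filter_upwards [this] with z hz
      exact hz.trans (ht' y hy)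

/-- A vector fixed by the annihilator of the polydisc `D` is only moved by the values on `D` of an
element of the group algebra. -/
theorem asAlgebraHom_apply_eq_zero {E : Type*} [AddCommGroup E] [Module ℂ E]
    (π : Representation ℂ (polarSubgroup F n) E) {v : E} {d : F}
    (hv : ∀ b, (∀ y ∈ box d (0 : Fin n → F), polarChar ψ y b = 1) → π b v = v)
    {t : MonoidAlgebra ℂ (polarSubgroup F n)}
    (ht : ∀ y ∈ box d (0 : Fin n → F), polarEval ψ y t = 0) : π.asAlgebraHom t v = 0 := by
  let D : AddSubmonoid (Fin n → F) :=
    { carrier := box d 0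
      zero_mem' := mem_box_self d 0
      add_mem' := fun ha hb => add_mem_box ha hb }
  -- `X b` is `b` viewed as a character of the polydisc `D`. By `hv` the vector `π b v` depends on
  -- `X b` only, so `t v` is determined by the image of `t` among formal combinations of characters
  -- of `D`. Linear independence of characters shows that this image is zero as soon as its values
  -- on `D` vanish.
  let X : polarSubgroup F n → (Multiplicative D →* ℂ) := fun b =>
    { toFun := fun y => polarChar ψ (Multiplicative.toAdd y).1 b
      map_one' := polarChar_zero ψ b
      map_mul' := fun y z => polarChar_add ψ _ _ b }
  have hX : ∀ b b', X b = X b' → π b v = π b' v := fun b b' h => by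
    have h1 : π (b'⁻¹ * b) v = v := by
      refine hv _ fun y hy => ?_
      have h2 : polarChar ψ y b = polarChar ψ y b' :=
        congrArg (fun f => f (Multiplicative.ofAdd ⟨y, hy⟩)) h
      rw [map_mul, h2, ← map_mul, inv_mul_cancel, map_one]
    rw [map_mul] at h1
    have h2 := congrArg (π b') h1
    rwa [Module.End.mul_apply, ← Module.End.mul_apply, ← map_mul, mul_inv_cancel, map_one] at h2
  let w : (Multiplicative D →* ℂ) → E := fun χ =>
    open Classical in if h : ∃ b, X b = χ then π h.choose v else 0
  have hw : ∀ b, w (X b) = π b v := fun b => by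
    have h : ∃ b', X b' = X b := ⟨b, rfl⟩
    exact (dif_pos h).trans (hX _ _ h.choose_spec)
  have e1 : ∀ t : MonoidAlgebra ℂ (polarSubgroup F n), π.asAlgebraHom t v =
      Finsupp.linearCombination ℂ w (Finsupp.mapDomain X t.coeff) := fun t => by
    rw [Finsupp.linearCombination_mapDomain]
    induction t using MonoidAlgebra.induction_on with
    | of b => simp [hw]
    | add s t hs ht => simp [hs, ht]
    | smul r t ht => simp [ht]
  have e2 : ∀ (t : MonoidAlgebra ℂ (polarSubgroup F n)) (y : Multiplicative D),
      polarEval ψ (Multiplicative.toAdd y).1 t =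
      Finsupp.linearCombination ℂ (fun χ : Multiplicative D →* ℂ => (χ : Multiplicative D → ℂ))
        (Finsupp.mapDomain X t.coeff) y := fun t y => by
    rw [Finsupp.linearCombination_mapDomain]
    induction t using MonoidAlgebra.induction_on with
    | of b =>
      rw [MonoidAlgebra.of_apply, polarEval_single]
      simp [X]
    | add s t hs ht => simp [hs, ht]
    | smul r t ht => simp [ht]
  have h0 : Finsupp.mapDomain X t.coeff = 0 := by
    refine linearIndependent_iff.1 (linearIndependent_monoidHom (Multiplicative D) ℂ) _ ?_
    funext y
    rw [← e2, ht _ (Multiplicative.toAdd y).2]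
    rfl
  rw [e1, h0, map_zero]

end Characters

/-! ### The action on `M_k` and integration along fibres. -/

section Units

variable {F : Type u} [Field F]

/-- The element of `O^* ⋉ B_n` given by a unit. -/
noncomputable def unitElem (n : ℕ) (u : F⟦X⟧ˣ) : HInf.level F n := ⟨⟨1, u⟩, smul_zero _⟩

theorem unitElem_polar (n : ℕ) (u : F⟦X⟧ˣ) : (unitElem n u : HInf F).polar = 0 := rfl

theorem unitElem_unit (n : ℕ) (u : F⟦X⟧ˣ) : (unitElem n u : HInf F).unit = u := rfl

theorem HInf.ext' {h h' : HInf F} (h₁ : h.polar = h'.polar) (h₂ : h.unit = h'.unit) : h = h' :=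
  SemidirectProduct.ext h₁ h₂

theorem unitElem_one (n : ℕ) : unitElem n (1 : F⟦X⟧ˣ) = 1 := rfl

theorem unitElem_mul (n : ℕ) (u u' : F⟦X⟧ˣ) : unitElem n (u * u') = unitElem n u * unitElem n u' :=
  Subtype.ext (HInf.ext' (by
    rw [Subgroup.coe_mul, HInf.polar_mul, unitElem_polar, unitElem_polar, unitElem_polar,
      smul_zero, add_zero]) rfl)

end Units


namespace MeasureRep

open Topology ValuativeRel MeasureTheory

variable {F : Type u} [Field F] [ValuativeRel F] [TopologicalSpace F] [IsNonarchimedeanLocalField F]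
  (ψ : ResidualChar F)

/-- The representation of `O^* ⋉ B_n` on `M_k`, `n ≤ k + 1`. -/
noncomputable def repOn {k n : ℕ} (hn : n ≤ k + 1) :
    Representation ℂ (HInf.level F n) (schwartzUnits F k) where
  toFun h := actOn ψ hn h
  map_one' := LinearMap.ext fun f => Subtype.ext (act_one ψ f)
  map_mul' h h' := LinearMap.ext fun f => Subtype.ext (act_mul ψ h h' f)

theorem repOn_coe {k n : ℕ} (hn : n ≤ k + 1) (h : HInf.level F n) (f : schwartzUnits F k) :
    (repOn ψ hn h f : F⟦X⟧ˣ → ℂ) = act ψ h f := rfl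

theorem act_apply (h : HInf F) (f : F⟦X⟧ˣ → ℂ) (x : F⟦X⟧ˣ) : act ψ h f x =
    ψ.toAddChar (PolarParts.residue F ((x : F⟦X⟧) • h.polar)) * f (h.unit * x) := rfl

theorem residue_smul_polar {m : ℕ} (b : HInf.level F (m + 1)) (x : F⟦X⟧ˣ) :
    PolarParts.residue F ((x : F⟦X⟧) • (b : HInf F).polar) =
      ∑ i, jet m x i * polarCoeff b i := by
  rw [PolarParts.residue_smul _ _ b.2]
  rfl

theorem act_polar {m : ℕ} (b : polarSubgroup F (m + 1)) (f : F⟦X⟧ˣ → ℂ) (x : F⟦X⟧ˣ) :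
    act ψ b.1 f x = polarChar ψ (jet m x) b * f x := by
  rw [act_apply, residue_smul_polar, show ((b : HInf.level F (m + 1)) : HInf F).unit = 1 from b.2,
    one_mul]
  rfl

theorem repOn_unitElem {k n : ℕ} (hn : n ≤ k + 1) (u : F⟦X⟧ˣ) (f : schwartzUnits F k)
    (x : F⟦X⟧ˣ) : (repOn ψ hn (unitElem n u) f : F⟦X⟧ˣ → ℂ) x = (f : F⟦X⟧ˣ → ℂ) (u * x) := by
  rw [repOn_coe, act_apply, unitElem_polar, smul_zero, map_zero, AddChar.map_zero_eq_one, one_mul,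
    unitElem_unit]

/-- The representation of `B_(m+1)` on `M_k`, `m ≤ k`. -/
noncomputable def polarRep {k m : ℕ} (h : m ≤ k) :
    Representation ℂ (polarSubgroup F (m + 1)) (schwartzUnits F k) :=
  (repOn ψ (Nat.succ_le_succ h)).comp (Subgroup.subtype _)

theorem polarRep_apply {k m : ℕ} (h : m ≤ k) (b : polarSubgroup F (m + 1))
    (f : schwartzUnits F k) (x : F⟦X⟧ˣ) :
    (polarRep ψ h b f : F⟦X⟧ˣ → ℂ) x = polarChar ψ (jet m x) b * (f : F⟦X⟧ˣ → ℂ) x :=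
  act_polar ψ b f x

theorem polarRep_asAlgebraHom {k m : ℕ} (h : m ≤ k) (t : MonoidAlgebra ℂ (polarSubgroup F (m + 1)))
    (f : schwartzUnits F k) (x : F⟦X⟧ˣ) : ((polarRep ψ h).asAlgebraHom t f : F⟦X⟧ˣ → ℂ) x =
      polarEval ψ (jet m x) t * (f : F⟦X⟧ˣ → ℂ) x := by
  induction t using MonoidAlgebra.induction_on with
  | of b =>
    rw [MonoidAlgebra.of_apply, Representation.asAlgebraHom_single, polarEval_single, one_smul,
      one_mul, polarRep_apply]
  | add s t hs ht =>
    rw [map_add, map_add, LinearMap.add_apply, Submodule.coe_add, Pi.add_apply, hs, ht, add_mul]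
  | smul r t ht =>
    rw [map_smul, map_smul, LinearMap.smul_apply, Submodule.coe_smul, Pi.smul_apply, ht,
      smul_eq_mul, smul_eq_mul, mul_assoc]

theorem continuous_truncate {m k : ℕ} (h : m ≤ k) :
    Continuous fun (y : Fin (k + 1) → F) (i : Fin (m + 1)) => y (Fin.castLE (by omega) i) := by
  fun_prop

theorem exists_isCompact_support {k m : ℕ} (h : m ≤ k) (f : schwartzUnits F k) :
    ∃ K : Set (Fin (m + 1) → F), IsCompact K ∧ ∀ x, (f : F⟦X⟧ˣ → ℂ) x ≠ 0 → jet m x ∈ K := by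
  obtain ⟨g, ⟨-, hc, -⟩, hfg⟩ := mem_schwartzUnits.1 f.2
  refine ⟨_, hc.image (continuous_truncate h), fun x hx => ⟨jet k x, subset_tsupport g ?_, rfl⟩⟩
  rw [Function.mem_support, ← hfg]
  exact hx

theorem tsupport_jets {n : ℕ} {g : (Fin (n + 1) → F) → ℂ} (hg : g ∈ schwartzJets F n)
    {y : Fin (n + 1) → F} (hy : y ∈ tsupport g) : g y ≠ 0 := by
  have hcl : IsClosed (Function.support g) :=
    ⟨by rw [Function.compl_support]; exact hg.1 {0}⟩
  rwa [tsupport, hcl.closure_eq] at hy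

/-- The function `y ↦ 1 / y_0` is continuous on `K`, hence bounded there. Applied to supports, this
says that elements of `M_k` vanish near `y_0 = 0`, which is the source of cuspidality. -/
theorem exists_lt_of_isCompact {n : ℕ} {K : Set (Fin (n + 1) → F)} (hK : IsCompact K)
    (h0 : ∀ y ∈ K, y 0 ≠ 0) : ∃ ε : F, ε ≠ 0 ∧ ∀ y ∈ K, valuation F ε < valuation F (y 0) := by
  have hc : IsCompact ((fun (y : Fin (n + 1) → F) (_ : Fin 1) => (y 0)⁻¹) '' K) := by
    refine hK.image_of_continuousOn (continuousOn_pi.2 fun _ => ?_)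
    exact ContinuousOn.inv₀ (by fun_prop) h0
  obtain ⟨d, hd, h⟩ := hc.exists_subset_box
  obtain ⟨ε, hε, hlt⟩ := exists_valuation_lt (inv_ne_zero hd)
  refine ⟨ε, hε, fun y hy => hlt.trans_le ?_⟩
  have h1 := h ⟨y, hy, rfl⟩ 0
  simp only [Pi.zero_apply, sub_zero, map_inv₀] at h1
  rw [map_inv₀]
  exact (inv_le_comm₀ (valuation_pos (h0 y hy)) (valuation_pos hd)).1 h1

theorem exists_lt_of_ne_zero {k : ℕ} (f : schwartzUnits F k) : ∃ ε : F, ε ≠ 0 ∧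
    ∀ x, (f : F⟦X⟧ˣ → ℂ) x ≠ 0 → valuation F ε < valuation F (jet k x 0) := by
  obtain ⟨g, hg, hfg⟩ := mem_schwartzUnits.1 f.2
  obtain ⟨ε, hε, h⟩ := exists_lt_of_isCompact hg.2.1 fun y hy h0 => tsupport_jets hg hy (hg.2.2 y h0)
  refine ⟨ε, hε, fun x hx => h _ (subset_tsupport g ?_)⟩
  rw [Function.mem_support, ← hfg]
  exact hx

theorem exists_forall_box_eq {k : ℕ} (f : schwartzUnits F k) (x₀ : F⟦X⟧ˣ) : ∃ c : F, c ≠ 0 ∧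
    ∀ x, jet k x ∈ box c (jet k x₀) → (f : F⟦X⟧ˣ → ℂ) x = (f : F⟦X⟧ˣ → ℂ) x₀ := by
  obtain ⟨g, hg, hfg⟩ := mem_schwartzUnits.1 f.2
  obtain ⟨c, hc, h⟩ := (nhds_basis_box (jet k x₀)).eventually_iff.1
    ((IsLocallyConstant.iff_eventually_eq _).1 hg.1 (jet k x₀))
  exact ⟨c, hc, fun x hx => by rw [hfg, hfg, h hx]⟩

/-- This is local constancy of `h ↦ act ψ h f` at the identity, read at level `n = 0` where there
are no polar coordinates. The radius `c` is uniform in `x`. -/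
theorem exists_forall_shift_eq {k : ℕ} (f : schwartzUnits F k) (ψ : ResidualChar F) :
    ∃ c : F, c ≠ 0 ∧ ∀ u, jet k u ∈ box c (jet k 1) →
      ∀ x, (f : F⟦X⟧ˣ → ℂ) (u * x) = (f : F⟦X⟧ˣ → ℂ) x := by
  let _ := HInf.depthTopology (F := F) k 0
  have h1 := (IsLocallyConstant.iff_eventually_eq _).1
    (isLocallyConstant_act ψ (k := k) (Nat.zero_le _) f.2) 1
  rw [nhds_induced, Filter.eventually_comap, nhds_prod_eq] at h1
  obtain ⟨s, hs, t, ht, hst⟩ := Filter.mem_prod_iff.1 h1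
  obtain ⟨c, hc, hcs⟩ := (nhds_basis_box _).mem_iff.1 hs
  refine ⟨c, hc, fun u hu x => ?_⟩
  have h2 := hst (Set.mk_mem_prod (hcs hu) (mem_of_mem_nhds ht)) (unitElem 0 u)
    (Prod.ext rfl (Subsingleton.elim _ _))
  have h3 := congrFun h2 x
  have h4 := repOn_unitElem ψ (Nat.zero_le (k + 1)) u f x
  rw [repOn_coe] at h4
  rw [← h4, h3, Subgroup.coe_one, act_one]

theorem jet_unip_last (i : ℕ) (x : F⟦X⟧ˣ) (y : F) :
    jet (i + 1) (x * unip i y) (Fin.last _) =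
      PowerSeries.coeff (i + 1) (x : F⟦X⟧) + jet i x 0 * y := by
  rw [jet_unip, Fin.snoc_last]

theorem jet_unip_castSucc (i : ℕ) (x : F⟦X⟧ˣ) (y : F) (j : Fin (i + 1)) :
    jet (i + 1) (x * unip i y) (Fin.castSucc j) = jet i x j := by
  rw [jet_unip, Fin.snoc_castSucc]

theorem coeff_eq_of_jet_eq {k j : ℕ} {x y : F⟦X⟧ˣ} (h : jet k x = jet k y) (hj : j ≤ k) :
    PowerSeries.coeff j (x : F⟦X⟧) = PowerSeries.coeff j (y : F⟦X⟧) :=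
  congrFun h ⟨j, Nat.lt_succ_of_le hj⟩

theorem jet_eq_of_jet_eq {k m : ℕ} (hm : m ≤ k) {x y : F⟦X⟧ˣ} (h : jet k x = jet k y) :
    jet m x = jet m y := funext fun j => coeff_eq_of_jet_eq h ((Nat.lt_succ_iff.1 j.2).trans hm)

theorem jet_mul_eq {k : ℕ} {x x' : F⟦X⟧ˣ} (y : F⟦X⟧ˣ) (h : jet k x = jet k x') :
    jet k (x * y) = jet k (x' * y) := by
  rw [← mulJet_jet, ← mulJet_jet, h]

theorem apply_eq_of_jet_eq {k : ℕ} (f : schwartzUnits F k) {x y : F⟦X⟧ˣ} (h : jet k x = jet k y) :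
    (f : F⟦X⟧ˣ → ℂ) x = (f : F⟦X⟧ˣ → ℂ) y := by
  obtain ⟨g, -, hfg⟩ := mem_schwartzUnits.1 f.2
  rw [hfg, hfg, h]

theorem jet_unip_one {i k : ℕ} (h : k ≤ i) (y : F) : jet k (unip i y) = jet k 1 := by
  refine jet_eq_of_jet_eq h ?_
  funext j
  have := jet_unip_castSucc i 1 y j
  rw [one_mul] at this
  exact this

/-- A finite set that computes the integral of every function supported in one disc and invariant
under a smaller one. -/
theorem exists_finset_integral [MeasurableSpace F] [BorelSpace F] {c d : F} (hc : c ≠ 0)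
    (hcd : valuation F c ≤ valuation F d) : ∃ (R : Finset F) (κ : ℂ), R.Nonempty ∧ κ ≠ 0 ∧
      (∀ r ∈ R, valuation F r ≤ valuation F d) ∧ ∀ f : F → ℂ,
        (∀ y z, valuation F z ≤ valuation F c → f (y + z) = f y) →
        (∀ y, f y ≠ 0 → valuation F y ≤ valuation F d) →
        ∫ y, f y ∂(Measure.addHaar : Measure F) = κ * ∑ r ∈ R, f r := by
  classical
  have := t2Space_localField F
  let P₀ : AddSubgroup F :=
    { carrier := {x | valuation F x ≤ valuation F c}
      zero_mem' := by simp
      add_mem' := fun {a b} ha hb => show valuation F (a + b) ≤ valuation F c from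
        (Valuation.map_add _ _ _).trans (max_le ha hb)
      neg_mem' := fun {x} ha => by simpa using ha }
  have hP₀ : ∀ {x}, x ∈ P₀ ↔ valuation F x ≤ valuation F c := Iff.rfl
  let rep : F → F := fun y => (QuotientAddGroup.mk y : F ⧸ P₀).out
  have hrep : ∀ y, y - rep y ∈ P₀ := fun y => by
    have h : (QuotientAddGroup.mk (rep y) : F ⧸ P₀) = QuotientAddGroup.mk y :=
      Quotient.out_eq' _
    have := QuotientAddGroup.eq.1 h
    rwa [neg_add_eq_sub] at this
  have hrep' : ∀ {y z}, y - z ∈ P₀ → rep y = rep z := fun {y z} h => by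
    have : (QuotientAddGroup.mk y : F ⧸ P₀) = QuotientAddGroup.mk z := by
      rw [QuotientAddGroup.eq, ← neg_mem_iff]
      convert h using 1
      abel
    exact congrArg Quotient.out this
  have hnhds : ∀ y : F, {z | z - y ∈ P₀} ∈ 𝓝 y := fun y => by
    have h2 : Filter.Tendsto (fun z : F => z - y) (𝓝 y) (𝓝 0) := by
      have : Continuous fun z : F => z - y := by fun_prop
      simpa using this.tendsto y
    exact h2 (nhds_zero_basis_le.mem_of_mem hc)
  have hclosed : IsOpen (P₀ : Set F) := P₀.isOpen_of_mem_nhds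
    (g := 0) (nhds_zero_basis_le.mem_of_mem hc)
  obtain ⟨t, ht, htc⟩ := (IsNonarchimedeanLocalField.isCompact_closedBall F
    (valuation F d)).elim_nhds_subcover _ fun y _ => hnhds y
  have hmeas : MeasurableSet (P₀ : Set F) := hclosed.measurableSet
  set μ : Measure F := Measure.addHaar
  have hfin : μ (P₀ : Set F) ≠ ⊤ :=
    (IsNonarchimedeanLocalField.isCompact_closedBall F (valuation F c)).measure_lt_top.ne
  have hpos : μ (P₀ : Set F) ≠ 0 := hclosed.measure_ne_zero μ ⟨0, zero_mem P₀⟩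
  have hcover : ∀ y, valuation F y ≤ valuation F d → rep y ∈ t.image rep := fun y hy => by
    obtain ⟨x, hx, hxy⟩ := Set.mem_iUnion₂.1 (htc hy)
    exact Finset.mem_image.2 ⟨x, hx, (hrep' hxy).symm⟩
  -- `R` represents the cosets of the small disc `P₀` that make up the large one, and `κ` is the
  -- common volume of these cosets.
  refine ⟨t.image rep, (μ (P₀ : Set F)).toReal, ⟨_, hcover 0 (by simp)⟩, ?_, ?_, fun f hf hs => ?_⟩
  · exact_mod_cast (ENNReal.toReal_ne_zero.2 ⟨hpos, hfin⟩)
  · intro r hr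
    obtain ⟨y, hy, rfl⟩ := Finset.mem_image.1 hr
    have : rep y = y - (y - rep y) := by ring
    rw [this]
    exact (Valuation.map_sub _ _ _).trans (max_le (ht y hy) ((hP₀.1 (hrep y)).trans hcd))
  · have hf' : ∀ y, f (rep y) = f y := fun y => by
      conv_rhs => rw [show y = rep y + (y - rep y) by ring, hf _ _ (hrep y)]
    have hrr : ∀ y, rep (rep y) = rep y := fun y => (hrep' (hrep y)).symm
    have e : f = fun y => ∑ r ∈ t.image rep,
        Set.indicator ((fun z => -r + z) ⁻¹' (P₀ : Set F)) (fun _ => f r) y := by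
      funext y
      by_cases hy : rep y ∈ t.image rep
      · rw [Finset.sum_eq_single (rep y)]
        · rw [Set.indicator_of_mem, hf']
          rw [Set.mem_preimage, SetLike.mem_coe, neg_add_eq_sub]
          exact hrep y
        · intro r hr hne
          refine Set.indicator_of_notMem (fun h => hne ?_) _
          rw [Set.mem_preimage, SetLike.mem_coe, neg_add_eq_sub] at h
          obtain ⟨z, -, rfl⟩ := Finset.mem_image.1 hr
          rw [hrep' h, hrr]
        · exact fun h => absurd hy h
      · have h0 : f y = 0 := by
          by_contra h
          exact hy (hcover y (hs y h))
        rw [h0]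
        refine (Finset.sum_eq_zero fun r hr => Set.indicator_of_notMem (fun h => hy ?_) _).symm
        rw [Set.mem_preimage, SetLike.mem_coe, neg_add_eq_sub] at h
        obtain ⟨z, hz, rfl⟩ := Finset.mem_image.1 hr
        rw [hrep' h, hrr]
        exact hr
    have hmr : ∀ r : F, MeasurableSet ((fun z => -r + z) ⁻¹' (P₀ : Set F)) := fun r =>
      (continuous_const.add continuous_id).measurable hmeas
    have hμr : ∀ r : F, μ ((fun z => -r + z) ⁻¹' (P₀ : Set F)) = μ (P₀ : Set F) := fun r =>
      measure_preimage_add μ _ _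
    conv_lhs => rw [e]
    rw [integral_finsetSum, Finset.mul_sum]
    · refine Finset.sum_congr rfl fun r _ => ?_
      rw [integral_indicator_const _ (hmr r), Measure.real, hμr, Complex.real_smul]
    · intro r _
      exact (integrable_indicator_iff (hmr r)).2 (integrableOn_const (by rw [hμr]; exact hfin))

/-- The integral over a fibre `≅ F` is a nonzero constant times a sum over a finite set `R` that
does not depend on the fibre. If all fibre integrals of `f` vanish, the sum over `r ∈ R` of the
translates of `f` by `1 + r t^(i+1)` is zero. Applying the invariant `θ` gives `|R| θ f = 0`. -/
theorem eq_zero_of_step_eq_zero {i : ℕ} {A : Type*} [AddCommGroup A] [Module ℂ A]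
    (θ : schwartzUnits F (i + 1) →ₗ[ℂ] A)
    (hθ : ∀ (y : F) f, θ (repOn ψ (Nat.zero_le _) (unitElem 0 (unip i y)) f) = θ f)
    {f : schwartzUnits F (i + 1)} (hf : step i f = 0) : θ f = 0 := by
  let _ : MeasurableSpace F := borel F
  have : BorelSpace F := ⟨rfl⟩
  obtain ⟨c, hc, hfc⟩ := exists_forall_shift_eq f ψ
  obtain ⟨K, hK, hKf⟩ := exists_isCompact_support le_rfl f
  obtain ⟨D, hD, hKD⟩ := hK.exists_subset_box
  obtain ⟨ε, hε, hfε⟩ := exists_lt_of_ne_zero f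
  -- In the fibre through `x`, the last coordinate is an affine function of `y` with slope `x_0`. On
  -- the support the coordinates are bounded by `|D|`, and `|x_0| > |ε|`, so the values of `y` in
  -- the support differ by at most `|D / ε|`, uniformly in `x`.
  obtain ⟨d, hcd, hDd⟩ : ∃ d : F, valuation F c ≤ valuation F d ∧
      valuation F (D / ε) ≤ valuation F d := by
    rcases le_total (valuation F c) (valuation F (D / ε)) with h | h
    · exact ⟨_, h, le_rfl⟩
    · exact ⟨_, le_rfl, h⟩
  obtain ⟨R, κ, hR, hκ, hRd, hint⟩ := exists_finset_integral hc hcd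
  have hper : ∀ x y z, valuation F z ≤ valuation F c →
      (f : F⟦X⟧ˣ → ℂ) (x * unip i (y + z)) = (f : F⟦X⟧ˣ → ℂ) (x * unip i y) := fun x y z hz => by
    -- Modulo `t^(i+2)` the units `1 + y t^(i+1)` multiply by adding the parameters, so periodicity
    -- in `y` is invariance of `f` under small units.
    have h1 : jet (i + 1) (x * unip i (y + z)) = jet (i + 1) (unip i z * (x * unip i y)) := by
      rw [mul_comm (unip i z)]
      funext j
      refine Fin.lastCases ?_ (fun j => ?_) j
      · rw [jet_unip_last, jet_unip_last]
        have h2 := jet_unip_last i x y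
        have h3 := jet_unip_castSucc i x y 0
        change PowerSeries.coeff (i + 1) _ = _ at h2
        change jet i _ 0 = jet i x 0 at h3
        rw [h2, h3]
        ring
      · rw [jet_unip_castSucc, jet_unip_castSucc]
        exact (jet_unip_castSucc i x y j).symm
    rw [apply_eq_of_jet_eq f h1]
    refine hfc _ (fun j => ?_) _
    have h2 := jet_unip i 1 z
    rw [one_mul] at h2
    rw [h2]
    refine Fin.lastCases ?_ (fun j => ?_) j
    · rw [Fin.snoc_last]
      have h0 : jet i (1 : F⟦X⟧ˣ) 0 = 1 := by simp [jet]
      have h3 : jet (i + 1) (1 : F⟦X⟧ˣ) (Fin.last _) =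
        PowerSeries.coeff (i + 1) ((1 : F⟦X⟧ˣ) : F⟦X⟧) := rfl
      rw [h0, h3, one_mul, add_sub_cancel_left]
      exact hz
    · rw [Fin.snoc_castSucc]
      have h3 : jet (i + 1) (1 : F⟦X⟧ˣ) j.castSucc = jet i 1 j := rfl
      rw [h3, sub_self, map_zero]
      exact zero_le
  have hsum : ∀ x, ∑ r ∈ R, (f : F⟦X⟧ˣ → ℂ) (x * unip i r) = 0 := fun x => by
    -- If the support in the fibre meets the disc of radius `|d|`, it lies inside this disc and the
    -- sum over `R` computes the integral. Otherwise every summand is zero, because `R` lies in the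
    -- disc.
    by_cases hx : ∃ y, valuation F y ≤ valuation F d ∧ (f : F⟦X⟧ˣ → ℂ) (x * unip i y) ≠ 0
    · obtain ⟨y, hy, hxy⟩ := hx
      have h1 := hint (fun y => (f : F⟦X⟧ˣ → ℂ) (x * unip i y)) (hper x) fun z hz => by
        have h2 : z = (z - y) + y := by ring
        rw [h2]
        refine (Valuation.map_add _ _ _).trans (max_le (le_trans ?_ hDd) hy)
        have hx0 : jet i x 0 ≠ 0 := jet_zero_ne i x
        have h3 : z - y = (jet (i + 1) (x * unip i z) (Fin.last _) -
            jet (i + 1) (x * unip i y) (Fin.last _)) / jet i x 0 := by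
          rw [jet_unip_last, jet_unip_last]
          field_simp
          ring
        have h4 : valuation F (jet (i + 1) (x * unip i z) (Fin.last _) -
            jet (i + 1) (x * unip i y) (Fin.last _)) ≤ valuation F D := by
          have a := hKD (hKf _ hz) (Fin.last _)
          have b := hKD (hKf _ hxy) (Fin.last _)
          simp only [Pi.zero_apply, sub_zero] at a b
          exact (Valuation.map_sub _ _ _).trans (max_le a b)
        have h5 : valuation F ε < valuation F (jet i x 0) := by
          have a := hfε _ hxy
          rwa [show jet (i + 1) (x * unip i y) 0 = jet i x 0 from jet_unip_castSucc i x y 0] at a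
        rw [h3, map_div₀, map_div₀]
        exact div_le_div₀ zero_le h4 (valuation_pos hε) h5.le
      have h2 : ∫ y, (f : F⟦X⟧ˣ → ℂ) (x * unip i y) ∂(Measure.addHaar : Measure F) = 0 :=
        congrFun (congrArg Subtype.val hf) x
      rw [h2] at h1
      exact (mul_eq_zero.1 h1.symm).resolve_left hκ
    · push Not at hx
      exact Finset.sum_eq_zero fun r hr => hx r (hRd r hr)
  have h0 : ∑ r ∈ R, repOn ψ (Nat.zero_le _) (unitElem 0 (unip i r)) f = 0 := by
    refine Subtype.ext (funext fun x => ?_)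
    rw [AddSubmonoidClass.coe_finsetSum, Finset.sum_apply, ZeroMemClass.coe_zero, Pi.zero_apply,
      ← hsum x]
    exact Finset.sum_congr rfl fun r _ => by rw [repOn_unitElem, mul_comm]
  have h1 := congrArg θ h0
  rw [map_sum, map_zero, Finset.sum_congr rfl fun r _ => hθ r f, Finset.sum_const,
    ← Nat.cast_smul_eq_nsmul ℂ] at h1
  exact (smul_eq_zero.1 h1).resolve_left (Nat.cast_ne_zero.2 hR.card_pos.ne')

end MeasureRep

/-! ### The tensor products `L ⊗ M_k` as spaces of functions, and Schur's lemma. -/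

section TensorFunctions
open scoped TensorProduct

variable {X : Type*} {L : Type*} [AddCommGroup L] [Module ℂ L] (S : Submodule ℂ (X → ℂ))

/-- Evaluation at `a` of a function with values in `L`. -/
noncomputable def tensorEval (L : Type*) [AddCommGroup L] [Module ℂ L] (a : X) : L ⊗[ℂ] S →ₗ[ℂ] L :=
  (TensorProduct.rid ℂ L).toLinearMap ∘ₗ
    TensorProduct.map LinearMap.id ((LinearMap.proj a).comp S.subtype)

theorem tensorEval_tmul (a : X) (l : L) (f : S) :
    tensorEval S L a (l ⊗ₜ f) = (f : X → ℂ) a • l := by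
  simp [tensorEval]

/-- Coordinates in a basis of `L` commute with evaluation, which reduces the claim to elements of
`S`; these are functions. -/
theorem tensorEval_injective {x y : L ⊗[ℂ] S} (h : ∀ a, tensorEval S L a x = tensorEval S L a y) :
    x = y := by
  classical
  let B := Module.Basis.ofVectorSpace ℂ L
  have key : ∀ (x : L ⊗[ℂ] S) i a, ((TensorProduct.equivFinsuppOfBasisLeft B x i : S) : X → ℂ) a =
      B.repr (tensorEval S L a x) i := fun x i a => by
    induction x using TensorProduct.induction_on with
    | zero => simp
    | tmul l f =>
      rw [TensorProduct.equivFinsuppOfBasisLeft_apply_tmul_apply, tensorEval_tmul]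
      simp [mul_comm]
    | add x y hx hy => simp [hx, hy]
  refine (TensorProduct.equivFinsuppOfBasisLeft B).injective (Finsupp.ext fun i =>
    Subtype.ext (funext fun a => ?_))
  rw [key, key, h]

end TensorFunctions

namespace MeasureRep

open Topology ValuativeRel MeasureTheory
open scoped TensorProduct

variable {F : Type u} [Field F] [ValuativeRel F] [TopologicalSpace F] [IsNonarchimedeanLocalField F]
  (ψ : ResidualChar F)

theorem isLocallyConstant_valuation_le :
    IsLocallyConstant fun z : F => (valuation F z ≤ 1) := by
  rw [IsLocallyConstant.iff_eventually_eq]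
  intro z
  have h2 : Filter.Tendsto (fun y : F => y - z) (𝓝 z) (𝓝 0) := by
    have : Continuous fun y : F => y - z := by fun_prop
    simpa using this.tendsto z
  filter_upwards [h2 (nhds_zero_basis_le.mem_of_mem one_ne_zero)] with y hy
  have hy : valuation F (y - z) ≤ 1 := by simpa using hy
  refine propext ⟨fun h => ?_, fun h => ?_⟩
  · rw [show z = y - (y - z) by ring]
    exact (Valuation.map_sub _ _ _).trans (max_le h hy)
  · rw [show y = (y - z) + z by ring]
    exact (Valuation.map_add _ _ _).trans (max_le hy h)

-- This lifts a density to one concentrated on a unit disc in every fibre. The ratio of the last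
-- coordinate to `y_0` is the natural fibre coordinate: multiplying by `1 + s t^(n+1)` adds `s` to
-- it.
open Classical in
theorem extend_mem_schwartzJets {n : ℕ} {g : (Fin (n + 1) → F) → ℂ} (hg : g ∈ schwartzJets F n) :
    (fun y : Fin (n + 1 + 1) → F => if valuation F (y (Fin.last _) / y 0) ≤ 1 then
      g (fun i => y (Fin.castSucc i)) else 0) ∈ schwartzJets F (n + 1) := by
  have := t2Space_localField F
  have hinit : Continuous fun (y : Fin (n + 1 + 1) → F) (i : Fin (n + 1)) => y (Fin.castSucc i) := by
    fun_prop
  refine ⟨?_, ?_, fun y hy => ?_⟩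
  · rw [IsLocallyConstant.iff_eventually_eq]
    intro y
    have h1 := (IsLocallyConstant.iff_eventually_eq _).1 (hg.1.comp_continuous hinit) y
    by_cases h0 : y 0 = 0
    · filter_upwards [h1] with z hz
      have h2 : g (fun i => y (Fin.castSucc i)) = 0 := hg.2.2 _ h0
      have h3 : g (fun i => z (Fin.castSucc i)) = 0 := hz.trans h2
      simp [h2, h3]
    · have h2 : ContinuousAt (fun y : Fin (n + 1 + 1) → F => y (Fin.last _) / y 0) y :=
        ContinuousAt.div (continuous_apply _).continuousAt (continuous_apply _).continuousAt h0
      have h3 := h2.eventually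
        ((IsLocallyConstant.iff_eventually_eq _).1 isLocallyConstant_valuation_le _)
      filter_upwards [h1, h3] with z hz hz'
      have hz : g (fun i => z (Fin.castSucc i)) = g (fun i => y (Fin.castSucc i)) := hz
      simp only [hz, hz']
  · have hc : Continuous fun p : (Fin (n + 1) → F) × F =>
        Fin.snoc (α := fun _ => F) p.1 (p.1 0 * p.2) :=
      continuous_snoc.comp
        (by fun_prop : Continuous fun p : (Fin (n + 1) → F) × F => (p.1, p.1 0 * p.2))
    refine HasCompactSupport.intro ((IsCompact.prod hg.2.1
      (IsNonarchimedeanLocalField.isCompact_closedBall F 1)).image hc) fun y hy => ?_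
    by_contra hne
    obtain ⟨h1, h2⟩ := ite_ne_right_iff.1 hne
    have h0 : y 0 ≠ 0 := fun h0 => h2 (hg.2.2 _ h0)
    refine hy ⟨(fun i => y (Fin.castSucc i), y (Fin.last _) / y 0),
      ⟨subset_tsupport g h2, h1⟩, ?_⟩
    funext i
    refine Fin.lastCases ?_ (fun j => ?_) i
    · simp only [Fin.snoc_last, Fin.castSucc_zero]
      field_simp
    · simp only [Fin.snoc_castSucc]
  · have : g (fun i => y (Fin.castSucc i)) = 0 := hg.2.2 _ hy
    simp [this]

/-- The lift from `extend_mem_schwartzJets` pushes forward to the original density times the volume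
of the unit disc, which is finite and nonzero. -/
theorem step_surjective (n : ℕ) : Function.Surjective (step (F := F) n) := by
  classical
  intro f
  let _ : MeasurableSpace F := borel F
  have : BorelSpace F := ⟨rfl⟩
  obtain ⟨g, hg, hfg⟩ := mem_schwartzUnits.1 f.2
  set μ : Measure F := Measure.addHaar
  have := t2Space_localField F
  have hcomp := IsNonarchimedeanLocalField.isCompact_closedBall F 1
  have hopen : IsOpen {x : F | valuation F x ≤ 1} := isLocallyConstant_valuation_le {True} |> fun h => by
    convert h using 1
    ext x
    simp
  have hμ : (μ.real {x : F | valuation F x ≤ 1} : ℂ) ≠ 0 := by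
    have h1 : μ {x : F | valuation F x ≤ 1} ≠ 0 := hopen.measure_ne_zero μ ⟨0, by simp⟩
    exact_mod_cast ENNReal.toReal_ne_zero.2 ⟨h1, hcomp.measure_lt_top.ne⟩
  let f' : schwartzUnits F (n + 1) := ⟨_, mem_schwartzUnits.2
    ⟨_, extend_mem_schwartzJets hg, fun x => rfl⟩⟩
  have hstep : step n f' = (μ.real {x : F | valuation F x ≤ 1} : ℂ) • f := by
    refine Subtype.ext (funext fun x => ?_)
    change ∫ y : F, (if valuation F (jet (n + 1) (x * unip n y) (Fin.last _) /
      jet (n + 1) (x * unip n y) 0) ≤ 1 then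
      g (fun i => jet (n + 1) (x * unip n y) (Fin.castSucc i)) else 0) ∂μ = _ * (f : F⟦X⟧ˣ → ℂ) x
    have h0 := jet_zero_ne n x
    have h1 : ∀ y, (jet (n + 1) (x * unip n y) (Fin.last _) / jet (n + 1) (x * unip n y) 0) =
        PowerSeries.coeff (n + 1) (x : F⟦X⟧) / jet n x 0 + y := fun y => by
      rw [jet_unip_last, show jet (n + 1) (x * unip n y) 0 = jet n x 0 from
        jet_unip_castSucc n x y 0]
      field_simp
    have h2 : ∀ y, (fun i => jet (n + 1) (x * unip n y) (Fin.castSucc i)) = jet n x := fun y =>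
      funext fun i => jet_unip_castSucc n x y i
    simp only [h1, h2]
    rw [integral_add_left_eq_self (fun y : F => if valuation F y ≤ 1 then g (jet n x) else 0)]
    have h3 : (fun y : F => if valuation F y ≤ 1 then g (jet n x) else 0) =
        Set.indicator {x : F | valuation F x ≤ 1} fun _ => g (jet n x) := by
      funext y
      simp [Set.indicator]
    rw [h3, integral_indicator_const _ hopen.measurableSet, Complex.real_smul, ← hfg]
  refine ⟨(μ.real {x : F | valuation F x ≤ 1} : ℂ)⁻¹ • f', ?_⟩
  rw [map_smul, hstep, smul_smul, inv_mul_cancel₀ hμ, one_smul]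

theorem proj_surjective {i j : ℕ} (h : i ≤ j) : Function.Surjective (proj (F := F) h) := by
  induction j, h using Nat.le_induction with
  | base => rw [proj_self]; exact fun x => ⟨x, rfl⟩
  | succ j hj ih =>
    rw [proj_succ hj]
    exact ih.comp (step_surjective j)

theorem step_unitElem (k : ℕ) (u : F⟦X⟧ˣ) (f : schwartzUnits F (k + 1)) :
    step k (repOn ψ (Nat.zero_le _) (unitElem 0 u) f) =
      repOn ψ (Nat.zero_le _) (unitElem 0 u) (step k f) :=
  actOn_step ψ (Nat.zero_le _) (unitElem 0 u) f

/-- Push-forward is peeled off one coefficient at a time. The functional `θ` kills the kernel of the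
top step, so it factors through it; the induced functional, obtained from any linear section `g`,
inherits the invariance because the step commutes with units. -/
theorem eq_zero_of_proj_eq_zero {i k : ℕ} (h : k ≤ i) {A : Type*} [AddCommGroup A] [Module ℂ A]
    (θ : schwartzUnits F i →ₗ[ℂ] A)
    (hθ : ∀ (u : F⟦X⟧ˣ) f, jet k u = jet k 1 →
      θ (repOn ψ (Nat.zero_le _) (unitElem 0 u) f) = θ f)
    {f : schwartzUnits F i} (hf : proj h f = 0) : θ f = 0 := by
  induction i, h using Nat.le_induction with
  | base =>
    rw [proj_self] at hf
    rw [show f = 0 from hf, map_zero]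
  | succ i hi ih =>
    have hker : ∀ f, step i f = 0 → θ f = 0 := fun f hf =>
      eq_zero_of_step_eq_zero ψ θ (fun y f => hθ _ f (jet_unip_one hi y)) hf
    obtain ⟨g, hg⟩ := (step (F := F) i).exists_rightInverse_of_surjective
      (LinearMap.range_eq_top.2 (step_surjective i))
    have hg' : ∀ f, step i (g f) = f := fun f => congrArg (fun l => l f) hg
    have hfac : ∀ f, θ (g (step i f)) = θ f := fun f => by
      rw [← sub_eq_zero, ← map_sub]
      exact hker _ (by rw [map_sub, hg', sub_self])
    rw [← hfac f]
    rw [proj_succ hi] at hf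
    refine ih (θ.comp g) (fun u f' hu => ?_) hf
    obtain ⟨f', rfl⟩ := step_surjective i f'
    rw [LinearMap.comp_apply, LinearMap.comp_apply, hfac, ← step_unitElem, hfac, hθ u f' hu]

theorem proj_repOn {i k n : ℕ} (h : k ≤ i) (hn : n ≤ k + 1) (hn' : n ≤ i + 1)
    (a : HInf.level F n) (f : schwartzUnits F i) :
    proj h (repOn ψ hn' a f) = repOn ψ hn a (proj h f) := actOn_proj ψ h hn hn' a f

theorem proj_polarRep {i k : ℕ} (h : k ≤ i) (t : MonoidAlgebra ℂ (polarSubgroup F (k + 1)))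
    (f : schwartzUnits F i) : proj h ((polarRep ψ h).asAlgebraHom t f) =
      (polarRep ψ le_rfl).asAlgebraHom t (proj h f) := by
  induction t using MonoidAlgebra.induction_on with
  | of b =>
    rw [MonoidAlgebra.of_apply, Representation.asAlgebraHom_single,
      Representation.asAlgebraHom_single, one_smul, one_smul]
    exact proj_repOn ψ h le_rfl (Nat.succ_le_succ h) b.1 f
  | add s t hs ht => simp only [map_add, LinearMap.add_apply, hs, ht]
  | smul r t ht => simp only [map_smul, LinearMap.smul_apply, ht]

/-- A map on `M_i` on which `O^*(k+1) ⋉ B_(k+1)` acts by `ψ` factors through the value at `1` of the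
push-forward to `M_k`. -/
theorem eq_zero_of_proj_apply_one {i k : ℕ} (h : k ≤ i) {A : Type*} [AddCommGroup A] [Module ℂ A]
    (θ : schwartzUnits F i →ₗ[ℂ] A)
    (hθ : ∀ (u : F⟦X⟧ˣ) f, jet k u = jet k 1 →
      θ (repOn ψ (Nat.zero_le _) (unitElem 0 u) f) = θ f)
    (hθ' : ∀ (b : polarSubgroup F (k + 1)) f,
      θ (polarRep ψ h b f) = polarChar ψ (jet k 1) b • θ f)
    {f : schwartzUnits F i} (hf : (proj h f : F⟦X⟧ˣ → ℂ) 1 = 0) : θ f = 0 := by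
  obtain ⟨c, hc, hfc⟩ := exists_forall_box_eq (proj h f) 1
  obtain ⟨K, hK, hKf⟩ := exists_isCompact_support le_rfl (proj h f)
  -- On the polydisc about the jet of `1` the push-forward of `f` is constant with value `0`, and on
  -- the rest of its support `t` vanishes; so `t` kills it. On the other hand `θ (t f) = θ f`, since
  -- `t` has value `1` at the jet of `1`.
  obtain ⟨t, ht, ht'⟩ := exists_polarEval_eq_indicator ψ hK hc (jet k 1)
  have h1 : ∀ t : MonoidAlgebra ℂ (polarSubgroup F (k + 1)),
      θ ((polarRep ψ h).asAlgebraHom t f) = polarEval ψ (jet k 1) t • θ f := fun t => by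
    induction t using MonoidAlgebra.induction_on with
    | of b =>
      rw [MonoidAlgebra.of_apply, Representation.asAlgebraHom_single, polarEval_single, one_smul,
        one_mul, hθ']
    | add s t hs ht => simp only [map_add, LinearMap.add_apply, hs, ht, add_smul]
    | smul r t ht => simp only [map_smul, LinearMap.smul_apply, ht, smul_assoc]
  have h2 := h1 t
  rw [ht _ (mem_box_self _ _), one_smul] at h2
  rw [← h2]
  refine eq_zero_of_proj_eq_zero ψ h θ hθ ?_
  rw [proj_polarRep]
  refine Subtype.ext (funext fun x => ?_)
  rw [polarRep_asAlgebraHom]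
  by_cases hx : jet k x ∈ box c (jet k 1)
  · rw [hfc x hx, hf, mul_zero]; rfl
  · by_cases hx' : (proj h f : F⟦X⟧ˣ → ℂ) x = 0
    · rw [hx', mul_zero]; rfl
    · rw [ht' _ (hKf x hx') hx, zero_mul]; rfl

theorem exists_apply_one_eq_one (k : ℕ) : ∃ f : schwartzUnits F k, (f : F⟦X⟧ˣ → ℂ) 1 = 1 := by
  classical
  -- A radius smaller than `1` keeps the polydisc about the jet of `1` away from `y_0 = 0`.
  obtain ⟨c, hc, hc1⟩ := exists_valuation_lt (F := F) one_ne_zero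
  have := t2Space_localField F
  have hopen : IsOpen (box c (jet k (1 : F⟦X⟧ˣ))) := isOpen_iff_mem_nhds.2 fun y hy => by
    rw [← box_eq_of_mem hy]
    exact box_mem_nhds hc y
  have hcomp := isCompact_box c (jet k (1 : F⟦X⟧ˣ))
  refine ⟨⟨_, mem_schwartzUnits.2 ⟨Set.indicator (box c (jet k (1 : F⟦X⟧ˣ))) 1, ⟨?_, ?_, ?_⟩,
    fun x => rfl⟩⟩, Set.indicator_of_mem (mem_box_self _ _) _⟩
  · rw [IsLocallyConstant.iff_eventually_eq]
    intro y
    by_cases hy : y ∈ box c (jet k (1 : F⟦X⟧ˣ))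
    · filter_upwards [hopen.mem_nhds hy] with z hz
      rw [Set.indicator_of_mem hz, Set.indicator_of_mem hy]
      rfl
    · filter_upwards [hcomp.isClosed.isOpen_compl.mem_nhds hy] with z hz
      rw [Set.indicator_of_notMem hz, Set.indicator_of_notMem hy]
  · exact HasCompactSupport.intro hcomp fun x hx => Set.indicator_of_notMem hx _
  · intro y hy
    refine Set.indicator_of_notMem (fun h => ?_) _
    have h0 := h 0
    have h1 : jet k (1 : F⟦X⟧ˣ) 0 = 1 := by simp [jet]
    rw [hy, h1, zero_sub, Valuation.map_neg] at h0
    exact not_lt_of_ge h0 hc1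

theorem exists_proj_apply_one_eq_one {i k : ℕ} (h : k ≤ i) :
    ∃ f : schwartzUnits F i, (proj h f : F⟦X⟧ˣ → ℂ) 1 = 1 := by
  obtain ⟨f, hf⟩ := exists_apply_one_eq_one (F := F) k
  obtain ⟨f, rfl⟩ := proj_surjective h f
  exact ⟨f, hf⟩

/-- Uniqueness of the Whittaker functional: semi-invariant maps on `M_i` are determined by their
value on one vector `f₀`. -/
theorem apply_eq_smul_of_semiInvariant {i k : ℕ} (h : k ≤ i) {A : Type*} [AddCommGroup A]
    [Module ℂ A] (θ : schwartzUnits F i →ₗ[ℂ] A)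
    (hθ : ∀ (u : F⟦X⟧ˣ) f, jet k u = jet k 1 →
      θ (repOn ψ (Nat.zero_le _) (unitElem 0 u) f) = θ f)
    (hθ' : ∀ (b : polarSubgroup F (k + 1)) f,
      θ (polarRep ψ h b f) = polarChar ψ (jet k 1) b • θ f)
    {f₀ : schwartzUnits F i} (hf₀ : (proj h f₀ : F⟦X⟧ˣ → ℂ) 1 = 1) (f : schwartzUnits F i) :
    θ f = (proj h f : F⟦X⟧ˣ → ℂ) 1 • θ f₀ := by
  rw [← sub_eq_zero, ← map_smul, ← map_sub]
  refine eq_zero_of_proj_apply_one ψ h θ hθ hθ' ?_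
  rw [map_sub, map_smul, Submodule.coe_sub, Submodule.coe_smul, Pi.sub_apply, Pi.smul_apply, hf₀,
    smul_eq_mul, mul_one, sub_self]

theorem tensorEval_repOn_unitElem {k n : ℕ} (hn : n ≤ k + 1) (a x : F⟦X⟧ˣ) {L : Type*}
    [AddCommGroup L] [Module ℂ L] (z : L ⊗[ℂ] schwartzUnits F k) :
    tensorEval (schwartzUnits F k) L x (TensorProduct.map LinearMap.id
      (repOn ψ hn (unitElem n a)) z) = tensorEval (schwartzUnits F k) L (a * x) z := by
  induction z using TensorProduct.induction_on with
  | zero => simp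
  | tmul l f =>
    rw [TensorProduct.map_tmul, tensorEval_tmul, tensorEval_tmul, repOn_unitElem,
      LinearMap.id_apply]
  | add x y hx hy => simp only [map_add, hx, hy]

theorem tensorEval_polarRep {k m : ℕ} (hm : m ≤ k) (b : polarSubgroup F (m + 1)) (x : F⟦X⟧ˣ)
    {L : Type*} [AddCommGroup L] [Module ℂ L] (z : L ⊗[ℂ] schwartzUnits F k) :
    tensorEval (schwartzUnits F k) L x (TensorProduct.map LinearMap.id (polarRep ψ hm b) z) =
      polarChar ψ (jet m x) b • tensorEval (schwartzUnits F k) L x z := by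
  induction z using TensorProduct.induction_on with
  | zero => simp
  | tmul l f =>
    rw [TensorProduct.map_tmul, tensorEval_tmul, tensorEval_tmul, polarRep_apply, mul_smul,
      LinearMap.id_apply]
  | add x y hx hy => simp only [map_add, hx, hy, smul_add]

theorem repOn_unitElem_eq {k n n' : ℕ} (hn : n ≤ k + 1) (hn' : n' ≤ k + 1) (u : F⟦X⟧ˣ) :
    repOn ψ hn (unitElem n u) = repOn ψ hn' (unitElem n' u) :=
  LinearMap.ext fun f => Subtype.ext (funext fun x => by rw [repOn_unitElem, repOn_unitElem])

/-- Schur's lemma: the equivariant maps `T ⊗ M_i → L ⊗ M_k` are induced by maps `T → L`. -/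
theorem exists_eq_map_proj {i k : ℕ} (h : k ≤ i) {T L : Type*} [AddCommGroup T] [Module ℂ T]
    [AddCommGroup L] [Module ℂ L]
    (f : T ⊗[ℂ] schwartzUnits F i →ₗ[ℂ] L ⊗[ℂ] schwartzUnits F k)
    (hf : ∀ (a : HInf.level F (k + 1)) x,
      f (TensorProduct.map LinearMap.id (repOn ψ (Nat.succ_le_succ h) a) x) =
        TensorProduct.map LinearMap.id (repOn ψ le_rfl a) (f x)) :
    ∃ g : T →ₗ[ℂ] L, f = TensorProduct.map g (proj h) := by
  obtain ⟨f₀, hf₀⟩ := exists_proj_apply_one_eq_one (F := F) h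
  -- As in Frobenius reciprocity, evaluating `f (t ⊗ φ)` at `1` turns equivariance into
  -- semi-invariance in `φ`, so uniqueness of the Whittaker functional applies for each `t`.
  let θ : T → schwartzUnits F i →ₗ[ℂ] L := fun t =>
    (tensorEval (schwartzUnits F k) L 1).comp (f.comp (TensorProduct.mk ℂ T _ t))
  have hθ : ∀ t φ, θ t φ = (proj h φ : F⟦X⟧ˣ → ℂ) 1 • θ t f₀ := fun t =>
    apply_eq_smul_of_semiInvariant ψ h (θ t) (fun u φ hu => by
      have h1 := hf (unitElem (k + 1) u) (t ⊗ₜ φ)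
      rw [TensorProduct.map_tmul, repOn_unitElem_eq ψ (Nat.succ_le_succ h) (Nat.zero_le _)] at h1
      change tensorEval _ _ _ (f (t ⊗ₜ _)) = tensorEval _ _ _ (f (t ⊗ₜ _))
      refine (congrArg _ h1).trans ?_
      rw [tensorEval_repOn_unitElem, mul_one]
      generalize f (t ⊗ₜ[ℂ] φ) = z
      induction z using TensorProduct.induction_on with
      | zero => simp
      | tmul l f => rw [tensorEval_tmul, tensorEval_tmul, apply_eq_of_jet_eq f hu]
      | add x y hx hy => simp only [map_add, hx, hy]) (fun b φ => by
      have h1 := hf b.1 (t ⊗ₜ φ)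
      rw [TensorProduct.map_tmul] at h1
      change tensorEval _ _ _ (f (t ⊗ₜ _)) = _ • tensorEval _ _ _ (f (t ⊗ₜ _))
      refine (congrArg _ h1).trans ?_
      exact tensorEval_polarRep ψ le_rfl b 1 _) hf₀
  let g : T →ₗ[ℂ] L :=
    (tensorEval (schwartzUnits F k) L 1).comp (f.comp ((TensorProduct.mk ℂ T _).flip f₀))
  refine ⟨g, TensorProduct.ext' fun t φ => tensorEval_injective _ fun a => ?_⟩
  -- The value at any `a` is the value at `1` after translation by the unit `a`.
  have h1 := hf (unitElem (k + 1) a) (t ⊗ₜ φ)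
  have h2 := tensorEval_repOn_unitElem ψ (k := k) le_rfl a 1 (f (t ⊗ₜ φ))
  rw [← h1, mul_one] at h2
  rw [← h2, TensorProduct.map_tmul, TensorProduct.map_tmul, tensorEval_tmul]
  refine (hθ t _).trans ?_
  rw [proj_repOn ψ h le_rfl, repOn_unitElem, mul_one]
  rfl

theorem map_proj_injective {i k : ℕ} (h : k ≤ i) {T L : Type*} [AddCommGroup T] [Module ℂ T]
    [AddCommGroup L] [Module ℂ L] {g g' : T →ₗ[ℂ] L}
    (e : TensorProduct.map g (proj (F := F) h) = TensorProduct.map g' (proj h)) : g = g' := by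
  obtain ⟨f₀, hf₀⟩ := exists_proj_apply_one_eq_one (F := F) h
  refine LinearMap.ext fun t => ?_
  have h1 := congrArg (fun l => tensorEval _ L 1 (l (t ⊗ₜ f₀))) e
  simpa only [TensorProduct.map_tmul, tensorEval_tmul, hf₀, one_smul] using h1

end MeasureRep

/-! ### Cuspidality through morphisms, and representations that act on their stages. -/

section Cuspidal
open Filter ProVect SmoothRep
variable {F : Type u} [Field F] [TopologicalSpace F]

theorem SmoothRep.isCuspidal_iff (V : SmoothRep F) : V.IsCuspidal ↔
    ∀ (Q : ProVect.{u}) (β : V.space ⟶ Q), V.IsSemiInvariant (subgroupB1 F) (fun _ => 1) β →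
      β = ProVect.zeroHom V.space Q := by
  constructor
  · rintro ⟨Q, q, hq, hQ⟩ W β hβ
    obtain ⟨γ, rfl, -⟩ := hq.existsUnique_desc W β hβ
    rw [hQ.eq_of_src γ (ProVect.zeroHom Q W), comp_zeroHom]
  · intro h
    let Q : ProVect.{u} := constant PUnit.{u+1} (by simp)
    have hQ : Limits.IsZero Q := ProVect.isZero_iff.2 fun j => Eventually.of_forall fun i x =>
      Subsingleton.elim (α := PUnit) _ _
    refine ⟨Q, ProVect.zeroHom _ _, ⟨?_, fun W β hβ => ⟨ProVect.zeroHom _ _, ?_, fun γ _ =>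
      hQ.eq_of_src _ _⟩⟩, hQ⟩
    · rw [isSemiInvariant_iff]
      exact fun j => ⟨_, le_rfl, Eventually.of_forall fun i h x =>
        Subsingleton.elim (α := PUnit) _ _⟩
    · exact (comp_zeroHom _).trans (h W β hβ).symm

/-- The endomorphisms `A i a`, `a ∈ O^* ⋉ B_(i+1)`, of the spaces `V_i` are compatible with the
transition maps and define the action on `V`. -/
structure SmoothRep.IsStrict (V : SmoothRep F)
    (A : ∀ i, HInf.level F (i + 1) → V.space.obj i →ₗ[ℂ] V.space.obj i) : Prop where
  tr_apply : ∀ {j i : ℕ} (_ : j ≤ i) (a : HInf F) (hj : a ∈ HInf.level F (j + 1))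
    (hi : a ∈ HInf.level F (i + 1)) (x : V.space.obj i),
      V.space.tr j i (A i ⟨a, hi⟩ x) = A j ⟨a, hj⟩ (V.space.tr j i x)
  act_eq : ∀ n j, ∀ᶠ i in atTop, ∀ (a : HInf F) (_ : a ∈ HInf.level F n)
    (hi : a ∈ HInf.level F (i + 1)) (x : V.space.obj i),
      V.act n j i a x = V.space.tr j i (A i ⟨a, hi⟩ x)

/-- For strict representations, the component `V_i → W_k` of a morphism is, for `i` large, an honest
intertwiner for `O^* ⋉ B_(k+1)`. This brings Hom spaces down to the linear algebra of single stages,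
where Schur's lemma applies. -/
theorem SmoothRep.IsStrict.happ_apply {V W : SmoothRep F}
    {A : ∀ i, HInf.level F (i + 1) → V.space.obj i →ₗ[ℂ] V.space.obj i}
    {B : ∀ i, HInf.level F (i + 1) → W.space.obj i →ₗ[ℂ] W.space.obj i}
    (hA : V.IsStrict A) (hB : W.IsStrict B) (f : V ⟶ W) (k : ℕ) : ∀ᶠ i in atTop,
      ∀ (a : HInf F) (hk : a ∈ HInf.level F (k + 1)) (hi : a ∈ HInf.level F (i + 1))
        (x : V.space.obj i), happ f.hom k i (A i ⟨a, hi⟩ x) = B k ⟨a, hk⟩ (happ f.hom k i x) := by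
  obtain ⟨i'', e₂, hk₂, hr⟩ := ((hB.act_eq (k + 1) k).and
    ((eventually_ge_atTop k).and (eventually_ge_atTop (W.ridx (k + 1) k)))).exists
  have hi' := le_max_left (hidx f.hom k) k
  set i' := max (hidx f.hom k) k
  filter_upwards [comm_happ f (k + 1) k hi' hr, hA.act_eq (k + 1) i',
    tr_happ f.hom hk₂, eventually_ge_atTop i'] with i e e₁ e₃ hi a hak hai x
  have h₂ := HInf.level_mono (Nat.succ_le_succ hk₂) hak
  rw [← happ_tr f.hom hi' hi, ← e₁ a hak hai, e a hak, e₂ a hak h₂, hB.tr_apply hk₂ a hak h₂, e₃]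

theorem SmoothRep.IsStrict.happ_of_semiInvariant {V : SmoothRep F}
    {A : ∀ i, HInf.level F (i + 1) → V.space.obj i →ₗ[ℂ] V.space.obj i} (hA : V.IsStrict A)
    {Q : ProVect.{u}} {n : ℕ} {T : Subgroup (HInf.level F n)} {κ : T → ℂ} {β : V.space ⟶ Q}
    (hβ : V.IsSemiInvariant T κ β) (j : ℕ) : ∀ᶠ i in atTop,
      ∀ (a : T) (ha : ((a : HInf.level F n) : HInf F) ∈ HInf.level F (i + 1)) x,
        happ β j i (A i ⟨_, ha⟩ x) = κ a • happ β j i x := by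
  obtain ⟨N, hN⟩ := hβ.eventually j
  have hk := le_max_left N (hidx β j)
  have hk' := le_max_right N (hidx β j)
  set k := max N (hidx β j)
  filter_upwards [hN k hk, hA.act_eq n k, eventually_ge_atTop k] with i e e' hi a ha x
  rw [← e, e' _ a.1.2 ha, happ_tr β hk' hi]

end Cuspidal

section
variable {F : Type u} [Field F] [ValuativeRel F] [TopologicalSpace F] [IsNonarchimedeanLocalField F]
  (ψ : ResidualChar F)

theorem map_asAlgebraHom_of_semiInvariant {n : ℕ} {E A : Type*} [AddCommGroup E] [Module ℂ E]
    [AddCommGroup A] [Module ℂ A] (π : Representation ℂ (polarSubgroup F n) E) (θ : E →ₗ[ℂ] A)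
    (y : Fin n → F) (h : ∀ b v, θ (π b v) = polarChar ψ y b • θ v)
    (t : MonoidAlgebra ℂ (polarSubgroup F n)) (v : E) :
    θ (π.asAlgebraHom t v) = polarEval ψ y t • θ v := by
  induction t using MonoidAlgebra.induction_on with
  | of b =>
    rw [MonoidAlgebra.of_apply, Representation.asAlgebraHom_single, polarEval_single, one_smul,
      one_mul, h]
  | add s t hs ht => simp only [map_add, LinearMap.add_apply, hs, ht, add_smul]
  | smul r t ht => simp only [map_smul, LinearMap.smul_apply, ht, smul_assoc]
end


/-! ### The functor `L ↦ L ⊗ 𝕄` and its Whittaker coinvariants. -/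

namespace MeasureRep
open Filter ProVect SmoothRep ValuativeRel
open scoped TensorProduct
variable {F : Type u} [Field F] [ValuativeRel F] [TopologicalSpace F] [IsNonarchimedeanLocalField F]
  (ψ : ResidualChar F)

theorem space_tr {j i : ℕ} (h : j ≤ i) : (space F).tr j i = proj h := tr_eq _ h

theorem repOn_mk {k n n' : ℕ} (hn : n ≤ k + 1) (hn' : n' ≤ k + 1) (a : HInf F)
    (h : a ∈ HInf.level F n) (h' : a ∈ HInf.level F n') :
    repOn ψ hn ⟨a, h⟩ = repOn ψ hn' ⟨a, h'⟩ :=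
  LinearMap.ext fun f => Subtype.ext (by rw [repOn_coe, repOn_coe])

theorem preFam_app (n j i : ℕ) (hi : max j n ≤ i) (hn : n ≤ i + 1) (a : HInf.level F n)
    (f : schwartzUnits F i) : (preFam ψ n).app j a (proj hi f) =
      proj ((le_max_left j n).trans hi) (repOn ψ hn a f) := by
  refine (congrArg (proj (le_max_left j n)) (proj_repOn ψ hi ((le_max_right j n).trans
    (Nat.le_succ _)) hn a f)).symm.trans ?_
  rw [proj_proj]

theorem rep_act (n j : ℕ) : ∀ᶠ i in atTop, ∀ (hj : j ≤ i) (a : HInf F) (_ : a ∈ HInf.level F n)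
    (hi : a ∈ HInf.level F (i + 1)) (f : schwartzUnits F i),
      (rep ψ).act n j i a f = proj hj (repOn ψ le_rfl ⟨a, hi⟩ f) := by
  filter_upwards [Fam.mk_app (preFam ψ n) j, eventually_ge_atTop (max j n)] with i e hi hj a ha hi' f
  refine (LinearMap.congr_fun (act_eq (rep ψ) j i ha) f).trans ((e ⟨a, ha⟩ f).trans ?_)
  refine Eq.trans ?_ (preFam_app ψ n j i hi (((le_max_right j n).trans hi).trans (Nat.le_succ i))
    ⟨a, ha⟩ f)
  exact congrArg _ (LinearMap.congr_fun (space_tr hi) f)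

/-- The action of `O^* ⋉ B_(i+1)` on `L_i ⊗ M_i`. -/
noncomputable def tensorRep (L : ProVect.{u}) (i : ℕ) (a : HInf.level F (i + 1)) :
    (tensor L (rep ψ)).space.obj i →ₗ[ℂ] (tensor L (rep ψ)).space.obj i :=
  TensorProduct.map LinearMap.id (repOn ψ le_rfl a)

theorem tensorRep_eq (L : ProVect.{u}) {i n : ℕ} (hn : n ≤ i + 1) (a : HInf F)
    (h : a ∈ HInf.level F n) (hi : a ∈ HInf.level F (i + 1)) :
    tensorRep ψ L i ⟨a, hi⟩ = TensorProduct.map LinearMap.id (repOn ψ hn ⟨a, h⟩) := by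
  rw [repOn_mk ψ hn le_rfl a h hi]
  rfl

/-- The map `g ⊗ proj`. -/
noncomputable def tensorProj {T L : ProVect.{u}} {j i : ℕ} (h : j ≤ i) (g : T.obj i →ₗ[ℂ] L.obj j) :
    (tensor T (rep ψ)).space.obj i →ₗ[ℂ] (tensor L (rep ψ)).space.obj j :=
  TensorProduct.map g (proj (F := F) h)

variable {ψ}

theorem tensor_space_tr (L : ProVect.{u}) {j i : ℕ} (h : j ≤ i) :
    (tensor L (rep ψ)).space.tr j i = tensorProj ψ h (L.tr j i) := by
  refine (tensor_tr L (space F) h).trans ?_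
  rw [space_tr h]
  rfl

theorem tensorProj_tensorProj {U T L : ProVect.{u}} {k j i : ℕ} (h : k ≤ j) (h' : j ≤ i)
    (g : T.obj j →ₗ[ℂ] L.obj k) (g' : U.obj i →ₗ[ℂ] T.obj j) (x) :
    tensorProj ψ h g (tensorProj ψ h' g' x) = tensorProj ψ (h.trans h') (g.comp g') x :=
  tensor_map_map (B₁ := schwartzUnits F j) (fun _ => rfl) (fun f => proj_proj h h' f) x

theorem tensorProj_injective {T L : ProVect.{u}} {j i : ℕ} (h : j ≤ i)
    {g g' : T.obj i →ₗ[ℂ] L.obj j} (e : tensorProj ψ h g = tensorProj ψ h g') : g = g' :=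
  map_proj_injective h e

theorem tensorProj_tensorRep {T L : ProVect.{u}} {j i : ℕ} (h : j ≤ i)
    (g : T.obj i →ₗ[ℂ] L.obj j) (a : HInf F) (hj : a ∈ HInf.level F (j + 1))
    (hi : a ∈ HInf.level F (i + 1)) (x) : tensorProj ψ h g (tensorRep ψ T i ⟨a, hi⟩ x) =
      tensorRep ψ L j ⟨a, hj⟩ (tensorProj ψ h g x) :=
  (tensor_map_map (B₁ := schwartzUnits F i) (h := g)
    (k := (proj h).comp (repOn ψ le_rfl ⟨a, hi⟩)) (fun _ => rfl) (fun _ => rfl) x).trans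
  (tensor_map_map (B₁ := schwartzUnits F j) (h := g)
    (k := (proj h).comp (repOn ψ le_rfl ⟨a, hi⟩)) (fun _ => rfl)
    (fun f => (proj_repOn ψ h le_rfl (Nat.succ_le_succ h) ⟨a, hj⟩ f).symm) x).symm

theorem exists_eq_tensorProj {T L : ProVect.{u}} {j i : ℕ} (h : j ≤ i)
    (f : (tensor T (rep ψ)).space.obj i →ₗ[ℂ] (tensor L (rep ψ)).space.obj j)
    (hf : ∀ (a : HInf F) (hj : a ∈ HInf.level F (j + 1)) (hi : a ∈ HInf.level F (i + 1)) x,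
      f (tensorRep ψ T i ⟨a, hi⟩ x) = tensorRep ψ L j ⟨a, hj⟩ (f x)) :
    ∃ g : T.obj i →ₗ[ℂ] L.obj j, f = tensorProj ψ h g :=
  exists_eq_map_proj ψ h (T := T.obj i) (L := L.obj j) f fun a x =>
    hf a a.2 (HInf.level_mono (Nat.succ_le_succ h) a.2) x

theorem isStrict_tensorRep (L : ProVect.{u}) : (tensor L (rep ψ)).IsStrict (tensorRep ψ L) where
  tr_apply {j i} h a hj hi x := by
    rw [tensor_space_tr L h]
    exact tensorProj_tensorRep h _ a hj hi x
  act_eq n j := by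
    filter_upwards [tensor_act L (rep ψ) n j, rep_act ψ n j, eventually_ge_atTop j] with
      i e e' hj a ha hi x
    refine (e a ha x).trans ?_
    rw [tensor_space_tr L hj]
    exact (tensor_map_map (B₁ := schwartzUnits F i) (fun _ => rfl)
      (fun f => (e' hj a ha hi f).symm) x).symm

variable (ψ) in
/-- The morphism `f ⊗ 𝕄`. -/
noncomputable def tensorMap {T L : ProVect.{u}} (f : T ⟶ L) : tensor T (rep ψ) ⟶ tensor L (rep ψ) :=
  (rep ψ).tensorFunctor.map f

theorem tensorMap_happ {T L : ProVect.{u}} (f : T ⟶ L) (j : ℕ) : ∀ᶠ i in atTop, ∀ h : j ≤ i,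
    happ (tensorMap ψ f).hom j i = tensorProj ψ h (happ f j i) := by
  filter_upwards [tensorFunctor_map_happ (rep ψ) f j] with i e h
  refine (LinearMap.ext e).trans ?_
  change TensorProduct.map (happ f j i) ((space F).tr j i) = _
  rw [space_tr h]
  rfl

theorem tensorMap_injective {T L : ProVect.{u}} {f g : T ⟶ L} (h : tensorMap ψ f = tensorMap ψ g) :
    f = g := by
  rw [hom_ext_iff]
  intro j
  filter_upwards [tensorMap_happ (ψ := ψ) f j, tensorMap_happ (ψ := ψ) g j,
    eventually_ge_atTop j] with i e e' hi x
  have := e hi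
  rw [h, e' hi] at this
  rw [tensorProj_injective hi this]

theorem exists_happ_eq {T L : ProVect.{u}} (f : tensor T (rep ψ) ⟶ tensor L (rep ψ)) (k : ℕ) :
    ∃ i, ∃ hk : k ≤ i, hidx f.hom k ≤ i ∧ ∃ g : T.obj i →ₗ[ℂ] L.obj k,
      happ f.hom k i = tensorProj ψ hk g := by
  obtain ⟨i, e, hi, hi'⟩ := (((isStrict_tensorRep T).happ_apply (isStrict_tensorRep L) f k).and
    ((eventually_ge_atTop k).and (eventually_ge_atTop (hidx f.hom k)))).exists
  obtain ⟨g, hg⟩ := exists_eq_tensorProj hi _ e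
  exact ⟨i, hi, hi', g, hg⟩

/-- Schur's lemma writes each component of `f` as `g k ⊗ proj` at a late enough stage. The `g k` are
compatible because `g ↦ g ⊗ proj` is injective. -/
theorem tensorMap_surjective {T L : ProVect.{u}} (f : tensor T (rep ψ) ⟶ tensor L (rep ψ)) :
    ∃ g, tensorMap ψ g = f := by
  choose idx hk hidx' g hg using exists_happ_eq f
  have key : ∀ k i (hi : idx k ≤ i), tensorProj ψ ((hk k).trans hi) ((g k).comp (T.tr (idx k) i)) =
      happ f.hom k i := fun k i hi => by
    refine LinearMap.ext fun x => ?_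
    rw [← happ_tr f.hom (hidx' k) hi x, hg, tensor_space_tr T hi, tensorProj_tensorProj]
  have hcompat : ∀ j j', j ≤ j' → ∀ᶠ i in atTop, ∀ x : T.obj i,
      L.tr j j' (g j' (T.tr (idx j') i x)) = g j (T.tr (idx j) i x) := fun j j' hj => by
    filter_upwards [tr_happ f.hom hj, eventually_ge_atTop (idx j),
      eventually_ge_atTop (idx j')] with i e hi hi' x
    have h0 : tensorProj ψ ((hk j).trans hi) ((L.tr j j').comp ((g j').comp (T.tr (idx j') i))) =
        tensorProj ψ ((hk j).trans hi) ((g j).comp (T.tr (idx j) i)) := by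
      rw [key j i hi]
      refine LinearMap.ext fun x => ?_
      rw [← e x, ← key j' i hi', tensor_space_tr L hj, tensorProj_tensorProj]
    exact LinearMap.congr_fun (tensorProj_injective _ h0) x
  refine ⟨homMk idx g hcompat, SmoothRep.Hom.ext ((hom_ext_iff _ _).2 fun j => ?_)⟩
  filter_upwards [tensorMap_happ (ψ := ψ) (homMk idx g hcompat) j, homMk_happ idx g hcompat j,
    eventually_ge_atTop (idx j)] with i e e' hi x
  rw [e ((hk j).trans hi), ← key j i hi,
    LinearMap.ext (f := happ _ j i) (g := (g j).comp (T.tr (idx j) i)) e']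

/-- `ℓ ⊗ φ ↦ (∫ φ)(1) ℓ`, with `∫ φ` the push-forward of `φ` to `M_0`. -/
noncomputable def whittakerStage (L : Type*) [AddCommGroup L] [Module ℂ L] (i : ℕ) :
    L ⊗[ℂ] schwartzUnits F i →ₗ[ℂ] L :=
  tensorEval (schwartzUnits F 0) L 1 ∘ₗ TensorProduct.map LinearMap.id (proj (Nat.zero_le i))

theorem whittakerStage_tmul {L : Type*} [AddCommGroup L] [Module ℂ L] {i : ℕ} (l : L)
    (f : schwartzUnits F i) : whittakerStage L i (l ⊗ₜ f) =
      (proj (Nat.zero_le i) f : F⟦X⟧ˣ → ℂ) 1 • l := by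
  simp [whittakerStage, tensorEval_tmul]

theorem whittakerStage_map {L L' : Type*} [AddCommGroup L] [Module ℂ L] [AddCommGroup L']
    [Module ℂ L'] (g : L →ₗ[ℂ] L') {j i : ℕ} (h : j ≤ i) (x : L ⊗[ℂ] schwartzUnits F i) :
    whittakerStage L' j (TensorProduct.map g (proj h) x) = g (whittakerStage L i x) := by
  induction x using TensorProduct.induction_on with
  | zero => simp
  | add x y hx hy => simp only [map_add, hx, hy]
  | tmul l f => rw [TensorProduct.map_tmul, whittakerStage_tmul, whittakerStage_tmul, proj_proj,
      map_smul]

theorem whittakerStage_repOn {L : Type*} [AddCommGroup L] [Module ℂ L] {i : ℕ}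
    (h : whittakerSubgroup F) (x : L ⊗[ℂ] schwartzUnits F i) :
    whittakerStage L i (TensorProduct.map LinearMap.id
      (repOn ψ (Nat.succ_le_succ (Nat.zero_le i)) (h : HInf.level F 1)) x) =
      whittakerChar ψ h • whittakerStage L i x := by
  induction x using TensorProduct.induction_on with
  | zero => simp
  | add x y hx hy => simp only [map_add, hx, hy, smul_add]
  | tmul l f =>
    rw [TensorProduct.map_tmul, whittakerStage_tmul, whittakerStage_tmul,
      proj_repOn ψ (Nat.zero_le i) le_rfl, repOn_coe, act_apply, smul_smul]
    have hj : jet 0 (((h : HInf.level F 1) : HInf F).unit * 1) = jet 0 1 := by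
      rw [mul_one]
      funext i
      obtain rfl : i = 0 := Fin.ext (by omega)
      have := h.2
      change PowerSeries.constantCoeff _ = 1 at this
      simpa [jet] using this
    rw [apply_eq_of_jet_eq (proj (Nat.zero_le i) f) hj, Units.val_one, one_smul]
    rfl

/-- For fixed `l`, uniqueness of the Whittaker functional at `k = 0` applies to `f ↦ θ (l ⊗ f)`: a
unit has the same `0`-jet as `1` exactly when it lies in `O^*(1)`. -/
theorem exists_eq_comp_whittakerStage {L A : Type*} [AddCommGroup L] [Module ℂ L] [AddCommGroup A]
    [Module ℂ A] {i : ℕ} (θ : L ⊗[ℂ] schwartzUnits F i →ₗ[ℂ] A)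
    (hθ : ∀ (h : whittakerSubgroup F) x, θ (TensorProduct.map LinearMap.id
      (repOn ψ (Nat.succ_le_succ (Nat.zero_le i)) (h : HInf.level F 1)) x) =
      whittakerChar ψ h • θ x) : ∃ γ : L →ₗ[ℂ] A, ∀ x, θ x = γ (whittakerStage L i x) := by
  obtain ⟨f₀, hf₀⟩ := exists_proj_apply_one_eq_one (F := F) (Nat.zero_le i)
  refine ⟨θ.comp ((TensorProduct.mk ℂ L (schwartzUnits F i)).flip f₀), fun x => ?_⟩
  induction x using TensorProduct.induction_on with
  | zero => simp
  | add x y hx hy => rw [map_add, hx, hy, map_add, map_add]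
  | tmul l f =>
    rw [whittakerStage_tmul, map_smul]
    refine apply_eq_smul_of_semiInvariant ψ (Nat.zero_le i)
      (θ.comp (TensorProduct.mk ℂ L (schwartzUnits F i) l)) ?_ ?_ hf₀ f
    · intro u f hu
      have hu' : unitElem 1 u ∈ whittakerSubgroup F := by
        change PowerSeries.constantCoeff (u : F⟦X⟧) = 1
        simpa [jet] using congrFun hu 0
      rw [repOn_unitElem_eq ψ (Nat.zero_le _) (Nat.succ_le_succ (Nat.zero_le i)) u]
      refine (hθ ⟨unitElem 1 u, hu'⟩ (l ⊗ₜ f)).trans ?_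
      have : whittakerChar ψ ⟨unitElem 1 u, hu'⟩ = 1 := by
        rw [whittakerChar, unitElem_polar, map_zero, AddChar.map_zero_eq_one]
      rw [this, one_smul]
      rfl
    · intro b f
      have hb : (b : HInf.level F 1) ∈ whittakerSubgroup F := by
        change PowerSeries.constantCoeff ((b.1 : HInf F).unit : F⟦X⟧) = 1
        rw [show (b.1 : HInf F).unit = 1 from b.2, Units.val_one, map_one]
      refine (hθ ⟨b.1, hb⟩ (l ⊗ₜ f)).trans ?_
      have h1 := residue_smul_polar b.1 (1 : F⟦X⟧ˣ)
      rw [Units.val_one, one_smul] at h1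
      rw [whittakerChar, h1]
      rfl

variable (ψ)

/-- `whittakerStage` as a map on the stages of `L ⊗ 𝕄`. -/
noncomputable def whittakerProj (L : ProVect.{u}) (i : ℕ) :
    (tensor L (rep ψ)).space.obj i →ₗ[ℂ] L.obj i := whittakerStage (F := F) (L.obj i) i

theorem whittakerProj_surjective (L : ProVect.{u}) (i : ℕ) :
    Function.Surjective (whittakerProj ψ L i) := fun l => by
  obtain ⟨f, hf⟩ := exists_proj_apply_one_eq_one (F := F) (Nat.zero_le i)
  refine ⟨(l ⊗ₜ f : L.obj i ⊗[ℂ] schwartzUnits F i), ?_⟩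
  exact (whittakerStage_tmul l f).trans (by rw [hf, one_smul])

theorem whittakerProj_tensorProj {T L : ProVect.{u}} {j i : ℕ} (h : j ≤ i)
    (g : T.obj i →ₗ[ℂ] L.obj j) (x) :
    whittakerProj ψ L j (tensorProj ψ h g x) = g (whittakerProj ψ T i x) :=
  whittakerStage_map g h x

theorem whittakerProj_tr (L : ProVect.{u}) {j i : ℕ} (h : j ≤ i) (x) :
    whittakerProj ψ L j ((tensor L (rep ψ)).space.tr j i x) =
      L.tr j i (whittakerProj ψ L i x) := by
  rw [tensor_space_tr L h, whittakerProj_tensorProj]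

theorem mem_level_of_one {a : HInf F} (h : a ∈ HInf.level F 1) (i : ℕ) :
    a ∈ HInf.level F (i + 1) := HInf.level_mono (Nat.succ_le_succ (Nat.zero_le i)) h

theorem whittakerProj_tensorRep (L : ProVect.{u}) {i : ℕ} (a : whittakerSubgroup F) (x) :
    whittakerProj ψ L i (tensorRep ψ L i ⟨_, mem_level_of_one a.1.2 i⟩ x) =
      whittakerChar ψ a • whittakerProj ψ L i x := by
  rw [tensorRep_eq ψ L (Nat.succ_le_succ (Nat.zero_le i)) _ a.1.2]
  exact whittakerStage_repOn a x

theorem exists_eq_comp_whittakerProj {L : ProVect.{u}} {A : Type*} [AddCommGroup A]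
    [Module ℂ A] {i : ℕ} (θ : (tensor L (rep ψ)).space.obj i →ₗ[ℂ] A)
    (hθ : ∀ (a : whittakerSubgroup F) (ha : ((a : HInf.level F 1) : HInf F) ∈ HInf.level F (i + 1))
      x, θ (tensorRep ψ L i ⟨_, ha⟩ x) = whittakerChar ψ a • θ x) :
    ∃ γ : L.obj i →ₗ[ℂ] A, ∀ x, θ x = γ (whittakerProj ψ L i x) :=
  exists_eq_comp_whittakerStage (F := F) (ψ := ψ) (L := L.obj i) θ
    fun a x => by
      have := hθ a (mem_level_of_one a.1.2 i) x
      rw [tensorRep_eq ψ L (Nat.succ_le_succ (Nat.zero_le i)) _ a.1.2] at this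
      exact this

/-- The morphism `L ⊗ 𝕄 → L`. -/
noncomputable def whittakerMap (L : ProVect.{u}) : (tensor L (rep ψ)).space ⟶ L :=
  homMk (fun j => j) (fun j => whittakerProj ψ L j) fun j j' hj => by
    filter_upwards [eventually_ge_atTop j'] with i hi x
    rw [whittakerProj_tr ψ L hi, whittakerProj_tr ψ L (hj.trans hi), tr_tr _ hj hi]

theorem whittakerMap_happ (L : ProVect.{u}) (j : ℕ) : ∀ᶠ i in atTop, ∀ x,
    happ (whittakerMap ψ L) j i x = L.tr j i (whittakerProj ψ L i x) := by
  filter_upwards [homMk_happ (fun j => j) (fun j => whittakerProj ψ L j) _ j,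
    eventually_ge_atTop j] with i e hi x
  exact (e x).trans (whittakerProj_tr ψ L hi x)

theorem whittakerMap_natural {L L' : ProVect.{u}} (g : L ⟶ L') :
    (tensorMap ψ g).hom ≫ whittakerMap ψ L' = whittakerMap ψ L ≫ g := by
  rw [hom_ext_iff]
  intro j
  obtain ⟨i', e₁, hi', hi'', hj⟩ := ((whittakerMap_happ ψ L' j).and
    ((eventually_ge_atTop (hidx (whittakerMap ψ L') j)).and
    ((eventually_ge_atTop (hidx g j)).and (eventually_ge_atTop j)))).exists
  filter_upwards [comp_happ (tensorMap ψ g).hom (whittakerMap ψ L') j hi',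
    comp_happ (whittakerMap ψ L) g j hi'', tensorMap_happ (ψ := ψ) g i',
    whittakerMap_happ ψ L i', eventually_ge_atTop i', tr_happ g hj] with i a b c d hi e x
  rw [a x, b x, d x, happ_tr g hi'' hi, e₁, c hi, whittakerProj_tensorProj, e]

/-- At a late stage each component of a semi-invariant `β` factors through `whittakerProj`. As
`whittakerProj` is surjective on every stage, the factors are compatible and unique. -/
theorem isCoinvariants_whittakerMap (L : ProVect.{u}) : (tensor L (rep ψ)).IsCoinvariants
    (whittakerSubgroup F) (whittakerChar ψ) (whittakerMap ψ L) where
  semiInvariant := by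
    rw [isSemiInvariant_iff]
    intro j
    obtain ⟨i', e₁, hi'⟩ := ((whittakerMap_happ ψ L j).and
      (eventually_ge_atTop (max j (hidx (whittakerMap ψ L) j)))).exists
    refine ⟨i', (le_max_right _ _).trans hi', ?_⟩
    filter_upwards [(isStrict_tensorRep (ψ := ψ) L).act_eq 1 i', eventually_ge_atTop i',
      whittakerMap_happ ψ L j] with i e hi e₂ h x
    rw [e _ h.1.2 (mem_level_of_one h.1.2 i), e₂ x, e₁, whittakerProj_tr ψ L hi,
      tr_tr _ ((le_max_left _ _).trans hi') hi, whittakerProj_tensorRep, map_smul]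
  existsUnique_desc Q β hβ := by
    have h2 := fun j => (((isStrict_tensorRep L).happ_of_semiInvariant hβ j).and
      ((eventually_ge_atTop (hidx β j)).and (eventually_ge_atTop j))).exists
    choose idx h2 h3 hj using h2
    choose γ hγ using fun j => exists_eq_comp_whittakerProj ψ _ (h2 j)
    have key : ∀ j i, idx j ≤ i → ∀ x, happ β j i x =
        γ j (L.tr (idx j) i (whittakerProj ψ L i x)) := fun j i hi x => by
      rw [← whittakerProj_tr ψ L hi, ← hγ, happ_tr β (h3 j) hi]
    have hcompat : ∀ j j', j ≤ j' → ∀ᶠ i in atTop, ∀ x : L.obj i,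
        Q.tr j j' (γ j' (L.tr (idx j') i x)) = γ j (L.tr (idx j) i x) := fun j j' hj => by
      filter_upwards [tr_happ β hj, eventually_ge_atTop (idx j), eventually_ge_atTop (idx j')]
        with i e hi hi' x
      obtain ⟨x, rfl⟩ := whittakerProj_surjective ψ L i x
      rw [← key j i hi, ← key j' i hi', e]
    refine ⟨homMk idx γ hcompat, ?_, fun γ' hγ' => ?_⟩
    · change whittakerMap ψ L ≫ homMk idx γ hcompat = β
      rw [hom_ext_iff]
      intro j
      obtain ⟨i', e₁, h₁, h₂⟩ := ((homMk_happ idx γ hcompat j).and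
        ((eventually_ge_atTop (hidx (homMk idx γ hcompat) j)).and
          (eventually_ge_atTop (idx j)))).exists
      filter_upwards [comp_happ (whittakerMap ψ L) (homMk idx γ hcompat) j h₁,
        whittakerMap_happ ψ L i', eventually_ge_atTop i'] with i a b hi x
      rw [a x, b x, e₁, tr_tr _ h₂ hi, key j i (h₂.trans hi)]
    · rw [hom_ext_iff]
      intro j
      have h₁ := le_refl (hidx γ' j)
      filter_upwards [comp_happ (whittakerMap ψ L) γ' j h₁,
        whittakerMap_happ ψ L (hidx γ' j), homMk_happ idx γ hcompat j,
        eventually_ge_atTop (idx j), eventually_ge_atTop (hidx γ' j)] with i a b c hi hi' x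
      obtain ⟨x, rfl⟩ := whittakerProj_surjective ψ L i x
      rw [c, ← key j i hi, ← hγ', a x, b x, happ_tr γ' h₁ hi']

/-- Cuspidality of `M_i` for a single vector: `f` vanishes for small `x_0`, so an element of the
group algebra of `B_1` can be `0` on the support of `f` and still have augmentation `1`, its value
at the trivial character `y = 0`. -/
theorem exists_asAlgebraHom_eq_zero {i : ℕ} (f : schwartzUnits F i) :
    ∃ t : MonoidAlgebra ℂ (polarSubgroup F 1), polarEval ψ 0 t = 1 ∧
      (polarRep ψ (Nat.zero_le i)).asAlgebraHom t f = 0 := by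
  obtain ⟨ε, hε, hf⟩ := exists_lt_of_ne_zero f
  obtain ⟨K, hK, hKf⟩ := exists_isCompact_support (Nat.zero_le i) f
  obtain ⟨t, ht, ht'⟩ := exists_polarEval_eq_indicator ψ hK hε 0
  refine ⟨t, ht 0 (mem_box_self _ _), Subtype.ext (funext fun x => ?_)⟩
  rw [polarRep_asAlgebraHom]
  by_cases hx : (f : F⟦X⟧ˣ → ℂ) x = 0
  · rw [hx, mul_zero]; rfl
  · rw [ht' _ (hKf x hx), zero_mul]
    · rfl
    · intro h
      have h3 := h 0
      rw [Pi.zero_apply, sub_zero] at h3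
      exact absurd (hf x hx) (not_lt.2 h3)

/-- A `B_1`-invariant functional sees the group algebra through the augmentation, so the element
that kills `f` and has augmentation `1` forces the value at `l ⊗ f` to vanish. -/
theorem eq_zero_of_polar_invariant {L A : Type*} [AddCommGroup L] [Module ℂ L] [AddCommGroup A]
    [Module ℂ A] {i : ℕ} (θ : L ⊗[ℂ] schwartzUnits F i →ₗ[ℂ] A)
    (hθ : ∀ (b : polarSubgroup F 1) x, θ (TensorProduct.map LinearMap.id
      (polarRep ψ (Nat.zero_le i) b) x) = θ x) (x) : θ x = 0 := by
  induction x using TensorProduct.induction_on with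
  | zero => exact map_zero _
  | add x y hx hy => rw [map_add, hx, hy, add_zero]
  | tmul l f =>
    obtain ⟨t, ht, ht'⟩ := exists_asAlgebraHom_eq_zero ψ f
    have h1 := map_asAlgebraHom_of_semiInvariant ψ (polarRep ψ (Nat.zero_le i))
      (θ.comp (TensorProduct.mk ℂ L (schwartzUnits F i) l)) 0
      (fun b f => by
        rw [polarChar_zero, one_smul]
        exact hθ b (l ⊗ₜ f)) t f
    rw [ht, ht', map_zero, one_smul] at h1
    exact h1.symm

theorem isCuspidal_tensor_rep (L : ProVect.{u}) : (tensor L (rep ψ)).IsCuspidal := by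
  rw [isCuspidal_iff]
  intro Q β hβ
  rw [eq_zeroHom_iff]
  intro j
  filter_upwards [(isStrict_tensorRep L).happ_of_semiInvariant hβ j] with i e x
  refine eq_zero_of_polar_invariant ψ (L := L.obj i) (happ β j i) (fun b x => ?_) x
  have := e ⟨b.1, b.2⟩ (mem_level_of_one b.1.2 i) x
  rw [tensorRep_eq ψ L (Nat.succ_le_succ (Nat.zero_le i)) _ b.1.2] at this
  exact this.trans (one_smul _ _)

end MeasureRep

/-! ### The subgroup `B_1` inside `B_(m+1)`. -/

section PolarMk
variable {F : Type u} [Field F] {n : ℕ}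

/-- The element of `B_n` with a given polar part. -/
noncomputable def polarMk (p : PolarParts F) (hp : (PowerSeries.X ^ n : F⟦X⟧) • p = 0) :
    polarSubgroup F n := ⟨⟨⟨Multiplicative.ofAdd p, 1⟩, hp⟩, rfl⟩

theorem polarMk_polar (p : PolarParts F) (hp : (PowerSeries.X ^ n : F⟦X⟧) • p = 0) :
    ((polarMk p hp).1 : HInf F).polar = p := rfl

theorem polarSubgroup_unit (b : polarSubgroup F n) : (b.1 : HInf F).unit = 1 := b.2

theorem X_pow_smul_polar (h : HInf.level F n) :
    (PowerSeries.X ^ n : F⟦X⟧) • (h : HInf F).polar = 0 := h.2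

theorem polarSubgroup_mul_comm (b b' : polarSubgroup F n) : b * b' = b' * b := by
  refine Subtype.ext (Subtype.ext (HInf.ext' ?_ ?_))
  · rw [Subgroup.coe_mul, Subgroup.coe_mul, Subgroup.coe_mul, Subgroup.coe_mul, HInf.polar_mul,
      HInf.polar_mul, polarSubgroup_unit, polarSubgroup_unit, Units.val_one, one_smul, one_smul,
      add_comm]
  · rw [Subgroup.coe_mul, Subgroup.coe_mul, Subgroup.coe_mul, Subgroup.coe_mul, HInf.unit_mul,
      HInf.unit_mul, polarSubgroup_unit, polarSubgroup_unit]

theorem polarAlgebra_mul_comm (t t' : MonoidAlgebra ℂ (polarSubgroup F n)) : t * t' = t' * t := by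
  let _ : CommMonoid (polarSubgroup F n) :=
    { (inferInstance : Monoid (polarSubgroup F n)) with mul_comm := polarSubgroup_mul_comm }
  exact mul_comm t t'

theorem polarSubgroup_ext {b b' : polarSubgroup F n}
    (h : (b.1 : HInf F).polar = (b'.1 : HInf F).polar) : b = b' :=
  Subtype.ext (Subtype.ext (HInf.ext' h ((polarSubgroup_unit b).trans (polarSubgroup_unit b').symm)))

theorem X_pow_succ_smul (m : ℕ) {p : PolarParts F} (hp : (PowerSeries.X ^ 1 : F⟦X⟧) • p = 0) :
    (PowerSeries.X ^ (m + 1) : F⟦X⟧) • p = 0 := by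
  rw [pow_succ, mul_smul, ← pow_one PowerSeries.X, hp, smul_zero]

theorem polar_mul_polarSubgroup (b b' : polarSubgroup F n) : ((b * b').1 : HInf F).polar =
    (b.1 : HInf F).polar + (b'.1 : HInf F).polar := by
  rw [Subgroup.coe_mul, Subgroup.coe_mul, HInf.polar_mul, polarSubgroup_unit, Units.val_one,
    one_smul]

/-- The inclusion `B_1 → B_(m+1)`. -/
noncomputable def cornerIncl (m : ℕ) : polarSubgroup F 1 →* polarSubgroup F (m + 1) where
  toFun b := polarMk (b.1 : HInf F).polar (X_pow_succ_smul m (X_pow_smul_polar b.1))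
  map_one' := polarSubgroup_ext rfl
  map_mul' b b' := polarSubgroup_ext (by
    rw [polarMk_polar, polar_mul_polarSubgroup, polar_mul_polarSubgroup, polarMk_polar,
      polarMk_polar])

theorem cornerIncl_polar (m : ℕ) (b : polarSubgroup F 1) :
    ((cornerIncl m b).1 : HInf F).polar = (b.1 : HInf F).polar := polarMk_polar _ _

/-- Elements of `B_1` are killed by `t`; hence they pair only with the coordinate `y_0`. -/
theorem polarCoeff_cornerIncl_succ (m : ℕ) (b : polarSubgroup F 1) (i : Fin m) :
    polarCoeff (cornerIncl m b).1 i.succ = 0 := by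
  rw [polarCoeff, cornerIncl_polar, Fin.val_succ, X_pow_succ_smul i (X_pow_smul_polar b.1), map_zero]

/-- `B_1` is normal: conjugation multiplies the polar part by a unit, which preserves the kernel of
`t`. This makes `cuspPart` stable under the whole group. -/
theorem exists_conj_cornerIncl {m : ℕ} (h : HInf.level F (m + 1)) (b : polarSubgroup F 1) :
    ∃ b' : polarSubgroup F 1, (cornerIncl m b').1 * h = h * (cornerIncl m b).1 := by
  have hp : (PowerSeries.X ^ 1 : F⟦X⟧) • (((h : HInf F).unit : F⟦X⟧) • (b.1 : HInf F).polar) =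
      0 := by
    rw [smul_comm, X_pow_smul_polar b.1, smul_zero]
  refine ⟨polarMk _ hp, Subtype.ext (HInf.ext' ?_ ?_)⟩
  · rw [Subgroup.coe_mul, Subgroup.coe_mul, HInf.polar_mul, HInf.polar_mul, cornerIncl_polar,
      cornerIncl_polar, polarMk_polar, polarSubgroup_unit, Units.val_one, one_smul, add_comm]
  · rw [Subgroup.coe_mul, Subgroup.coe_mul, HInf.unit_mul, HInf.unit_mul, polarSubgroup_unit,
      polarSubgroup_unit, one_mul, mul_one]

end PolarMk

/-! ### Fourier analysis on a smooth stage: injectivity on the cuspidal part. -/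

section Stage
open Topology ValuativeRel MeasureRep
open scoped TensorProduct
variable {F : Type u} [Field F] [ValuativeRel F] [TopologicalSpace F] [IsNonarchimedeanLocalField F]
  (ψ : ResidualChar F) {m : ℕ} {E : Type w} [AddCommGroup E] [Module ℂ E]
  (π : Representation ℂ (HInf.level F (m + 1)) E)

/-- A smooth representation of `O_m^* ⋉ B_(m+1)`. -/
structure IsSmoothStage : Prop where
  exists_polar (v : E) : ∃ d : F, d ≠ 0 ∧ ∀ b : polarSubgroup F (m + 1),
    (∀ i, valuation F (polarCoeff b.1 i * d) < 1) → π b.1 v = v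
  exists_unit (v : E) (a₀ : F⟦X⟧ˣ) : ∃ c : F, c ≠ 0 ∧ ∀ a, jet m a ∈ box c (jet m a₀) →
    π (unitElem _ a) v = π (unitElem _ a₀) v

/-- The restriction to `B_(m+1)`. -/
noncomputable def polarRestrict : Representation ℂ (polarSubgroup F (m + 1)) E := π.comp (Subgroup.subtype _)

/-- The restriction to `B_1`. -/
noncomputable def cornerRestrict : Representation ℂ (polarSubgroup F 1) E :=
  (polarRestrict π).comp (cornerIncl m)

theorem polarRestrict_apply (b : polarSubgroup F (m + 1)) : polarRestrict π b = π b.1 := rfl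

theorem cornerRestrict_apply (b : polarSubgroup F 1) : cornerRestrict π b =
    π (cornerIncl m b).1 := rfl

/-- The kernel of the projection to the `χ_y`-coinvariants under `B_(m+1)`. -/
def polarKernel (y : Fin (m + 1) → F) : Submodule ℂ E :=
  Submodule.span ℂ {v | ∃ b w, v = polarRestrict π b w - polarChar ψ y b • w}

/-- The kernel of the projection to the coinvariants under `B_1`. -/
def cuspPart : Submodule ℂ E := Submodule.span ℂ {v | ∃ b w, v = cornerRestrict π b w - w}

/-- The coinvariants for `B_(m+1)` and the character `b ↦ ψ(Res b)`. -/
abbrev StageQuot : Type w := E ⧸ polarKernel ψ π (jet m 1)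

/-- The function `a ↦ [a v]` on `O^*`. -/
noncomputable def orbitMap : E →ₗ[ℂ] F⟦X⟧ˣ → StageQuot ψ π :=
  LinearMap.pi fun a => (polarKernel ψ π (jet m 1)).mkQ.comp (π (unitElem _ a))

theorem orbitMap_apply (v : E) (a : F⟦X⟧ˣ) :
    orbitMap ψ π v a = (polarKernel ψ π (jet m 1)).mkQ (π (unitElem _ a) v) := rfl

theorem unitElem_mul_eq {n : ℕ} (a : F⟦X⟧ˣ) (h : HInf.level F n) :
    ∃ b : polarSubgroup F n, ((b.1 : HInf F).polar = (a : F⟦X⟧) • (h : HInf F).polar) ∧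
      unitElem n a * h = b.1 * unitElem n ((h : HInf F).unit * a) := by
  have hp : (PowerSeries.X ^ n : F⟦X⟧) • ((a : F⟦X⟧) • (h : HInf F).polar) = 0 := by
    rw [smul_comm, X_pow_smul_polar h, smul_zero]
  refine ⟨polarMk _ hp, rfl, Subtype.ext (HInf.ext' ?_ ?_)⟩
  · rw [Subgroup.coe_mul, Subgroup.coe_mul, HInf.polar_mul, HInf.polar_mul, unitElem_polar,
      unitElem_polar, polarMk_polar, unitElem_unit, smul_zero, add_zero, zero_add]
  · rw [Subgroup.coe_mul, Subgroup.coe_mul, HInf.unit_mul, HInf.unit_mul, unitElem_unit,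
      unitElem_unit, polarSubgroup_unit, one_mul, mul_comm]

/-- Moving `a` past `h` produces a polar factor `a · h.polar`, which acts on the coinvariants by a
scalar. The result has the same shape as the action on `𝕄`, so `orbitMap` is an intertwiner into
`L`-valued functions on `O^*`. -/
theorem orbitMap_rep (h : HInf.level F (m + 1)) (v : E) (a : F⟦X⟧ˣ) :
    orbitMap ψ π (π h v) a =
      ψ.toAddChar (PolarParts.residue F ((a : F⟦X⟧) • (h : HInf F).polar)) •
        orbitMap ψ π v ((h : HInf F).unit * a) := by
  obtain ⟨b, hb, e⟩ := unitElem_mul_eq a h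
  rw [orbitMap_apply, orbitMap_apply, ← Module.End.mul_apply, ← map_mul, e, map_mul,
    Module.End.mul_apply, ← map_smul, ← sub_eq_zero, ← map_sub]
  refine (Submodule.Quotient.mk_eq_zero _).2 (Submodule.subset_span
    ⟨b, π (unitElem _ ((h : HInf F).unit * a)) v, ?_⟩)
  rw [polarRestrict_apply]
  congr 2
  rw [← hb]
  have := residue_smul_polar b.1 (1 : F⟦X⟧ˣ)
  rw [Units.val_one, one_smul] at this
  rw [this]
  rfl

theorem orbitMap_polar (b : polarSubgroup F (m + 1)) (v : E) (a : F⟦X⟧ˣ) :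
    orbitMap ψ π (polarRestrict π b v) a = polarChar ψ (jet m a) b • orbitMap ψ π v a := by
  rw [polarRestrict_apply, orbitMap_rep, show (b.1 : HInf F).unit = 1 from b.2, one_mul,
    residue_smul_polar]
  rfl

theorem orbitMap_corner (b : polarSubgroup F 1) (v : E) (a : F⟦X⟧ˣ) :
    orbitMap ψ π (cornerRestrict π b v) a = polarChar ψ (jet 0 a) b • orbitMap ψ π v a := by
  rw [cornerRestrict_apply, orbitMap_rep]
  rw [polarSubgroup_unit, one_mul, cornerIncl_polar]
  congr 1
  exact congrArg ψ.toAddChar (residue_smul_polar (m := 0) b.1 a)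

theorem orbitMap_polar_asAlgebraHom (t : MonoidAlgebra ℂ (polarSubgroup F (m + 1))) (v : E)
    (a : F⟦X⟧ˣ) : orbitMap ψ π ((polarRestrict π).asAlgebraHom t v) a =
      polarEval ψ (jet m a) t • orbitMap ψ π v a :=
  map_asAlgebraHom_of_semiInvariant ψ (polarRestrict π)
    ((LinearMap.proj a).comp (orbitMap ψ π)) _ (fun b v => orbitMap_polar ψ π b v a) t v

theorem orbitMap_corner_asAlgebraHom (t : MonoidAlgebra ℂ (polarSubgroup F 1)) (v : E)
    (a : F⟦X⟧ˣ) : orbitMap ψ π ((cornerRestrict π).asAlgebraHom t v) a =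
      polarEval ψ (jet 0 a) t • orbitMap ψ π v a :=
  map_asAlgebraHom_of_semiInvariant ψ (cornerRestrict π)
    ((LinearMap.proj a).comp (orbitMap ψ π)) _ (fun b v => orbitMap_corner ψ π b v a) t v

/-- Modulo `cuspPart` the group `B_1` acts trivially, hence its group algebra acts through the
augmentation. -/
theorem cornerRestrict_sub_mem (t : MonoidAlgebra ℂ (polarSubgroup F 1)) (v : E) :
    (cornerRestrict π).asAlgebraHom t v - polarEval ψ 0 t • v ∈ cuspPart π := by
  have h1 := map_asAlgebraHom_of_semiInvariant ψ (cornerRestrict π) (cuspPart π).mkQ 0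
    (fun b v => by
      rw [polarChar_zero, one_smul, ← sub_eq_zero, ← map_sub]
      exact (Submodule.Quotient.mk_eq_zero _).2 (Submodule.subset_span ⟨b, v, rfl⟩)) t v
  rw [← map_smul, ← sub_eq_zero, ← map_sub] at h1
  exact (Submodule.Quotient.mk_eq_zero _).1 h1

theorem rep_mem_cuspPart (h : HInf.level F (m + 1)) {v : E} (hv : v ∈ cuspPart π) :
    π h v ∈ cuspPart π := by
  induction hv using Submodule.span_induction with
  | mem v hv =>
    obtain ⟨b, w, rfl⟩ := hv
    obtain ⟨b', e⟩ := exists_conj_cornerIncl h b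
    refine Submodule.subset_span ⟨b', π h w, ?_⟩
    rw [map_sub, cornerRestrict_apply, cornerRestrict_apply, ← Module.End.mul_apply,
      ← Module.End.mul_apply, ← map_mul, ← map_mul, e]
  | zero => rw [map_zero]; exact zero_mem _
  | add v w _ _ hv hw => rw [map_add]; exact add_mem hv hw
  | smul c v _ hv => rw [map_smul]; exact Submodule.smul_mem _ c hv

/-- Since `ψ` is non-trivial on `O_F`, an element that annihilates the polydisc of radius `|d|` has
small coordinates. This translates between `exists_polar` and annihilators of polydiscs. -/
theorem valuation_lt_of_polarChar_eq_one {n : ℕ} {d : F} (b : polarSubgroup F n)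
    (h : ∀ y ∈ box d (0 : Fin n → F), polarChar ψ y b = 1) (i : Fin n) :
    valuation F (polarCoeff b.1 i * d) < 1 := by
  by_contra hlt
  rw [not_lt] at hlt
  obtain ⟨x, hx, hx'⟩ := ψ.exists_ne_one
  have hne : polarCoeff b.1 i * d ≠ 0 := by
    intro h0
    rw [h0, map_zero] at hlt
    exact not_lt_of_ge hlt zero_lt_one
  refine hx' ?_
  -- This `y` pairs with `b` to `x`, where `ψ x ≠ 1`. It lies in the polydisc because `|x| ≤ 1 ≤
  -- |polarCoeff b.1 i * d|`.
  have h1 := h (Pi.single i (d * (x / (polarCoeff b.1 i * d)))) fun j => ?_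
  · rw [polarChar_apply, Finset.sum_eq_single i, Pi.single_eq_same] at h1
    · rwa [show d * (x / (polarCoeff b.1 i * d)) * polarCoeff b.1 i = x by
        rw [mul_comm (polarCoeff b.1 i)] at hne ⊢
        have := left_ne_zero_of_mul hne
        have := right_ne_zero_of_mul hne
        field_simp] at h1
    · intro j _ hj
      rw [Pi.single_eq_of_ne hj, zero_mul]
    · simp
  · rw [Pi.zero_apply, sub_zero]
    by_cases hj : j = i
    · subst hj
      rw [Pi.single_eq_same, map_mul, map_div₀]
      exact mul_le_of_le_one_right' ((div_le_one₀ (valuation_pos hne)).2 (hx.trans hlt))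
    · rw [Pi.single_eq_of_ne hj, map_zero]
      exact zero_le

variable {π} (hπ : IsSmoothStage π)
include hπ

theorem IsSmoothStage.exists_fixed (v : E) : ∃ d : F, d ≠ 0 ∧ ∀ b,
    (∀ y ∈ box d (0 : Fin (m + 1) → F), polarChar ψ y b = 1) → polarRestrict π b v = v := by
  obtain ⟨d, hd, h⟩ := hπ.exists_polar v
  exact ⟨d, hd, fun b hb => h b (valuation_lt_of_polarChar_eq_one ψ b hb)⟩

/-- If some `|a_i| > |d|`, then `c t^(-i-1)` with `c = x / a_i` and `ψ x ≠ 1` is small enough to fix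
`v`, yet it multiplies the value of the orbit function at `a` by `ψ x`. So that value is zero. -/
theorem IsSmoothStage.orbitMap_support (v : E) : ∃ d : F, d ≠ 0 ∧ ∀ a,
    orbitMap ψ π v a ≠ 0 → jet m a ∈ box d 0 := by
  obtain ⟨d, hd, h⟩ := hπ.exists_polar v
  refine ⟨d, hd, fun a ha i => ?_⟩
  rw [Pi.zero_apply, sub_zero]
  by_contra hlt
  rw [not_le] at hlt
  have h0 : jet m a i ≠ 0 := fun h0 => by
    rw [h0, map_zero] at hlt
    exact not_lt_zero hlt
  obtain ⟨x, hx, hx'⟩ := ψ.exists_ne_one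
  have h1 : polarRestrict π (polarElem i (x / jet m a i)) v = v := h _ fun j => by
    rw [polarCoeff_polarElem]
    by_cases hj : j = i
    · subst hj
      rw [Pi.single_eq_same, map_mul, map_div₀]
      calc _ ≤ 1 / valuation F (jet m a j) * valuation F d :=
            mul_le_mul_left (div_le_div_of_nonneg_right hx zero_le) _
        _ < 1 := by
          rw [one_div, inv_mul_lt_one₀ (valuation_pos h0)]
          exact hlt
    · rw [Pi.single_eq_of_ne hj, zero_mul, map_zero]
      exact zero_lt_one
  have h2 := orbitMap_polar ψ π (polarElem i (x / jet m a i)) v a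
  rw [h1, polarChar_polarElem, mul_div_cancel₀ _ h0] at h2
  have h3 : (ψ.toAddChar x - 1) • orbitMap ψ π v a = 0 := by
    rw [sub_smul, one_smul, ← h2, sub_self]
  exact (smul_ne_zero (sub_ne_zero.2 hx') ha) h3

-- Passing from `w` to `b w - w` multiplies the orbit function at `a` by `χ(b) - 1`, where `χ` is
-- the character of `B_1` given by `a_0`. This factor vanishes for small `a_0`.
omit hπ in
theorem orbitMap_eq_zero_of_cuspPart {v : E} (hv : v ∈ cuspPart π) : ∃ ε : F, ε ≠ 0 ∧ ∀ a,
    jet 0 a ∈ box ε 0 → orbitMap ψ π v a = 0 := by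
  induction hv using Submodule.span_induction with
  | mem v hv =>
    obtain ⟨b, w, rfl⟩ := hv
    obtain ⟨ε, hε, h⟩ := (nhds_basis_box (0 : Fin 1 → F)).eventually_iff.1
      ((IsLocallyConstant.iff_eventually_eq _).1 (isLocallyConstant_polarChar ψ b) 0)
    refine ⟨ε, hε, fun a ha => ?_⟩
    rw [map_sub, Pi.sub_apply, orbitMap_corner, h ha, polarChar_zero, one_smul, sub_self]
  | zero => exact ⟨1, one_ne_zero, fun a _ => by rw [map_zero]; rfl⟩
  | add v w _ _ hv hw =>
    obtain ⟨ε, hε, h⟩ := hv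
    obtain ⟨ε', hε', h'⟩ := hw
    rcases le_total (valuation F ε) (valuation F ε') with hle | hle
    · exact ⟨ε, hε, fun a ha => by
        rw [map_add, Pi.add_apply, h a ha, h' a (box_mono hle _ ha), add_zero]⟩
    · exact ⟨ε', hε', fun a ha => by
        rw [map_add, Pi.add_apply, h' a ha, h a (box_mono hle _ ha), add_zero]⟩
  | smul c v _ hv =>
    obtain ⟨ε, hε, h⟩ := hv
    exact ⟨ε, hε, fun a ha => by rw [map_smul, Pi.smul_apply, h a ha, smul_zero]⟩

/-- A vector that dies in the fibre at `y` dies on a neighbourhood of `y`. For a generator `b w -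
χ_y(b) w`, take a polydisc on which `χ_z(b) = χ_y(b)` and let `t` cut it out of the polydisc `D`
that carries `w`. Then `t (b - χ_y(b))` vanishes on all of `D` and kills `w`. -/
theorem IsSmoothStage.exists_of_mem_polarKernel {y : Fin (m + 1) → F} {v : E}
    (hv : v ∈ polarKernel ψ π y) : ∃ c : F, c ≠ 0 ∧ ∃ t : MonoidAlgebra ℂ (polarSubgroup F (m + 1)),
      (∀ z ∈ box c y, polarEval ψ z t = 1) ∧ (polarRestrict π).asAlgebraHom t v = 0 := by
  induction hv using Submodule.span_induction with
  | mem v hv =>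
    obtain ⟨b, w, rfl⟩ := hv
    obtain ⟨c, hc, h⟩ := (nhds_basis_box y).eventually_iff.1
      ((IsLocallyConstant.iff_eventually_eq _).1 (isLocallyConstant_polarChar ψ b) y)
    obtain ⟨d, hd, hw⟩ := hπ.exists_fixed ψ w
    obtain ⟨t, ht, ht'⟩ := exists_polarEval_eq_indicator ψ (isCompact_box d 0) hc y
    refine ⟨c, hc, t, ht, ?_⟩
    have h1 := asAlgebraHom_apply_eq_zero ψ (polarRestrict π) hw
      (t := t * (MonoidAlgebra.single b 1 - MonoidAlgebra.single 1 (polarChar ψ y b)))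
      fun z hz => by
        rw [map_mul, map_sub, polarEval_single, polarEval_single, one_mul, map_one, mul_one]
        by_cases hzc : z ∈ box c y
        · rw [h hzc, sub_self, mul_zero]
        · rw [ht' z hz hzc, zero_mul]
    rw [map_mul, map_sub, Representation.asAlgebraHom_single, Representation.asAlgebraHom_single,
      Module.End.mul_apply, LinearMap.sub_apply, one_smul, LinearMap.smul_apply, map_one] at h1
    exact h1
  | zero => exact ⟨1, one_ne_zero, 1, fun z _ => map_one _, map_zero _⟩
  | add v w _ _ hv hw =>
    obtain ⟨c, hc, t, ht, h⟩ := hv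
    obtain ⟨c', hc', t', ht', h'⟩ := hw
    have h1 : (polarRestrict π).asAlgebraHom (t * t') (v + w) = 0 := by
      rw [map_add, map_mul, Module.End.mul_apply, Module.End.mul_apply, h', map_zero, add_zero,
        ← Module.End.mul_apply, ← map_mul, polarAlgebra_mul_comm, map_mul, Module.End.mul_apply, h,
        map_zero]
    rcases le_total (valuation F c) (valuation F c') with hle | hle
    · exact ⟨c, hc, t * t', fun z hz => by
        rw [map_mul, ht z hz, ht' z (box_mono hle _ hz), one_mul], h1⟩
    · exact ⟨c', hc', t * t', fun z hz => by
        rw [map_mul, ht' z hz, ht z (box_mono hle _ hz), one_mul], h1⟩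
  | smul r v _ hv =>
    obtain ⟨c, hc, t, ht, h⟩ := hv
    exact ⟨c, hc, t, ht, by rw [map_smul, h, smul_zero]⟩

/-- A section with zero fibres is zero. Near each `y` some `t` equals `1` and kills `v`, so `1 - t`
vanishes near `y` and fixes `v`. By compactness a finite product of these vanishes on the polydisc
that carries `v`; it then kills `v`, while fixing it. -/
theorem IsSmoothStage.eq_zero_of_forall_mem_polarKernel {v : E}
    (hv : ∀ y, v ∈ polarKernel ψ π y) : v = 0 := by
  obtain ⟨d, hd, hd'⟩ := hπ.exists_fixed ψ v
  have h1 : ∃ t : MonoidAlgebra ℂ (polarSubgroup F (m + 1)),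
      (∀ z ∈ box d (0 : Fin (m + 1) → F), polarEval ψ z t = 0) ∧
        (polarRestrict π).asAlgebraHom t v = v := by
    refine (isCompact_box d 0).induction_on (p := fun S => ∃ t : MonoidAlgebra ℂ _,
      (∀ z ∈ S, polarEval ψ z t = 0) ∧ (polarRestrict π).asAlgebraHom t v = v) ?_ ?_ ?_ ?_
    · exact ⟨1, fun z hz => hz.elim, by rw [map_one]; rfl⟩
    · rintro s t hst ⟨x, hx, hx'⟩
      exact ⟨x, fun z hz => hx z (hst hz), hx'⟩
    · rintro s t ⟨x, hx, hx'⟩ ⟨x', h, h'⟩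
      refine ⟨x * x', fun z hz => ?_, ?_⟩
      · rw [map_mul]
        rcases hz with hz | hz
        · rw [hx z hz, zero_mul]
        · rw [h z hz, mul_zero]
      · rw [map_mul, Module.End.mul_apply, h', hx']
    · intro y _
      obtain ⟨c, hc, t, ht, h⟩ := hπ.exists_of_mem_polarKernel ψ (hv y)
      refine ⟨box c y, mem_nhdsWithin_of_mem_nhds (box_mem_nhds hc y), 1 - t, fun z hz => ?_, ?_⟩
      · rw [map_sub, map_one, ht z hz, sub_self]
      · rw [map_sub, map_one, LinearMap.sub_apply, h, sub_zero]; rfl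
  obtain ⟨t, ht, h⟩ := h1
  rw [← h]
  exact asAlgebraHom_apply_eq_zero ψ (polarRestrict π) hd' ht

-- Translation by `a⁻¹` carries the fibre at the jet of `1` to the fibre at the jet of `a`.
omit hπ in
theorem polarKernel_of_orbitMap_eq_zero {v : E} {a : F⟦X⟧ˣ} (h : orbitMap ψ π v a = 0) :
    v ∈ polarKernel ψ π (jet m a) := by
  have h1 : π (unitElem _ a) v ∈ polarKernel ψ π (jet m 1) := (Submodule.Quotient.mk_eq_zero _).1 h
  have h2 : ∀ w ∈ polarKernel ψ π (jet m 1), π (unitElem _ a⁻¹) w ∈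
      polarKernel ψ π (jet m a) := fun w hw => by
    induction hw using Submodule.span_induction with
    | mem w hw =>
      obtain ⟨b, w, rfl⟩ := hw
      obtain ⟨b', hb', e⟩ := unitElem_mul_eq a⁻¹ b.1
      rw [show (b.1 : HInf F).unit = 1 from b.2, one_mul] at e
      refine Submodule.subset_span ⟨b', π (unitElem _ a⁻¹) w, ?_⟩
      rw [map_sub, map_smul, polarRestrict_apply, polarRestrict_apply, ← Module.End.mul_apply,
        ← map_mul, e, map_mul, Module.End.mul_apply]
      congr 2
      have h3 := residue_smul_polar b.1 (1 : F⟦X⟧ˣ)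
      have h4 := residue_smul_polar b'.1 a
      rw [hb', smul_smul, Units.mul_inv, ← Units.val_one, h3] at h4
      exact congrArg ψ.toAddChar h4
    | zero => rw [map_zero]; exact zero_mem _
    | add v w _ _ hv hw => rw [map_add]; exact add_mem hv hw
    | smul c v _ hv => rw [map_smul]; exact Submodule.smul_mem _ c hv
  have h3 := h2 _ h1
  rwa [← Module.End.mul_apply, ← map_mul, ← unitElem_mul, inv_mul_cancel, unitElem_one, map_one] at h3

-- If `y_0 = 0`, the character `χ_y` is trivial on `B_1`, so the defining relations of `cuspPart`
-- are among those of the `χ_y`-coinvariants.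
omit hπ in
theorem cuspPart_le_polarKernel {y : Fin (m + 1) → F} (hy : y 0 = 0) :
    cuspPart π ≤ polarKernel ψ π y := by
  refine Submodule.span_mono ?_
  rintro _ ⟨b, w, rfl⟩
  refine ⟨cornerIncl m b, w, ?_⟩
  have h1 : polarChar ψ y (cornerIncl m b) = 1 := by
    rw [polarChar_apply, Finset.sum_eq_zero, AddChar.map_zero_eq_one]
    intro i _
    refine Fin.cases ?_ (fun i => ?_) i
    · rw [hy, zero_mul]
    · rw [polarCoeff_cornerIncl_succ, mul_zero]
  rw [h1, one_smul, cornerRestrict_apply, polarRestrict_apply]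

/-- The fibres over `y_0 = 0` vanish because `v` lies in `cuspPart`. Every other `y` is the jet of a
unit `a`, and there the fibre vanishes because the orbit function does. -/
theorem IsSmoothStage.eq_zero_of_orbitMap {v : E} (hv : v ∈ cuspPart π)
    (h : orbitMap ψ π v = 0) : v = 0 := by
  refine hπ.eq_zero_of_forall_mem_polarKernel ψ fun y => ?_
  by_cases hy : y 0 = 0
  · exact cuspPart_le_polarKernel ψ hy hv
  · obtain ⟨a, rfl⟩ := jet_surj m hy
    exact polarKernel_of_orbitMap_eq_zero ψ (congrFun h a)

end Stage

/-! ### The image of the cuspidal part of a smooth stage is `L ⊗ M_m`. -/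

section Stage
open Topology ValuativeRel MeasureRep
open scoped TensorProduct
variable {F : Type u} [Field F] [ValuativeRel F] [TopologicalSpace F] [IsNonarchimedeanLocalField F]
  (ψ : ResidualChar F) {m : ℕ} {E : Type w} [AddCommGroup E] [Module ℂ E]
  {π : Representation ℂ (HInf.level F (m + 1)) E}

theorem exists_polarEval_eq_iUnion {n : ℕ} (s : Finset (Fin n → F)) (c : (Fin n → F) → F)
    (hc : ∀ y ∈ s, c y ≠ 0) {K : Set (Fin n → F)} (hK : IsCompact K) :
    ∃ t : MonoidAlgebra ℂ (polarSubgroup F n), (∀ z ∈ ⋃ y ∈ s, box (c y) y, polarEval ψ z t = 1) ∧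
      ∀ z ∈ K, z ∉ ⋃ y ∈ s, box (c y) y → polarEval ψ z t = 0 := by
  classical
  induction s using Finset.induction_on with
  | empty => exact ⟨0, fun z hz => by simp at hz, fun z _ _ => map_zero _⟩
  | insert y s hy ih =>
    obtain ⟨t, ht, ht'⟩ := ih fun y hy => hc y (Finset.mem_insert_of_mem hy)
    obtain ⟨x, hx, hx'⟩ := exists_polarEval_eq_indicator ψ hK (hc y (Finset.mem_insert_self y s)) y
    -- Inclusion–exclusion: `t + x - t x = 1 - (1 - t)(1 - x)` is the indicator of a union.
    refine ⟨t + x - t * x, fun z hz => ?_, fun z hz hz' => ?_⟩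
    · rw [Finset.set_biUnion_insert] at hz
      rw [map_sub, map_add, map_mul]
      rcases hz with hz | hz
      · rw [hx z hz]; ring
      · rw [ht z hz]; ring
    · rw [Finset.set_biUnion_insert, Set.mem_union, not_or] at hz'
      rw [map_sub, map_add, map_mul, hx' z hz hz'.1, ht' z hz hz'.2]; ring

variable (hπ : IsSmoothStage π)
include hπ

/-- Local solutions are patched by trigonometric polynomials: `v + t (w - v)` agrees with `w` on the
new polydisc, where `t` is `1`, and with `v` on the rest of the old ones, where `t` is `0`. -/
theorem IsSmoothStage.exists_orbitMap_eq_on (s : Finset (Fin (m + 1) → F))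
    (c : (Fin (m + 1) → F) → F) (f : (Fin (m + 1) → F) → StageQuot ψ π)
    (h : ∀ y ∈ s, ∃ v, ∀ a, jet m a ∈ box (c y) y → orbitMap ψ π v a = f (jet m a))
    (hc : ∀ y ∈ s, c y ≠ 0) : ∃ v, ∀ a, jet m a ∈ ⋃ y ∈ s, box (c y) y →
      orbitMap ψ π v a = f (jet m a) := by
  classical
  induction s using Finset.induction_on with
  | empty => exact ⟨0, fun a ha => by simp at ha⟩
  | insert y s hy ih =>
    obtain ⟨v, hv⟩ := ih (fun y hy => h y (Finset.mem_insert_of_mem hy))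
      fun y hy => hc y (Finset.mem_insert_of_mem hy)
    obtain ⟨w, hw⟩ := h y (Finset.mem_insert_self y s)
    obtain ⟨t, ht, ht'⟩ := exists_polarEval_eq_indicator ψ
      (s.isCompact_biUnion fun y _ => isCompact_box (c y) y) (hc y (Finset.mem_insert_self y s)) y
    refine ⟨v + (polarRestrict π).asAlgebraHom t (w - v), fun a ha => ?_⟩
    rw [map_add, Pi.add_apply, orbitMap_polar_asAlgebraHom, map_sub, Pi.sub_apply]
    rw [Finset.set_biUnion_insert] at ha
    by_cases ha' : jet m a ∈ box (c y) y
    · rw [ht _ ha', hw a ha', one_smul, add_sub_cancel]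
    · have ha'' := ha.resolve_left ha'
      rw [ht' _ ha'' ha', hv a ha'', zero_smul, add_zero]

/-- Near `a₀` the orbit function of `a₀⁻¹ w₀` is constant with value `l`, the class of `w₀`, by
smoothness in the unit variable. Multiples of such vectors solve the problem locally. The solutions
are glued over the support of `φ`, cut off outside it, and finally moved into `cuspPart`. -/
theorem IsSmoothStage.exists_orbitMap_eq_smul (φ : schwartzUnits F m) (l : StageQuot ψ π) :
    ∃ v ∈ cuspPart π, ∀ a, orbitMap ψ π v a = (φ : F⟦X⟧ˣ → ℂ) a • l := by
  obtain ⟨g, hg, hφ⟩ := mem_schwartzUnits.1 φ.2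
  obtain ⟨w₀, rfl⟩ := Submodule.mkQ_surjective _ l
  set l := (polarKernel ψ π (jet m 1)).mkQ w₀ with hl
  have hloc : ∀ y ∈ tsupport g, ∃ c : F, c ≠ 0 ∧ ∃ v, ∀ a, jet m a ∈ box c y →
      orbitMap ψ π v a = g (jet m a) • l := fun y hy => by
    have hy0 : y 0 ≠ 0 := fun h0 => tsupport_jets hg hy (hg.2.2 y h0)
    obtain ⟨a₀, rfl⟩ := jet_surj m hy0
    obtain ⟨c, hc, h⟩ := hπ.exists_unit (π (unitElem _ a₀⁻¹) w₀) a₀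
    obtain ⟨c', hc', h'⟩ := (nhds_basis_box (jet m a₀)).eventually_iff.1
      ((IsLocallyConstant.iff_eventually_eq _).1 hg.1 (jet m a₀))
    have key : ∀ a, jet m a ∈ box c (jet m a₀) → jet m a ∈ box c' (jet m a₀) →
        orbitMap ψ π (g (jet m a₀) • π (unitElem _ a₀⁻¹) w₀) a = g (jet m a) • l := fun a h₁ h₂ => by
      rw [map_smul, Pi.smul_apply, orbitMap_apply, h a h₁, h' h₂, ← Module.End.mul_apply, ← map_mul,
        ← unitElem_mul, mul_inv_cancel, unitElem_one, map_one]
      rfl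
    rcases le_total (valuation F c) (valuation F c') with hle | hle
    · exact ⟨c, hc, _, fun a ha => key a ha (box_mono hle _ ha)⟩
    · exact ⟨c', hc', _, fun a ha => key a (box_mono hle _ ha) ha⟩
  choose! c hc hv using hloc
  have hK : IsCompact (tsupport g) := hg.2.1
  obtain ⟨s, hs, hcov⟩ := hK.elim_nhds_subcover (fun y => box (c y) y)
    fun y hy => box_mem_nhds (hc y hy) y
  obtain ⟨v, hv⟩ := hπ.exists_orbitMap_eq_on ψ s c (fun y => g y • l) (fun y hy => hv y (hs y hy))
    fun y hy => hc y (hs y hy)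
  obtain ⟨d, hd, hvd⟩ := hπ.orbitMap_support ψ v
  obtain ⟨t, ht, ht'⟩ := exists_polarEval_eq_iUnion ψ s c (fun y hy => hc y (hs y hy))
    (isCompact_box d 0)
  have h1 : ∀ a, orbitMap ψ π ((polarRestrict π).asAlgebraHom t v) a =
      (φ : F⟦X⟧ˣ → ℂ) a • l := fun a => by
    rw [orbitMap_polar_asAlgebraHom, hφ]
    by_cases ha : jet m a ∈ ⋃ y ∈ s, box (c y) y
    · rw [ht _ ha, hv a ha, one_smul]
    · rw [show g (jet m a) = 0 from by
        by_contra h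
        exact ha (hcov (subset_tsupport g h)), zero_smul]
      by_cases hva : orbitMap ψ π v a = 0
      · rw [hva, smul_zero]
      · rw [ht' _ (hvd a hva) ha, zero_smul]
  obtain ⟨ε, hε, hφε⟩ := exists_lt_of_ne_zero φ
  obtain ⟨K, hK, hKφ⟩ := exists_isCompact_support (Nat.zero_le m) φ
  -- Write `v'` for the vector found so far. The element `x` has augmentation `1`, so `v' - x v'`
  -- lies in `cuspPart`. On the support of `φ` it evaluates to `0`, as `|a_0| > |ε|` there, so
  -- subtracting `x v'` does not change the orbit function.
  obtain ⟨x, hx, hx'⟩ := exists_polarEval_eq_indicator ψ hK hε 0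
  have h2 := cornerRestrict_sub_mem ψ π x ((polarRestrict π).asAlgebraHom t v)
  rw [hx _ (mem_box_self _ _), one_smul] at h2
  refine ⟨_, neg_mem h2, fun a => ?_⟩
  rw [map_neg, Pi.neg_apply, map_sub, Pi.sub_apply, orbitMap_corner_asAlgebraHom, h1, neg_sub]
  by_cases ha : (φ : F⟦X⟧ˣ → ℂ) a = 0
  · rw [ha, zero_smul, smul_zero, sub_zero]
  · rw [hx' _ (hKφ a ha), zero_smul, sub_zero]
    intro h
    have h3 := h 0
    rw [Pi.zero_apply, sub_zero] at h3
    exact absurd (hφε a ha) (not_lt.2 h3)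

/-- The orbit function depends only on the `m`-jet, is locally constant, has bounded support and
vanishes near `y_0 = 0`. It therefore takes finitely many values and is a finite sum of terms `l ⊗
1_{g = l}`. -/
theorem IsSmoothStage.exists_tensorEval_eq {v : E} (hv : v ∈ cuspPart π) :
    ∃ z : StageQuot ψ π ⊗[ℂ] schwartzUnits F m, ∀ a,
      tensorEval (schwartzUnits F m) _ a z = orbitMap ψ π v a := by
  classical
  obtain ⟨d, hd, hvd⟩ := hπ.orbitMap_support ψ v
  obtain ⟨ε, hε, hvε⟩ := orbitMap_eq_zero_of_cuspPart ψ hv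
  let g : (Fin (m + 1) → F) → StageQuot ψ π := fun y =>
    if h : y 0 ≠ 0 then orbitMap ψ π v (jet_surj m h).choose else 0
  have hg : ∀ a, g (jet m a) = orbitMap ψ π v a := fun a => by
    have h0 := jet_zero_ne m a
    obtain ⟨c, hc, h⟩ := hπ.exists_unit v a
    rw [show g (jet m a) = orbitMap ψ π v (jet_surj m h0).choose from dif_pos h0, orbitMap_apply,
      orbitMap_apply, h _ (by rw [(jet_surj m h0).choose_spec]; exact mem_box_self _ _)]
  have hg0 : ∀ y, y 0 = 0 → g y = 0 := fun y hy => dif_neg (not_not.2 hy)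
  have hgd : ∀ y, g y ≠ 0 → y ∈ box d 0 := fun y hy => by
    by_cases h0 : y 0 = 0
    · exact absurd (hg0 y h0) hy
    · obtain ⟨a, rfl⟩ := jet_surj m h0
      rw [hg] at hy
      exact hvd a hy
  have hgl : IsLocallyConstant g := by
    rw [IsLocallyConstant.iff_eventually_eq]
    intro y
    by_cases h0 : y 0 = 0
    · refine (nhds_basis_box y).eventually_iff.2 ⟨ε, hε, fun z hz => ?_⟩
      rw [hg0 y h0]
      by_cases hz0 : z 0 = 0
      · exact hg0 z hz0
      · obtain ⟨a, rfl⟩ := jet_surj m hz0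
        rw [hg]
        refine hvε a fun i => ?_
        obtain rfl : i = 0 := Fin.ext (by omega)
        have := hz 0
        rw [h0] at this
        exact this
    · obtain ⟨a, rfl⟩ := jet_surj m h0
      obtain ⟨c, hc, h⟩ := hπ.exists_unit v a
      have := t2Space_localField F
      have h1 : ∀ᶠ z : Fin (m + 1) → F in 𝓝 (jet m a), z 0 ≠ 0 :=
        (continuous_apply (0 : Fin (m + 1))).continuousAt.eventually_ne h0
      filter_upwards [h1, box_mem_nhds hc (jet m a)] with z hz hz'
      obtain ⟨b, rfl⟩ := jet_surj m hz
      rw [hg, hg, orbitMap_apply, orbitMap_apply, h b hz']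
  have hfin : (Set.range g).Finite := by
    have hcov := (isCompact_box d (0 : Fin (m + 1) → F)).elim_finite_subcover
      (fun l : StageQuot ψ π => g ⁻¹' {l}) (fun l => hgl _)
      (fun y _ => Set.mem_iUnion.2 ⟨g y, rfl⟩)
    obtain ⟨t, ht⟩ := hcov
    refine (Set.Finite.insert 0 t.finite_toSet).subset ?_
    rintro _ ⟨y, rfl⟩
    by_cases hy : g y = 0
    · exact Or.inl hy
    · obtain ⟨l, hl, h⟩ := Set.mem_iUnion₂.1 (ht (hgd y hy))
      exact Or.inr (by rwa [show g y = l from h])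
  have hind : ∀ l : StageQuot ψ π, l ≠ 0 →
      (fun a => if g (jet m a) = l then (1 : ℂ) else 0) ∈ schwartzUnits F m := fun l hl => by
    refine mem_schwartzUnits.2 ⟨fun y => if g y = l then 1 else 0,
      ⟨hgl.comp fun z => if z = l then (1 : ℂ) else 0, ?_, fun y hy => ?_⟩, fun a => rfl⟩
    · have := t2Space_localField F
      refine HasCompactSupport.intro (isCompact_box d 0) fun y hy => if_neg fun h => ?_
      exact hy (hgd y (by rw [h]; exact hl))
    · refine if_neg ?_
      rw [hg0 y hy]
      exact hl.symm
  refine ⟨∑ l ∈ (hfin.toFinset.erase 0).attach, l.1 ⊗ₜ[ℂ]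
    (⟨_, hind l.1 (Finset.ne_of_mem_erase l.2)⟩ : schwartzUnits F m), fun a => ?_⟩
  rw [map_sum]
  simp only [tensorEval_tmul]
  rw [Finset.sum_attach (hfin.toFinset.erase 0)
    (fun l => (if g (jet m a) = l then (1 : ℂ) else 0) • l), ← hg]
  by_cases h0 : g (jet m a) = 0
  · rw [h0]
    refine Finset.sum_eq_zero fun l hl => ?_
    rw [if_neg (Finset.ne_of_mem_erase hl).symm, zero_smul]
  · rw [Finset.sum_eq_single (g (jet m a)), if_pos rfl, one_smul]
    · intro l _ hl
      rw [if_neg hl.symm, zero_smul]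
    · intro h
      exact absurd (Finset.mem_erase.2 ⟨h0, hfin.mem_toFinset.2 ⟨_, rfl⟩⟩) h

omit hπ in
theorem tensorEval_repOn {k n : ℕ} (hn : n ≤ k + 1) (h : HInf.level F n) (x : F⟦X⟧ˣ) {L : Type*}
    [AddCommGroup L] [Module ℂ L] (z : L ⊗[ℂ] schwartzUnits F k) :
    tensorEval (schwartzUnits F k) L x (TensorProduct.map LinearMap.id (repOn ψ hn h) z) =
      ψ.toAddChar (PolarParts.residue F ((x : F⟦X⟧) • (h : HInf F).polar)) •
        tensorEval (schwartzUnits F k) L ((h : HInf F).unit * x) z := by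
  induction z using TensorProduct.induction_on with
  | zero => simp
  | add z z' hz hz' => simp only [map_add, hz, hz', smul_add]
  | tmul l f =>
    rw [TensorProduct.map_tmul, tensorEval_tmul, tensorEval_tmul, repOn_coe, act_apply, smul_smul]
    rfl

/-- The part of a smooth stage generated by the `b w - w`, `b ∈ B_1`, is `L ⊗ M_m`. -/
theorem IsSmoothStage.exists_equiv : ∃ e : cuspPart π ≃ₗ[ℂ] StageQuot ψ π ⊗[ℂ] schwartzUnits F m,
    ∀ h v, e ⟨π h v.1, rep_mem_cuspPart π h v.2⟩ =
      TensorProduct.map LinearMap.id (repOn ψ le_rfl h) (e v) := by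
  -- Both spaces embed into the functions from `O^*` to `StageQuot ψ π`, by evaluations and by
  -- `orbitMap`, and they have the same image there.
  let J : StageQuot ψ π ⊗[ℂ] schwartzUnits F m →ₗ[ℂ] F⟦X⟧ˣ → StageQuot ψ π :=
    LinearMap.pi fun a => tensorEval (schwartzUnits F m) _ a
  let Φ : cuspPart π →ₗ[ℂ] F⟦X⟧ˣ → StageQuot ψ π := (orbitMap ψ π).domRestrict (cuspPart π)
  have hJ : Function.Injective J := fun x y h => tensorEval_injective _ fun a => congrFun h a
  have hΦ : Function.Injective Φ := by
    rw [injective_iff_map_eq_zero]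
    exact fun v hv => Subtype.ext (hπ.eq_zero_of_orbitMap ψ v.2 hv)
  have hr : LinearMap.range Φ = LinearMap.range J := by
    apply le_antisymm
    · rintro _ ⟨v, rfl⟩
      obtain ⟨z, hz⟩ := hπ.exists_tensorEval_eq ψ v.2
      exact ⟨z, funext hz⟩
    · rintro _ ⟨z, rfl⟩
      induction z using TensorProduct.induction_on with
      | zero => rw [map_zero]; exact zero_mem _
      | add z z' hz hz' => rw [map_add]; exact add_mem hz hz'
      | tmul l f =>
        obtain ⟨v, hv, h⟩ := hπ.exists_orbitMap_eq_smul ψ f l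
        exact ⟨⟨v, hv⟩, funext fun a => (h a).trans (tensorEval_tmul _ a l f).symm⟩
  let e := ((LinearEquiv.ofInjective Φ hΦ).trans (LinearEquiv.ofEq _ _ hr)).trans
    (LinearEquiv.ofInjective J hJ).symm
  have he : ∀ v a, tensorEval (schwartzUnits F m) _ a (e v) = orbitMap ψ π v.1 a := fun v a => by
    have h1 : LinearEquiv.ofInjective J hJ (e v) =
        LinearEquiv.ofEq _ _ hr (LinearEquiv.ofInjective Φ hΦ v) :=
      LinearEquiv.apply_symm_apply _ _
    exact congrFun (congrArg Subtype.val h1) a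
  refine ⟨e, fun h v => tensorEval_injective _ fun a => ?_⟩
  rw [he, tensorEval_repOn, orbitMap_rep, he]

end Stage

/-! ### Spaces of translates, which turn the action on a pro-vector space into smooth stages. -/

section Translates
variable {G : Type*} [Group G] {A : Type*} [AddCommGroup A] [Module ℂ A]

variable (G A) in
/-- Right translation of functions on a group. -/
def rightTranslation : Representation ℂ G (G → A) where
  toFun h := LinearMap.funLeft ℂ A (fun g => g * h)
  map_one' := LinearMap.ext fun f => funext fun g => congrArg f (mul_one g)
  map_mul' h h' := LinearMap.ext fun f => funext fun g => congrArg f (mul_assoc g h h').symm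

theorem rightTranslation_apply (h : G) (f : G → A) (g : G) :
    rightTranslation G A h f g = f (g * h) := rfl

/-- The span of the translates of a space of functions. -/
def translateSpan {B : Type*} [AddCommGroup B] [Module ℂ B] (φ : B →ₗ[ℂ] G → A) :
    Submodule ℂ (G → A) :=
  Submodule.span ℂ {f | ∃ h w, f = rightTranslation G A h (φ w)}

theorem rightTranslation_mem {B : Type*} [AddCommGroup B] [Module ℂ B] (φ : B →ₗ[ℂ] G → A) (h : G)
    {f : G → A} (hf : f ∈ translateSpan φ) : rightTranslation G A h f ∈ translateSpan φ := by
  induction hf using Submodule.span_induction with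
  | mem f hf =>
    obtain ⟨h', w, rfl⟩ := hf
    exact Submodule.subset_span ⟨h * h', w, by rw [map_mul, Module.End.mul_apply]⟩
  | zero => rw [map_zero]; exact zero_mem _
  | add v w _ _ hv hw => rw [map_add]; exact add_mem hv hw
  | smul c v _ hv => rw [map_smul]; exact Submodule.smul_mem _ c hv

/-- The representation by translations on `translateSpan`. -/
def translateRep {B : Type*} [AddCommGroup B] [Module ℂ B] (φ : B →ₗ[ℂ] G → A) :
    Representation ℂ G (translateSpan φ) where
  toFun h := (rightTranslation G A h).restrict fun _ hf => rightTranslation_mem φ h hf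
  map_one' := LinearMap.ext fun f => Subtype.ext (by
    rw [LinearMap.restrict_coe_apply, map_one]; rfl)
  map_mul' h h' := LinearMap.ext fun f => Subtype.ext (by
    rw [LinearMap.restrict_coe_apply, map_mul]; rfl)

/-- The inclusion of the generating functions. -/
def translateIncl {B : Type*} [AddCommGroup B] [Module ℂ B] (φ : B →ₗ[ℂ] G → A) :
    B →ₗ[ℂ] translateSpan φ :=
  φ.codRestrict _ fun w => Submodule.subset_span ⟨1, w, by rw [map_one]; rfl⟩

/-- The value at the identity. -/
def translateEval {B : Type*} [AddCommGroup B] [Module ℂ B] (φ : B →ₗ[ℂ] G → A) :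
    translateSpan φ →ₗ[ℂ] A := (LinearMap.proj 1).comp (Submodule.subtype _)

end Translates

section Box
open ValuativeRel Topology
variable {F : Type u} [Field F] [ValuativeRel F] [TopologicalSpace F] [IsNonarchimedeanLocalField F]

theorem exists_box_of_isLocallyConstant {m n : ℕ} {A : Type*} {f : HInf.level F n → A}
    (hf : @IsLocallyConstant _ _ (HInf.depthTopology m n) f) (g₀ : HInf.level F n) :
    ∃ c : F, c ≠ 0 ∧ ∀ g : HInf.level F n,
      jet m (g : HInf F).unit ∈ box c (jet m (g₀ : HInf F).unit) →
        polarCoeff g ∈ box c (polarCoeff g₀) → f g = f g₀ := by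
  let _ := HInf.depthTopology (F := F) m n
  have h1 := (IsLocallyConstant.iff_eventually_eq _).1 hf g₀
  rw [nhds_induced, Filter.eventually_comap] at h1
  have h2 : (𝓝 (HInf.coords m n g₀)) = 𝓝 (jet m (g₀ : HInf F).unit) ×ˢ 𝓝 (polarCoeff g₀) :=
    nhds_prod_eq
  rw [h2] at h1
  obtain ⟨⟨c, c'⟩, ⟨hc, hc'⟩, h⟩ :=
    ((nhds_basis_box (jet m (g₀ : HInf F).unit)).prod
      (nhds_basis_box (polarCoeff g₀))).eventually_iff.1 h1
  have key : ∀ g : HInf.level F n, jet m (g : HInf F).unit ∈ box c (jet m (g₀ : HInf F).unit) →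
      polarCoeff g ∈ box c' (polarCoeff g₀) → f g = f g₀ := fun g h1 h2 =>
    h (x := (jet m (g : HInf F).unit, polarCoeff g)) ⟨h1, h2⟩ g rfl
  rcases le_total (valuation F c) (valuation F c') with hle | hle
  · exact ⟨c, hc, fun g h1 h2 => key g h1 (box_mono hle _ h2)⟩
  · exact ⟨c', hc', fun g h1 h2 => key g (box_mono hle _ h1) h2⟩

theorem isSmoothStage_of_span_eq_top {m : ℕ} {E : Type*} [AddCommGroup E] [Module ℂ E]
    {π : Representation ℂ (HInf.level F (m + 1)) E} {S : Set E} (hS : Submodule.span ℂ S = ⊤)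
    (h₁ : ∀ v ∈ S, ∃ d : F, d ≠ 0 ∧ ∀ b : polarSubgroup F (m + 1),
      (∀ i, valuation F (polarCoeff b.1 i * d) < 1) → π b.1 v = v)
    (h₂ : ∀ v ∈ S, ∀ a₀ : F⟦X⟧ˣ, ∃ c : F, c ≠ 0 ∧ ∀ a, jet m a ∈ box c (jet m a₀) →
      π (unitElem _ a) v = π (unitElem _ a₀) v) : IsSmoothStage π where
  exists_polar v := by
    have hv : v ∈ Submodule.span ℂ S := by rw [hS]; trivial
    induction hv using Submodule.span_induction with
    | mem v hv => exact h₁ v hv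
    | zero => exact ⟨1, one_ne_zero, fun b _ => map_zero _⟩
    | add v w _ _ hv hw =>
      obtain ⟨d, hd, h⟩ := hv
      obtain ⟨d', hd', h'⟩ := hw
      have hlt : ∀ {d d' x : F}, valuation F d ≤ valuation F d' → valuation F (x * d') < 1 →
          valuation F (x * d) < 1 := fun hle hx => by
        rw [map_mul] at hx ⊢
        exact lt_of_le_of_lt (mul_le_mul_right hle _) hx
      rcases le_total (valuation F d) (valuation F d') with hle | hle
      · exact ⟨d', hd', fun b hb => by rw [map_add, h b fun k => hlt hle (hb k), h' b hb]⟩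
      · exact ⟨d, hd, fun b hb => by rw [map_add, h' b fun k => hlt hle (hb k), h b hb]⟩
    | smul r v _ hv =>
      obtain ⟨d, hd, h⟩ := hv
      exact ⟨d, hd, fun b hb => by rw [map_smul, h b hb]⟩
  exists_unit v a₀ := by
    have hv : v ∈ Submodule.span ℂ S := by rw [hS]; trivial
    induction hv using Submodule.span_induction with
    | mem v hv => exact h₂ v hv a₀
    | zero => exact ⟨1, one_ne_zero, fun b _ => (map_zero _).trans (map_zero _).symm⟩
    | add v w _ _ hv hw =>
      obtain ⟨d, hd, h⟩ := hv
      obtain ⟨d', hd', h'⟩ := hw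
      rcases le_total (valuation F d) (valuation F d') with hle | hle
      · exact ⟨d, hd, fun a ha => by rw [map_add, map_add, h a ha, h' a (box_mono hle _ ha)]⟩
      · exact ⟨d', hd', fun a ha => by rw [map_add, map_add, h' a ha, h a (box_mono hle _ ha)]⟩
    | smul r v _ hv =>
      obtain ⟨d, hd, h⟩ := hv
      exact ⟨d, hd, fun a ha => by rw [map_smul, map_smul, h a ha]⟩

end Box

namespace SmoothRep
open Filter ProVect ValuativeRel MeasureRep
variable {F : Type u} [Field F] [ValuativeRel F] [TopologicalSpace F] [IsNonarchimedeanLocalField F]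
  (V : SmoothRep F)

/-- The function `g ↦ g w` on `O^* ⋉ B_n`. -/
noncomputable def actFun (n j i : ℕ) : V.space.obj i →ₗ[ℂ] HInf.level F n → V.space.obj j :=
  LinearMap.pi fun g => V.act n j i g

theorem actFun_apply (n j i : ℕ) (w : V.space.obj i) (g : HInf.level F n) :
    V.actFun n j i w g = V.act n j i g w := rfl

theorem exists_act_zero_eq (j : ℕ) : ∃ m, ∀ᶠ i in atTop, ∀ u : F⟦X⟧ˣ, jet m u = jet m 1 → ∀ x,
    V.act 0 j i (unitElem 0 u : HInf.level F 0) x =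
      V.act 0 j i (unitElem 0 1 : HInf.level F 0) x := by
  obtain ⟨m, hm⟩ := V.isLocallyConstant_act 0 j
  refine ⟨m, hm.mono fun i h u hu x => ?_⟩
  obtain ⟨c, hc, e⟩ := exists_box_of_isLocallyConstant (h x) (unitElem 0 1)
  refine e (unitElem 0 u) ?_ fun k => k.elim0
  rw [unitElem_unit, unitElem_unit, hu]
  exact mem_box_self _ _

/-- The depth to which `O^*` acts on `V_j`. -/
noncomputable def unitDepth (j : ℕ) : ℕ := (V.exists_act_zero_eq j).choose

/-- The depth in the smoothness of `V.ρ n` may grow with `n`. The action of a unit on `V_j` is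
already determined at level `0`, so `unitDepth j` serves for all `n`; this is what permits the
choice `n = m + 1`. -/
theorem act_unitElem_mul (n : ℕ) {j m : ℕ} (hm : V.unitDepth j ≤ m) : ∀ᶠ i in atTop,
    ∀ u : F⟦X⟧ˣ, jet m u = jet m 1 → ∀ g : HInf.level F n, ∀ w : V.space.obj i,
      V.act n j i (unitElem n u * g : HInf.level F n) w = V.act n j i g w := by
  obtain ⟨i₁, h₀, h₁, hr⟩ := (((V.exists_act_zero_eq j).choose_spec).and
    ((V.act_mono (Nat.zero_le n) j).and (eventually_ge_atTop (V.ridx n j)))).exists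
  filter_upwards [V.act_mul n j hr] with i e u hu g w
  have e₁ := e (unitElem n u : HInf.level F n) (unitElem n u).2 g g.2 w
  have e₂ := e 1 (one_mem _) g g.2 w
  rw [one_mul] at e₂
  rw [Subgroup.coe_mul, e₁, e₂]
  have h₂ := h₁ (unitElem 0 u : HInf.level F 0) (unitElem 0 u).2 (V.act n i₁ i g w)
  have h₃ := h₁ 1 (one_mem _) (V.act n i₁ i g w)
  exact h₂.trans ((h₀ u (jet_eq_of_jet_eq hm hu) _).trans h₃.symm)

theorem act_mul_mul (n j : ℕ) : ∃ i', ∀ᶠ i'' in atTop, ∀ᶠ i in atTop,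
    ∀ (g x h : HInf.level F n) (w : V.space.obj i), V.act n j i (g * x * h : HInf.level F n) w =
      V.act n j i' g (V.act n i' i'' x (V.act n i'' i h w)) := by
  refine ⟨V.ridx n j, (eventually_ge_atTop (V.ridx n (V.ridx n j))).mono fun i'' hi'' => ?_⟩
  filter_upwards [V.act_mul n j le_rfl, V.act_mul n (V.ridx n j) hi''] with i e e' g x h w
  rw [mul_assoc, Subgroup.coe_mul, e g g.2 _ (x * h).2, Subgroup.coe_mul, e' x x.2 h h.2]

/-- A unit congruent to `1` modulo `t^(m+1)` acts trivially on `B_(m+1)`, so it is central in `O^* ⋉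
B_(m+1)`. -/
theorem unitElem_mul_comm {m : ℕ} {u : F⟦X⟧ˣ} (hu : jet m u = jet m 1)
    (g : HInf.level F (m + 1)) : g * unitElem _ u = unitElem _ u * g := by
  refine Subtype.ext (HInf.ext' ?_ ?_)
  · rw [Subgroup.coe_mul, Subgroup.coe_mul, HInf.polar_mul, HInf.polar_mul, unitElem_polar,
      smul_zero, add_zero, zero_add, unitElem_unit]
    obtain ⟨q, hq⟩ : (PowerSeries.X ^ (m + 1) : F⟦X⟧) ∣ (u : F⟦X⟧) - 1 := by
      rw [PowerSeries.X_pow_dvd_iff]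
      intro i hi
      rw [map_sub, sub_eq_zero]
      exact coeff_eq_of_jet_eq hu (Nat.lt_succ_iff.1 hi)
    rw [show (u : F⟦X⟧) = 1 + q * PowerSeries.X ^ (m + 1) by rw [mul_comm q, ← hq]; ring, add_smul,
      one_smul, mul_smul, X_pow_smul_polar g, smul_zero, add_zero]
  · rw [Subgroup.coe_mul, Subgroup.coe_mul, HInf.unit_mul, HInf.unit_mul, unitElem_unit, mul_comm]

/-- The depth `m'` supplied by smoothness may exceed `m`. A factor `u` that is trivial to order `m`
replaces the coefficients of `a` beyond `m` by those of `a₀`. -/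
theorem exists_jet_mul {m m' : ℕ} {c : F} {a a₀ : F⟦X⟧ˣ}
    (h : jet m a ∈ box c (jet m a₀)) : ∃ u, jet m u = jet m 1 ∧
      jet m' (a * u) ∈ box c (jet m' a₀) := by
  let y : Fin (max m m' + 1) → F := fun i => if (i : ℕ) ≤ m then PowerSeries.coeff (i : ℕ) (a : F⟦X⟧)
    else PowerSeries.coeff (i : ℕ) (a₀ : F⟦X⟧)
  have hy : y 0 ≠ 0 := by
    rw [show y 0 = jet m a 0 from if_pos (Nat.zero_le _)]
    exact jet_zero_ne m a
  obtain ⟨a', ha'⟩ := jet_surj _ hy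
  have hc : ∀ i, i ≤ max m m' → PowerSeries.coeff i (a' : F⟦X⟧) = if i ≤ m then
      PowerSeries.coeff i (a : F⟦X⟧) else PowerSeries.coeff i (a₀ : F⟦X⟧) := fun i hi =>
    congrFun ha' ⟨i, Nat.lt_succ_of_le hi⟩
  refine ⟨a' * a⁻¹, ?_, ?_⟩
  · rw [← mul_inv_cancel a]
    refine jet_mul_eq _ (funext fun i => ?_)
    have hi := Nat.lt_succ_iff.1 i.2
    exact (hc i (hi.trans (le_max_left _ _))).trans (if_pos hi)
  · rw [mul_comm, inv_mul_cancel_right]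
    intro i
    have hi := Nat.lt_succ_iff.1 i.2
    have := hc i (hi.trans (le_max_right _ _))
    change valuation F (PowerSeries.coeff (i : ℕ) (a' : F⟦X⟧) - PowerSeries.coeff (i : ℕ) _) ≤ _
    rw [this]
    split_ifs with him
    · exact h ⟨i, Nat.lt_succ_of_le him⟩
    · rw [sub_self, map_zero]
      exact zero_le

/-- Right translation by `x` sends `g ↦ g h w` to `g ↦ g x h w = g (x (h w))`, and the inner factor
is locally constant in `x` by smoothness of `V`. It is enough to check this on the spanning
translates. -/
theorem isSmoothStage_translateRep {m j : ℕ} (hm : V.unitDepth j ≤ m) : ∀ᶠ i in atTop,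
    IsSmoothStage (translateRep (V.actFun (m + 1) j i)) := by
  obtain ⟨i', hi'⟩ := V.act_mul_mul (m + 1) j
  obtain ⟨m', hm'⟩ := V.isLocallyConstant_act (m + 1) i'
  obtain ⟨i'', h₁, h₂⟩ := (hi'.and hm').exists
  filter_upwards [h₁, V.act_unitElem_mul (m + 1) hm] with i e e'
  refine isSmoothStage_of_span_eq_top (Submodule.span_span_coe_preimage) ?_ ?_
  · rintro ⟨_, hv⟩ ⟨h, w, rfl⟩
    obtain ⟨c, hc, hb⟩ := exists_box_of_isLocallyConstant (h₂ (V.act (m + 1) i'' i h w)) 1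
    refine ⟨c⁻¹, inv_ne_zero hc, fun b hbc => Subtype.ext (funext fun g => ?_)⟩
    change V.act (m + 1) j i (g * b.1 * h : HInf.level F (m + 1)) w =
      V.act (m + 1) j i (g * h : HInf.level F (m + 1)) w
    rw [e, hb, ← e, mul_one]
    · rw [polarSubgroup_unit, Subgroup.coe_one, HInf.unit_one]
      exact mem_box_self _ _
    · intro k
      have h3 := hbc k
      rw [polarCoeff_one, Pi.zero_apply, sub_zero]
      rw [map_mul, map_inv₀] at h3
      exact ((mul_inv_lt_iff₀ (valuation_pos hc)).1 h3).le.trans (one_mul _).le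
  · rintro ⟨_, hv⟩ ⟨h, w, rfl⟩ a₀
    obtain ⟨c, hc, hb⟩ := exists_box_of_isLocallyConstant (h₂ (V.act (m + 1) i'' i h w))
      (unitElem _ a₀)
    refine ⟨c, hc, fun a ha => Subtype.ext (funext fun g => ?_)⟩
    obtain ⟨u, hu, hau⟩ := exists_jet_mul (m' := m') ha
    change V.act (m + 1) j i (g * unitElem _ a * h : HInf.level F (m + 1)) w =
      V.act (m + 1) j i (g * unitElem _ a₀ * h : HInf.level F (m + 1)) w
    -- The correction `u` is central and can be moved to the far left, where it acts trivially on
    -- `V_j`.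
    rw [e g (unitElem _ a₀), ← hb (unitElem _ (a * u)) hau, ← e,
      mul_comm a u, unitElem_mul, ← mul_assoc g, unitElem_mul_comm hu, mul_assoc (unitElem _ u),
      mul_assoc (unitElem _ u), e' u hu]
    intro k
    rw [polarCoeff, polarCoeff, unitElem_polar, unitElem_polar, sub_self, map_zero]
    exact zero_le

/-- All translates are orbit functions of the vectors `h w`, which lie in a single stage of `V` of
countable dimension. -/
theorem rank_translateSpan_le (n j : ℕ) : ∀ᶠ i in atTop,
    Module.rank ℂ (translateSpan (V.actFun n j i)) ≤ Cardinal.aleph0 := by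
  filter_upwards [V.act_mul n j le_rfl] with i e
  have hle : translateSpan (V.actFun n j i) ≤ LinearMap.range (V.actFun n j (V.ridx n j)) := by
    refine Submodule.span_le.2 ?_
    rintro _ ⟨h, w, rfl⟩
    refine ⟨V.act n (V.ridx n j) i h w, funext fun g => ?_⟩
    rw [rightTranslation_apply, actFun_apply, actFun_apply, Subgroup.coe_mul, e g g.2 h h.2]
  exact (Submodule.rank_mono hle).trans ((rank_range_le _).trans (V.space.rank_le _))

/-- Multiplicativity with two different levels, needed because the level rises from one stage of the
tower to the next. -/
theorem act_act {n n' j i₁ : ℕ} (hn : n ≤ n') (hi : V.ridx n j ≤ i₁) : ∀ᶠ i in atTop,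
    ∀ g ∈ HInf.level F n, ∀ h ∈ HInf.level F n', ∀ w : V.space.obj i,
      V.act n j i₁ g (V.act n' i₁ i h w) = V.act n' j i (g * h) w := by
  obtain ⟨i', h₁, h₂, h₃⟩ := ((V.act_mono hn j).and ((eventually_ge_atTop (V.ridx n' j)).and
    (eventually_ge_atTop i₁))).exists
  filter_upwards [V.tr_act n' h₃, V.act_mul n' j h₂] with i e e' g hg h hh w
  rw [← e, V.act_tr hi h₃, ← h₁ g hg, e' g (HInf.level_mono hn hg) h hh]

end SmoothRep

/-! ### The tower of smooth stages of a representation. -/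

namespace SmoothRep
open Filter ProVect ValuativeRel MeasureRep
open scoped TensorProduct
variable {F : Type u} [Field F] [ValuativeRel F] [TopologicalSpace F] [IsNonarchimedeanLocalField F]

/-- A tower of smooth representations `E_k` of the groups `O_(m k)^* ⋉ B_(m k + 1)` through which
the transition maps of `V` factor. -/
structure StageTower (V : SmoothRep F) where
  s : ℕ → ℕ
  s_strictMono : StrictMono s
  m : ℕ → ℕ
  m_strictMono : StrictMono m
  E : ℕ → Type u
  [addCommGroup : ∀ k, AddCommGroup (E k)]
  [module : ∀ k, Module ℂ (E k)]
  rank_le : ∀ k, Module.rank ℂ (E k) ≤ Cardinal.aleph0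
  π : ∀ k, Representation ℂ (HInf.level F (m k + 1)) (E k)
  smooth : ∀ k, IsSmoothStage (π k)
  c : ∀ k, V.space.obj (s (k + 1)) →ₗ[ℂ] E k
  b : ∀ k, E k →ₗ[ℂ] V.space.obj (s k)
  b_c : ∀ k x, b k (c k x) = V.space.tr (s k) (s (k + 1)) x
  c_b : ∀ (k : ℕ) (h : HInf F) (hk : h ∈ HInf.level F (m k + 1))
    (hk' : h ∈ HInf.level F (m (k + 1) + 1)) (v : E (k + 1)),
      c k (b (k + 1) (π (k + 1) ⟨h, hk'⟩ v)) = π k ⟨h, hk⟩ (c k (b (k + 1) v))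
  c_act : ∀ k, ∀ᶠ i in atTop, ∀ (h : HInf.level F (m k + 1)) x,
    c k (V.act (m k + 1) (s (k + 1)) i h x) = π k h (c k (V.space.tr (s (k + 1)) i x))

attribute [instance] StageTower.addCommGroup StageTower.module

variable (V : SmoothRep F)

/-- A strictly increasing bound for `unitDepth`. -/
noncomputable def depthBound (j : ℕ) : ℕ := j + ∑ l ∈ Finset.range (j + 1), V.unitDepth l

theorem depthBound_strictMono : StrictMono V.depthBound := strictMono_nat_of_lt_succ fun j => by
  rw [depthBound, depthBound, Finset.sum_range_succ _ (j + 1)]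
  omega

theorem unitDepth_le (j : ℕ) : V.unitDepth j ≤ V.depthBound j := by
  rw [depthBound, Finset.sum_range_succ]
  omega

/-- The conditions at `k` involve `s k`, `s (k+1)` and `s (k+2)`, and each holds once the last index
involved is large in terms of the earlier ones; hence a recursive choice. -/
theorem exists_indices : ∃ s : ℕ → ℕ, StrictMono s ∧ ∀ k,
    (IsSmoothStage (translateRep (V.actFun (V.depthBound (s k) + 1) (s k) (s (k + 1)))) ∧
    Module.rank ℂ (translateSpan (V.actFun (V.depthBound (s k) + 1) (s k) (s (k + 1)))) ≤
      Cardinal.aleph0 ∧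
    (∀ x, V.act (V.depthBound (s k) + 1) (s k) (s (k + 1)) 1 x =
      V.space.tr (s k) (s (k + 1)) x) ∧
    V.ridx (V.depthBound (s k) + 1) (s k) ≤ s (k + 1)) ∧
    ∀ g ∈ HInf.level F (V.depthBound (s k) + 1),
      ∀ h ∈ HInf.level F (V.depthBound (s (k + 1)) + 1), ∀ w : V.space.obj (s (k + 2)),
      V.act (V.depthBound (s k) + 1) (s k) (s (k + 1)) g
        (V.act (V.depthBound (s (k + 1)) + 1) (s (k + 1)) (s (k + 2)) h w) =
      V.act (V.depthBound (s (k + 1)) + 1) (s k) (s (k + 2)) (g * h) w := by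
  have h₁ : ∀ j, ∃ N, ∀ i, N ≤ i →
      (IsSmoothStage (translateRep (V.actFun (V.depthBound j + 1) j i)) ∧
      Module.rank ℂ (translateSpan (V.actFun (V.depthBound j + 1) j i)) ≤ Cardinal.aleph0 ∧
      (∀ x, V.act (V.depthBound j + 1) j i 1 x = V.space.tr j i x) ∧
      V.ridx (V.depthBound j + 1) j ≤ i) := fun j =>
    eventually_atTop.1 ((V.isSmoothStage_translateRep (V.unitDepth_le j)).and
      ((V.rank_translateSpan_le _ j).and ((V.act_one _ j).and (eventually_ge_atTop _))))
  have h₂ : ∀ j i₁, ∃ N, ∀ i, N ≤ i → j ≤ i₁ → V.ridx (V.depthBound j + 1) j ≤ i₁ →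
      ∀ g ∈ HInf.level F (V.depthBound j + 1), ∀ h ∈ HInf.level F (V.depthBound i₁ + 1),
        ∀ w : V.space.obj i, V.act (V.depthBound j + 1) j i₁ g
          (V.act (V.depthBound i₁ + 1) i₁ i h w) = V.act (V.depthBound i₁ + 1) j i (g * h) w :=
    fun j i₁ => by
      by_cases hj : j ≤ i₁ ∧ V.ridx (V.depthBound j + 1) j ≤ i₁
      · obtain ⟨N, hN⟩ := eventually_atTop.1 (V.act_act
          (Nat.succ_le_succ (V.depthBound_strictMono.monotone hj.1)) hj.2)
        exact ⟨N, fun i hi _ _ => hN i hi⟩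
      · exact ⟨0, fun i _ h h' => absurd ⟨h, h'⟩ hj⟩
  choose B₁ h₁ using h₁
  choose B₂ h₂ using h₂
  -- The recursion remembers only the last index `j`. Summing `B₂ a j` over all `a ≤ j` covers the
  -- unknown previous one.
  let next : ℕ → ℕ := fun j => j + 1 + B₁ j + ∑ a ∈ Finset.range (j + 1), B₂ a j
  let s : ℕ → ℕ := fun k => next^[k] 0
  have hs : ∀ k, s (k + 1) = s k + 1 + B₁ (s k) + ∑ a ∈ Finset.range (s k + 1), B₂ a (s k) :=
    fun k => Function.iterate_succ_apply' next k 0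
  have hmono : StrictMono s := strictMono_nat_of_lt_succ fun k => by rw [hs]; omega
  have hB : ∀ k, V.ridx (V.depthBound (s k) + 1) (s k) ≤ s (k + 1) := fun k =>
    (h₁ (s k) (s (k + 1)) (by rw [hs]; omega)).2.2.2
  refine ⟨s, hmono, fun k => ⟨h₁ _ _ (by rw [hs]; omega), ?_⟩⟩
  have hle := (hmono (Nat.lt_succ_self k)).le
  refine h₂ (s k) (s (k + 1)) (s (k + 2)) ?_ hle (hB k)
  rw [hs (k + 1)]
  have : B₂ (s k) (s (k + 1)) ≤ ∑ a ∈ Finset.range (s (k + 1) + 1), B₂ a (s (k + 1)) :=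
    Finset.single_le_sum (f := fun a => B₂ a (s (k + 1))) (fun _ _ => Nat.zero_le _)
      (Finset.mem_range.2 (Nat.lt_succ_of_le hle))
  omega

/-- `E_k` is spanned by the translates of the orbit functions `g ↦ g w`, `c` sends `w` to its orbit
function, and `b` evaluates at the identity. Then `b ∘ c` is the action of `1`, which is the
transition map. -/
theorem nonempty_stageTower : Nonempty (StageTower V) := by
  obtain ⟨s, hs, h⟩ := V.exists_indices
  refine ⟨
    { s := s
      s_strictMono := hs
      m := fun k => V.depthBound (s k)
      m_strictMono := V.depthBound_strictMono.comp hs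
      E := fun k => translateSpan (V.actFun (V.depthBound (s k) + 1) (s k) (s (k + 1)))
      rank_le := fun k => (h k).1.2.1
      π := fun k => translateRep _
      smooth := fun k => (h k).1.1
      c := fun k => translateIncl _
      b := fun k => translateEval _
      b_c := fun k x => (h k).1.2.2.1 x
      c_b := fun k a hk hk' v => ?_
      c_act := fun k => ?_ }⟩
  · refine Subtype.ext (funext fun g => ?_)
    obtain ⟨v, hv⟩ := v
    change V.act _ (s k) (s (k + 1)) g (v (1 * ⟨a, hk'⟩)) =
      V.act _ (s k) (s (k + 1)) (g * ⟨a, hk⟩ : HInf.level F _) (v 1)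
    induction hv using Submodule.span_induction with
    | mem v hv =>
      obtain ⟨x, w, rfl⟩ := hv
      rw [rightTranslation_apply, rightTranslation_apply, actFun_apply, actFun_apply,
        (h k).2 _ g.2 _ (SetLike.coe_mem _), (h k).2 _ (SetLike.coe_mem _) _ (SetLike.coe_mem _)]
      congr 2
      rw [Subgroup.coe_mul, Subgroup.coe_mul, Subgroup.coe_mul, Subgroup.coe_mul, Subgroup.coe_one,
        one_mul, one_mul, mul_assoc]
    | zero => rw [Pi.zero_apply, Pi.zero_apply, map_zero, map_zero]
    | add v w _ _ hv hw => rw [Pi.add_apply, Pi.add_apply, map_add, map_add, hv, hw]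
    | smul r v _ hv => rw [Pi.smul_apply, Pi.smul_apply, map_smul, map_smul, hv]
  · filter_upwards [V.act_mul (V.depthBound (s k) + 1) (s k) (h k).1.2.2.2,
      eventually_ge_atTop (s (k + 1))] with i e hi a x
    refine Subtype.ext (funext fun g => ?_)
    change V.act _ (s k) (s (k + 1)) g (V.act _ (s (k + 1)) i a x) =
      V.act _ (s k) (s (k + 1)) (g * a : HInf.level F _) (V.space.tr (s (k + 1)) i x)
    rw [V.act_tr (h k).1.2.2.2 hi, Subgroup.coe_mul, e g g.2 a a.2]

variable {V}

theorem cornerIncl_val (m : ℕ) (b : polarSubgroup F 1) :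
    ((cornerIncl m b).1 : HInf F) = (b.1 : HInf F) :=
  HInf.ext' (cornerIncl_polar m b) ((polarSubgroup_unit _).trans (polarSubgroup_unit b).symm)

/-- The map from `V` to the constant pro-vector space `E_k / cuspPart` is `B_1`-invariant, hence
zero by cuspidality. For pro-vector spaces this means that it vanishes after composition with some
transition map. -/
theorem StageTower.eventually_mem_cuspPart (D : StageTower V) (hV : V.IsCuspidal) (k : ℕ) :
    ∀ᶠ i in atTop, ∀ x, D.c k (V.space.tr (D.s (k + 1)) i x) ∈ cuspPart (D.π k) := by
  have hA : Module.rank ℂ (D.E k ⧸ cuspPart (D.π k)) ≤ Cardinal.aleph0 :=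
    (rank_quotient_le _).trans (D.rank_le k)
  let β := toConstant (V := V.space) _ hA (D.s (k + 1)) ((cuspPart (D.π k)).mkQ.comp (D.c k))
  have hβ : V.IsSemiInvariant (subgroupB1 F) (fun _ => 1) β := by
    rw [isSemiInvariant_iff]
    intro j
    obtain ⟨i', e, h₁, h₂⟩ := ((toConstant_happ (V := V.space) _ hA (D.s (k + 1))
      ((cuspPart (D.π k)).mkQ.comp (D.c k)) j).and ((eventually_ge_atTop (hidx β j)).and
        (eventually_ge_atTop (D.s (k + 1))))).exists
    refine ⟨i', h₁, ?_⟩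
    filter_upwards [toConstant_happ (V := V.space) _ hA (D.s (k + 1))
      ((cuspPart (D.π k)).mkQ.comp (D.c k)) j, V.tr_act 1 h₂, D.c_act k,
      V.act_mono (Nat.succ_le_succ (Nat.zero_le (D.m k))) (D.s (k + 1))] with i e₁ e₂ e₃ e₄ h x
    rw [one_smul]
    refine (e _).trans (Eq.trans ?_ (e₁ x).symm)
    let b : polarSubgroup F 1 := ⟨h.1, h.2⟩
    have hb := cornerIncl_val (D.m k) b
    rw [e₂, ← e₄ _ h.1.2, LinearMap.comp_apply, LinearMap.comp_apply,
      show ((h : HInf.level F 1) : HInf F) = (cornerIncl (D.m k) b).1 from hb.symm, e₃]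
    exact (Submodule.Quotient.eq _).2 (Submodule.subset_span ⟨b, _, rfl⟩)
  have h0 := (isCuspidal_iff V).1 hV _ β hβ
  rw [eq_zeroHom_iff] at h0
  filter_upwards [h0 0, toConstant_happ (V := V.space) _ hA (D.s (k + 1))
    ((cuspPart (D.π k)).mkQ.comp (D.c k)) 0] with i e e' x
  exact (Submodule.Quotient.mk_eq_zero _).1 ((e' x).symm.trans (e x))

theorem StageTower.c_b_mem (D : StageTower V) (k : ℕ) {v : D.E (k + 1)}
    (hv : v ∈ cuspPart (D.π (k + 1))) : D.c k (D.b (k + 1) v) ∈ cuspPart (D.π k) := by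
  induction hv using Submodule.span_induction with
  | mem v hv =>
    obtain ⟨b, w, rfl⟩ := hv
    have hk : (b.1 : HInf F) ∈ HInf.level F (D.m k + 1) := mem_level_of_one b.1.2 _
    have hk' : (b.1 : HInf F) ∈ HInf.level F (D.m (k + 1) + 1) := mem_level_of_one b.1.2 _
    have hb : (cornerIncl (D.m k) b).1 = ⟨(b.1 : HInf F), hk⟩ := Subtype.ext (cornerIncl_val _ b)
    have hb' : (cornerIncl (D.m (k + 1)) b).1 = ⟨(b.1 : HInf F), hk'⟩ :=
      Subtype.ext (cornerIncl_val _ b)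
    refine Submodule.subset_span ⟨b, D.c k (D.b (k + 1) w), ?_⟩
    rw [map_sub, map_sub, cornerRestrict_apply, cornerRestrict_apply, hb, hb',
      D.c_b k (b.1 : HInf F) hk hk' w]
  | zero => rw [map_zero, map_zero]; exact zero_mem _
  | add v w _ _ hv hw => rw [map_add, map_add]; exact add_mem hv hw
  | smul c v _ hv => rw [map_smul, map_smul]; exact Submodule.smul_mem _ c hv

end SmoothRep

/-! ### Interleaving a cuspidal representation with `L ⊗ 𝕄`. -/

section Split
open MeasureRep
open scoped TensorProduct
variable {F : Type u} [Field F] [ValuativeRel F] [TopologicalSpace F] [IsNonarchimedeanLocalField F]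

/-- The isomorphism on `cuspPart` is extended to a linear map `p` on all of `E` so that it can be
composed with maps into `E`. Off `cuspPart` the extension is arbitrary, and equivariance is claimed
on `cuspPart` only. -/
theorem IsSmoothStage.exists_split (ψ : ResidualChar F) {m : ℕ} {E : Type w} [AddCommGroup E]
    [Module ℂ E] {π : Representation ℂ (HInf.level F (m + 1)) E} (hπ : IsSmoothStage π) :
    ∃ (p : E →ₗ[ℂ] StageQuot ψ π ⊗[ℂ] schwartzUnits F m)
      (ι : StageQuot ψ π ⊗[ℂ] schwartzUnits F m →ₗ[ℂ] E),
      (∀ y, p (ι y) = y) ∧ (∀ y, ι y ∈ cuspPart π) ∧ (∀ v ∈ cuspPart π, ι (p v) = v) ∧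
      (∀ h, ∀ v ∈ cuspPart π, p (π h v) = TensorProduct.map LinearMap.id (repOn ψ le_rfl h) (p v)) ∧
      ∀ h y, ι (TensorProduct.map LinearMap.id (repOn ψ le_rfl h) y) = π h (ι y) := by
  obtain ⟨e, he⟩ := hπ.exists_equiv ψ
  obtain ⟨p, hp⟩ := LinearMap.exists_extend e.toLinearMap
  have hp' : ∀ v (hv : v ∈ cuspPart π), p v = e ⟨v, hv⟩ := fun v hv =>
    LinearMap.congr_fun hp ⟨v, hv⟩
  have h1 : ∀ y, p (e.symm y).1 = y := fun y => by
    rw [hp' _ (e.symm y).2]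
    exact e.apply_symm_apply y
  have h2 : ∀ v ∈ cuspPart π, (e.symm (p v)).1 = v := fun v hv => by
    rw [hp' _ hv, e.symm_apply_apply]
  have h3 : ∀ h, ∀ v ∈ cuspPart π,
      p (π h v) = TensorProduct.map LinearMap.id (repOn ψ le_rfl h) (p v) := fun h v hv => by
    rw [hp' _ (rep_mem_cuspPart π h hv), hp' _ hv]
    exact he h ⟨v, hv⟩
  refine ⟨p, (Submodule.subtype _).comp e.symm.toLinearMap, h1, fun y => (e.symm y).2, h2, h3,
    fun h y => ?_⟩
  have h4 := h3 h (e.symm y).1 (e.symm y).2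
  rw [h1] at h4
  change (e.symm (TensorProduct.map LinearMap.id (repOn ψ le_rfl h) y)).1 = π h (e.symm y).1
  rw [← h4]
  exact h2 _ (rep_mem_cuspPart π h (e.symm y).2)

end Split

namespace SmoothRep
open Filter ProVect ValuativeRel MeasureRep
open scoped TensorProduct
variable {F : Type u} [Field F] [ValuativeRel F] [TopologicalSpace F] [IsNonarchimedeanLocalField F]

/-- An interleaving of `V` with `L ⊗ M`. -/
structure Interleaving (ψ : ResidualChar F) (V : SmoothRep F) where
  L : ProVect.{u}
  s : ℕ → ℕ
  s_strictMono : StrictMono s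
  m : ℕ → ℕ
  m_strictMono : StrictMono m
  γ : ∀ k, V.space.obj (s (k + 1)) →ₗ[ℂ] L.obj k ⊗[ℂ] schwartzUnits F (m k)
  δ : ∀ k, L.obj k ⊗[ℂ] schwartzUnits F (m k) →ₗ[ℂ] V.space.obj (s k)
  γ_δ : ∀ k y, γ k (δ (k + 1) y) =
    TensorProduct.map (L.tr k (k + 1)) (proj (m_strictMono.monotone k.le_succ)) y
  δ_γ : ∀ k, ∀ᶠ i in atTop, ∀ x,
    δ k (γ k (V.space.tr (s (k + 1)) i x)) = V.space.tr (s k) i x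
  δ_map : ∀ k y, δ k (TensorProduct.map (L.tr k (k + 1)) (proj (m_strictMono.monotone k.le_succ)) y)
    = V.space.tr (s k) (s (k + 1)) (δ (k + 1) y)
  γ_act : ∀ k, ∀ᶠ i in atTop, ∀ (h : HInf.level F (m k + 1)) x,
    γ k (V.act (m k + 1) (s (k + 1)) i h x) =
      TensorProduct.map LinearMap.id (repOn ψ le_rfl h) (γ k (V.space.tr (s (k + 1)) i x))

/-- With `γ = p ∘ c` and `δ = b ∘ ι`, the composites `γ_k ∘ δ_(k+1)` are equivariant, so by Schur's
lemma they are `τ_k ⊗ proj`. The maps `τ_k` are the transition maps of `L`. Cuspidality ensures that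
`ι ∘ p` acts as the identity on what comes from late stages of `V`. -/
theorem IsCuspidal.nonempty_interleaving (ψ : ResidualChar F) {V : SmoothRep F}
    (hV : V.IsCuspidal) : Nonempty (Interleaving ψ V) := by
  obtain ⟨D⟩ := V.nonempty_stageTower
  choose p ι hpι hι hιp hp hιπ using fun k => (D.smooth k).exists_split ψ
  have hm : ∀ k, D.m k ≤ D.m (k + 1) := fun k => D.m_strictMono.monotone k.le_succ
  have hτ : ∀ k, ∃ τ : StageQuot ψ (D.π (k + 1)) →ₗ[ℂ] StageQuot ψ (D.π k),
      (p k).comp ((D.c k).comp ((D.b (k + 1)).comp (ι (k + 1)))) =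
        TensorProduct.map τ (proj (hm k)) := fun k => by
    -- Equivariance of `p` is available because `ι` lands in the cuspidal part and `c ∘ b` preserves
    -- it.
    refine exists_eq_map_proj ψ (hm k) _ fun a x => ?_
    have ha : (a : HInf F) ∈ HInf.level F (D.m (k + 1) + 1) :=
      HInf.level_mono (Nat.succ_le_succ (hm k)) a.2
    have h1 := hιπ (k + 1) ⟨a, ha⟩ x
    have h2 := D.c_b k a a.2 ha (ι (k + 1) x)
    have h3 := hp k a _ (D.c_b_mem k (hι (k + 1) x))
    change p k (D.c k (D.b (k + 1) (ι (k + 1) _))) = _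
    refine Eq.trans ?_ h3
    refine congrArg (p k) (Eq.trans ?_ h2)
    exact congrArg (fun y => D.c k (D.b (k + 1) y)) h1
  choose τ hτ using hτ
  have hL : ∀ k, Module.rank ℂ (StageQuot ψ (D.π k)) ≤ Cardinal.aleph0 := fun k =>
    (rank_quotient_le _).trans (D.rank_le k)
  let L := ofSteps (fun k => StageQuot ψ (D.π k)) hL τ
  have htr : ∀ k, L.tr k (k + 1) = τ k := fun k => LinearMap.ext fun x =>
    (ofSteps_tr_succ _ hL τ le_rfl x).trans (L.tr_self k (τ k x))
  have hγδ : ∀ k y, p k (D.c k (D.b (k + 1) (ι (k + 1) y))) =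
      TensorProduct.map (L.tr k (k + 1)) (proj (hm k)) y := fun k y =>
    (LinearMap.congr_fun (hτ k) y).trans
      (congrArg (fun t => TensorProduct.map t (proj (hm k)) y) (htr k).symm)
  refine ⟨
    { L := L
      s := D.s
      s_strictMono := D.s_strictMono
      m := D.m
      m_strictMono := D.m_strictMono
      γ := fun k => (p k).comp (D.c k)
      δ := fun k => (D.b k).comp (ι k)
      γ_δ := hγδ
      δ_γ := fun k => ?_
      δ_map := fun k y => ?_
      γ_act := fun k => ?_ }⟩
  · filter_upwards [D.eventually_mem_cuspPart hV k,
      eventually_ge_atTop (D.s (k + 1))] with i h hi x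
    change D.b k (ι k (p k (D.c k _))) = _
    rw [hιp k _ (h x), D.b_c, V.space.tr_tr (D.s_strictMono.monotone k.le_succ) hi]
  · change D.b k (ι k _) = _
    rw [← hγδ k y, hιp k _ (D.c_b_mem k (hι (k + 1) y)), D.b_c]
    rfl
  · filter_upwards [D.eventually_mem_cuspPart hV k, D.c_act k] with i h e a x
    change p k (D.c k _) = _
    rw [e, hp k _ _ (h x)]
    rfl

namespace Interleaving
variable {ψ : ResidualChar F} {V : SmoothRep F} (D : Interleaving ψ V)

/-- The transition map `L_k ⊗ M_(m k) → L_j ⊗ M_(m j)`. -/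
noncomputable def tr {j k : ℕ} (h : j ≤ k) :
    D.L.obj k ⊗[ℂ] schwartzUnits F (D.m k) →ₗ[ℂ] D.L.obj j ⊗[ℂ] schwartzUnits F (D.m j) :=
  TensorProduct.map (D.L.tr j k) (proj (D.m_strictMono.monotone h))

theorem tr_self (k : ℕ) (y) : D.tr (le_refl k) y = y := by
  have h : D.L.tr k k = LinearMap.id := LinearMap.ext (D.L.tr_self k)
  rw [tr, proj_self, h, TensorProduct.map_id, LinearMap.id_apply]

theorem tr_tr {i j k : ℕ} (hij : i ≤ j) (hjk : j ≤ k) (y) :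
    D.tr hij (D.tr hjk y) = D.tr (hij.trans hjk) y :=
  tensor_map_map (B₁ := schwartzUnits F (D.m j)) (D.L.tr_tr hij hjk) (fun f => proj_proj _ _ f) y

theorem δ_tr {j k : ℕ} (h : j ≤ k) (y) :
    D.δ j (D.tr h y) = V.space.tr (D.s j) (D.s k) (D.δ k y) := by
  induction k, h using Nat.le_induction with
  | base => rw [tr_self, ProVect.tr_self]
  | succ k hk ih =>
    rw [← D.tr_tr hk k.le_succ, ih]
    refine (congrArg _ (D.δ_map k y)).trans ?_
    exact V.space.tr_tr (D.s_strictMono.monotone hk) (D.s_strictMono.monotone k.le_succ) _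

theorem tr_γ {j k : ℕ} (h : j ≤ k) : ∀ᶠ i in atTop, ∀ x,
    D.tr h (D.γ k (V.space.tr (D.s (k + 1)) i x)) = D.γ j (V.space.tr (D.s (j + 1)) i x) := by
  induction k, h using Nat.le_induction with
  | base => exact Eventually.of_forall fun i x => D.tr_self j _
  | succ k hk ih =>
    filter_upwards [ih, D.δ_γ (k + 1)] with i e e' x
    rw [← e, ← e', D.γ_δ, ← D.tr_tr hk k.le_succ]
    rfl

theorem le_m (j : ℕ) : j ≤ D.m j := D.m_strictMono.le_apply

theorem le_s (j : ℕ) : j ≤ D.s j := D.s_strictMono.le_apply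

/-- The map `L_j ⊗ M_(m j) → L_j ⊗ M_j`. -/
noncomputable def fromStage (j : ℕ) :
    D.L.obj j ⊗[ℂ] schwartzUnits F (D.m j) →ₗ[ℂ] (tensor D.L (rep ψ)).space.obj j :=
  TensorProduct.map LinearMap.id (proj (D.le_m j))

/-- The map `L_i ⊗ M_i → L_j ⊗ M_(m j)`. -/
noncomputable def toStage {j i : ℕ} (h : D.m j ≤ i) :
    (tensor D.L (rep ψ)).space.obj i →ₗ[ℂ] D.L.obj j ⊗[ℂ] schwartzUnits F (D.m j) :=
  TensorProduct.map (D.L.tr j i) (proj h)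

theorem tr_fromStage {j k : ℕ} (h : j ≤ k) (y) :
    (tensor D.L (rep ψ)).space.tr j k (D.fromStage k y) = D.fromStage j (D.tr h y) := by
  rw [tensor_space_tr D.L h]
  exact (tensor_map_map (B₁ := schwartzUnits F k) (fun _ => rfl) (fun f => proj_proj _ _ f)
    y).trans (tensor_map_map (B₁ := schwartzUnits F (D.m j)) (fun _ => rfl)
      (fun f => proj_proj _ _ f) y).symm

theorem tr_toStage {j k i : ℕ} (h : j ≤ k) (hi : D.m k ≤ i) (y) :
    D.tr h (D.toStage hi y) = D.toStage ((D.m_strictMono.monotone h).trans hi) y :=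
  tensor_map_map (B₁ := schwartzUnits F (D.m k))
    (D.L.tr_tr h ((D.le_m k).trans hi)) (fun f => proj_proj _ _ f) y

theorem toStage_tr {j i i' : ℕ} (h : D.m j ≤ i) (hi : i ≤ i') (y) :
    D.toStage h ((tensor D.L (rep ψ)).space.tr i i' y) = D.toStage (h.trans hi) y := by
  rw [tensor_space_tr D.L hi]
  exact tensor_map_map (B₁ := schwartzUnits F i)
    (D.L.tr_tr ((D.le_m j).trans h) hi) (fun f => proj_proj _ _ f) y

theorem fromStage_toStage {j i : ℕ} (h : D.m j ≤ i) (y) :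
    D.fromStage j (D.toStage h y) = (tensor D.L (rep ψ)).space.tr j i y := by
  rw [tensor_space_tr D.L ((D.le_m j).trans h)]
  exact tensor_map_map (B₁ := schwartzUnits F (D.m j)) (fun _ => rfl) (fun f => proj_proj _ _ f) y

theorem toStage_fromStage {j k : ℕ} (h : D.m j ≤ k) (y) :
    D.toStage h (D.fromStage k y) = D.tr ((D.le_m j).trans h) y :=
  tensor_map_map (B₁ := schwartzUnits F k) (fun _ => rfl) (fun f => proj_proj _ _ f) y

theorem fromStage_act (j : ℕ) (h : HInf F) (hj : h ∈ HInf.level F (j + 1))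
    (hm : h ∈ HInf.level F (D.m j + 1)) (y) :
    D.fromStage j (TensorProduct.map LinearMap.id (repOn ψ le_rfl ⟨h, hm⟩) y) =
      tensorRep ψ D.L j ⟨h, hj⟩ (D.fromStage j y) :=
  (tensor_map_map (B₁ := schwartzUnits F (D.m j)) (h := LinearMap.id)
    (k := (proj (D.le_m j)).comp (repOn ψ le_rfl ⟨h, hm⟩)) (fun _ => rfl) (fun _ => rfl) y).trans
  (tensor_map_map (B₁ := schwartzUnits F j) (h := LinearMap.id)
    (k := (proj (D.le_m j)).comp (repOn ψ le_rfl ⟨h, hm⟩)) (fun _ => rfl)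
    (fun f => (proj_repOn ψ (D.le_m j) le_rfl (Nat.succ_le_succ (D.le_m j)) ⟨h, hj⟩ f).symm)
    y).symm

/-- The morphism `V → L ⊗ M` of pro-vector spaces. -/
noncomputable def toHom : V.space ⟶ (tensor D.L (rep ψ)).space :=
  homMk (fun j => D.s (j + 1)) (fun j => (D.fromStage j).comp (D.γ j)) fun j j' h => by
    filter_upwards [D.tr_γ h] with i e x
    exact (D.tr_fromStage h _).trans (congrArg _ (e x))

theorem toHom_happ (j : ℕ) : ∀ᶠ i in atTop, ∀ x, happ D.toHom j i x =
    D.fromStage j (D.γ j (V.space.tr (D.s (j + 1)) i x)) :=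
  homMk_happ _ _ _ j

/-- The morphism `L ⊗ M → V` of pro-vector spaces. -/
noncomputable def invHom : (tensor D.L (rep ψ)).space ⟶ V.space :=
  homMk (fun j => D.m j)
    (fun j => (V.space.tr j (D.s j)).comp ((D.δ j).comp (D.toStage le_rfl))) fun j j' h => by
    filter_upwards [eventually_ge_atTop (D.m j')] with i hi y
    have hj := D.s_strictMono.monotone h
    change V.space.tr j j' (V.space.tr j' (D.s j') (D.δ j' (D.toStage _ _))) =
      V.space.tr j (D.s j) (D.δ j (D.toStage _ _))
    rw [D.toStage_tr _ hi, D.toStage_tr _ ((D.m_strictMono.monotone h).trans hi),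
      ← D.tr_toStage h hi, D.δ_tr, V.space.tr_tr h (D.le_s j'), V.space.tr_tr (D.le_s j) hj]

theorem invHom_happ (j : ℕ) : ∀ᶠ i in atTop, ∀ (h : D.m j ≤ i) y, happ D.invHom j i y =
    V.space.tr j (D.s j) (D.δ j (D.toStage h y)) := by
  refine (homMk_happ _ _ _ j).mono fun i e h y => (e y).trans ?_
  exact congrArg (fun z => V.space.tr j (D.s j) (D.δ j z)) (D.toStage_tr le_rfl h y)

/-- The composites of `γ` and `δ` in either order are transition maps, and transition maps represent
identities in the pro-category. -/
theorem toHom_invHom : D.toHom ≫ D.invHom = 𝟙 V.space := by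
  rw [hom_ext_iff]
  intro j
  obtain ⟨k, e, hk, hk'⟩ := ((D.invHom_happ j).and ((eventually_ge_atTop (D.m j)).and
    (eventually_ge_atTop (hidx D.invHom j)))).exists
  filter_upwards [comp_happ D.toHom D.invHom j hk', id_happ V.space j, D.toHom_happ k,
    D.tr_γ ((D.le_m j).trans hk), D.δ_γ j, eventually_ge_atTop (D.s j)] with i e₁ e₂ e₃ e₄ e₅ hi x
  rw [e₁, e₂, e hk, e₃, D.toStage_fromStage, e₄, e₅, V.space.tr_tr (D.le_s j) hi]

theorem invHom_toHom : D.invHom ≫ D.toHom = 𝟙 (tensor D.L (rep ψ)).space := by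
  rw [hom_ext_iff]
  intro j
  obtain ⟨k, e, hk, hk'⟩ := ((D.toHom_happ j).and ((eventually_ge_atTop (D.s (j + 1))).and
    (eventually_ge_atTop (hidx D.toHom j)))).exists
  have hjk : j + 1 ≤ k := (D.le_s _).trans hk
  filter_upwards [comp_happ D.invHom D.toHom j hk', id_happ (tensor D.L (rep ψ)).space j,
    D.invHom_happ k, eventually_ge_atTop (D.m k)] with i e₁ e₂ e₃ hi x
  have h1 := D.γ_δ j (D.toStage ((D.m_strictMono.monotone hjk).trans hi) x)
  rw [e₁, e₂, e, e₃ hi, V.space.tr_tr hk (D.le_s k), ← D.δ_tr hjk, D.tr_toStage hjk hi]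
  refine (congrArg (D.fromStage j) h1).trans ?_
  exact (congrArg (D.fromStage j) (D.tr_toStage j.le_succ _ x)).trans (D.fromStage_toStage _ x)

/-- The morphism `V → L ⊗ M` of representations. -/
noncomputable def toRepHom : V ⟶ tensor D.L (rep ψ) :=
  homOfHapp D.toHom fun n j => by
    -- Equivariance is tested at a stage `N ≥ n`, where `O^* ⋉ B_n` acts on both `M_N` and `M_(m
    -- N)`.
    obtain ⟨N, hact, hn, hj, hr⟩ := (((isStrict_tensorRep (ψ := ψ) D.L).act_eq n j).and
      ((eventually_ge_atTop n).and ((eventually_ge_atTop j).and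
        (eventually_ge_atTop ((tensor D.L (rep ψ)).ridx n j))))).exists
    obtain ⟨i', e, e', h', hN⟩ := ((D.toHom_happ j).and ((D.tr_γ hj).and
      ((eventually_ge_atTop (hidx D.toHom j)).and (eventually_ge_atTop (D.s (N + 1)))))).exists
    have hnm : n ≤ D.m N + 1 := (hn.trans (D.le_m N)).trans (Nat.le_succ _)
    refine ⟨i', N, h', hr, ?_⟩
    filter_upwards [D.toHom_happ N, V.tr_act n hN, D.γ_act N, V.act_mono hnm (D.s (N + 1))] with
      i e₁ e₂ e₃ e₄ h hh x
    have hm := HInf.level_mono hnm hh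
    have hN' := HInf.level_mono (hn.trans (Nat.le_succ N)) hh
    rw [e, ← e', ← D.tr_fromStage, e₂, ← e₄ h hh, e₁, hact h hh hN',
      ← D.fromStage_act N h hN' hm, e₃ ⟨h, hm⟩]

instance : IsIso D.toRepHom :=
  have : IsIso D.toRepHom.hom := ⟨D.invHom, D.toHom_invHom, D.invHom_toHom⟩
  isIso_of_hom _

end Interleaving

/-- Essential surjectivity of `L ↦ L ⊗ 𝕄` onto the cuspidal representations. -/
theorem IsCuspidal.exists_iso_tensor (ψ : ResidualChar F) {V : SmoothRep F}
    (hV : V.IsCuspidal) : ∃ L : ProVect.{u}, Nonempty (tensor L (rep ψ) ≅ V) := by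
  obtain ⟨D⟩ := hV.nonempty_interleaving ψ
  exact ⟨D.L, ⟨(asIso D.toRepHom).symm⟩⟩

end SmoothRep

/-! ### Systems of subspaces and monomorphisms. -/

namespace ProVect
open Filter
variable {S : Type v} {U V W : ProVect.{u}}

section Sub
variable (V) (K : ∀ i, Submodule ℂ (V.obj i))
  (hK : ∀ i j, i ≤ j → ∀ x ∈ K j, V.tr i j x ∈ K i)

/-- The pro-vector space of a compatible system of subspaces. -/
def sub : ProVect.{u} where
  obj i := K i
  rank_le i := (Submodule.rank_le _).trans (V.rank_le i)
  map {i j} h := (V.map h).restrict fun x hx => tr_eq V h ▸ hK i j h x hx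
  map_self i x := Subtype.ext (V.map_self i _)
  map_map hij hjk x := Subtype.ext (V.map_map hij hjk _)

/-- The inclusion of the `i`-th stage. -/
def subVal (i : ℕ) : (V.sub K hK).obj i →ₗ[ℂ] V.obj i := (K i).subtype

theorem subVal_injective (i : ℕ) : Function.Injective (V.subVal K hK i) :=
  Subtype.val_injective

theorem subVal_tr {i j : ℕ} (h : i ≤ j) (x) :
    V.subVal K hK i ((V.sub K hK).tr i j x) = V.tr i j (V.subVal K hK j x) := by
  rw [tr_eq _ h, tr_eq _ h]
  rfl

/-- The inclusion of a compatible system of subspaces. -/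
noncomputable def subIncl : V.sub K hK ⟶ V :=
  homMk (fun j => j) (V.subVal K hK) fun j j' h => by
    filter_upwards [eventually_ge_atTop j'] with i hi x
    rw [subVal_tr V K hK hi, subVal_tr V K hK (h.trans hi), V.tr_tr h hi]

theorem subIncl_happ (j : ℕ) : ∀ᶠ i in atTop, ∀ x,
    happ (V.subIncl K hK) j i x = V.tr j i (V.subVal K hK i x) := by
  filter_upwards [homMk_happ (fun j => j) (V.subVal K hK) _ j, eventually_ge_atTop j] with i e hi x
  exact (e x).trans (subVal_tr V K hK hi x)

theorem subIncl_comp_app (a : Fam S U (V.sub K hK)) (j : ℕ) : ∀ᶠ i in atTop, ∀ s x,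
    ((const S (V.subIncl K hK)).comp a).app j i s x = V.subVal K hK j (a.app j i s x) := by
  obtain ⟨k, e, e', hk, hj⟩ := ((const_app S (V.subIncl K hK) j).and
    ((V.subIncl_happ K hK j).and ((eventually_ge_atTop
      ((const S (V.subIncl K hK)).idx j)).and (eventually_ge_atTop j)))).exists
  filter_upwards [Fam.comp_app (const S (V.subIncl K hK)) a j hk, a.tr_app hj] with i e₁ e₂ s x
  rw [e₁, e, e', ← e₂, subVal_tr V K hK hj]

/-- The inclusion is injective on every stage. It allows the axioms of a subrepresentation to be
checked after composing with the inclusion. -/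
theorem subIncl_comp_injective {a b : Fam S U (V.sub K hK)}
    (h : (const S (V.subIncl K hK)).comp a = (const S (V.subIncl K hK)).comp b) : a = b := by
  refine (Fam.ext_iff _ _).2 fun j => ?_
  filter_upwards [subIncl_comp_app V K hK a j, subIncl_comp_app V K hK b j] with i e e' s x
  refine V.subVal_injective K hK j ?_
  rw [← e s x, ← e' s x, h]

end Sub

end ProVect

namespace SmoothRep
open Filter ProVect ValuativeRel

section
variable {F : Type u} [Field F] [TopologicalSpace F] {U V W : SmoothRep F}

section Sub
variable (V) (K : ∀ i, Submodule ℂ (V.space.obj i))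
  (hK : ∀ i j, i ≤ j → ∀ x ∈ K j, V.space.tr i j x ∈ K i)
  (hK' : ∀ n j, ∀ᶠ i in atTop, ∀ h ∈ HInf.level F n, ∀ x ∈ K i, V.act n j i h x ∈ K j)

include hK' in
theorem exists_subFam (n : ℕ) : ∃ ρ : Fam (HInf.level F n) (V.space.sub K hK) (V.space.sub K hK),
    IsSmoothFam ρ ∧ (const _ (V.space.subIncl K hK)).comp ρ =
      (V.ρ n).comp (const _ (V.space.subIncl K hK)) := by
  have h0 : ∀ j, ∃ i, (∀ h ∈ HInf.level F n, ∀ x ∈ K i, V.act n j i h x ∈ K j) ∧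
      V.ridx n j ≤ i ∧ ∃ m, ∀ x, @IsLocallyConstant _ _ (HInf.depthTopology m n)
        (fun h : HInf.level F n => V.act n j i h x) := fun j => by
    obtain ⟨m, hm⟩ := V.isLocallyConstant_act n j
    obtain ⟨i, h₁, h₂, h₃⟩ := ((hK' n j).and ((eventually_ge_atTop (V.ridx n j)).and hm)).exists
    exact ⟨i, h₁, h₂, m, h₃⟩
  choose idx hidx hr m hm using h0
  let p : PreFam (HInf.level F n) (V.space.sub K hK) (V.space.sub K hK) :=
    { idx := idx
      app := fun j h => (V.act n j (idx j) h).restrict (hidx j h h.2)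
      compat := fun {j j'} hj => by
        obtain ⟨i, e, hi, hi'⟩ := ((V.tr_act n hj).and ((eventually_ge_atTop (idx j)).and
          (eventually_ge_atTop (idx j')))).exists
        refine ⟨i, hi, hi', fun h x => Subtype.ext ?_⟩
        change V.space.map hj (V.act n j' (idx j') h (V.space.map hi' x.1)) =
          V.act n j (idx j) h (V.space.map hi x.1)
        rw [← tr_eq, ← tr_eq, ← tr_eq, V.act_tr (hr j') hi', V.act_tr (hr j) hi, e] }
  refine ⟨Fam.mk p, ⟨p, rfl, fun j => ⟨m j, fun x => ?_⟩⟩, (Fam.ext_iff _ _).2 fun j => ?_⟩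
  · let _ := HInf.depthTopology (F := F) (m j) n
    exact IsLocallyConstant.desc _ Subtype.val (hm j x.1) Subtype.val_injective
  · filter_upwards [subIncl_comp_app V.space K hK (Fam.mk p) j, Fam.mk_app p j,
      Fam.comp_app (V.ρ n) (const _ (V.space.subIncl K hK)) j (le_refl (V.ridx n j)),
      const_app (HInf.level F n) (V.space.subIncl K hK) (V.ridx n j),
      V.space.subIncl_happ K hK (V.ridx n j), eventually_ge_atTop (idx j)] with i e₁ e₂ e₃ e₄ e₅ hi h x
    rw [e₁, e₂, e₃, e₄, e₅ x, ← act_coe, V.act_tr le_rfl ((hr j).trans hi)]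
    change V.act n j (idx j) h (V.space.subVal K hK (idx j) _) = _
    rw [subVal_tr V.space K hK hi, V.act_tr (hr j) hi]

/-- The action on the pro-vector space of a stable system of subspaces. -/
noncomputable def subFam (n : ℕ) : Fam (HInf.level F n) (V.space.sub K hK) (V.space.sub K hK) :=
  (V.exists_subFam K hK hK' n).choose

theorem subIncl_comp_subFam (n : ℕ) :
    (const _ (V.space.subIncl K hK)).comp (V.subFam K hK hK' n) =
      (V.ρ n).comp (const _ (V.space.subIncl K hK)) :=
  (V.exists_subFam K hK hK' n).choose_spec.2

theorem subIncl_comp_restrict_subFam {S : Type v} (n : ℕ) (p : S → HInf.level F n) :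
    (const S (V.space.subIncl K hK)).comp ((V.subFam K hK hK' n).restrict p) =
      ((V.ρ n).restrict p).comp (const S (V.space.subIncl K hK)) := by
  rw [← restrict_const p, ← Fam.restrict_comp, subIncl_comp_subFam, Fam.restrict_comp]

/-- The subrepresentation given by a stable system of subspaces. -/
noncomputable def sub : SmoothRep F where
  space := V.space.sub K hK
  ρ := V.subFam K hK hK'
  smooth n := (V.exists_subFam K hK hK' n).choose_spec.1
  restrict_eq h := by
    refine subIncl_comp_injective V.space K hK ?_
    rw [subIncl_comp_restrict_subFam, V.restrict_eq h, subIncl_comp_subFam]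
  one_eq n := by
    refine subIncl_comp_injective V.space K hK ?_
    rw [subIncl_comp_restrict_subFam, V.one_eq n]
    exact (Fam.id_comp _).trans (Fam.comp_id _).symm
  mul_eq n := by
    refine subIncl_comp_injective V.space K hK ?_
    rw [subIncl_comp_restrict_subFam, V.mul_eq n, ← Fam.comp_assoc, subIncl_comp_restrict_subFam,
      Fam.comp_assoc, Fam.comp_assoc, subIncl_comp_restrict_subFam]

/-- The inclusion of the subrepresentation given by a stable system of subspaces. -/
noncomputable def subIncl : V.sub K hK hK' ⟶ V :=
  ⟨V.space.subIncl K hK, V.subIncl_comp_subFam K hK hK'⟩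

end Sub

/-- The elements at the `i`-th stage that are killed by the components of `f` defined there. -/
def kerStage (f : V ⟶ W) (i : ℕ) : Submodule ℂ (V.space.obj i) where
  carrier := {x | ∀ k ≤ i, hidx f.hom k ≤ i → happ f.hom k i x = 0}
  zero_mem' _ _ _ := map_zero _
  add_mem' hx hy k hk h := by rw [map_add, hx k hk h, hy k hk h, add_zero]
  smul_mem' c x hx k hk h := by rw [map_smul, hx k hk h, smul_zero]

theorem tr_mem_kerStage (f : V ⟶ W) (i j : ℕ) (hij : i ≤ j) (x) (hx : x ∈ kerStage f j) :
    V.space.tr i j x ∈ kerStage f i := fun k hk h => by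
  rw [happ_tr f.hom h hij, hx k (hk.trans hij) (h.trans hij)]

theorem act_mem_kerStage (f : V ⟶ W) (n j : ℕ) : ∀ᶠ i in atTop, ∀ h ∈ HInf.level F n,
    ∀ x ∈ kerStage f i, V.act n j i h x ∈ kerStage f j := by
  have h1 : ∀ᶠ i in atTop, ∀ k ∈ Set.Iic j, hidx f.hom k ≤ j → ∀ h ∈ HInf.level F n,
      ∀ x ∈ kerStage f i, happ f.hom k j (V.act n j i h x) = 0 := by
    refine (eventually_all_finite (Set.finite_Iic j)).2 fun k _ => ?_
    by_cases hk : hidx f.hom k ≤ j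
    · filter_upwards [comm_happ f n k hk le_rfl, eventually_ge_atTop (W.ridx n k),
        eventually_ge_atTop (hidx f.hom (W.ridx n k))] with i e h₁ h₂ _ h hh x hx
      rw [e h hh, hx _ h₁ h₂, map_zero]
    · exact Eventually.of_forall fun i h => absurd h hk
  filter_upwards [h1] with i e h hh x hx k hk hk'
  exact e k hk hk' h hh x hx

/-- The kernels on stages form a subrepresentation annihilated by `f`, so its inclusion is the zero
morphism. A monomorphism thus need not be injective on stages: elements of the kernel die only under
a transition map. -/
theorem tr_eq_zero_of_mono (f : V ⟶ W) [Mono f] (j : ℕ) : ∀ᶠ i in atTop, ∀ x ∈ kerStage f i,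
    V.space.tr j i x = 0 := by
  let ι := V.subIncl (kerStage f) (tr_mem_kerStage f) (act_mem_kerStage f)
  have h : ι ≫ f = zeroHom _ V ≫ f := by
    refine Hom.ext (((eq_zeroHom_iff _).2 fun k => ?_).trans (zeroHom_comp f.hom).symm)
    have hk := le_max_left (hidx f.hom k) k
    have hk' := le_max_right (hidx f.hom k) k
    filter_upwards [comp_happ ι.hom f.hom k hk,
      V.space.subIncl_happ (kerStage f) (tr_mem_kerStage f) (max (hidx f.hom k) k),
      eventually_ge_atTop (max (hidx f.hom k) k)] with i e e' hi x
    refine (e x).trans ?_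
    refine (congrArg (happ f.hom k _) (e' x)).trans ?_
    rw [happ_tr f.hom hk hi]
    exact x.2 k (hk'.trans hi) (hk.trans hi)
  have h0 : ι.hom = ProVect.zeroHom _ _ := congrArg Hom.hom ((cancel_mono f).1 h)
  filter_upwards [(eq_zeroHom_iff _).1 h0 j,
    V.space.subIncl_happ (kerStage f) (tr_mem_kerStage f) j] with i e e' x hx
  exact (e' ⟨x, hx⟩).symm.trans (e ⟨x, hx⟩)

end

end SmoothRep

/-! ### Subobjects of `𝕄` are cuspidal. -/

namespace MeasureRep
open Filter ProVect SmoothRep ValuativeRel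
variable {F : Type u} [Field F] [ValuativeRel F] [TopologicalSpace F] [IsNonarchimedeanLocalField F]
  (ψ : ResidualChar F)

/-- Let `β` be `B_1`-invariant. For a vector `x` of `U`, an element `t` of the group algebra of
`B_1` with augmentation `1` kills the image of `x` in `𝕄`. Then `t x` lies in the kernel of `f` and
dies under a transition map, whereas `β (t x) = β x`. -/
theorem isCuspidal_of_mono {U : SmoothRep F} (f : U ⟶ rep ψ) [Mono f] : U.IsCuspidal := by
  rw [isCuspidal_iff]
  intro Q β hβ
  rw [eq_zeroHom_iff]
  intro j
  obtain ⟨k, hker, hk⟩ := ((tr_eq_zero_of_mono f (hidx β j)).and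
    (eventually_ge_atTop (hidx β j))).exists
  obtain ⟨N, hN⟩ := hβ.eventually j
  have hkk := le_max_left k N
  have hNk := le_max_right k N
  set k' := max k N
  -- Membership in `kerStage f k` involves only the finitely many components `l ≤ k`, so one stage
  -- `a` of `𝕄` can serve all of them.
  have hr : ∀ᶠ a in atTop, ∀ l ∈ Set.Iic k, (rep ψ).ridx 1 l ≤ a ∧
      ∀ (hl : l ≤ a) (b : HInf F) (_ : b ∈ HInf.level F 1) (hi : b ∈ HInf.level F (a + 1))
        (φ : schwartzUnits F a), (rep ψ).act 1 l a b φ = proj hl (repOn ψ le_rfl ⟨b, hi⟩ φ) :=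
    (eventually_all_finite (Set.finite_Iic k)).2 fun l _ =>
      (eventually_ge_atTop _).and (rep_act ψ 1 l)
  obtain ⟨a, ha, hka⟩ := (hr.and (eventually_ge_atTop k)).exists
  have hcomm : ∀ᶠ i in atTop, ∀ l ∈ Set.Iic k, hidx f.hom l ≤ k → ∀ b ∈ HInf.level F 1, ∀ x,
      happ f.hom l k (U.act 1 k i b x) = (rep ψ).act 1 l a b (happ f.hom a i x) := by
    refine (eventually_all_finite (Set.finite_Iic k)).2 fun l hl => ?_
    by_cases hlk : hidx f.hom l ≤ k
    · filter_upwards [comm_happ f 1 l hlk (ha l hl).1] with i e _ using e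
    · exact Eventually.of_forall fun i h => absurd h hlk
  filter_upwards [hcomm, hN k' hNk, U.tr_act 1 hkk] with i e₁ e₂ e₃ x
  obtain ⟨φ, hφ⟩ : ∃ φ : schwartzUnits F a, φ = happ f.hom a i x := ⟨_, rfl⟩
  obtain ⟨t, ht, ht'⟩ := exists_asAlgebraHom_eq_zero ψ φ
  -- The stages of `U` are not modules over the group algebra. The vector `y` is a linear
  -- combination of the `b x` and stands in for `t x`; only its value under `β` and its images under
  -- `f` are recorded.
  have key : ∀ t : MonoidAlgebra ℂ (polarSubgroup F 1), ∃ y : U.space.obj k,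
      happ β j k y = polarEval ψ 0 t • happ β j i x ∧
      ∀ l (hl : l ≤ k), hidx f.hom l ≤ k → happ f.hom l k y = proj (hl.trans hka)
        ((polarRep ψ (Nat.zero_le a)).asAlgebraHom t φ) := fun t => by
    induction t using MonoidAlgebra.induction_on with
    | of b =>
      refine ⟨U.act 1 k i b.1 x, ?_, fun l hl hlk => ?_⟩
      · rw [← e₃, happ_tr β hk hkk, MonoidAlgebra.of_apply, polarEval_single, polarChar_zero,
          one_mul]
        exact e₂ ⟨b.1, b.2⟩ x
      · rw [e₁ l hl hlk _ b.1.2, ← hφ]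
        refine ((ha l hl).2 (hl.trans hka) _ b.1.2 (mem_level_of_one b.1.2 a) _).trans ?_
        rw [MonoidAlgebra.of_apply, Representation.asAlgebraHom_single, one_smul,
          repOn_mk ψ le_rfl (Nat.succ_le_succ (Nat.zero_le a)) _ _ b.1.2]
        rfl
    | add s t hs ht =>
      obtain ⟨y, h₁, h₂⟩ := hs
      obtain ⟨z, h₃, h₄⟩ := ht
      refine ⟨y + z, by rw [map_add, map_add, h₁, h₃, add_smul], fun l hl hlk => ?_⟩
      rw [map_add (polarRep ψ (Nat.zero_le a)).asAlgebraHom, LinearMap.add_apply, map_add (proj _)]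
      exact (map_add _ y z).trans (congrArg₂ (· + ·) (h₂ l hl hlk) (h₄ l hl hlk))
    | smul r t ht =>
      obtain ⟨y, h₁, h₂⟩ := ht
      refine ⟨r • y, by rw [map_smul, map_smul, h₁, smul_assoc], fun l hl hlk => ?_⟩
      rw [map_smul (polarRep ψ (Nat.zero_le a)).asAlgebraHom, LinearMap.smul_apply,
        map_smul (proj _)]
      exact (map_smul _ r y).trans (congrArg (r • ·) (h₂ l hl hlk))
  obtain ⟨y, h₁, h₂⟩ := key t
  rw [ht, one_smul] at h₁
  rw [← h₁, ← happ_tr β le_rfl hk, hker y fun l hl hlk => ?_, map_zero]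
  rw [h₂ l hl hlk, ht', map_zero]
  rfl

end MeasureRep

/-! ### Subobjects of the constant pro-vector space `ℂ`. -/

namespace ProVect
open Filter
variable {V W : ProVect.{u}}

/-- The constant pro-vector space `ℂ`. -/
def unit : ProVect.{u} := constant (ULift.{u} ℂ) (by
  rw [rank_ulift, Module.rank_self, Cardinal.lift_one]
  exact Cardinal.one_le_aleph0)

theorem unit_tr {j i : ℕ} (h : j ≤ i) (r : unit.{u}.obj i) : unit.{u}.tr j i r = r :=
  constant_tr (ULift.{u} ℂ) _ h r

/-- The value of an element of the constant pro-vector space `ℂ`. -/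
def unitEquiv (i : ℕ) : unit.{u}.obj i ≃ₗ[ℂ] ℂ := ULift.moduleEquiv

theorem unitEquiv_tr {j i : ℕ} (h : j ≤ i) (r : unit.{u}.obj i) :
    unitEquiv j (unit.{u}.tr j i r) = unitEquiv i r := by
  rw [unit_tr h]
  rfl

/-- As for representations, but since the target is constant, the kernel of the component `0` alone
has to be considered. -/
theorem tr_eq_zero_of_mono (f : V ⟶ unit.{u}) [Mono f] (j : ℕ) :
    ∀ᶠ i in atTop, ∀ x, happ f 0 i x = 0 → V.tr j i x = 0 := by
  let K : ∀ i, Submodule ℂ (V.obj i) := fun i =>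
    { carrier := {x | hidx f 0 ≤ i → happ f 0 i x = 0}
      zero_mem' := fun _ => map_zero _
      add_mem' := fun hx hy h => by rw [map_add, hx h, hy h, add_zero]
      smul_mem' := fun c x hx h => by rw [map_smul, hx h, smul_zero] }
  have hK : ∀ i j, i ≤ j → ∀ x ∈ K j, V.tr i j x ∈ K i := fun i j hij x hx h => by
    rw [happ_tr f h hij, hx (h.trans hij)]
  have h : V.subIncl K hK ≫ f = zeroHom _ V ≫ f := by
    refine ((eq_zeroHom_iff _).2 fun k => ?_).trans (zeroHom_comp f).symm
    filter_upwards [comp_happ (V.subIncl K hK) f k le_rfl, V.subIncl_happ K hK (hidx f k),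
      eventually_ge_atTop (hidx f k), eventually_ge_atTop (hidx f 0),
      tr_happ f (Nat.zero_le k)] with i e₁ e₂ hi hi' e₃ x
    rw [e₁, e₂, happ_tr f le_rfl hi, ← (unitEquiv k).map_eq_zero_iff,
      ← unitEquiv_tr (Nat.zero_le k), e₃, (unitEquiv 0).map_eq_zero_iff]
    exact x.2 hi'
  have h0 := (eq_zeroHom_iff _).1 ((cancel_mono f).1 h) j
  filter_upwards [h0, V.subIncl_happ K hK j] with i e e' x hx
  exact (e' ⟨x, fun _ => hx⟩).symm.trans (e _)

/-- A subobject of the constant pro-vector space `ℂ` is zero or everything. -/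
theorem isZero_or_isIso_of_mono (f : V ⟶ unit.{u}) [Mono f] : Limits.IsZero V ∨ IsIso f := by
  by_cases h0 : ∃ i, hidx f 0 ≤ i ∧ ∀ x, happ f 0 i x = 0
  · obtain ⟨i₀, hi₀, h0⟩ := h0
    refine Or.inl (isZero_iff.2 fun j => ?_)
    filter_upwards [tr_eq_zero_of_mono f j, eventually_ge_atTop i₀] with i e hi x
    exact e x (by rw [← happ_tr f hi₀ hi, h0])
  refine Or.inr ?_
  have h1 : ∀ i, hidx f 0 ≤ i → ∃ e, unitEquiv 0 (happ f 0 i e) = 1 := fun i hi => by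
    by_contra h
    refine h0 ⟨i, hi, fun x => ?_⟩
    by_contra hx
    have hx' : unitEquiv 0 (happ f 0 i x) ≠ 0 := fun h => hx ((unitEquiv 0).map_eq_zero_iff.1 h)
    exact h ⟨(unitEquiv 0 (happ f 0 i x))⁻¹ • x, by
      rw [map_smul, map_smul, smul_eq_mul, inv_mul_cancel₀ hx']⟩
  -- The kernel of the functional `f_0` dies in `V_j`, so late transition maps to `V_j` have rank at
  -- most one and equal `f_0(·) v_j`. The vectors `v_j` are compatible and define the inverse `ℂ →
  -- V`.
  have h2 : ∀ j, ∃ N, hidx f 0 ≤ N ∧ ∃ v : V.obj j, ∀ i, N ≤ i → ∀ y,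
      V.tr j i y = unitEquiv 0 (happ f 0 i y) • v := fun j => by
    obtain ⟨N, hN, hf, hj⟩ := ((tr_eq_zero_of_mono f j).and ((eventually_ge_atTop (hidx f 0)).and
      (eventually_ge_atTop j))).exists
    obtain ⟨e, he⟩ := h1 N hf
    refine ⟨N, hf, V.tr j N e, fun i hi y => ?_⟩
    have := hN (V.tr N i y - unitEquiv 0 (happ f 0 i y) • e) (by
      rw [← (unitEquiv 0).map_eq_zero_iff, map_sub, map_sub, map_smul, map_smul, he,
        happ_tr f hf hi, smul_eq_mul, mul_one, sub_self])
    rwa [map_sub, map_smul, V.tr_tr hj hi, sub_eq_zero] at this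
  choose N hN v hv using h2
  have hcompat : ∀ j j', j ≤ j' → V.tr j j' (v j') = v j := fun j j' hj => by
    have hi := le_max_left (N j) (max (N j') j')
    have hi' := (le_max_left (N j') j').trans (le_max_right (N j) _)
    have hi'' := (le_max_right (N j') j').trans (le_max_right (N j) _)
    obtain ⟨e, he⟩ := h1 _ ((hN j).trans hi)
    have a := hv j _ hi e
    have b := hv j' _ hi' e
    rw [he, one_smul] at a b
    rw [← a, ← b, V.tr_tr hj hi'']
  have hf1 : ∀ i, hidx f 0 ≤ i → unitEquiv 0 (happ f 0 i (v i)) = 1 := fun i hi => by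
    obtain ⟨e, he⟩ := h1 _ (hi.trans (le_max_left i (N i)))
    have a := hv i _ (le_max_right i (N i)) e
    rw [he, one_smul] at a
    rw [← a, happ_tr f hi (le_max_left _ _), he]
  let s : unit.{u} ⟶ V := homMk (fun _ => 0)
    (fun j => (LinearMap.toSpanSingleton ℂ _ (v j)).comp (unitEquiv 0).toLinearMap)
    fun j j' h => Eventually.of_forall fun i x => by
      change V.tr j j' (unitEquiv 0 (unit.{u}.tr 0 i x) • v j') =
        unitEquiv 0 (unit.{u}.tr 0 i x) • v j
      rw [map_smul, hcompat j j' h]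
  have hs : ∀ j, ∀ᶠ i in atTop, ∀ r, happ s j i r = unitEquiv i r • v j := fun j => by
    refine (homMk_happ _ _ _ j).mono fun i e r => (e r).trans ?_
    exact congrArg (fun c : ℂ => c • v j) (unitEquiv_tr (Nat.zero_le i) r)
  refine ⟨s, (hom_ext_iff _ _).2 fun j => ?_, (hom_ext_iff _ _).2 fun j => ?_⟩
  · obtain ⟨k, e, hk⟩ := ((hs j).and (eventually_ge_atTop (hidx s j))).exists
    filter_upwards [comp_happ f s j hk, id_happ V j, tr_happ f (Nat.zero_le k),
      eventually_ge_atTop (N j)] with i e₁ e₂ e₃ hi x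
    rw [e₁, e₂, e, hv j i hi, ← e₃, unitEquiv_tr (Nat.zero_le k)]
  · obtain ⟨k, e, hk, hk'⟩ := ((tr_happ f (Nat.zero_le j)).and ((eventually_ge_atTop
      (hidx f j)).and (eventually_ge_atTop (hidx f 0)))).exists
    filter_upwards [comp_happ s f j hk, id_happ unit.{u} j, hs k,
      eventually_ge_atTop j] with i e₁ e₂ e₃ hi r
    refine (unitEquiv j).injective ?_
    rw [e₁, e₂, e₃, map_smul, map_smul, unitEquiv_tr hi, ← unitEquiv_tr (Nat.zero_le j), e,
      hf1 k hk', smul_eq_mul, mul_one]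

end ProVect

/-! ### Isomorphisms given on stages, and irreducibility of `𝕄`. -/

namespace SmoothRep
open Filter ProVect ValuativeRel
variable {F : Type u} [Field F] [TopologicalSpace F] {V W : SmoothRep F}

/-- The isomorphism given by compatible equivariant isomorphisms on stages. -/
theorem IsStrict.nonempty_iso {A : ∀ i, HInf.level F (i + 1) → V.space.obj i →ₗ[ℂ] V.space.obj i}
    {B : ∀ i, HInf.level F (i + 1) → W.space.obj i →ₗ[ℂ] W.space.obj i}
    (hA : V.IsStrict A) (hB : W.IsStrict B) (e : ∀ i, V.space.obj i ≃ₗ[ℂ] W.space.obj i)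
    (he : ∀ {j i} (_ : j ≤ i) x, W.space.tr j i (e i x) = e j (V.space.tr j i x))
    (he' : ∀ i a x, e i (A i a x) = B i a (e i x)) : Nonempty (V ≅ W) := by
  have he'' : ∀ {j i} (_ : j ≤ i) x, V.space.tr j i ((e i).symm x) =
      (e j).symm (W.space.tr j i x) := fun {j i} h x => by
    rw [LinearEquiv.eq_symm_apply, ← he h, LinearEquiv.apply_symm_apply]
  let f : V.space ⟶ W.space := homMk (fun j => j) (fun j => (e j).toLinearMap) fun j j' h => by
    filter_upwards [eventually_ge_atTop j'] with i hi x
    change W.space.tr j j' (e j' _) = e j _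
    rw [he h, V.space.tr_tr h hi]
  let g : W.space ⟶ V.space := homMk (fun j => j) (fun j => (e j).symm.toLinearMap) fun j j' h => by
    filter_upwards [eventually_ge_atTop j'] with i hi x
    change V.space.tr j j' ((e j').symm _) = (e j).symm _
    rw [he'' h, W.space.tr_tr h hi]
  have hf : ∀ j, ∀ᶠ i in atTop, ∀ x, happ f j i x = e j (V.space.tr j i x) := fun j =>
    homMk_happ _ _ _ j
  have hg : ∀ j, ∀ᶠ i in atTop, ∀ x, happ g j i x = (e j).symm (W.space.tr j i x) := fun j =>
    homMk_happ _ _ _ j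
  have hfg : f ≫ g = 𝟙 _ := (hom_ext_iff _ _).2 fun j => by
    obtain ⟨k, e₁, hk, hj⟩ := ((hg j).and ((eventually_ge_atTop (hidx g j)).and
      (eventually_ge_atTop j))).exists
    filter_upwards [comp_happ f g j hk, id_happ V.space j, hf k,
      eventually_ge_atTop k] with i e₂ e₃ e₄ hi x
    rw [e₂, e₃, e₁, e₄, he hj, LinearEquiv.symm_apply_apply, V.space.tr_tr hj hi]
  have hgf : g ≫ f = 𝟙 _ := (hom_ext_iff _ _).2 fun j => by
    obtain ⟨k, e₁, hk, hj⟩ := ((hf j).and ((eventually_ge_atTop (hidx f j)).and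
      (eventually_ge_atTop j))).exists
    filter_upwards [comp_happ g f j hk, id_happ W.space j, hg k,
      eventually_ge_atTop k] with i e₂ e₃ e₄ hi x
    rw [e₂, e₃, e₁, e₄, he'' hj, LinearEquiv.apply_symm_apply, W.space.tr_tr hj hi]
  let φ : V ⟶ W := homOfHapp f fun n j => by
    obtain ⟨k, e₁, e₂, hk, hk', hj, hn⟩ := ((hB.act_eq n j).and ((hf j).and
      ((eventually_ge_atTop (hidx f j)).and ((eventually_ge_atTop (W.ridx n j)).and
        ((eventually_ge_atTop j).and (eventually_ge_atTop n)))))).exists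
    refine ⟨k, k, hk, hk', ?_⟩
    filter_upwards [hf k, hA.act_eq n k, eventually_ge_atTop k] with i e₃ e₄ hi h hh x
    have hk'' := HInf.level_mono (hn.trans (Nat.le_succ k)) hh
    have hi' := HInf.level_mono ((hn.trans hi).trans (Nat.le_succ i)) hh
    rw [e₂, e₄ h hh hi', hA.tr_apply hi h hk'' hi', e₃, e₁ h hh hk'', ← he', he hj]
  have : IsIso φ.hom := ⟨g, hfg, hgf⟩
  have := isIso_of_hom φ
  exact ⟨asIso φ⟩

end SmoothRep

namespace MeasureRep
open Filter ProVect SmoothRep ValuativeRel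
open scoped TensorProduct
variable {F : Type u} [Field F] [ValuativeRel F] [TopologicalSpace F] [IsNonarchimedeanLocalField F]
  (ψ : ResidualChar F)

theorem isStrict_rep : (rep ψ).IsStrict fun i a =>
    (repOn ψ le_rfl a : schwartzUnits F i →ₗ[ℂ] schwartzUnits F i) where
  tr_apply {j i} h a hj hi f := by
    refine (LinearMap.congr_fun (space_tr h) _).trans ?_
    refine Eq.trans ?_ (congrArg (repOn ψ le_rfl ⟨a, hj⟩)
      (LinearMap.congr_fun (space_tr h) f)).symm
    exact (proj_repOn ψ h le_rfl (Nat.succ_le_succ h) ⟨a, hj⟩ f).trans rfl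
  act_eq n j := by
    filter_upwards [rep_act ψ n j, eventually_ge_atTop j] with i e hj a ha hi f
    exact (e hj a ha hi f).trans (LinearMap.congr_fun (space_tr hj) _).symm

theorem nonempty_tensor_unit_iso : Nonempty (tensor unit (rep ψ) ≅ rep ψ) := by
  let e : ∀ i, unit.{u}.obj i ⊗[ℂ] schwartzUnits F i ≃ₗ[ℂ] schwartzUnits F i := fun i =>
    (TensorProduct.congr (unitEquiv i) (LinearEquiv.refl ℂ _)).trans (TensorProduct.lid ℂ _)
  have he : ∀ i r f, e i (r ⊗ₜ f) = unitEquiv i r • f := fun i r f => by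
    simp only [e, LinearEquiv.trans_apply, TensorProduct.congr_tmul, LinearEquiv.refl_apply,
      TensorProduct.lid_tmul]
  have he₁ : ∀ {j i} (h : j ≤ i) (x : unit.{u}.obj i ⊗[ℂ] schwartzUnits F i),
      proj h (e i x) = e j (TensorProduct.map (unit.tr j i) (proj h) x) := fun {j i} h x => by
    induction x using TensorProduct.induction_on with
    | zero => rw [map_zero, map_zero, map_zero, map_zero]
    | add x y hx hy => rw [map_add, map_add, map_add, map_add, hx, hy]
    | tmul r f => rw [TensorProduct.map_tmul, he, he, map_smul, unitEquiv_tr h]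
  have he₂ : ∀ i a (x : unit.{u}.obj i ⊗[ℂ] schwartzUnits F i),
      e i (TensorProduct.map LinearMap.id (repOn ψ le_rfl a) x) = repOn ψ le_rfl a (e i x) :=
    fun i a x => by
      induction x using TensorProduct.induction_on with
      | zero => rw [map_zero, map_zero, map_zero]
      | add x y hx hy => rw [map_add, map_add, map_add, map_add, hx, hy]
      | tmul r f => rw [TensorProduct.map_tmul, he, he, map_smul, LinearMap.id_apply]
  refine (isStrict_tensorRep unit).nonempty_iso (isStrict_rep ψ) e (fun {j i} h x => ?_) he₂
  rw [tensor_space_tr unit h]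
  exact (LinearMap.congr_fun (space_tr h) _).trans (he₁ h x)

theorem not_isZero_rep : ¬ Limits.IsZero (rep ψ) := by
  rw [SmoothRep.isZero_iff, ProVect.isZero_iff]
  intro h
  obtain ⟨i, hi⟩ := (h 0).exists
  obtain ⟨f, hf⟩ := exists_proj_apply_one_eq_one (F := F) (Nat.zero_le i)
  have h0 : proj (Nat.zero_le i) f = 0 := (LinearMap.congr_fun (space_tr (Nat.zero_le i)) f).symm.trans
    (hi f)
  rw [h0] at hf
  exact zero_ne_one hf

instance : (rep ψ).tensorFunctor.Faithful := ⟨fun h => tensorMap_injective h⟩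

instance : (rep ψ).tensorFunctor.Full := ⟨fun f => tensorMap_surjective f⟩

theorem isZero_tensor_of_isZero {L : ProVect.{u}} (h : Limits.IsZero L) :
    Limits.IsZero (tensor L (rep ψ)) := by
  rw [SmoothRep.isZero_iff, ProVect.isZero_iff]
  intro j
  filter_upwards [ProVect.isZero_iff.1 h j, eventually_ge_atTop j] with i e hi x
  have h0 : L.tr j i = 0 := LinearMap.ext e
  rw [tensor_space_tr L hi, h0]
  exact LinearMap.congr_fun (TensorProduct.map_zero_left _) x

/-- A subobject is cuspidal, hence isomorphic to some `L ⊗ 𝕄`, and `𝕄 ≅ ℂ ⊗ 𝕄`. Fullness turns the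
inclusion into a morphism `L → ℂ`, and faithfulness makes that morphism monic. -/
theorem isIrreducible_rep : (rep ψ).IsIrreducible := by
  refine ⟨not_isZero_rep ψ, fun U f hf => ?_⟩
  obtain ⟨L, ⟨α⟩⟩ := (isCuspidal_of_mono ψ f).exists_iso_tensor ψ
  obtain ⟨ε⟩ := nonempty_tensor_unit_iso ψ
  obtain ⟨g, hg⟩ := tensorMap_surjective (α.hom ≫ f ≫ ε.inv)
  have hm : Mono ((rep ψ).tensorFunctor.map g) := by
    change Mono (tensorMap ψ g)
    rw [hg]
    infer_instance
  have := (rep ψ).tensorFunctor.mono_of_mono_map hm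
  rcases isZero_or_isIso_of_mono g with h | h
  · exact Or.inl ((isZero_tensor_of_isZero ψ h).of_iso α.symm)
  · have h1 : IsIso (tensorMap ψ g) := inferInstanceAs (IsIso ((rep ψ).tensorFunctor.map g))
    have h2 : f = α.inv ≫ tensorMap ψ g ≫ ε.hom := by
      rw [hg, Category.assoc, Category.assoc, ε.inv_hom_id, Category.comp_id, α.inv_hom_id_assoc]
    rw [h2]
    exact Or.inr inferInstance

end MeasureRep

/-! ### Coinvariants as a functor, and the two universal properties. -/

namespace SmoothRep
open Filter ProVect ValuativeRel

section
variable {F : Type u} [Field F] [TopologicalSpace F] {V W : SmoothRep F}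

theorem IsSemiInvariant.precomp {n : ℕ} {T : Subgroup (HInf.level F n)} {κ : T → ℂ}
    {Q : ProVect.{u}} {β : W.space ⟶ Q} (hβ : W.IsSemiInvariant T κ β) (f : V ⟶ W) :
    V.IsSemiInvariant T κ (f.hom ≫ β) := by
  have key : ((const T β).twist κ).comp (const T f.hom) =
      ((const T β).comp (const T f.hom)).twist κ := by
    generalize const T β = b
    generalize const T f.hom = a
    induction a using Quotient.inductionOn with
    | h a =>
    induction b using Quotient.inductionOn with
    | h b => rfl
  have h : (const T f.hom).comp ((V.ρ n).restrict ((↑) : T → HInf.level F n)) =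
      ((W.ρ n).restrict ((↑) : T → HInf.level F n)).comp (const T f.hom) := by
    rw [← restrict_const ((↑) : T → HInf.level F n) f.hom, ← Fam.restrict_comp, f.comm,
      Fam.restrict_comp]
  unfold IsSemiInvariant at hβ ⊢
  rw [const_comp, Fam.comp_assoc, h, ← Fam.comp_assoc, hβ, key]

/-- Coinvariants form a functor. -/
theorem exists_coinvariantsFunctor {n : ℕ} (T : Subgroup (HInf.level F n)) (κ : T → ℂ) :
    ∃ (G : SmoothRep F ⥤ ProVect.{u}) (q : forget F ⟶ G),
      ∀ V : SmoothRep F, V.IsCoinvariants T κ (q.app V) := by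
  choose Q q hq using fun V : SmoothRep F => V.exists_isCoinvariants T κ
  choose m hm hm' using fun (V W : SmoothRep F) (f : V ⟶ W) =>
    (hq V).existsUnique_desc _ _ ((hq W).semiInvariant.precomp f)
  exact ⟨
    { obj := Q
      map := fun {V W} f => m V W f
      map_id := fun V => (hm' V V (𝟙 V) _ ((Category.comp_id _).trans (Category.id_comp _).symm)).symm
      map_comp := fun {U V W} f g => (hm' U W (f ≫ g) _ (by
        change q U ≫ m U V f ≫ m V W g = (f.hom ≫ g.hom) ≫ q W
        rw [← Category.assoc, hm, Category.assoc, hm, Category.assoc])).symm },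
    { app := q
      naturality := fun V W f => (hm V W f).symm }, hq⟩

theorem IsCoinvariants.exists_iso {n : ℕ} {T : Subgroup (HInf.level F n)} {κ : T → ℂ}
    {Q Q' : ProVect.{u}} {q : V.space ⟶ Q} {q' : V.space ⟶ Q'} (hq : V.IsCoinvariants T κ q)
    (hq' : V.IsCoinvariants T κ q') : ∃ e : Q ≅ Q', q ≫ e.hom = q' := by
  obtain ⟨f, hf, -⟩ := hq.existsUnique_desc _ _ hq'.semiInvariant
  obtain ⟨g, hg, -⟩ := hq'.existsUnique_desc _ _ hq.semiInvariant
  refine ⟨⟨f, g, ?_, ?_⟩, hf⟩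
  · exact (hq.existsUnique_desc _ _ hq.semiInvariant).unique
      (by rw [← Category.assoc, hf, hg]) (Category.comp_id q)
  · exact (hq'.existsUnique_desc _ _ hq'.semiInvariant).unique
      (by rw [← Category.assoc, hg, hf]) (Category.comp_id q')

theorem IsCoinvariants.hom_ext {n : ℕ} {T : Subgroup (HInf.level F n)} {κ : T → ℂ}
    {Q : ProVect.{u}} {q : V.space ⟶ Q} (hq : V.IsCoinvariants T κ q) {W : ProVect.{u}}
    {f g : Q ⟶ W} (h : q ≫ f = q ≫ g) (hs : V.IsSemiInvariant T κ (q ≫ g)) : f = g :=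
  (hq.existsUnique_desc _ _ hs).unique h rfl

end

end SmoothRep

namespace MeasureRep
open SmoothRep
variable {F : Type u} [Field F] [ValuativeRel F] [TopologicalSpace F] [IsNonarchimedeanLocalField F]
  (ψ : ResidualChar F)

/-- For an isomorphism `β` the universal property is exactly full faithfulness of `L ↦ L ⊗ 𝕄`. -/
theorem isHomSpace_of_isIso {L : ProVect.{u}} {V : SmoothRep F}
    (β : (rep ψ).tensorFunctor.obj L ⟶ V) [IsIso β] : IsHomSpace (rep ψ) V β := fun T f => by
  obtain ⟨g, hg⟩ := (rep ψ).tensorFunctor.map_surjective (f ≫ inv β)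
  refine ⟨g, by change _ ≫ β = f; rw [hg, Category.assoc, IsIso.inv_hom_id, Category.comp_id], fun g' hg' =>
    (rep ψ).tensorFunctor.map_injective ?_⟩
  rw [hg, ← hg', Category.assoc, IsIso.hom_inv_id, Category.comp_id]

/-- Some isomorphism `L' ⊗ 𝕄 ≅ V` exists and also has the universal property; representing objects
being unique, `β` differs from it by an isomorphism `L ≅ L'`. -/
theorem isIso_of_isHomSpace {V : SmoothRep F} (hV : V.IsCuspidal) {L : ProVect.{u}}
    {β : (rep ψ).tensorFunctor.obj L ⟶ V} (hβ : IsHomSpace (rep ψ) V β) : IsIso β := by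
  obtain ⟨L', ⟨e⟩⟩ : ∃ L', Nonempty ((rep ψ).tensorFunctor.obj L' ≅ V) := hV.exists_iso_tensor ψ
  have he := isHomSpace_of_isIso ψ e.hom
  obtain ⟨g, hg, -⟩ := he L β
  obtain ⟨h, hh, -⟩ := hβ L' e.hom
  have h₁ : g ≫ h = 𝟙 L := (hβ L β).unique
    (by rw [Functor.map_comp, Category.assoc, hh, hg])
    (by rw [(rep ψ).tensorFunctor.map_id, Category.id_comp])
  have h₂ : h ≫ g = 𝟙 L' := (he L' e.hom).unique
    (by rw [Functor.map_comp, Category.assoc, hg, hh])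
    (by rw [(rep ψ).tensorFunctor.map_id, Category.id_comp])
  have : IsIso g := ⟨h, h₁, h₂⟩
  rw [← hg]
  infer_instance

/-- The functor `L ↦ L ⊗ 𝕄` to the category of cuspidal representations. -/
noncomputable def cuspidalTensorFunctor : ProVect.{u} ⥤ (cuspidalReps F).FullSubcategory :=
  (cuspidalReps F).lift (rep ψ).tensorFunctor (isCuspidal_tensor_rep ψ)

instance : (cuspidalTensorFunctor ψ).IsEquivalence where
  faithful := Functor.Faithful.of_comp_iso
    ((cuspidalReps F).liftCompιIso (rep ψ).tensorFunctor (isCuspidal_tensor_rep ψ))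
  full := Functor.Full.of_comp_faithful_iso
    ((cuspidalReps F).liftCompιIso (rep ψ).tensorFunctor (isCuspidal_tensor_rep ψ))
  essSurj := ⟨fun V => by
    obtain ⟨L, ⟨e⟩⟩ := IsCuspidal.exists_iso_tensor ψ V.property
    exact ⟨L, ⟨(cuspidalReps F).isoMk e⟩⟩⟩

/-- The coinvariants of `L ⊗ 𝕄` are `L`, naturally in `L`. So `W` composed with the equivalence `L ↦
L ⊗ 𝕄` is isomorphic to the identity, and `W` on cuspidal representations is an equivalence by
two-out-of-three. -/
theorem isEquivalence_of_isWhittakerFunctor {W : SmoothRep F ⥤ ProVect.{u}}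
    {q : SmoothRep.forget F ⟶ W} (h : IsWhittakerFunctor ψ W q) :
    ((cuspidalReps F).ι ⋙ W).IsEquivalence := by
  obtain ⟨q, hq, hn⟩ : ∃ q : ∀ V : SmoothRep F, V.space ⟶ W.obj V,
      (∀ V : SmoothRep F, V.IsCoinvariants (whittakerSubgroup F) (whittakerChar ψ) (q V)) ∧
      ∀ {V V' : SmoothRep F} (f : V ⟶ V'), f.hom ≫ q V' = q V ≫ W.map f :=
    ⟨q.app, h, fun f => q.naturality f⟩
  choose e he using fun L : ProVect.{u} =>
    (hq (tensor L (rep ψ))).exists_iso (isCoinvariants_whittakerMap ψ L)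
  have hnat : ∀ {L L' : ProVect.{u}} (g : L ⟶ L'),
      W.map (tensorMap ψ g) ≫ (e L').hom = (e L).hom ≫ g := fun {L L'} g => by
    have h3 : q (tensor L (rep ψ)) ≫ (e L).hom ≫ g = (tensorMap ψ g).hom ≫ whittakerMap ψ L' := by
      rw [← Category.assoc, he, whittakerMap_natural]
    refine (hq (tensor L (rep ψ))).hom_ext ?_ ?_
    · rw [h3, ← Category.assoc, ← hn, Category.assoc, he]
    · rw [h3]
      exact (isCoinvariants_whittakerMap ψ L').semiInvariant.precomp _
  let η : cuspidalTensorFunctor ψ ⋙ (cuspidalReps F).ι ⋙ W ≅ 𝟭 ProVect.{u} :=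
    NatIso.ofComponents e hnat
  have : (cuspidalTensorFunctor ψ ⋙ (cuspidalReps F).ι ⋙ W).IsEquivalence :=
    Functor.isEquivalence_of_iso η.symm
  exact Functor.isEquivalence_of_comp_left (cuspidalTensorFunctor ψ) _

end MeasureRep

theorem mainTheorem7 {F : Type u} [Field F] [ValuativeRel F] [TopologicalSpace F]
    [IsNonarchimedeanLocalField F] (hF : ringChar 𝓀[F] ≠ 2) (ψ : ResidualChar F) :
    (∀ V : SmoothRep F, V.IsCuspidal →
      (∃ (L : ProVect.{u}) (β : (MeasureRep.rep ψ).tensorFunctor.obj L ⟶ V),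
        IsHomSpace (MeasureRep.rep ψ) V β) ∧
      ∀ (L : ProVect.{u}) (β : (MeasureRep.rep ψ).tensorFunctor.obj L ⟶ V),
        IsHomSpace (MeasureRep.rep ψ) V β → IsIso β) ∧
    (∃ (W : SmoothRep F ⥤ ProVect.{u}) (q : SmoothRep.forget F ⟶ W), IsWhittakerFunctor ψ W q) ∧
    (∀ (W : SmoothRep F ⥤ ProVect.{u}) (q : SmoothRep.forget F ⟶ W), IsWhittakerFunctor ψ W q →
      ((cuspidalReps F).ι ⋙ W).IsEquivalence) ∧
    (MeasureRep.rep ψ).IsIrreducible := by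
  refine ⟨fun V hV => ⟨?_, fun L β hβ => MeasureRep.isIso_of_isHomSpace ψ hV hβ⟩,
    SmoothRep.exists_coinvariantsFunctor _ _,
    fun W q h => MeasureRep.isEquivalence_of_isWhittakerFunctor ψ h,
    MeasureRep.isIrreducible_rep ψ⟩
  obtain ⟨L, ⟨e⟩⟩ : ∃ L, Nonempty ((MeasureRep.rep ψ).tensorFunctor.obj L ≅ V) :=
    hV.exists_iso_tensor ψ
  exact ⟨L, e.hom, MeasureRep.isHomSpace_of_isIso ψ e.hom⟩
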